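/- **Conventions.** Algorithms are deterministic programs for a random access machine with finitely many integer registers and finitely many integer arrays with indirect addressing, with the operations $+,-,\times$, integer division and remainder, comparisons, branching and loops. Running time is worst-case and measured by logarithmic cost: every operation is charged the bit lengths of the numbers and addresses it handles. "Solvable in time $O(T(n))$" means that one program and one constant $K$ exist such that, for every $n\ge 1$, the program answers every instance of size $n$ correctly in time at most $K\,T(n)$. **SETH** (Strong Exponential Time Hypothesis): for every $\varepsilon>0$ there is a $k$ such that $k$-SAT (satisfiability of CNF formulas with pairwise distinct clauses of at most $k$ literals) on $N$ variables is not solvable in time $O(2^{(1-\varepsilon)N})$. For $Q\in\mathbb{R}^{n\times d_q}$ with rows $Q_1,\dots,Q_n$ and $V\in\mathbb{R}^{n\times d_v}$ let $S\in\mathbb{R}^{n\times n}$, $S_{ij}=e^{Q_i^TQ_j}$, and let $Y=S\cdot V\in\mathbb{R}^{n\times d_v}$ be the unnormalized exponential dot-product self-attention. **Theorem.** Assume SETH. Let $d_q=d_q(n)$ and $d_v=d_v(n)\ge 1$ be functions of $n$ with $d_q=\omega(\log n)$. Then for every $\varepsilon>0$, computing from $n$, $Q$, $V$ a matrix $\hat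 Y\in\mathbb{R}^{n\times d_v}$ that satisfies any one of the following conditions requires $\Omega(n^{2-\varepsilon})$ time, in the sense that the task is not solvable in time $O(n^{2-\varepsilon})$: 1. $\hat Y=Y$ (exact computation); 2. $|\hat Y_{ij}-Y_{ij}|\le\mu|Y_{ij}|$ for all $i\in[n]$, $j\in[d_v]$ (multiplicative approximation), for any fixed real $\mu$ with $0\le\mu<1$; 3. $|\hat Y_{ij}-Y_{ij}|\le\mu$ for all $i\in[n]$, $j\in[d_v]$ (additive approximation), for any fixed real $\mu\ge 0$. This holds even if the algorithms only have to handle matrices $Q$ with entries in $\{0,1,\dots,2\lfloor\log_2 n\rfloor\}$ and $V$ with entries in $\{0,1\}$. The matrices $Q$ and $V$ are stored column by column in arrays, padded by zeros. In 1 the entries of $\hat Y$ are returned symbolically: each entry is given as a finite sum of terms $b\,e^{x}$ with integers $b\ne 0$ and $x$, and the output is one list of all these terms, each with the position $(i,j)$ of its entry. In 2 and 3 the entries of $\hat Y$ are returned as rational numbers (numerator and positive denominator). -/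

import Mathlib

/-! ## Random access machines with logarithmic cost

A machine has finitely many integer registers and finitely many integer arrays (those mentioned in
its program; arrays are addressed indirectly, by computed integers). Programs are structured, with
loops `loop e p` (repeat `p` as long as `e` is nonzero). Every operation is charged the bit lengths
of the addresses and of the values it handles, so that the running time is a bit complexity. -/

namespace FineGrained

/-- Contents of the registers (`reg r`) and of the arrays (`arr a` at address `z`). -/
structure State where
  reg : ℕ → ℤ
  arr : ℕ → ℤ → ℤ

/-- The logarithmic cost of handling the integer `z`: one plus its number of binary digits. -/
def bitCost (z : ℤ) : ℕ := z.natAbs.size + 1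

/-- The binary operations of the machine. -/
inductive BinOp where
  | add | sub | mul | div | mod | lt | eq

/-- Value of a binary operation; comparisons return `1` (true) or `0` (false). -/
def BinOp.eval : BinOp → ℤ → ℤ → ℤ
  | .add, x, y => x + y
  | .sub, x, y => x - y
  | .mul, x, y => x * y
  | .div, x, y => x / y
  | .mod, x, y => x % y
  | .lt, x, y => if x < y then 1 else 0
  | .eq, x, y => if x = y then 1 else 0

/-- Integer expressions: constants, registers, array cells, binary operations. -/
inductive Expr where
  | const (z : ℤ)
  | reg (r : ℕ)
  | get (a : ℕ) (idx : Expr)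
  | op (o : BinOp) (e₁ e₂ : Expr)

/-- Value of an expression. -/
def Expr.eval (s : State) : Expr → ℤ
  | .const z => z
  | .reg r => s.reg r
  | .get a idx => s.arr a (idx.eval s)
  | .op o e₁ e₂ => o.eval (e₁.eval s) (e₂.eval s)

/-- Logarithmic cost of evaluating an expression: the sum of the costs of all values that occur,
operands, addresses and results alike. -/
def Expr.cost (s : State) : Expr → ℕ
  | .const z => bitCost z
  | .reg r => bitCost (s.reg r)
  | .get a idx => idx.cost s + bitCost (s.arr a (idx.eval s))
  | .op o e₁ e₂ => e₁.cost s + e₂.cost s + bitCost (o.eval (e₁.eval s) (e₂.eval s))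

/-- Programs. -/
inductive Program where
  | skip
  | assign (r : ℕ) (e : Expr)
  | store (a : ℕ) (idx e : Expr)
  | seq (p q : Program)
  | ite (e : Expr) (p q : Program)
  | loop (e : Expr) (p : Program)

/-- The state after writing `z` into register `r`. -/
def State.setReg (s : State) (r : ℕ) (z : ℤ) : State :=
  { s with reg := Function.update s.reg r z }

/-- The state after writing `z` into cell `i` of array `a`. -/
def State.setArr (s : State) (a : ℕ) (i z : ℤ) : State :=
  { s with arr := Function.update s.arr a (Function.update (s.arr a) i z) }

/-- `Exec p s s' t`: started in state `s`, the program `p` halts in state `s'` after time `t`.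
A test succeeds when its value is nonzero. -/
inductive Exec : Program → State → State → ℕ → Prop where
  | skip (s : State) : Exec .skip s s 1
  | assign (s : State) (r : ℕ) (e : Expr) :
      Exec (.assign r e) s (s.setReg r (e.eval s)) (e.cost s + 1)
  | store (s : State) (a : ℕ) (idx e : Expr) :
      Exec (.store a idx e) s (s.setArr a (idx.eval s) (e.eval s)) (idx.cost s + e.cost s + 1)
  | seq {p q : Program} {s s₁ s₂ : State} {t₁ t₂ : ℕ} :
      Exec p s s₁ t₁ → Exec q s₁ s₂ t₂ → Exec (.seq p q) s s₂ (t₁ + t₂)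
  | iteTrue {e : Expr} {p q : Program} {s s' : State} {t : ℕ} :
      e.eval s ≠ 0 → Exec p s s' t → Exec (.ite e p q) s s' (e.cost s + t + 1)
  | iteFalse {e : Expr} {p q : Program} {s s' : State} {t : ℕ} :
      e.eval s = 0 → Exec q s s' t → Exec (.ite e p q) s s' (e.cost s + t + 1)
  | whileTrue {e : Expr} {p : Program} {s s₁ s₂ : State} {t₁ t₂ : ℕ} :
      e.eval s ≠ 0 → Exec p s s₁ t₁ → Exec (.loop e p) s₁ s₂ t₂ →
        Exec (.loop e p) s s₂ (e.cost s + t₁ + t₂ + 1)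
  | whileFalse {e : Expr} {p : Program} {s : State} :
      e.eval s = 0 → Exec (.loop e p) s s (e.cost s + 1)

/-- A computational problem: instances of each size `n`, their encoding as an initial state, and
the final states that are correct answers. -/
structure Problem where
  Inst : ℕ → Type
  input : (n : ℕ) → Inst n → State
  Correct : (n : ℕ) → Inst n → State → Prop

/-- Some (deterministic) program solves every instance of every size `n ≥ 1`, in worst-case time
`O(T n)`. -/
def Problem.SolvableInTime (A : Problem) (T : ℕ → ℝ) : Prop :=
  ∃ (p : Program) (K : ℝ), ∀ n : ℕ, 1 ≤ n → ∀ x : A.Inst n,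
    ∃ (s' : State) (t : ℕ), Exec p (A.input n x) s' t ∧ A.Correct n x s' ∧ (t : ℝ) ≤ K * T n

/-! ## k-SAT and the Strong Exponential Time Hypothesis -/

/-- A literal over `N` variables: a variable and the truth value that satisfies the literal. -/
abbrev Literal (N : ℕ) := Fin N × Bool

/-- A formula in conjunctive normal form whose (pairwise distinct) clauses have at most `k`
literals. -/
structure KCNF (k N : ℕ) where
  clauses : List (List (Literal N))
  width_le : ∀ c ∈ clauses, c.length ≤ k
  nodup : clauses.Nodup

/-- Some assignment satisfies a literal of every clause. -/
def KCNF.Satisfiable {k N : ℕ} (φ : KCNF k N) : Prop :=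
  ∃ τ : Fin N → Bool, ∀ c ∈ φ.clauses, ∃ l ∈ c, τ l.1 = l.2

/-- The literal `x_v` is encoded by `v + 1`, its negation by `-(v + 1)`. -/
def Literal.code {N : ℕ} (l : Literal N) : ℤ :=
  if l.2 then (l.1 : ℤ) + 1 else -((l.1 : ℤ) + 1)

/-- The code of the `r`-th literal of the `j`-th clause (`0` if there is none). -/
def KCNF.code {k N : ℕ} (φ : KCNF k N) (j r : ℕ) : ℤ :=
  match (φ.clauses.getD j [])[r]? with
  | some l => Literal.code l
  | none => 0

/-- Input of k-SAT: register `0` holds the number of variables, register `1` the number of clauses,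
and cell `j * k + r` of array `0` the `r`-th literal of the `j`-th clause. -/
def KCNF.input {k N : ℕ} (φ : KCNF k N) : State where
  reg := fun i => if i = 0 then (N : ℤ) else if i = 1 then (φ.clauses.length : ℤ) else 0
  arr := fun a z =>
    if a = 0 ∧ 0 ≤ z ∧ z < φ.clauses.length * k then φ.code (z.toNat / k) (z.toNat % k) else 0

/-- k-SAT, with the number of variables as the size. The answer is returned in register `0`
(nonzero for "satisfiable"). -/
def kSAT (k : ℕ) : Problem where
  Inst := fun N => KCNF k N
  input := fun _ φ => φ.input
  Correct := fun _ φ s' => s'.reg 0 ≠ 0 ↔ φ.Satisfiable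

/-- The Strong Exponential Time Hypothesis: for every `ε > 0` there is a `k` such that k-SAT on `N`
variables cannot be solved in time `O(2 ^ ((1 - ε) N))`. -/
def SETH : Prop :=
  ∀ ε : ℝ, 0 < ε → ∃ k : ℕ, ¬ (kSAT k).SolvableInTime (fun N => (2 : ℝ) ^ ((1 - ε) * (N : ℝ)))

/-! ## Self-attention -/

/-- The score matrix `S i j = f (Q i) (K j)`. -/
def scoreMatrix {n d : ℕ} (f : (Fin d → ℝ) → (Fin d → ℝ) → ℝ) (Q K : Matrix (Fin n) (Fin d) ℝ) :
    Matrix (Fin n) (Fin n) ℝ :=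
  Matrix.of fun i j => f (Q i) (K j)

/-- Generalized self-attention `h(S) · V`. -/
noncomputable def attention {n d dv : ℕ} (f : (Fin d → ℝ) → (Fin d → ℝ) → ℝ)
    (h : Matrix (Fin n) (Fin n) ℝ → Matrix (Fin n) (Fin n) ℝ)
    (Q K : Matrix (Fin n) (Fin d) ℝ) (V : Matrix (Fin n) (Fin dv) ℝ) : Matrix (Fin n) (Fin dv) ℝ :=
  h (scoreMatrix f Q K) * V

/-- Exponential dot-product self-attention with `K = Q` and without normalization. -/
noncomputable def expDotAttention {n d dv : ℕ} (Q : Matrix (Fin n) (Fin d) ℝ)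
    (V : Matrix (Fin n) (Fin dv) ℝ) : Matrix (Fin n) (Fin dv) ℝ :=
  attention (fun x y => Real.exp (x ⬝ᵥ y)) id Q Q V

/-- The instances on which algorithms are tested: `Q` has entries in `{0, …, 2 ⌊log₂ n⌋}` and `V`
has entries in `{0, 1}`. (Asking less of the algorithms makes a lower bound stronger, and a time
bound in terms of `n` alone needs entries of bounded length.) -/
structure AttentionInstance (n d dv : ℕ) where
  Q : Matrix (Fin n) (Fin d) ℕ
  V : Matrix (Fin n) (Fin dv) ℕ
  Q_le : ∀ i k, Q i k ≤ 2 * Nat.log 2 n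
  V_le : ∀ i c, V i c ≤ 1

/-- The self-attention matrix `Y` of an instance. -/
noncomputable def AttentionInstance.Y {n d dv : ℕ} (x : AttentionInstance n d dv) :
    Matrix (Fin n) (Fin dv) ℝ :=
  expDotAttention (x.Q.map (Nat.cast : ℕ → ℝ)) (x.V.map (Nat.cast : ℕ → ℝ))

/-- Column by column storage of an `n × m` matrix: cell `j * n + i` holds the entry `(i, j)`; all
other cells hold `0`. -/
def storeMatrix {n m : ℕ} (A : Matrix (Fin n) (Fin m) ℕ) (z : ℤ) : ℤ :=
  ∑ i : Fin n, ∑ j : Fin m, if z = (j : ℤ) * n + i then (A i j : ℤ) else 0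

/-- Input of self-attention: register `0` holds `n`, array `0` holds `Q`, array `1` holds `V`. -/
def AttentionInstance.input {n d dv : ℕ} (x : AttentionInstance n d dv) : State where
  reg := fun i => if i = 0 then (n : ℤ) else 0
  arr := fun a => if a = 0 then storeMatrix x.Q else if a = 1 then storeMatrix x.V else fun _ => 0

/-- The final state holds the matrix `Ŷ` of rational numbers, stored column by column: numerators
in array `2`, positive denominators in array `3`. -/
def HoldsRational {n dv : ℕ} (s : State) (Yhat : Matrix (Fin n) (Fin dv) ℝ) : Prop :=
  ∀ (i : Fin n) (c : Fin dv), 0 < s.arr 3 ((c : ℤ) * n + i) ∧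
    Yhat i c = (s.arr 2 ((c : ℤ) * n + i) : ℝ) / (s.arr 3 ((c : ℤ) * n + i) : ℝ)

/-- The final state holds the matrix `Ŷ`, whose entries are integer combinations of powers of
Euler's number `e`, as a list of nonzero terms in any order: register `0` holds the number of terms,
and the `r`-th term says that `b * e ^ x` is a summand of the entry `(i, c)`, with `i`, `c`, `b`, `x`
in the `r`-th cells of the arrays `2`, `3`, `4`, `5`. -/
def HoldsSymbolic {n dv : ℕ} (s : State) (Yhat : Matrix (Fin n) (Fin dv) ℝ) : Prop :=
  (∀ r < (s.reg 0).toNat, s.arr 4 r ≠ 0) ∧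
  ∀ (i : Fin n) (c : Fin dv), Yhat i c =
    ∑ r ∈ Finset.range (s.reg 0).toNat,
      if s.arr 2 r = (i : ℤ) ∧ s.arr 3 r = (c : ℤ)
      then (s.arr 4 r : ℝ) * Real.exp (s.arr 5 r : ℝ) else 0

/-- The problem of computing, for instances of dimensions `n × d n` and `n × dv n`, a matrix `Ŷ`
that is related to `Y` by `Rel` and that is returned in the format `Holds`. The dimensions are fixed
functions of `n`, on which the program may depend, so that `n` is the only parameter in the input. -/
def attentionProblem (d dv : ℕ → ℕ)
    (Holds : {n m : ℕ} → State → Matrix (Fin n) (Fin m) ℝ → Prop)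
    (Rel : {n m : ℕ} → Matrix (Fin n) (Fin m) ℝ → Matrix (Fin n) (Fin m) ℝ → Prop) :
    Problem where
  Inst := fun n => AttentionInstance n (d n) (dv n)
  input := fun _ x => x.input
  Correct := fun _ x s' => ∃ Yhat, Holds s' Yhat ∧ Rel Yhat x.Y

/-- Exact computation: `Ŷ = Y`. -/
def exactAttention (d dv : ℕ → ℕ) : Problem :=
  attentionProblem d dv HoldsSymbolic fun Yhat Y => Yhat = Y

/-- Entrywise multiplicative approximation: `|Ŷ i j - Y i j| ≤ μ |Y i j|`. -/
def mulApproxAttention (μ : ℝ) (d dv : ℕ → ℕ) : Problem :=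
  attentionProblem d dv HoldsRational fun Yhat Y => ∀ i j, |Yhat i j - Y i j| ≤ μ * |Y i j|

/-- Entrywise additive approximation: `|Ŷ i j - Y i j| ≤ μ`. -/
def addApproxAttention (μ : ℝ) (d dv : ℕ → ℕ) : Problem :=
  attentionProblem d dv HoldsRational fun Yhat Y => ∀ i j, |Yhat i j - Y i j| ≤ μ

end FineGrained

/-!
An algorithm `A` that computes or approximates self-attention in time `O(n ^ (2 - ε))`, where `ε ≤ 1`
without loss of generality, would decide
`k`-SAT over `N` variables in time `O(2 ^ ((1 - ε / 8) N))`, for all `k`, against SETH. The reduction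
runs `A` once, on an instance with `n = 2 ^ (E + 2)` rows, where `E` is slightly more than `N / 2`.

*Split and list.* The assignments of the first and of the second half of the variables become rows
`i` and `b` of `Q`. Every clause owns two columns, in which the row `i` holds `(α, 1 - α)` and the row
`b` holds `(1, β)`, where `α` and `β` say whether the half assignment satisfies the clause; the inner
product of these pairs is `1` if one of the halves satisfies the clause and `0` otherwise. So the
score of two rows counts the satisfied clauses, and the formula is satisfiable if and only if some
score takes the greatest possible value `T`. As `V` selects the rows of second halves, the entry of
`Y` in row `i` is the sum of `exp (2 (E + 2) · score i b)` over all `b`; the factor `2 (E + 2)`, which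
is `2 log₂ n`, makes a single greatest score outweigh all smaller ones.

*Sparsification.* This needs `2 T` columns, but `d n` is only known to exceed every multiple of
`log n`, that is, of `N`; so the formula must have `O(N)` clauses. By the sparsification lemma of
Impagliazzo, Paturi and Zane, it is a disjunction of `2 ^ (γ N)` such formulas: repeatedly branch on
a flower, whose heart or whose petals are added as clauses. The path to a leaf of the branching tree
is encoded by `adviceBits` many bits, because petals are rarely chosen. All leaves are treated in the
same instance: the bits of advice become part of the index of a row, and further pairs of columns make
the greatest score impossible for rows with different advice. This is `exists_agreeCount_iff`.

*Evaluation of the answers.* A calibrating row of `Q` has the score `T` with all second halves, so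
that its entry of `Y` is `2 ^ E · exp (2 (E + 2) T)`. From approximations with a relative error below
`1`, a comparison with the calibrating row tells which rows contain the score `T`
(`threshold_iff`); hence no approximation of `exp` has to be computed by the machine. An additive
error is a small relative error, since the entries are at least `2 ^ E`. For exact symbolic answers,
the powers of `e` with integer exponents are linearly independent over the integers, so that the
coefficient of `exp (2 (E + 2) T)` in a row counts its greatest scores (`sum_coeff_eq_card`).
`RecoversTopScore` is the common interface of these evaluations.

*Machine programs.* Arithmetic expressions with bounded sums and products (`BExpr`) are compiled to
programs whose time is polynomial in the range `Λ` of the sums and in the bit length of the data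
(`BExpr.exec_compile`). The predicates that describe the sparsification, the instance and brute force
are such expressions, which reduces the running times to closure properties of a class of functions
(`Impl`). The algorithm `A` only touches registers and arrays of small index, so that its run on the
input of the instance can be repeated inside of a longer program whose own data have large indices
(`Exec.frame`); the data that `A` leaves behind have no more bits in total than its running time, which
bounds the cost of reading its answers.
-/

open FineGrained

namespace FineGrained

/-! ### Executions: framing, loops, and the size of the data written -/

/-- All registers mentioned in the expression, and all arrays, have an index below `R`. -/
def Expr.Below (R : ℕ) : Expr → Prop
  | .const _ => True
  | .reg r => r < R
  | .get a idx => a < R ∧ idx.Below R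
  | .op _ e₁ e₂ => e₁.Below R ∧ e₂.Below R

/-- All registers and arrays mentioned in the program have an index below `R`. -/
def Program.Below (R : ℕ) : Program → Prop
  | .skip => True
  | .assign r e => r < R ∧ e.Below R
  | .store a idx e => a < R ∧ idx.Below R ∧ e.Below R
  | .seq p q => p.Below R ∧ q.Below R
  | .ite e p q => e.Below R ∧ p.Below R ∧ q.Below R
  | .loop e p => e.Below R ∧ p.Below R

theorem Expr.Below.mono {R R' : ℕ} (h : R ≤ R') : ∀ {e : Expr}, e.Below R → e.Below R'
  | .const _, _ => trivial
  | .reg _, he => lt_of_lt_of_le he h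
  | .get _ _, he => ⟨he.1.trans_le h, he.2.mono h⟩
  | .op _ _ _, he => ⟨he.1.mono h, he.2.mono h⟩

theorem Program.Below.mono {R R' : ℕ} (h : R ≤ R') : ∀ {p : Program}, p.Below R → p.Below R'
  | .skip, _ => trivial
  | .assign _ _, hp => ⟨hp.1.trans_le h, hp.2.mono h⟩
  | .store _ _ _, hp => ⟨hp.1.trans_le h, hp.2.1.mono h, hp.2.2.mono h⟩
  | .seq _ _, hp => ⟨hp.1.mono h, hp.2.mono h⟩
  | .ite _ _ _, hp => ⟨hp.1.mono h, hp.2.1.mono h, hp.2.2.mono h⟩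
  | .loop _ _, hp => ⟨hp.1.mono h, hp.2.mono h⟩

theorem Expr.exists_below : ∀ e : Expr, ∃ R, e.Below R
  | .const _ => ⟨0, trivial⟩
  | .reg r => ⟨r + 1, Nat.lt_succ_self r⟩
  | .get a idx => by
    obtain ⟨R, h⟩ := idx.exists_below
    exact ⟨max (a + 1) R, by simp, h.mono (le_max_right _ _)⟩
  | .op _ e₁ e₂ => by
    obtain ⟨R₁, h₁⟩ := e₁.exists_below
    obtain ⟨R₂, h₂⟩ := e₂.exists_below
    exact ⟨max R₁ R₂, h₁.mono (le_max_left _ _), h₂.mono (le_max_right _ _)⟩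

theorem Program.exists_below : ∀ p : Program, ∃ R, p.Below R
  | .skip => ⟨0, trivial⟩
  | .assign r e => by
    obtain ⟨R, h⟩ := e.exists_below
    exact ⟨max (r + 1) R, by simp, h.mono (le_max_right _ _)⟩
  | .store a idx e => by
    obtain ⟨R₁, h₁⟩ := idx.exists_below
    obtain ⟨R₂, h₂⟩ := e.exists_below
    exact ⟨max (a + 1) (max R₁ R₂), by simp, h₁.mono (by simp), h₂.mono (by simp)⟩
  | .seq p q => by
    obtain ⟨R₁, h₁⟩ := p.exists_below
    obtain ⟨R₂, h₂⟩ := q.exists_below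
    exact ⟨max R₁ R₂, h₁.mono (le_max_left _ _), h₂.mono (le_max_right _ _)⟩
  | .ite e p q => by
    obtain ⟨R, h⟩ := e.exists_below
    obtain ⟨R₁, h₁⟩ := p.exists_below
    obtain ⟨R₂, h₂⟩ := q.exists_below
    exact ⟨max R (max R₁ R₂), h.mono (by simp), h₁.mono (by simp), h₂.mono (by simp)⟩
  | .loop e p => by
    obtain ⟨R₁, h₁⟩ := e.exists_below
    obtain ⟨R₂, h₂⟩ := p.exists_below
    exact ⟨max R₁ R₂, h₁.mono (le_max_left _ _), h₂.mono (le_max_right _ _)⟩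

/-- The states agree on all registers and arrays of index below `R`. -/
def State.AgreeBelow (R : ℕ) (s s' : State) : Prop :=
  (∀ r < R, s.reg r = s'.reg r) ∧ ∀ a < R, s.arr a = s'.arr a

/-- The states agree on all registers and arrays of index at least `R`. -/
def State.AgreeAbove (R : ℕ) (s s' : State) : Prop :=
  (∀ r, R ≤ r → s.reg r = s'.reg r) ∧ ∀ a, R ≤ a → s.arr a = s'.arr a

theorem State.AgreeAbove.trans {R : ℕ} {s₁ s₂ s₃ : State} (h : s₁.AgreeAbove R s₂)
    (h' : s₂.AgreeAbove R s₃) : s₁.AgreeAbove R s₃ :=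
  ⟨fun r hr => (h.1 r hr).trans (h'.1 r hr), fun a ha => (h.2 a ha).trans (h'.2 a ha)⟩

theorem State.AgreeAbove.refl (R : ℕ) (s : State) : s.AgreeAbove R s :=
  ⟨fun _ _ => rfl, fun _ _ => rfl⟩

theorem Expr.eval_congr {R : ℕ} {s s' : State} (h : s.AgreeBelow R s') :
    ∀ {e : Expr}, e.Below R → e.eval s = e.eval s' ∧ e.cost s = e.cost s'
  | .const _, _ => ⟨rfl, rfl⟩
  | .reg r, he => by simp [Expr.eval, Expr.cost, h.1 r he]
  | .get a idx, he => by
    obtain ⟨h1, h2⟩ := Expr.eval_congr h he.2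
    simp [Expr.eval, Expr.cost, h1, h2, h.2 a he.1]
  | .op o e₁ e₂, he => by
    obtain ⟨h1, h2⟩ := Expr.eval_congr h he.1
    obtain ⟨h3, h4⟩ := Expr.eval_congr h he.2
    simp [Expr.eval, Expr.cost, h1, h2, h3, h4]

/-- A program neither reads nor writes registers and arrays that it does not mention. -/
theorem Exec.frame {R : ℕ} {p : Program} {s s' : State} {t : ℕ} (h : Exec p s s' t) :
    ∀ {u : State}, p.Below R → s.AgreeBelow R u →
      ∃ u', Exec p u u' t ∧ s'.AgreeBelow R u' ∧ u.AgreeAbove R u' := by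
  induction h with
  | skip s => exact fun {u} _ hu => ⟨u, .skip u, hu, .refl _ _⟩
  | assign s r e =>
    intro u hp hu
    obtain ⟨h1, h2⟩ := Expr.eval_congr hu hp.2
    refine ⟨u.setReg r (e.eval u), h2 ▸ .assign u r e, ⟨fun r' hr' => ?_, hu.2⟩,
      ⟨fun r' hr' => ?_, fun _ _ => rfl⟩⟩
    · by_cases hrr : r' = r <;> simp [State.setReg, Function.update, hrr, h1, hu.1 r' hr']
    · have : r' ≠ r := by have := hp.1; omega
      simp [State.setReg, Function.update, this]
  | store s a idx e =>
    intro u hp hu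
    obtain ⟨h1, h2⟩ := Expr.eval_congr hu hp.2.1
    obtain ⟨h3, h4⟩ := Expr.eval_congr hu hp.2.2
    refine ⟨u.setArr a (idx.eval u) (e.eval u), h2 ▸ h4 ▸ .store u a idx e,
      ⟨hu.1, fun a' ha' => ?_⟩, ⟨fun _ _ => rfl, fun a' ha' => ?_⟩⟩
    · by_cases haa : a' = a
      · subst haa; simp [State.setArr, h1, h3, hu.2 _ ha']
      · simp [State.setArr, Function.update, haa, hu.2 a' ha']
    · have : a' ≠ a := by have := hp.1; omega
      simp [State.setArr, Function.update, this]
  | seq _ _ ih₁ ih₂ =>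
    intro u hp hu
    obtain ⟨u₁, e₁, hu₁, hf₁⟩ := ih₁ hp.1 hu
    obtain ⟨u₂, e₂, hu₂, hf₂⟩ := ih₂ hp.2 hu₁
    exact ⟨u₂, .seq e₁ e₂, hu₂, hf₁.trans hf₂⟩
  | iteTrue he _ ih =>
    intro u hp hu
    obtain ⟨h1, h2⟩ := Expr.eval_congr hu hp.1
    obtain ⟨u₁, e₁, hu₁, hf₁⟩ := ih hp.2.1 hu
    exact ⟨u₁, h2 ▸ .iteTrue (h1 ▸ he) e₁, hu₁, hf₁⟩
  | iteFalse he _ ih =>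
    intro u hp hu
    obtain ⟨h1, h2⟩ := Expr.eval_congr hu hp.1
    obtain ⟨u₁, e₁, hu₁, hf₁⟩ := ih hp.2.2 hu
    exact ⟨u₁, h2 ▸ .iteFalse (h1 ▸ he) e₁, hu₁, hf₁⟩
  | whileTrue he _ _ ih₁ ih₂ =>
    intro u hp hu
    obtain ⟨h1, h2⟩ := Expr.eval_congr hu hp.1
    obtain ⟨u₁, e₁, hu₁, hf₁⟩ := ih₁ hp.2 hu
    obtain ⟨u₂, e₂, hu₂, hf₂⟩ := ih₂ hp hu₁
    exact ⟨u₂, h2 ▸ .whileTrue (h1 ▸ he) e₁ e₂, hu₂, hf₁.trans hf₂⟩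
  | whileFalse he =>
    intro u hp hu
    obtain ⟨h1, h2⟩ := Expr.eval_congr hu hp.1
    exact ⟨u, h2 ▸ .whileFalse (h1 ▸ he), hu, .refl _ _⟩

theorem bitCost_eval_le_cost (s : State) : ∀ e : Expr, bitCost (e.eval s) ≤ e.cost s
  | .const _ => le_rfl
  | .reg _ => le_rfl
  | .get _ _ => Nat.le_add_left _ _
  | .op _ _ _ => Nat.le_add_left _ _

/-- Logarithmic cost bounds the total length of what a run leaves in an array: this makes it
possible to read the output of a program within its own time bound. -/
theorem Exec.sum_bitCost_arr_le {p : Program} {s s' : State} {t : ℕ} (h : Exec p s s' t) (a : ℕ)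
    (I : Finset ℤ) :
    ∑ z ∈ I, bitCost (s'.arr a z) ≤ ∑ z ∈ I, bitCost (s.arr a z) + t := by
  induction h with
  | skip s => omega
  | assign s r e => simp only [State.setReg]; omega
  | store s a' idx e =>
    by_cases haa : a = a'
    · subst haa
      have h1 := bitCost_eval_le_cost s e
      have : ∑ z ∈ I, bitCost ((s.setArr a (idx.eval s) (e.eval s)).arr a z)
          ≤ ∑ z ∈ I, (bitCost (s.arr a z) + if z = idx.eval s then bitCost (e.eval s) else 0) := by
        refine Finset.sum_le_sum fun z _ => ?_
        by_cases hz : z = idx.eval s <;> simp [State.setArr, Function.update, hz]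
      rw [Finset.sum_add_distrib, Finset.sum_ite_eq'] at this
      split_ifs at this <;> omega
    · simp [State.setArr, Function.update, haa]
  | seq _ _ ih₁ ih₂ => omega
  | iteTrue _ _ ih => omega
  | iteFalse _ _ ih => omega
  | whileTrue _ _ _ ih₁ ih₂ => omega
  | whileFalse _ => omega

theorem Exec.bitCost_reg_le {p : Program} {s s' : State} {t : ℕ} (h : Exec p s s' t) (r : ℕ) :
    bitCost (s'.reg r) ≤ bitCost (s.reg r) + t := by
  induction h with
  | skip s => omega
  | assign s r' e =>
    have h1 := bitCost_eval_le_cost s e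
    by_cases hr : r = r'
    · simp [State.setReg, Function.update, hr]; omega
    · simp [State.setReg, Function.update, hr]
  | store s a' idx e => simp only [State.setArr]; omega
  | seq _ _ ih₁ ih₂ => omega
  | iteTrue _ _ ih => omega
  | iteFalse _ _ ih => omega
  | whileTrue _ _ _ ih₁ ih₂ => omega
  | whileFalse _ => omega

/-- A loop that runs `n` times, with an invariant indexed by the number of finished rounds. -/
theorem Exec.loop_of_invariant {e : Expr} {p : Program} (I : ℕ → State → Prop) (n : ℕ)
    (cost : ℕ → ℕ) (c : ℕ)
    (step : ∀ i < n, ∀ s, I i s → e.eval s ≠ 0 ∧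
      ∃ s' t, Exec p s s' t ∧ I (i + 1) s' ∧ e.cost s + t + 1 ≤ cost i)
    (halt : ∀ s, I n s → e.eval s = 0 ∧ e.cost s + 1 ≤ c) {s : State} (hs : I 0 s) :
    ∃ s' t, Exec (.loop e p) s s' t ∧ I n s' ∧ t ≤ ∑ i ∈ Finset.range n, cost i + c := by
  suffices H : ∀ m i, i + m = n → ∀ s, I i s → ∃ s' t, Exec (.loop e p) s s' t ∧ I n s' ∧
      t ≤ ∑ j ∈ Finset.range m, cost (i + j) + c by
    obtain ⟨s', t, h⟩ := H n 0 (zero_add n) s hs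
    exact ⟨s', t, by simpa using h⟩
  intro m
  induction m with
  | zero =>
    intro i hi s hs
    obtain rfl : i = n := by omega
    obtain ⟨h1, h2⟩ := halt s hs
    exact ⟨s, _, .whileFalse h1, hs, by simpa using h2⟩
  | succ m ih =>
    intro i hi s hs
    obtain ⟨h1, s₁, t₁, hx, hI, ht⟩ := step i (by omega) s hs
    obtain ⟨s₂, t₂, hx₂, hI₂, ht₂⟩ := ih (i + 1) (by omega) s₁ hI
    refine ⟨s₂, _, .whileTrue h1 hx hx₂, hI₂, ?_⟩
    rw [Finset.sum_range_succ']
    have : ∑ j ∈ Finset.range m, cost (i + 1 + j) = ∑ j ∈ Finset.range m, cost (i + (j + 1)) :=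
      Finset.sum_congr rfl fun j _ => by congr 1; omega
    simp only [add_zero]
    omega

theorem bitCost_le_of_abs_le {z : ℤ} {b : ℕ} (h : |z| ≤ 2 ^ b) : bitCost z ≤ b + 2 := by
  have : z.natAbs < 2 ^ (b + 1) := by
    have h' : z.natAbs ≤ 2 ^ b := by
      rw [Int.abs_eq_natAbs] at h
      exact_mod_cast h
    rw [pow_succ]
    have := Nat.pos_of_ne_zero (pow_ne_zero b (two_ne_zero (α := ℕ)))
    omega
  have := Nat.size_le.2 this
  unfold bitCost
  omega

theorem abs_le_two_pow_bitCost (z : ℤ) : |z| ≤ 2 ^ bitCost z := by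
  rw [Int.abs_eq_natAbs]
  have h1 : z.natAbs < 2 ^ z.natAbs.size := Nat.lt_size_self _
  have h2 : (2 : ℕ) ^ z.natAbs.size ≤ 2 ^ bitCost z := Nat.pow_le_pow_right (by norm_num) (by simp [bitCost])
  exact_mod_cast (h1.trans_le h2).le

/-! ### A language of bounded expressions and its compilation -/

/-- The data on which bounded expressions depend: the range `lam` of all loops, the arrays, and the
variables (de Bruijn indices: `var 0` is the innermost one). -/
structure Env where
  lam : ℕ
  arr : ℕ → ℤ → ℤ
  var : ℕ → ℤ

/-- The environment inside a loop with counter `z`. -/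
def Env.push (e : Env) (z : ℤ) : Env :=
  { e with var := fun n => Nat.casesOn n z e.var }

@[simp] theorem Env.push_lam (e : Env) (z : ℤ) : (e.push z).lam = e.lam := rfl

/-- The environment outside the innermost loop. -/
def Env.pop (e : Env) : Env :=
  { e with var := fun n => e.var (n + 1) }

/-- Arithmetic expressions with sums and products over `{0, …, lam - 1}`. All loops having the same
range, the cost of evaluation is polynomial in `lam` and in the length of the data. -/
inductive BExpr where
  | const (z : ℤ)
  | var (n : ℕ)
  | get (a : ℕ) (e : BExpr)
  | op (o : BinOp) (e₁ e₂ : BExpr)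
  | sum (e : BExpr)
  | prod (e : BExpr)

/-- Value of a bounded expression. -/
def BExpr.den : BExpr → Env → ℤ
  | .const z, _ => z
  | .var n, env => env.var n
  | .get a e, env => env.arr a (e.den env)
  | .op o e₁ e₂, env => o.eval (e₁.den env) (e₂.den env)
  | .sum e, env => ∑ i ∈ Finset.range env.lam, e.den (env.push i)
  | .prod e, env => ∏ i ∈ Finset.range env.lam, e.den (env.push i)

/-- The program that evaluates a bounded expression. The range of the loops is in register `lr`,
the `n`-th variable in register `vars n`; the result goes to register `t`, and only registers of
index at least `t` are written. -/
def BExpr.compile (lr : ℕ) : BExpr → (ℕ → ℕ) → ℕ → Program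
  | .const z, _, t => .assign t (.const z)
  | .var n, vars, t => .assign t (.reg (vars n))
  | .get a e, vars, t => .seq (e.compile lr vars t) (.assign t (.get a (.reg t)))
  | .op o e₁ e₂, vars, t => .seq (e₁.compile lr vars t) (.seq (e₂.compile lr vars (t + 1))
      (.assign t (.op o (.reg t) (.reg (t + 1)))))
  | .sum e, vars, t => .seq (.assign t (.const 0)) (.seq (.assign (t + 1) (.const 0))
      (.loop (.op .lt (.reg (t + 1)) (.reg lr))
        (.seq (e.compile lr (fun n => Nat.casesOn n (t + 1) vars) (t + 2))
          (.seq (.assign t (.op .add (.reg t) (.reg (t + 2))))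
            (.assign (t + 1) (.op .add (.reg (t + 1)) (.const 1)))))))
  | .prod e, vars, t => .seq (.assign t (.const 1)) (.seq (.assign (t + 1) (.const 0))
      (.loop (.op .lt (.reg (t + 1)) (.reg lr))
        (.seq (e.compile lr (fun n => Nat.casesOn n (t + 1) vars) (t + 2))
          (.seq (.assign t (.op .mul (.reg t) (.reg (t + 2))))
            (.assign (t + 1) (.op .add (.reg (t + 1)) (.const 1)))))))

/-- All data of the environment have at most `β` bits. -/
structure Env.Bounded (env : Env) (β : ℕ) : Prop where
  lam : env.lam ≤ 2 ^ β
  arr : ∀ a z, |env.arr a z| ≤ 2 ^ β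
  var : ∀ n, |env.var n| ≤ 2 ^ β

theorem Env.Bounded.push {env : Env} {β i : ℕ} (h : env.Bounded β) (hi : i < env.lam) :
    (env.push i).Bounded β := by
  refine ⟨h.lam, h.arr, fun n => ?_⟩
  cases n with
  | zero =>
    have : i ≤ 2 ^ β := hi.le.trans h.lam
    have h' : |(i : ℤ)| ≤ 2 ^ β := by rw [Nat.abs_cast]; exact_mod_cast this
    exact h'
  | succ n => exact h.var n

theorem abs_binOp_eval_le {o : BinOp} {x y : ℤ} {m n : ℕ} (hx : |x| ≤ 2 ^ m) (hy : |y| ≤ 2 ^ n) :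
    |o.eval x y| ≤ 2 ^ (m + n + 1) := by
  have hm : (1 : ℤ) ≤ 2 ^ m := one_le_pow₀ (by norm_num)
  have hn : (1 : ℤ) ≤ 2 ^ n := one_le_pow₀ (by norm_num)
  have hmn : (2 : ℤ) ^ (m + n + 1) = 2 ^ m * 2 ^ n * 2 := by rw [pow_succ, pow_add]
  have h1 : (2 : ℤ) ^ m + 2 ^ n ≤ 2 ^ (m + n + 1) := by rw [hmn]; nlinarith
  have h2 : (1 : ℤ) ≤ 2 ^ (m + n + 1) := one_le_pow₀ (by norm_num)
  cases o with
  | add => exact ((abs_add_le x y).trans (add_le_add hx hy)).trans h1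
  | sub => exact ((abs_sub x y).trans (add_le_add hx hy)).trans h1
  | mul =>
    have : |x * y| ≤ 2 ^ m * 2 ^ n := by
      rw [abs_mul]; exact mul_le_mul hx hy (abs_nonneg _) (by positivity)
    simp only [BinOp.eval]
    nlinarith
  | div =>
    have : |x / y| ≤ |x| := by
      rw [Int.abs_eq_natAbs, Int.abs_eq_natAbs]
      exact_mod_cast Int.natAbs_ediv_le_natAbs x y
    simp only [BinOp.eval]
    linarith
  | mod =>
    simp only [BinOp.eval]
    rcases eq_or_ne y 0 with rfl | h
    · simp only [Int.emod_zero]; linarith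
    · rw [abs_of_nonneg (Int.emod_nonneg x h)]
      have := Int.emod_lt_abs x h
      linarith
  | lt => simp only [BinOp.eval]; split_ifs <;> simp [h2]
  | eq => simp only [BinOp.eval]; split_ifs <;> simp [h2]

theorem add_pow_le_pow_add {X a b : ℕ} (hX : 2 ≤ X) : X ^ a + X ^ b + 1 ≤ X ^ (a + b + 2) := by
  have h1 : 1 ≤ X ^ a := Nat.one_le_pow _ _ (by omega)
  have h2 : 1 ≤ X ^ b := Nat.one_le_pow _ _ (by omega)
  have h3 : 2 ^ 2 ≤ X ^ 2 := Nat.pow_le_pow_left hX 2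
  rw [pow_add, pow_add]
  nlinarith [Nat.mul_le_mul (Nat.mul_le_mul h1 h2) h3, Nat.mul_le_mul (le_refl (X ^ a * X ^ b)) h3]

theorem sum_three_pow_le {X a b c m : ℕ} (hX : 2 ≤ X) (hm : m ≤ 8) :
    X ^ a + X ^ b + X ^ c + m ≤ X ^ (a + b + c + 5) := by
  have h1 : 1 ≤ X ^ a := Nat.one_le_pow _ _ (by omega)
  have h2 : 1 ≤ X ^ b := Nat.one_le_pow _ _ (by omega)
  have h4 : 1 ≤ X ^ c := Nat.one_le_pow _ _ (by omega)
  have h3 : 2 ^ 5 ≤ X ^ 5 := Nat.pow_le_pow_left hX 5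
  rw [pow_add, pow_add, pow_add]
  have hab : X ^ a ≤ X ^ a * X ^ b * X ^ c := by
    rw [mul_assoc]; exact Nat.le_mul_of_pos_right _ (by positivity)
  have hb : X ^ b ≤ X ^ a * X ^ b * X ^ c := by
    rw [mul_comm (X ^ a), mul_assoc]; exact Nat.le_mul_of_pos_right _ (by positivity)
  have hc : X ^ c ≤ X ^ a * X ^ b * X ^ c := Nat.le_mul_of_pos_left _ (by positivity)
  have := Nat.mul_le_mul (le_refl (X ^ a * X ^ b * X ^ c)) h3
  omega

theorem abs_sum_range_le {f : ℕ → ℤ} {n : ℕ} {b : ℤ} (h : ∀ i < n, |f i| ≤ b) :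
    |∑ i ∈ Finset.range n, f i| ≤ n * b := by
  refine (Finset.abs_sum_le_sum_abs _ _).trans ?_
  refine (Finset.sum_le_card_nsmul _ _ b fun i hi => h i (Finset.mem_range.1 hi)).trans ?_
  simp

theorem abs_prod_range_le {f : ℕ → ℤ} {n : ℕ} {b : ℤ} (h : ∀ i < n, |f i| ≤ b) :
    |∏ i ∈ Finset.range n, f i| ≤ b ^ n := by
  rw [Finset.abs_prod]
  refine (Finset.prod_le_prod (fun _ _ => abs_nonneg _)
    fun i hi => h i (Finset.mem_range.1 hi)).trans ?_
  simp

/-- The values of a bounded expression have polynomially many bits. -/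
theorem BExpr.exists_abs_den_le (e : BExpr) : ∃ c, ∀ (env : Env) (β : ℕ), env.Bounded β →
    |e.den env| ≤ 2 ^ (env.lam + β + 2) ^ c := by
  have hmono : ∀ {a b : ℕ}, a ≤ b → (2 : ℤ) ^ a ≤ 2 ^ b := fun h =>
    pow_le_pow_right₀ (by norm_num) h
  induction e with
  | const z =>
    refine ⟨bitCost z, fun env β _ => (abs_le_two_pow_bitCost z).trans (hmono ?_)⟩
    exact (Nat.lt_pow_self (by omega)).le
  | var n => exact ⟨1, fun env β h => (h.var n).trans (hmono (by simp; omega))⟩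
  | get a e _ => exact ⟨1, fun env β h => (h.arr a _).trans (hmono (by simp; omega))⟩
  | op o e₁ e₂ ih₁ ih₂ =>
    obtain ⟨c₁, h₁⟩ := ih₁
    obtain ⟨c₂, h₂⟩ := ih₂
    exact ⟨c₁ + c₂ + 2, fun env β h => (abs_binOp_eval_le (h₁ env β h) (h₂ env β h)).trans
      (hmono (add_pow_le_pow_add (by omega)))⟩
  | sum e ih =>
    obtain ⟨c, hc⟩ := ih
    refine ⟨c + 1 + 2, fun env β h => ?_⟩
    have key : ∀ i < env.lam, |e.den (env.push i)| ≤ 2 ^ (env.lam + β + 2) ^ c :=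
      fun i hi => by simpa only [Env.push_lam] using hc _ β (h.push hi)
    refine (abs_sum_range_le key).trans ?_
    have h1 : (env.lam : ℤ) ≤ 2 ^ env.lam := by exact_mod_cast (Nat.lt_two_pow_self).le
    refine (mul_le_mul_of_nonneg_right h1 (by positivity)).trans ?_
    rw [← pow_add]
    refine hmono (le_trans ?_ (add_pow_le_pow_add (by omega)))
    rw [pow_one]
    omega
  | prod e ih =>
    obtain ⟨c, hc⟩ := ih
    refine ⟨c + 1, fun env β h => ?_⟩
    have key : ∀ i < env.lam, |e.den (env.push i)| ≤ 2 ^ (env.lam + β + 2) ^ c :=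
      fun i hi => by simpa only [Env.push_lam] using hc _ β (h.push hi)
    refine (abs_prod_range_le key).trans ?_
    rw [← pow_mul, pow_succ]
    exact hmono (Nat.mul_le_mul_left _ (by omega))

/-- The effect of evaluating a bounded expression: the result is in register `t`, and nothing else
is changed but registers above `t`. -/
structure EvalsTo (s s' : State) (t : ℕ) (z : ℤ) : Prop where
  result : s'.reg t = z
  arr : s'.arr = s.arr
  reg : ∀ r < t, s'.reg r = s.reg r

/-- The environment described by a state. -/
def State.env (s : State) (lam : ℕ) (vars : ℕ → ℕ) : Env where
  lam := lam
  arr := s.arr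
  var := fun n => s.reg (vars n)

@[simp] theorem State.env_lam (s : State) (lam : ℕ) (vars : ℕ → ℕ) : (s.env lam vars).lam = lam :=
  rfl

theorem State.env_congr {s s' : State} {lam t : ℕ} {vars : ℕ → ℕ} (harr : s'.arr = s.arr)
    (hreg : ∀ r < t, s'.reg r = s.reg r) (hvars : ∀ n, vars n < t) :
    s'.env lam vars = s.env lam vars := by
  simp [State.env, harr, hreg _ (hvars _)]

/-- Loop of the compiled sums and products, for an operation `o` with partial results `acc`. -/
theorem BExpr.exec_loop {lr t lam β c M : ℕ} {vars : ℕ → ℕ} {e : BExpr} {o : BinOp} {s : State}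
    (hlr : s.reg lr = lam) (hlt : lr < t) (hvars : ∀ n, vars n < t)
    (hB : (s.env lam vars).Bounded β) (acc : ℕ → ℤ) (hacc0 : s.reg t = acc 0)
    (hcount : s.reg (t + 1) = 0)
    (hacc : ∀ i < lam, acc (i + 1) = o.eval (acc i) (e.den ((s.env lam vars).push i)))
    (haccM : ∀ i ≤ lam, |acc i| ≤ 2 ^ M)
    (heM : ∀ i < lam, |e.den ((s.env lam vars).push i)| ≤ 2 ^ M)
    (ih : ∀ (vars : ℕ → ℕ) (t : ℕ) (s : State), s.reg lr = lam → lr < t → (∀ n, vars n < t) →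
      (s.env lam vars).Bounded β → ∃ s' τ, Exec (e.compile lr vars t) s s' τ ∧
        EvalsTo s s' t (e.den (s.env lam vars)) ∧ τ ≤ c) :
    ∃ s' τ, Exec (.loop (.op .lt (.reg (t + 1)) (.reg lr))
        (.seq (e.compile lr (fun n => Nat.casesOn n (t + 1) vars) (t + 2))
          (.seq (.assign t (.op o (.reg t) (.reg (t + 2))))
            (.assign (t + 1) (.op .add (.reg (t + 1)) (.const 1)))))) s s' τ ∧
      EvalsTo s s' t (acc lam) ∧ τ ≤ (lam + 1) * (c + 5 * β + 3 * M + 40) := by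
  have hlamβ : (lam : ℤ) ≤ 2 ^ β := by exact_mod_cast hB.lam
  have hcostz : ∀ i ≤ lam, bitCost (i : ℤ) ≤ β + 2 := fun i hi =>
    bitCost_le_of_abs_le (by rw [Nat.abs_cast]; exact le_trans (by exact_mod_cast hi) hlamβ)
  have hcost01 : ∀ (p : Prop) [Decidable p], bitCost (if p then 1 else 0) ≤ 2 := by
    intro p _; split_ifs <;> decide
  obtain ⟨s', τ, hex, ⟨h0, h1, h2, h3⟩, hτ⟩ := Exec.loop_of_invariant
    (e := .op .lt (.reg (t + 1)) (.reg lr))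
    (p := (.seq (e.compile lr (fun n => Nat.casesOn n (t + 1) vars) (t + 2))
          (.seq (.assign t (.op o (.reg t) (.reg (t + 2))))
            (.assign (t + 1) (.op .add (.reg (t + 1)) (.const 1))))))
    (fun i s' => i ≤ lam ∧ EvalsTo s s' t (acc i) ∧ s'.reg (t + 1) = i ∧ s'.reg lr = lam) lam
    (fun _ => c + 5 * β + 3 * M + 40) (2 * β + 12) (s := s)
    (by
      rintro i hi s₁ ⟨-, hev, hci, hl⟩
      refine ⟨by simp [Expr.eval, BinOp.eval, hci, hl, hi], ?_⟩
      have henv : s₁.env lam (fun n => Nat.casesOn n (t + 1) vars) = (s.env lam vars).push i := by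
        simp only [State.env, Env.push, hev.arr, Env.mk.injEq, true_and]
        funext n
        cases n with
        | zero => exact hci
        | succ n => exact hev.reg _ (hvars n)
      obtain ⟨s₂, τ, hx, hev₂, hτ⟩ := ih (fun n => Nat.casesOn n (t + 1) vars) (t + 2) s₁ hl
        (by omega) (by rintro (_ | n); exacts [by simp, (hvars n).trans (by omega)])
        (by rw [henv]; exact hB.push hi)
      rw [henv] at hev₂
      have ht2 : s₂.reg t = acc i := (hev₂.reg t (by omega)).trans hev.result
      have hc2 : s₂.reg (t + 1) = i := (hev₂.reg (t + 1) (by omega)).trans hci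
      refine ⟨_, _, .seq hx (.seq (.assign _ _ _) (.assign _ _ _)), ⟨by omega, ⟨?_, ?_, ?_⟩, ?_, ?_⟩, ?_⟩
      · simp [State.setReg, Expr.eval, ht2, hev₂.result, hacc i hi]
      · exact hev₂.arr.trans hev.arr
      · intro r hr
        have h1 : r ≠ t := by omega
        have h2 : r ≠ t + 1 := by omega
        simp [State.setReg, h1, h2, hev₂.reg r (by omega), hev.reg r hr]
      · simp [State.setReg, Expr.eval, BinOp.eval, hc2]
      · have h1 : lr ≠ t := by omega
        have h2 : lr ≠ t + 1 := by omega
        simp [State.setReg, h1, h2, hev₂.reg lr (by omega), hl]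
      · have b1 := hcostz i hi.le
        have b2 := hcostz lam le_rfl
        have b3 := bitCost_le_of_abs_le (haccM i hi.le)
        have b4 := bitCost_le_of_abs_le (heM i hi)
        have b5 := bitCost_le_of_abs_le (haccM (i + 1) hi)
        rw [hacc i hi] at b5
        have b6 := hcostz (i + 1) hi
        have b7 : bitCost 1 = 2 := by decide
        have b8 := hcost01 ((i : ℤ) < lam)
        push_cast at b6
        simp [Expr.cost, Expr.eval, BinOp.eval, State.setReg, hc2, ht2, hev₂.result, hci, hl]
          at b1 b2 b3 b4 b5 b6 b7 b8 hτ ⊢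
        omega)
    (by
      rintro s₁ ⟨-, hev, hci, hl⟩
      have b2 := hcostz lam le_rfl
      have b8 : bitCost 0 = 1 := by decide
      refine ⟨by simp [Expr.eval, BinOp.eval, hci, hl], ?_⟩
      simp [Expr.cost, Expr.eval, BinOp.eval, hci, hl]
      omega)
    ⟨Nat.zero_le _, ⟨hacc0, rfl, fun _ _ => rfl⟩, by simpa using hcount, hlr⟩
  refine ⟨s', τ, hex, h1, hτ.trans ?_⟩
  simp only [Finset.sum_const, Finset.card_range, smul_eq_mul]
  nlinarith

theorem loop_cost_le {lam β c M τ m : ℕ}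
    (hτ : τ ≤ (lam + 1) * ((lam + β + 2) ^ c + 5 * β + 3 * (lam + β + 2) ^ M + 40)) (hm : m ≤ 5) :
    m + τ ≤ (lam + β + 2) ^ (c + M + 12) := by
  set X := lam + β + 2 with hX
  have h2 : 2 ≤ X := by omega
  have h1 : 1 ≤ X ^ c := Nat.one_le_pow _ _ (by omega)
  have h3 : 1 ≤ X ^ M := Nat.one_le_pow _ _ (by omega)
  have h4 : 1 ≤ X ^ c * X ^ M := Nat.mul_le_mul h1 h3
  have hc : X ^ c ≤ X ^ c * X ^ M := Nat.le_mul_of_pos_right _ h3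
  have hM : X ^ M ≤ X ^ c * X ^ M := Nat.le_mul_of_pos_left _ h1
  have hXX : X ≤ X * (X ^ c * X ^ M) := Nat.le_mul_of_pos_right _ h4
  have hP : X ^ c * X ^ M ≤ X * (X ^ c * X ^ M) := Nat.le_mul_of_pos_left _ (by omega)
  have h5 : X ^ c + 5 * β + 3 * X ^ M + 40 ≤ 54 * (X * (X ^ c * X ^ M)) := by omega
  have h6 : m + τ ≤ X * (64 * (X * (X ^ c * X ^ M))) := by
    have : τ ≤ X * (54 * (X * (X ^ c * X ^ M))) := hτ.trans (Nat.mul_le_mul (by omega) h5)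
    have : X ≤ X * (X * (X ^ c * X ^ M)) := Nat.le_mul_of_pos_right _ (by omega)
    nlinarith
  have h7 : 2 ^ 10 ≤ X ^ 10 := Nat.pow_le_pow_left h2 10
  calc m + τ ≤ X * (64 * (X * (X ^ c * X ^ M))) := h6
    _ = X ^ c * X ^ M * X ^ 2 * 64 := by ring
    _ ≤ X ^ c * X ^ M * X ^ 2 * X ^ 10 := Nat.mul_le_mul_left _ (by omega)
    _ = X ^ (c + M + 12) := by ring

/-- Compiled bounded expressions compute their value in polynomial time. -/
theorem BExpr.exec_compile (e : BExpr) : ∃ c, ∀ (lr lam β : ℕ) (vars : ℕ → ℕ) (t : ℕ) (s : State),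
    s.reg lr = lam → lr < t → (∀ n, vars n < t) → (s.env lam vars).Bounded β →
    ∃ s' τ, Exec (e.compile lr vars t) s s' τ ∧ EvalsTo s s' t (e.den (s.env lam vars)) ∧
      τ ≤ (lam + β + 2) ^ c := by
  induction e with
  | const z =>
    refine ⟨bitCost z + 1, fun lr lam β vars t s _ _ _ _ => ⟨_, _, .assign _ _ _, ⟨?_, rfl, ?_⟩, ?_⟩⟩
    · simp [State.setReg, Expr.eval, BExpr.den]
    · intro r hr; simp [State.setReg, hr.ne]
    · exact (Nat.lt_pow_self (show 1 < lam + β + 2 by omega)).le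
  | var n =>
    refine ⟨2, fun lr lam β vars t s _ _ hv hB => ⟨_, _, .assign _ _ _, ⟨?_, rfl, ?_⟩, ?_⟩⟩
    · simp [State.setReg, Expr.eval, BExpr.den, State.env]
    · intro r hr; simp [State.setReg, hr.ne]
    · have h1 := bitCost_le_of_abs_le (hB.var n)
      have h2 : bitCost (s.reg (vars n)) ≤ β + 2 := h1
      simp only [Expr.cost]
      nlinarith
  | get a e ih =>
    obtain ⟨c, ih⟩ := ih
    obtain ⟨c', hc'⟩ := e.exists_abs_den_le
    refine ⟨c + c' + 1 + 5, fun lr lam β vars t s hl hlr hv hB => ?_⟩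
    obtain ⟨s₁, τ, hx, hev, hτ⟩ := ih lr lam β vars t s hl hlr hv hB
    refine ⟨_, _, .seq hx (.assign _ _ _), ⟨?_, hev.arr, ?_⟩, ?_⟩
    · simp [State.setReg, Expr.eval, BExpr.den, hev.result, hev.arr, State.env]
    · intro r hr; simp [State.setReg, hr.ne, hev.reg r hr]
    · have h1 := bitCost_le_of_abs_le (hB.arr a (e.den (s.env lam vars)))
      have h2 := bitCost_le_of_abs_le (hc' _ _ hB)
      have h3 := sum_three_pow_le (X := lam + β + 2) (a := c) (b := c') (c := 1) (m := 5) (by omega)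
        (by omega)
      rw [State.env_lam] at h2
      rw [pow_one] at h3
      have h4 : bitCost (s.arr a (e.den (s.env lam vars))) ≤ β + 2 := h1
      simp only [Expr.cost, Expr.eval, hev.result, hev.arr]
      omega
  | op o e₁ e₂ ih₁ ih₂ =>
    obtain ⟨c₁, ih₁⟩ := ih₁
    obtain ⟨c₂, ih₂⟩ := ih₂
    obtain ⟨d₁, hd₁⟩ := e₁.exists_abs_den_le
    obtain ⟨d₂, hd₂⟩ := e₂.exists_abs_den_le
    obtain ⟨d₃, hd₃⟩ := (BExpr.op o e₁ e₂).exists_abs_den_le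
    refine ⟨(c₁ + c₂ + d₁ + 5) + d₂ + d₃ + 5, fun lr lam β vars t s hl hlr hv hB => ?_⟩
    obtain ⟨s₁, τ₁, hx₁, hev₁, hτ₁⟩ := ih₁ lr lam β vars t s hl hlr hv hB
    have henv : s₁.env lam vars = s.env lam vars := State.env_congr hev₁.arr hev₁.reg hv
    obtain ⟨s₂, τ₂, hx₂, hev₂, hτ₂⟩ := ih₂ lr lam β vars (t + 1) s₁
      ((hev₁.reg lr hlr).trans hl) (by omega) (fun n => (hv n).trans (by omega)) (henv ▸ hB)
    have hr2 : s₂.reg t = e₁.den (s.env lam vars) := (hev₂.reg t (by omega)).trans hev₁.result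
    refine ⟨_, _, .seq hx₁ (.seq hx₂ (.assign _ _ _)), ⟨?_, hev₂.arr.trans hev₁.arr, ?_⟩, ?_⟩
    · simp [State.setReg, Expr.eval, BExpr.den, hr2, hev₂.result, henv]
    · intro r hr
      simp [State.setReg, hr.ne, hev₂.reg r (by omega), hev₁.reg r hr]
    · have h1 := bitCost_le_of_abs_le (hd₁ _ _ hB)
      have h2 := bitCost_le_of_abs_le (hd₂ _ _ hB)
      have h3 := bitCost_le_of_abs_le (hd₃ _ _ hB)
      have h4 := sum_three_pow_le (X := lam + β + 2) (a := c₁) (b := c₂) (c := d₁) (m := 7)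
        (by omega) (by omega)
      have h5 := sum_three_pow_le (X := lam + β + 2) (a := c₁ + c₂ + d₁ + 5) (b := d₂) (c := d₃)
        (m := 0) (by omega) (by omega)
      rw [State.env_lam] at h1 h2 h3
      rw [BExpr.den] at h3
      simp only [Expr.cost, Expr.eval, hev₂.result, hr2, henv]
      omega
  | sum e ih =>
    obtain ⟨c, ih⟩ := ih
    obtain ⟨d, hd⟩ := e.exists_abs_den_le
    refine ⟨c + (d + 4 + 2) + 12, fun lr lam β vars t s hl hlr hv hB => ?_⟩
    set s₁ := (s.setReg t 0).setReg (t + 1) 0 with hs₁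
    have hreg : ∀ r < t, s₁.reg r = s.reg r := by
      intro r hr
      have h1 : r ≠ t := by omega
      have h2 : r ≠ t + 1 := by omega
      simp [hs₁, State.setReg, h1, h2]
    have henv : s₁.env lam vars = s.env lam vars := State.env_congr rfl hreg hv
    have hd' : ∀ i < lam, |e.den ((s.env lam vars).push i)| ≤ 2 ^ (lam + β + 2) ^ d :=
      fun i hi => by simpa only [Env.push_lam, State.env_lam] using hd _ β (hB.push hi)
    have hacc : ∀ i ≤ lam, |∑ j ∈ Finset.range i, e.den ((s.env lam vars).push j)| ≤
        2 ^ ((lam + β + 2) ^ (d + 4 + 2)) := by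
      intro i hi
      refine (abs_sum_range_le fun j hj => hd' j (by omega)).trans ?_
      have h1 : (i : ℤ) ≤ 2 ^ lam := by exact_mod_cast hi.trans (Nat.lt_two_pow_self).le
      refine (mul_le_mul_of_nonneg_right h1 (by positivity)).trans ?_
      rw [← pow_add]
      refine pow_le_pow_right₀ (by norm_num) (le_trans ?_ (add_pow_le_pow_add (by omega)))
      have : lam ≤ (lam + β + 2) ^ 4 := (Nat.le_self_pow (by norm_num) _).trans
        (Nat.pow_le_pow_left (by omega) 4)
      omega
    obtain ⟨s', τ, hx, hev, hτ⟩ := BExpr.exec_loop (lr := lr) (t := t) (lam := lam) (β := β)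
      (c := (lam + β + 2) ^ c) (M := (lam + β + 2) ^ (d + 4 + 2)) (vars := vars) (e := e) (o := .add)
      (s := s₁) ((hreg lr hlr).trans hl) hlr hv (henv ▸ hB)
      (fun i => ∑ j ∈ Finset.range i, e.den ((s.env lam vars).push j))
      (by simp [hs₁, State.setReg]) (by simp [hs₁, State.setReg])
      (fun i _ => by rw [henv, Finset.sum_range_succ]; rfl) hacc
      (fun i hi => by
        rw [henv]
        refine (hd' i hi).trans (pow_le_pow_right₀ (by norm_num) ?_)
        exact Nat.pow_le_pow_right (by omega) (by omega))
      (fun vars t s => ih lr lam β vars t s)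
    refine ⟨s', _, .seq (.assign _ _ _) (.seq (.assign _ _ _) hx),
      ⟨hev.result, hev.arr, fun r hr => (hev.reg r hr).trans (hreg r hr)⟩, ?_⟩
    have b0 : bitCost 0 = 1 := by decide
    simp only [Expr.cost, b0]
    have := loop_cost_le (m := 5) hτ le_rfl
    omega
  | prod e ih =>
    obtain ⟨c, ih⟩ := ih
    obtain ⟨d, hd⟩ := e.exists_abs_den_le
    refine ⟨c + (d + 4 + 2) + 12, fun lr lam β vars t s hl hlr hv hB => ?_⟩
    set s₁ := (s.setReg t 1).setReg (t + 1) 0 with hs₁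
    have hreg : ∀ r < t, s₁.reg r = s.reg r := by
      intro r hr
      have h1 : r ≠ t := by omega
      have h2 : r ≠ t + 1 := by omega
      simp [hs₁, State.setReg, h1, h2]
    have henv : s₁.env lam vars = s.env lam vars := State.env_congr rfl hreg hv
    have hd' : ∀ i < lam, |e.den ((s.env lam vars).push i)| ≤ 2 ^ (lam + β + 2) ^ d :=
      fun i hi => by simpa only [Env.push_lam, State.env_lam] using hd _ β (hB.push hi)
    have hacc : ∀ i ≤ lam, |∏ j ∈ Finset.range i, e.den ((s.env lam vars).push j)| ≤
        2 ^ ((lam + β + 2) ^ (d + 4 + 2)) := by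
      intro i hi
      refine (abs_prod_range_le fun j hj => hd' j (by omega)).trans ?_
      rw [← pow_mul]
      refine pow_le_pow_right₀ (by norm_num) ?_
      rw [show d + 4 + 2 = d + 1 + 5 by ring, pow_add, pow_succ]
      refine (Nat.mul_le_mul_left _ (show i ≤ lam + β + 2 by omega)).trans ?_
      exact Nat.le_mul_of_pos_right _ (by positivity)
    obtain ⟨s', τ, hx, hev, hτ⟩ := BExpr.exec_loop (lr := lr) (t := t) (lam := lam) (β := β)
      (c := (lam + β + 2) ^ c) (M := (lam + β + 2) ^ (d + 4 + 2)) (vars := vars) (e := e) (o := .mul)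
      (s := s₁) ((hreg lr hlr).trans hl) hlr hv (henv ▸ hB)
      (fun i => ∏ j ∈ Finset.range i, e.den ((s.env lam vars).push j))
      (by simp [hs₁, State.setReg]) (by simp [hs₁, State.setReg])
      (fun i _ => by rw [henv, Finset.prod_range_succ]; rfl) hacc
      (fun i hi => by
        rw [henv]
        refine (hd' i hi).trans (pow_le_pow_right₀ (by norm_num) ?_)
        exact Nat.pow_le_pow_right (by omega) (by omega))
      (fun vars t s => ih lr lam β vars t s)
    refine ⟨s', _, .seq (.assign _ _ _) (.seq (.assign _ _ _) hx),
      ⟨hev.result, hev.arr, fun r hr => (hev.reg r hr).trans (hreg r hr)⟩, ?_⟩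
    have b0 : bitCost 0 = 1 := by decide
    have b1 : bitCost 1 = 2 := by decide
    simp only [Expr.cost, b0, b1]
    have := loop_cost_le (m := 5) hτ le_rfl
    omega

/-! ### Functions and predicates given by bounded expressions -/

/-- Renaming of the variables of a bounded expression. -/
def BExpr.rename : BExpr → (ℕ → ℕ) → BExpr
  | .const z, _ => .const z
  | .var n, ξ => .var (ξ n)
  | .get a e, ξ => .get a (e.rename ξ)
  | .op o e₁ e₂, ξ => .op o (e₁.rename ξ) (e₂.rename ξ)
  | .sum e, ξ => .sum (e.rename fun n => Nat.casesOn n 0 fun m => ξ m + 1)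
  | .prod e, ξ => .prod (e.rename fun n => Nat.casesOn n 0 fun m => ξ m + 1)

theorem BExpr.den_rename (e : BExpr) : ∀ (ξ : ℕ → ℕ) (env : Env),
    (e.rename ξ).den env = e.den { env with var := fun n => env.var (ξ n) } := by
  have hpush : ∀ (ξ : ℕ → ℕ) (env : Env) (z : ℤ),
      ({ env.push z with var := fun n => (env.push z).var (Nat.casesOn n 0 fun m => ξ m + 1) } : Env)
        = ({ env with var := fun n => env.var (ξ n) } : Env).push z := by
    intro ξ env z
    simp only [Env.push, Env.mk.injEq, true_and]
    funext n
    cases n <;> rfl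
  induction e with
  | const z => intros; rfl
  | var n => intros; rfl
  | get a e ih => intro ξ env; simp only [BExpr.rename, BExpr.den, ih]
  | op o e₁ e₂ ih₁ ih₂ => intro ξ env; simp only [BExpr.rename, BExpr.den, ih₁, ih₂]
  | sum e ih =>
    intro ξ env
    simp only [BExpr.rename, BExpr.den, ih]
    exact Finset.sum_congr rfl fun i _ => by rw [hpush]
  | prod e ih =>
    intro ξ env
    simp only [BExpr.rename, BExpr.den, ih]
    exact Finset.prod_congr rfl fun i _ => by rw [hpush]

/-- The function is given by a bounded expression. -/
def Impl (f : Env → ℤ) : Prop := ∃ e : BExpr, ∀ env, e.den env = f env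

open Classical in
/-- The predicate is decided by a bounded expression with value `0` or `1`. -/
def ImplP (p : Env → Prop) : Prop := Impl fun e => if p e then 1 else 0

section Impl

variable {f g : Env → ℤ} {p q : Env → Prop}

theorem Impl.congr (hf : Impl f) (h : ∀ e, g e = f e) : Impl g := by
  rwa [show g = f from funext h]

theorem ImplP.congr (hp : ImplP p) (h : ∀ e, q e ↔ p e) : ImplP q := by
  rwa [show q = p from funext fun e => propext (h e)]

theorem Impl.const (z : ℤ) : Impl fun _ => z := ⟨.const z, fun _ => rfl⟩

theorem Impl.var (n : ℕ) : Impl fun e => e.var n := ⟨.var n, fun _ => rfl⟩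

theorem Impl.get (a : ℕ) (hf : Impl f) : Impl fun e => e.arr a (f e) := by
  obtain ⟨x, hx⟩ := hf
  exact ⟨.get a x, fun e => by simp [BExpr.den, hx]⟩

theorem Impl.op (o : BinOp) (hf : Impl f) (hg : Impl g) : Impl fun e => o.eval (f e) (g e) := by
  obtain ⟨x, hx⟩ := hf
  obtain ⟨y, hy⟩ := hg
  exact ⟨.op o x y, fun e => by simp [BExpr.den, hx, hy]⟩

theorem Impl.add (hf : Impl f) (hg : Impl g) : Impl fun e => f e + g e := hf.op .add hg

theorem Impl.sub (hf : Impl f) (hg : Impl g) : Impl fun e => f e - g e := hf.op .sub hg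

theorem Impl.mul (hf : Impl f) (hg : Impl g) : Impl fun e => f e * g e := hf.op .mul hg

theorem Impl.div (hf : Impl f) (hg : Impl g) : Impl fun e => f e / g e := hf.op .div hg

theorem Impl.mod (hf : Impl f) (hg : Impl g) : Impl fun e => f e % g e := hf.op .mod hg

theorem Impl.npow (hf : Impl f) (n : ℕ) : Impl fun e => f e ^ n := by
  induction n with
  | zero => exact (Impl.const 1).congr fun e => pow_zero _
  | succ n ih => exact (ih.mul hf).congr fun e => pow_succ _ _

theorem Impl.pop (hf : Impl f) : Impl fun e => f e.pop := by
  obtain ⟨x, hx⟩ := hf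
  exact ⟨x.rename (· + 1), fun e => by rw [BExpr.den_rename]; exact hx _⟩

theorem ImplP.pop (hp : ImplP p) : ImplP fun e => p e.pop := Impl.pop hp

theorem Impl.sum {f : Env → ℤ → ℤ} (hf : Impl fun e => f e.pop (e.var 0)) :
    Impl fun e => ∑ i ∈ Finset.range e.lam, f e i := by
  obtain ⟨x, hx⟩ := hf
  exact ⟨.sum x, fun e => Finset.sum_congr rfl fun i _ => hx _⟩

theorem Impl.prod {f : Env → ℤ → ℤ} (hf : Impl fun e => f e.pop (e.var 0)) :
    Impl fun e => ∏ i ∈ Finset.range e.lam, f e i := by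
  obtain ⟨x, hx⟩ := hf
  exact ⟨.prod x, fun e => Finset.prod_congr rfl fun i _ => hx _⟩

theorem Impl.lam : Impl fun e => (e.lam : ℤ) :=
  (Impl.sum (f := fun _ _ => 1) (Impl.const 1)).congr fun e => by simp

theorem ImplP.lt (hf : Impl f) (hg : Impl g) : ImplP fun e => f e < g e :=
  (hf.op .lt hg).congr fun e => by simp [BinOp.eval]

theorem ImplP.eq (hf : Impl f) (hg : Impl g) : ImplP fun e => f e = g e :=
  (hf.op .eq hg).congr fun e => by simp [BinOp.eval]

theorem ImplP.not (hp : ImplP p) : ImplP fun e => ¬ p e :=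
  ((Impl.const 1).sub hp).congr fun e => by by_cases h : p e <;> simp [h]

theorem ImplP.and (hp : ImplP p) (hq : ImplP q) : ImplP fun e => p e ∧ q e :=
  (Impl.mul hp hq).congr fun e => by by_cases h : p e <;> by_cases h' : q e <;> simp [h, h']

theorem ImplP.or (hp : ImplP p) (hq : ImplP q) : ImplP fun e => p e ∨ q e :=
  (hp.not.and hq.not).not.congr fun e => by tauto

theorem ImplP.imp (hp : ImplP p) (hq : ImplP q) : ImplP fun e => p e → q e :=
  (hp.not.or hq).congr fun e => by tauto

theorem ImplP.iff (hp : ImplP p) (hq : ImplP q) : ImplP fun e => (p e ↔ q e) :=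
  ((hp.imp hq).and (hq.imp hp)).congr fun e => by tauto

theorem ImplP.le (hf : Impl f) (hg : Impl g) : ImplP fun e => f e ≤ g e :=
  (ImplP.lt hg hf).not.congr fun e => by simp

theorem ImplP.ne (hf : Impl f) (hg : Impl g) : ImplP fun e => f e ≠ g e :=
  (ImplP.eq hf hg).not

theorem ImplP.const (P : Prop) : ImplP fun _ => P := Impl.const _

theorem Impl.ite [∀ e, Decidable (p e)] (hp : ImplP p) (hf : Impl f) (hg : Impl g) :
    Impl fun e => if p e then f e else g e :=
  ((Impl.mul hp hf).add (Impl.mul hp.not hg)).congr fun e => by by_cases h : p e <;> simp [h]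

theorem ImplP.ite (hp : ImplP p) {p' : Env → Prop} (hp' : ImplP p') (hq : ImplP q) :
    ImplP fun e => (p e ∧ p' e) ∨ (¬ p e ∧ q e) :=
  (hp.and hp').or (hp.not.and hq)

theorem ImplP.forall_lt {p : Env → ℤ → Prop} (hp : ImplP fun e => p e.pop (e.var 0)) :
    ImplP fun e => ∀ i < e.lam, p e (i : ℕ) := by
  classical
  refine (Impl.prod (f := fun e z => if p e z then 1 else 0) (hp.congr fun _ => Iff.rfl)).congr
    fun e => ?_
  split_ifs with h
  · exact (Finset.prod_eq_one fun i hi => if_pos (h i (Finset.mem_range.1 hi))).symm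
  · push Not at h
    obtain ⟨i, hi, h⟩ := h
    exact (Finset.prod_eq_zero (Finset.mem_range.2 hi) (if_neg h)).symm

theorem ImplP.exists_lt {p : Env → ℤ → Prop} (hp : ImplP fun e => p e.pop (e.var 0)) :
    ImplP fun e => ∃ i < e.lam, p e (i : ℕ) :=
  (ImplP.forall_lt (p := fun e z => ¬ p e z) hp.not).not.congr fun e => by push Not; rfl

theorem Impl.count {p : Env → ℤ → Prop} [∀ e z, Decidable (p e z)] (hp : ImplP fun e => p e.pop (e.var 0)) :
    Impl fun e => (((Finset.range e.lam).filter fun i : ℕ => p e i).card : ℤ) := by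
  refine (Impl.sum (f := fun e z => if p e z then 1 else 0)
    (Impl.ite hp (Impl.const 1) (Impl.const 0))).congr
    fun e => ?_
  rw [Finset.card_filter]
  push_cast
  rfl

theorem ImplP.forall_lt_const {p : ℕ → Env → Prop} (hp : ∀ t, ImplP (p t)) (k : ℕ) :
    ImplP fun e => ∀ t < k, p t e := by
  induction k with
  | zero => exact (ImplP.const True).congr fun e => by simp
  | succ k ih => exact (ih.and (hp k)).congr fun e => Nat.forall_lt_succ_right

theorem ImplP.exists_lt_const {p : ℕ → Env → Prop} (hp : ∀ t, ImplP (p t)) (k : ℕ) :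
    ImplP fun e => ∃ t < k, p t e :=
  (ImplP.forall_lt_const (fun t => (hp t).not) k).not.congr fun e => by push Not; rfl

/-- Powers with variable exponent, as long as the exponent does not exceed the range of loops. -/
theorem Impl.powMin (hf : Impl f) (hg : Impl g) : Impl fun e => f e ^ min (g e).toNat e.lam := by
  classical
  refine (Impl.prod (f := fun e z => if z < g e then f e else 1)
    (Impl.ite (ImplP.lt (Impl.var 0) hg.pop) hf.pop (Impl.const 1))).congr fun e => ?_
  rw [Finset.prod_ite, Finset.prod_const, Finset.prod_const_one, mul_one]
  congr 1
  rw [show ((Finset.range e.lam).filter fun i : ℕ => (i : ℤ) < g e) =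
    Finset.range (min (g e).toNat e.lam) by ext i; simp; omega, Finset.card_range]

end Impl

/-! ### Sparsification of set families -/

section Sparsification

variable {α : Type*} [DecidableEq α]

/-- The inclusion-minimal members of a family. -/
def minimalSets (F : Finset (Finset α)) : Finset (Finset α) :=
  F.filter fun C => ∀ D ∈ F, D ⊆ C → C ⊆ D

/-- The minimal members of size `j` that contain `H`. -/
def minimalAbove (F : Finset (Finset α)) (j : ℕ) (H : Finset α) : Finset (Finset α) :=
  (minimalSets F).filter fun C => C.card = j ∧ H ⊆ C

/-- Many (at least `θ i`) minimal members of size `j` share the nonempty heart `H`, the petals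
having size `i`. -/
structure IsFlower (θ : ℕ → ℕ) (F : Finset (Finset α)) (j i : ℕ) (H : Finset α) : Prop where
  nonempty : H.Nonempty
  card_add : H.card + i = j
  one_le : 1 ≤ i
  le_card : θ i ≤ (minimalAbove F j H).card

/-- A flower whose members are smallest and, among those, whose petals are smallest. -/
structure IsSmallestFlower (θ : ℕ → ℕ) (F : Finset (Finset α)) (j i : ℕ) (H : Finset α) : Prop
    extends IsFlower θ F j i H where
  le : ∀ j' i' H', (j' < j ∨ j' = j ∧ i' < i) → ¬ IsFlower θ F j' i' H'

/-- The petals of the flower with heart `H`. -/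
def petals (F : Finset (Finset α)) (j : ℕ) (H : Finset α) : Finset (Finset α) :=
  (minimalAbove F j H).image (· \ H)

/-- The members of `F` outside `F₀` that have size `i`. -/
def addedOfSize (F₀ F : Finset (Finset α)) (i : ℕ) : Finset (Finset α) :=
  (F \ F₀).filter fun C => C.card = i

/-- The members of `F` outside `F₀` that have size less than `i`. -/
def addedBelow (F₀ F : Finset (Finset α)) (i : ℕ) : Finset (Finset α) :=
  (F \ F₀).filter fun C => C.card < i

/-- The minimal members of `F` outside `F₀` that have size `i` and contain `E`. -/
def addedMinimal (F₀ F : Finset (Finset α)) (i : ℕ) (E : Finset α) : Finset (Finset α) :=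
  (minimalSets F \ F₀).filter fun C => C.card = i ∧ E ⊆ C

theorem mem_minimalSets {F : Finset (Finset α)} {C : Finset α} :
    C ∈ minimalSets F ↔ C ∈ F ∧ ∀ D ∈ F, D ⊆ C → C ⊆ D := by
  simp [minimalSets]

theorem mem_minimalAbove {F : Finset (Finset α)} {j : ℕ} {H C : Finset α} :
    C ∈ minimalAbove F j H ↔ C ∈ minimalSets F ∧ C.card = j ∧ H ⊆ C := by
  simp [minimalAbove]

/-- Every member contains a minimal member. -/
theorem exists_minimalSets_subset {F : Finset (Finset α)} {C : Finset α} (hC : C ∈ F) :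
    ∃ D ∈ minimalSets F, D ⊆ C := by
  obtain ⟨D, hD, hmin⟩ := (F.filter (· ⊆ C)).exists_min_image Finset.card ⟨C, by simp [hC]⟩
  rw [Finset.mem_filter] at hD
  refine ⟨D, mem_minimalSets.2 ⟨hD.1, fun D' hD' hs => ?_⟩, hD.2⟩
  have := hmin D' (by simp [hD', hs.trans hD.2])
  exact (Finset.eq_of_subset_of_card_le hs this).ge

/-- Bookkeeping after `S` steps that led from `F₀` to `F`, among them `p i` steps that added the
petals of size `i`. The bounds `minimal_le` and `size_le` say that a set kills few added sets, and
that added sets are still minimal unless a smaller set has killed them. -/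
structure SparsifyInv (θ : ℕ → ℕ) (L : Finset α) (k : ℕ) (F₀ F : Finset (Finset α)) (S : ℕ)
    (p : ℕ → ℕ) : Prop where
  subset : F₀ ⊆ F
  le_ground : ∀ C ∈ F, C ⊆ L
  card_le : ∀ C ∈ F, C.card ≤ k
  added : ∀ C ∈ F \ F₀, C.Nonempty ∧ C.card < k
  minimal_le : ∀ i E, E.Nonempty → E.card < i → (addedMinimal F₀ F i E).card ≤ 2 * θ (i - 1)
  size_le : ∀ i, (addedOfSize F₀ F i).card ≤
    2 * θ (i - 1) * (addedBelow F₀ F i).card + (addedMinimal F₀ F i ∅).card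
  steps_le : S ≤ (F \ F₀).card
  petals_le : ∀ i, p i * θ i ≤ (addedOfSize F₀ F i).card

theorem SparsifyInv.init (θ : ℕ → ℕ) {L : Finset α} {k : ℕ} {F₀ : Finset (Finset α)}
    (hL : ∀ C ∈ F₀, C ⊆ L) (hk : ∀ C ∈ F₀, C.card ≤ k) : SparsifyInv θ L k F₀ F₀ 0 0 where
  subset := subset_rfl
  le_ground := hL
  card_le := hk
  added := by simp
  minimal_le := fun i E _ _ => by
    have : minimalSets F₀ \ F₀ = ∅ := Finset.sdiff_eq_empty_iff_subset.2 (Finset.filter_subset _ _)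
    simp [addedMinimal, this]
  size_le := by simp [addedOfSize]
  steps_le := Nat.zero_le _
  petals_le := by simp

/-- Adding a set `T` of new sets of size `s` that contain no member of `F`. The new sets do not
contradict `minimal_le`, because a smaller set is contained in at most `θ (s - 1)` old minimal sets
of size `s` and in at most as many new ones; and the old sets that are no longer minimal are paid
for in `size_le` by the elements of `T`, which kill at most `2 * θ (i - 1)` sets of size `i` each. -/
theorem SparsifyInv.union {θ : ℕ → ℕ} {L : Finset α} {k : ℕ} {F₀ F : Finset (Finset α)} {S : ℕ}
    {p : ℕ → ℕ} (hI : SparsifyInv θ L k F₀ F S p) {T : Finset (Finset α)} {s : ℕ}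
    (hT : T.Nonempty) (hs : 1 ≤ s) (hsk : s < k) (hcard : ∀ D ∈ T, D.card = s)
    (hL : ∀ D ∈ T, D ⊆ L) (hnew : ∀ D ∈ T, ∀ C ∈ F, ¬ C ⊆ D)
    (hdeg : ∀ E : Finset α, E.Nonempty → E.card < s → (minimalAbove F s E).card ≤ θ (s - 1))
    (hdegT : ∀ E : Finset α, E.Nonempty → E.card < s →
      (T.filter fun C => E ⊆ C).card ≤ θ (s - 1))
    {p' : ℕ → ℕ} (hp' : ∀ i, p' i * θ i ≤ p i * θ i + if i = s then T.card else 0) :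
    SparsifyInv θ L k F₀ (F ∪ T) (S + 1) p' := by
  have hdisj : ∀ D ∈ T, D ∉ F := fun D hD hF => hnew D hD D hF subset_rfl
  have hdisj₀ : ∀ D ∈ T, D ∉ F₀ := fun D hD hF => hdisj D hD (hI.subset hF)
  have hFT : Disjoint (F \ F₀) T := Finset.disjoint_left.2 fun D hD hDT =>
    hdisj D hDT (Finset.mem_sdiff.1 hD).1
  have hsd : (F ∪ T) \ F₀ = (F \ F₀) ∪ T := by
    rw [Finset.union_sdiff_distrib]
    congr 1
    exact Finset.sdiff_eq_self_of_disjoint (Finset.disjoint_left.2 fun D hD => hdisj₀ D hD)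
  have hmin : ∀ C, C ∈ minimalSets (F ∪ T) ↔
      (C ∈ minimalSets F ∧ ∀ D ∈ T, ¬ D ⊆ C) ∨ C ∈ T := by
    intro C
    simp only [mem_minimalSets, Finset.mem_union]
    constructor
    · rintro ⟨hC | hC, hm⟩
      · refine Or.inl ⟨⟨hC, fun D hD => hm D (Or.inl hD)⟩, fun D hD hDC => ?_⟩
        exact hnew D hD C hC (hm D (Or.inr hD) hDC)
      · exact Or.inr hC
    · rintro (⟨⟨hC, hm⟩, hno⟩ | hC)
      · refine ⟨Or.inl hC, ?_⟩
        rintro D (hD | hD) hDC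
        · exact hm D hD hDC
        · exact absurd hDC (hno D hD)
      · refine ⟨Or.inr hC, ?_⟩
        rintro D (hD | hD) hDC
        · exact absurd hDC (hnew C hC D hD)
        · exact (Finset.eq_of_subset_of_card_le hDC (by rw [hcard C hC, hcard D hD])).ge
  have haddT : ∀ i, (addedOfSize F₀ (F ∪ T) i).card =
      (addedOfSize F₀ F i).card + if i = s then T.card else 0 := by
    intro i
    rw [addedOfSize, hsd, Finset.filter_union, Finset.card_union_of_disjoint
      (Finset.disjoint_filter_filter hFT)]
    congr 1
    split_ifs with his
    · rw [Finset.filter_true_of_mem fun D hD => (hcard D hD).trans his.symm]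
    · rw [Finset.filter_false_of_mem fun D hD h => his (h.symm.trans (hcard D hD)),
        Finset.card_empty]
  have hbelow : ∀ i, (addedBelow F₀ (F ∪ T) i).card =
      (addedBelow F₀ F i).card + if s < i then T.card else 0 := by
    intro i
    rw [addedBelow, hsd, Finset.filter_union, Finset.card_union_of_disjoint
      (Finset.disjoint_filter_filter hFT)]
    congr 1
    split_ifs with his
    · rw [Finset.filter_true_of_mem fun D hD => (hcard D hD).trans_lt his]
    · rw [Finset.filter_false_of_mem fun D hD h => his ((hcard D hD).symm.trans_lt h),
        Finset.card_empty]
  refine ⟨hI.subset.trans Finset.subset_union_left, ?_, ?_, ?_, ?_, ?_, ?_, ?_⟩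
  · intro C hC
    rcases Finset.mem_union.1 hC with h | h
    exacts [hI.le_ground C h, hL C h]
  · intro C hC
    rcases Finset.mem_union.1 hC with h | h
    exacts [hI.card_le C h, (hcard C h).trans_le hsk.le]
  · intro C hC
    rw [hsd] at hC
    rcases Finset.mem_union.1 hC with h | h
    · exact hI.added C h
    · exact ⟨Finset.card_pos.1 (by rw [hcard C h]; omega), (hcard C h).trans_lt hsk⟩
  · intro i E hE hEi
    by_cases his : i = s
    · subst his
      have hsub : addedMinimal F₀ (F ∪ T) i E ⊆
          minimalAbove F i E ∪ T.filter fun C => E ⊆ C := by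
        intro C hC
        simp only [addedMinimal, Finset.mem_filter, Finset.mem_sdiff, hmin] at hC
        simp only [Finset.mem_union, mem_minimalAbove, Finset.mem_filter]
        tauto
      have h1 := hdeg E hE hEi
      have h2 := hdegT E hE hEi
      have h3 := (Finset.card_le_card hsub).trans (Finset.card_union_le _ _)
      omega
    · refine (Finset.card_le_card ?_).trans (hI.minimal_le i E hE hEi)
      intro C hC
      simp only [addedMinimal, Finset.mem_filter, Finset.mem_sdiff, hmin] at hC ⊢
      rcases hC with ⟨⟨⟨h, -⟩ | h, h0⟩, h1, h2⟩
      · exact ⟨⟨h, h0⟩, h1, h2⟩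
      · exact absurd (h1.symm.trans (hcard C h)) his
  · intro i
    rw [haddT, hbelow]
    have hold := hI.size_le i
    rcases lt_trichotomy i s with h | rfl | h
    · have hsub : addedMinimal F₀ F i ∅ ⊆ addedMinimal F₀ (F ∪ T) i ∅ := by
        intro C hC
        simp only [addedMinimal, Finset.mem_filter, Finset.mem_sdiff, hmin] at hC ⊢
        refine ⟨⟨Or.inl ⟨hC.1.1, fun D hD hDC => ?_⟩, hC.1.2⟩, hC.2⟩
        have := Finset.card_le_card hDC
        rw [hcard D hD] at this
        omega
      have := Finset.card_le_card hsub
      simp only [h.ne, h.not_gt, if_false, add_zero]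
      omega
    · have hsub : addedMinimal F₀ F i ∅ ∪ T ⊆ addedMinimal F₀ (F ∪ T) i ∅ := by
        intro C hC
        simp only [addedMinimal, Finset.mem_union, Finset.mem_filter, Finset.mem_sdiff, hmin] at hC ⊢
        rcases hC with hC | hC
        · refine ⟨⟨Or.inl ⟨hC.1.1, fun D hD hDC => ?_⟩, hC.1.2⟩, hC.2⟩
          have hDC' := Finset.eq_of_subset_of_card_le hDC (by rw [hcard D hD, hC.2.1])
          exact hdisj D hD (hDC' ▸ (mem_minimalSets.1 hC.1.1).1)
        · exact ⟨⟨Or.inr hC, hdisj₀ C hC⟩, hcard C hC, Finset.empty_subset _⟩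
      have hd : Disjoint (addedMinimal F₀ F i ∅) T := Finset.disjoint_left.2 fun D hD hDT => by
        simp only [addedMinimal, Finset.mem_filter, Finset.mem_sdiff] at hD
        exact hdisj D hDT (mem_minimalSets.1 hD.1.1).1
      have := Finset.card_le_card hsub
      rw [Finset.card_union_of_disjoint hd] at this
      simp only [if_true, lt_irrefl, if_false, add_zero]
      omega
    · have hsub : addedMinimal F₀ F i ∅ ⊆
          addedMinimal F₀ (F ∪ T) i ∅ ∪ T.biUnion fun D => addedMinimal F₀ F i D := by
        intro C hC
        simp only [addedMinimal, Finset.mem_union, Finset.mem_biUnion, Finset.mem_filter,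
          Finset.mem_sdiff, hmin] at hC ⊢
        by_cases hk : ∃ D ∈ T, D ⊆ C
        · obtain ⟨D, hD, hDC⟩ := hk
          exact Or.inr ⟨D, hD, hC.1, hC.2.1, hDC⟩
        · push Not at hk
          exact Or.inl ⟨⟨Or.inl ⟨hC.1.1, hk⟩, hC.1.2⟩, hC.2⟩
      have h1 := (Finset.card_le_card hsub).trans (Finset.card_union_le _ _)
      have h2 : (T.biUnion fun D => addedMinimal F₀ F i D).card ≤ T.card * (2 * θ (i - 1)) :=
        Finset.card_biUnion_le_card_mul _ _ _ fun D hD => hI.minimal_le i D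
          (Finset.card_pos.1 (by rw [hcard D hD]; omega)) (by rw [hcard D hD]; exact h)
      simp only [h.ne', h, if_false, if_true]
      rw [mul_add, mul_comm (2 * θ (i - 1)) T.card]
      omega
  · rw [hsd, Finset.card_union_of_disjoint hFT]
    have := hI.steps_le
    have := hT.card_pos
    omega
  · intro i
    rw [haddT]
    exact (hp' i).trans (Nat.add_le_add_right (hI.petals_le i) _)

/-- No flower is smaller than the smallest one, so that sizes below its own have small degrees. -/
theorem IsSmallestFlower.card_minimalAbove_le {θ : ℕ → ℕ} (hθ : Monotone θ)
    {F : Finset (Finset α)} {j i s : ℕ} {H E : Finset α} (h : IsSmallestFlower θ F j i H)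
    (hs : s < j) (hE : E.Nonempty) (hEs : E.card < s) :
    (minimalAbove F s E).card + 1 ≤ θ (s - 1) := by
  by_contra hcon
  refine h.le s (s - E.card) E (Or.inl hs) ⟨hE, by omega, by omega, ?_⟩
  have := hE.card_pos
  exact (hθ (show s - E.card ≤ s - 1 by omega)).trans (by omega)

/-- The heart of a smallest flower is a proper subset of a minimal member, so that it contains no
member of the family. -/
theorem SparsifyInv.heart {θ : ℕ → ℕ} (hθ : Monotone θ) (hθ1 : 1 ≤ θ 0) {L : Finset α} {k : ℕ}
    {F₀ F : Finset (Finset α)} {S : ℕ} {p : ℕ → ℕ} (hI : SparsifyInv θ L k F₀ F S p) {j i : ℕ}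
    {H : Finset α} (h : IsSmallestFlower θ F j i H) :
    SparsifyInv θ L k F₀ (F ∪ {H}) (S + 1) p := by
  have hi := h.one_le
  have hj := h.card_add
  have hH := h.nonempty.card_pos
  obtain ⟨C, hC⟩ : (minimalAbove F j H).Nonempty := Finset.card_pos.1
    ((hθ1.trans (hθ (Nat.zero_le i))).trans h.le_card)
  rw [mem_minimalAbove, mem_minimalSets] at hC
  have hjk := hI.card_le C hC.1.1
  refine hI.union (T := {H}) (s := H.card) (by simp) hH (by omega) (by simp) ?_ ?_ ?_ ?_ (by simp)
  · simpa using hC.2.2.trans (hI.le_ground C hC.1.1)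
  · intro D hD D' hD' hs
    rw [Finset.mem_singleton] at hD
    subst hD
    have := Finset.card_le_card ((hC.1.2 D' hD' (hs.trans hC.2.2)).trans hs)
    omega
  · intro E hE hEs
    have := h.card_minimalAbove_le hθ (by omega) hE hEs
    omega
  · intro E _ _
    refine (Finset.card_filter_le _ _).trans ?_
    simpa using hθ1.trans (hθ (Nat.zero_le _))

theorem card_petals (F : Finset (Finset α)) (j : ℕ) (H : Finset α) :
    (petals F j H).card = (minimalAbove F j H).card := by
  refine Finset.card_image_of_injOn fun C hC D hD hCD => ?_
  have h1 := (mem_minimalAbove.1 hC).2.2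
  have h2 := (mem_minimalAbove.1 hD).2.2
  rw [← Finset.sdiff_union_of_subset h1, ← Finset.sdiff_union_of_subset h2]
  rw [show C \ H = D \ H from hCD]

/-- The petals of a smallest flower are proper subsets of minimal members. If many of them contained
a set `E`, then the heart together with `E` would be the heart of a flower with smaller petals. -/
theorem SparsifyInv.petal {θ : ℕ → ℕ} (hθ : Monotone θ) (hθ1 : 1 ≤ θ 0) {L : Finset α} {k : ℕ}
    {F₀ F : Finset (Finset α)} {S : ℕ} {p : ℕ → ℕ} (hI : SparsifyInv θ L k F₀ F S p) {j i : ℕ}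
    {H : Finset α} (h : IsSmallestFlower θ F j i H) :
    i < k ∧ SparsifyInv θ L k F₀ (F ∪ petals F j H) (S + 1)
      (fun l => p l + if l = i then 1 else 0) := by
  have hi := h.one_le
  have hj := h.card_add
  have hH := h.nonempty.card_pos
  have hne : (minimalAbove F j H).Nonempty := Finset.card_pos.1
    ((hθ1.trans (hθ (Nat.zero_le i))).trans h.le_card)
  obtain ⟨C, hC⟩ := hne
  rw [mem_minimalAbove, mem_minimalSets] at hC
  have hjk := hI.card_le C hC.1.1
  refine ⟨by omega, hI.union (T := petals F j H) (s := i) (Finset.card_pos.1 ?_) hi (by omega)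
    ?_ ?_ ?_ ?_ ?_ ?_⟩
  · rw [card_petals]
    exact (hθ1.trans (hθ (Nat.zero_le i))).trans h.le_card
  · intro D hD
    obtain ⟨C, hC, rfl⟩ := Finset.mem_image.1 hD
    rw [mem_minimalAbove] at hC
    rw [Finset.card_sdiff_of_subset hC.2.2]
    omega
  · intro D hD
    obtain ⟨C, hC, rfl⟩ := Finset.mem_image.1 hD
    rw [mem_minimalAbove, mem_minimalSets] at hC
    exact Finset.sdiff_subset.trans (hI.le_ground C hC.1.1)
  · intro D hD D' hD' hs
    obtain ⟨C, hC, rfl⟩ := Finset.mem_image.1 hD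
    rw [mem_minimalAbove, mem_minimalSets] at hC
    have h1 := Finset.card_le_card ((hC.1.2 D' hD' (hs.trans Finset.sdiff_subset)).trans hs)
    rw [Finset.card_sdiff_of_subset hC.2.2] at h1
    omega
  · intro E hE hEs
    have := h.card_minimalAbove_le hθ (by omega) hE hEs
    omega
  · intro E hE hEs
    have hEc := hE.card_pos
    by_cases hdj : Disjoint H E
    · -- a petal containing `E` comes from a set containing `H ∪ E`, which is a larger heart
      have hsub : ((petals F j H).filter fun C => E ⊆ C) ⊆
          (minimalAbove F j (H ∪ E)).image (· \ H) := by
        intro D hD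
        rw [Finset.mem_filter] at hD
        obtain ⟨C, hC, rfl⟩ := Finset.mem_image.1 hD.1
        rw [mem_minimalAbove] at hC
        exact Finset.mem_image.2 ⟨C, mem_minimalAbove.2 ⟨hC.1, hC.2.1,
          Finset.union_subset hC.2.2 (hD.2.trans Finset.sdiff_subset)⟩, rfl⟩
      refine (Finset.card_le_card hsub).trans (Finset.card_image_le.trans ?_)
      by_contra hcon
      refine h.le j (i - E.card) (H ∪ E) (Or.inr ⟨rfl, by omega⟩)
        ⟨h.nonempty.mono Finset.subset_union_left, ?_, by omega, ?_⟩
      · rw [Finset.card_union_of_disjoint hdj]; omega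
      · exact (hθ (show i - E.card ≤ i - 1 by omega)).trans (by omega)
    · rw [Finset.filter_false_of_mem, Finset.card_empty]
      · exact Nat.zero_le _
      · intro D hD hED
        obtain ⟨C, hC, rfl⟩ := Finset.mem_image.1 hD
        exact hdj (Finset.disjoint_of_subset_right hED Finset.disjoint_sdiff)
  · intro l
    split_ifs with hl
    · subst hl
      rw [card_petals]
      have := h.le_card
      nlinarith
    · simp

/-- The bounds `b i` (per variable) for the number of sets of size below `i` that are added. The
recursion is that of `SparsifyInv.addedBelow_le`, with `R * b i` for the threshold `θ (i - 1)`. -/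
def sparsifyBound (R : ℕ) : ℕ → ℕ
  | 0 => 1
  | i + 1 => sparsifyBound R i + 2 * (R * sparsifyBound R i) * (sparsifyBound R i + 2)

/-- The number of petals that makes a flower. It exceeds the number of petals that can be added at
all by the factor `R` per variable, so that petals are rarely added. -/
def flowerThreshold (R i : ℕ) : ℕ := R * sparsifyBound R (i + 1)

theorem sparsifyBound_mono (R : ℕ) : Monotone (sparsifyBound R) :=
  monotone_nat_of_le_succ fun _ => Nat.le_add_right _ _

theorem one_le_sparsifyBound (R i : ℕ) : 1 ≤ sparsifyBound R i :=
  sparsifyBound_mono R (Nat.zero_le i)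

theorem flowerThreshold_mono (R : ℕ) : Monotone (flowerThreshold R) := fun _ _ h =>
  Nat.mul_le_mul_left _ (sparsifyBound_mono R (Nat.succ_le_succ h))

theorem one_le_flowerThreshold {R : ℕ} (hR : 1 ≤ R) (i : ℕ) : 1 ≤ flowerThreshold R i :=
  Nat.mul_le_mul hR (one_le_sparsifyBound R (i + 1))

/-- Up to the factor `8 * R`, every bound is at most the square of the preceding one. -/
theorem mul_sparsifyBound_le {R : ℕ} (hR : 1 ≤ R) (i : ℕ) :
    8 * R * sparsifyBound R i ≤ (8 * R) ^ 2 ^ i := by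
  induction i with
  | zero => simp [sparsifyBound]
  | succ i ih =>
    have h1 := one_le_sparsifyBound R i
    rw [pow_succ, pow_mul]
    refine le_trans ?_ (Nat.pow_le_pow_left ih 2)
    rw [sparsifyBound]
    set b := sparsifyBound R i
    have h2 : b ≤ R * (b * b) := by
      calc b ≤ b * b := Nat.le_mul_of_pos_left _ h1
        _ ≤ R * (b * b) := Nat.le_mul_of_pos_left _ hR
    have h3 : R * b ≤ R * (b * b) := Nat.mul_le_mul_left _ (Nat.le_mul_of_pos_left _ h1)
    have h4 : b + 2 * (R * b) * (b + 2) ≤ 8 * (R * (b * b)) := by nlinarith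
    calc 8 * R * (b + 2 * (R * b) * (b + 2)) ≤ 8 * R * (8 * (R * (b * b))) :=
          Nat.mul_le_mul_left _ h4
      _ = (8 * R * b) ^ 2 := by ring

/-- An added set of size `i` is minimal, and then it is one of few sets above one of the at most
`2 * N` elements of the ground set, or it has been killed by one of the smaller added sets. -/
theorem SparsifyInv.addedBelow_le {R : ℕ} (hR : 1 ≤ R) {L : Finset α} {k N : ℕ}
    (hL : L.card ≤ 2 * N) {F₀ F : Finset (Finset α)} {S : ℕ} {p : ℕ → ℕ}
    (hI : SparsifyInv (flowerThreshold R) L k F₀ F S p) (i : ℕ) :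
    (addedBelow F₀ F i).card ≤ sparsifyBound R i * N := by
  induction i with
  | zero => simp [addedBelow]
  | succ i ih =>
    have hsplit : (addedBelow F₀ F (i + 1)).card ≤
        (addedBelow F₀ F i).card + (addedOfSize F₀ F i).card := by
      refine (Finset.card_le_card ?_).trans (Finset.card_union_le _ _)
      intro C hC
      simp only [addedBelow, addedOfSize, Finset.mem_union, Finset.mem_filter] at hC ⊢
      rcases Nat.lt_succ_iff_lt_or_eq.1 hC.2 with h | h
      exacts [Or.inl ⟨hC.1, h⟩, Or.inr ⟨hC.1, h⟩]
    rcases Nat.eq_zero_or_pos i with rfl | hi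
    · have : addedOfSize F₀ F 0 = ∅ := by
        rw [addedOfSize, Finset.filter_false_of_mem]
        intro C hC h0
        have := (hI.added C hC).1.card_pos
        omega
      rw [this, Finset.card_empty] at hsplit
      exact (hsplit.trans ih).trans (Nat.mul_le_mul_right _ (sparsifyBound_mono R (Nat.le_succ 0)))
    · have hθ : flowerThreshold R (i - 1) = R * sparsifyBound R i := by
        rw [flowerThreshold, Nat.sub_add_cancel hi]
      have hM : (addedMinimal F₀ F i ∅).card ≤ L.card * (2 * flowerThreshold R (i - 1)) := by
        have hsub : addedMinimal F₀ F i ∅ ⊆ L.biUnion fun l => addedMinimal F₀ F i {l} := by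
          intro C hC
          simp only [addedMinimal, Finset.mem_filter, Finset.mem_sdiff] at hC
          have hCF := (mem_minimalSets.1 hC.1.1).1
          obtain ⟨l, hl⟩ : C.Nonempty := Finset.card_pos.1 (by omega)
          refine Finset.mem_biUnion.2 ⟨l, hI.le_ground C hCF hl, ?_⟩
          simp only [addedMinimal, Finset.mem_filter, Finset.mem_sdiff]
          exact ⟨hC.1, hC.2.1, by simpa using hl⟩
        refine (Finset.card_le_card hsub).trans (Finset.card_biUnion_le_card_mul _ _ _ fun l _ => ?_)
        rcases Nat.lt_or_ge 1 i with h1 | h1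
        · exact hI.minimal_le i {l} (by simp) (by simpa using h1)
        · have : addedMinimal F₀ F i {l} ⊆ {{l}} := by
            intro C hC
            simp only [addedMinimal, Finset.mem_filter] at hC
            rw [Finset.mem_singleton]
            refine (Finset.eq_of_subset_of_card_le hC.2.2 ?_).symm
            rw [Finset.card_singleton]
            omega
          have h2 := Finset.card_le_card this
          rw [Finset.card_singleton] at h2
          have := one_le_flowerThreshold hR (i - 1)
          omega
      have hsz := hI.size_le i
      rw [hθ] at hM hsz
      rw [sparsifyBound]
      set b := sparsifyBound R i
      set P := (addedBelow F₀ F i).card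
      have h1 : 2 * (R * b) * P ≤ 2 * (R * b) * (b * N) := Nat.mul_le_mul_left _ ih
      have h2 : L.card * (2 * (R * b)) ≤ 2 * N * (2 * (R * b)) := Nat.mul_le_mul_right _ hL
      have h3 : (b + 2 * (R * b) * (b + 2)) * N =
          b * N + 2 * (R * b) * (b * N) + 2 * N * (2 * (R * b)) := by ring
      omega

theorem SparsifyInv.steps_le_mul {R : ℕ} (hR : 1 ≤ R) {L : Finset α} {k N : ℕ}
    (hL : L.card ≤ 2 * N) {F₀ F : Finset (Finset α)} {S : ℕ} {p : ℕ → ℕ}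
    (hI : SparsifyInv (flowerThreshold R) L k F₀ F S p) : S ≤ sparsifyBound R k * N := by
  refine (hI.steps_le.trans (le_of_eq ?_)).trans (hI.addedBelow_le hR hL k)
  rw [addedBelow, Finset.filter_true_of_mem fun C hC => (hI.added C hC).2]

/-- Adding the petals of size `i` adds `θ i` sets at once, which is `R` times the number of sets of
this size that can be added per variable. -/
theorem SparsifyInv.petals_mul_le {R : ℕ} (hR : 1 ≤ R) {L : Finset α} {k N : ℕ}
    (hL : L.card ≤ 2 * N) {F₀ F : Finset (Finset α)} {S : ℕ} {p : ℕ → ℕ}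
    (hI : SparsifyInv (flowerThreshold R) L k F₀ F S p) (i : ℕ) : p i * R ≤ N := by
  have h1 := hI.petals_le i
  have h2 := hI.addedBelow_le hR hL (i + 1)
  have h3 : (addedOfSize F₀ F i).card ≤ (addedBelow F₀ F (i + 1)).card :=
    Finset.card_le_card fun C hC => by
      simp only [addedBelow, addedOfSize, Finset.mem_filter] at hC ⊢
      exact ⟨hC.1, by omega⟩
  have h4 : sparsifyBound R (i + 1) * (p i * R) ≤ sparsifyBound R (i + 1) * N := by
    refine le_trans (le_of_eq ?_) ((h1.trans h3).trans h2)
    rw [flowerThreshold]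
    ring
  exact Nat.le_of_mul_le_mul_left h4 (one_le_sparsifyBound R _)

/-- A family without flowers is sparse. -/
theorem card_minimalSets_le {θ : ℕ → ℕ} (hθ : Monotone θ) (hθ1 : 1 ≤ θ 0) {L : Finset α} {k N : ℕ}
    (hL : L.card ≤ 2 * N) {F : Finset (Finset α)} (hFL : ∀ C ∈ F, C ⊆ L) (hFk : ∀ C ∈ F, C.card ≤ k)
    (hno : ∀ j i H, ¬ IsFlower θ F j i H) :
    (minimalSets F).card ≤ 1 + 2 * N * (k * θ k) := by
  have hsub : minimalSets F ⊆ {∅} ∪ L.biUnion fun l =>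
      (Finset.Icc 1 k).biUnion fun j => minimalAbove F j {l} := by
    intro C hC
    have hCF := (mem_minimalSets.1 hC).1
    rcases C.eq_empty_or_nonempty with rfl | ⟨l, hl⟩
    · simp
    · refine Finset.mem_union_right _ (Finset.mem_biUnion.2 ⟨l, hFL C hCF hl,
        Finset.mem_biUnion.2 ⟨C.card, Finset.mem_Icc.2 ⟨Finset.card_pos.2 ⟨l, hl⟩, hFk C hCF⟩, ?_⟩⟩)
      exact mem_minimalAbove.2 ⟨hC, rfl, by simpa using hl⟩
  refine (Finset.card_le_card hsub).trans ((Finset.card_union_le _ _).trans ?_)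
  rw [Finset.card_singleton]
  refine Nat.add_le_add_left (le_trans ?_ (Nat.mul_le_mul_right _ hL)) _
  refine Finset.card_biUnion_le_card_mul _ _ _ fun l _ => ?_
  refine (Finset.card_biUnion_le_card_mul _ _ (θ k) fun j hj => ?_).trans (by simp)
  rw [Finset.mem_Icc] at hj
  rcases Nat.lt_or_ge 1 j with h1 | h1
  · by_contra hcon
    refine hno j (j - 1) {l} ⟨by simp, by rw [Finset.card_singleton]; omega, by omega, ?_⟩
    exact (hθ (show j - 1 ≤ k by omega)).trans (by omega)
  · have : minimalAbove F j {l} ⊆ {{l}} := by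
      intro C hC
      rw [mem_minimalAbove] at hC
      rw [Finset.mem_singleton]
      refine (Finset.eq_of_subset_of_card_le hC.2.2 ?_).symm
      rw [Finset.card_singleton]
      omega
    exact (Finset.card_le_card this).trans (by simpa using hθ1.trans (hθ (Nat.zero_le k)))

end Sparsification

/-! ### Clauses as integer codes -/

/-- The `t`-th digit of a clause code in base `2 * N + 1`, shifted to `{-N, …, N}`. -/
def codeDigit (N c : ℤ) (t : ℕ) : ℤ := c / (2 * N + 1) ^ t % (2 * N + 1) - N

/-- The clause with code `c`, as a set of literal codes: the nonzero ones among the first `k`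
digits. A clause has several codes. -/
def decode (k : ℕ) (N c : ℤ) : Finset ℤ := ((Finset.range k).image (codeDigit N c)).erase 0

/-- The codes of the literals over `N` variables. -/
noncomputable def literalCodes (N : ℕ) : Finset ℤ := (Finset.Icc (-(N : ℤ)) N).erase 0

theorem card_literalCodes (N : ℕ) : (literalCodes N).card = 2 * N := by
  rw [literalCodes, Finset.card_erase_of_mem (by simp), Int.card_Icc]
  omega

theorem mem_decode {k : ℕ} {N c z : ℤ} :
    z ∈ decode k N c ↔ z ≠ 0 ∧ ∃ t < k, codeDigit N c t = z := by
  simp [decode]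

theorem decode_subset (k N : ℕ) (c : ℤ) : decode k N c ⊆ literalCodes N := by
  intro z hz
  obtain ⟨h0, t, -, rfl⟩ := mem_decode.1 hz
  have h1 := Int.emod_nonneg (c / (2 * (N : ℤ) + 1) ^ t) (show 2 * (N : ℤ) + 1 ≠ 0 by omega)
  have h2 := Int.emod_lt_of_pos (c / (2 * (N : ℤ) + 1) ^ t) (show 0 < 2 * (N : ℤ) + 1 by omega)
  rw [literalCodes, Finset.mem_erase, Finset.mem_Icc]
  refine ⟨h0, ?_, ?_⟩ <;> unfold codeDigit <;> omega

theorem card_decode_le (k : ℕ) (N c : ℤ) : (decode k N c).card ≤ k :=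
  (Finset.card_erase_le).trans (Finset.card_image_le.trans (by simp))

theorem exists_digits (b k : ℕ) (f : ℕ → ℕ) (hf : ∀ t < k, f t < b) :
    ∃ c < b ^ k, ∀ t < k, c / b ^ t % b = f t := by
  induction k generalizing f with
  | zero => exact ⟨0, by simp, by simp⟩
  | succ k ih =>
    obtain ⟨c, hc, h⟩ := ih (fun t => f (t + 1)) fun t ht => hf (t + 1) (by omega)
    have h0 := hf 0 (by omega)
    refine ⟨f 0 + b * c, ?_, ?_⟩
    · rw [pow_succ']
      nlinarith
    · rintro (_ | t) ht
      · simp [Nat.mod_eq_of_lt h0]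
      · have hb : 0 < b := by omega
        rw [pow_succ', ← Nat.div_div_eq_div_mul, Nat.add_mul_div_left _ _ hb,
          Nat.div_eq_of_lt h0, zero_add, h t (by omega)]

/-- Every set of at most `k` literals has a code below `(2 * N + 1) ^ k`. -/
theorem exists_decode_eq {k N : ℕ} {C : Finset ℤ} (hC : C ⊆ literalCodes N) (hk : C.card ≤ k) :
    ∃ c : ℕ, c < (2 * N + 1) ^ k ∧ decode k N c = C := by
  have hget : ∀ t, C.toList.getD t 0 ∈ Finset.Icc (-(N : ℤ)) N := by
    intro t
    rcases Nat.lt_or_ge t C.toList.length with h | h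
    · rw [List.getD_eq_getElem _ _ h]
      have := hC (Finset.mem_toList.1 (List.getElem_mem h))
      exact Finset.mem_of_mem_erase this
    · rw [List.getD_eq_default _ _ h]
      simp
  obtain ⟨c, hc, h⟩ := exists_digits (2 * N + 1) k (fun t => (C.toList.getD t 0 + N).toNat)
    fun t _ => by
      have := Finset.mem_Icc.1 (hget t)
      show (C.toList.getD t 0 + N).toNat < _
      omega
  have hdig : ∀ t < k, codeDigit N c t = C.toList.getD t 0 := by
    intro t ht
    have h1 : ((c / (2 * N + 1) ^ t % (2 * N + 1) : ℕ) : ℤ) = (C.toList.getD t 0 + N).toNat := by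
      rw [h t ht]
    have := Finset.mem_Icc.1 (hget t)
    push_cast at h1
    rw [codeDigit, h1]
    omega
  refine ⟨c, hc, Finset.ext fun z => ?_⟩
  rw [mem_decode]
  constructor
  · rintro ⟨h0, t, ht, rfl⟩
    rw [hdig t ht] at h0 ⊢
    rcases Nat.lt_or_ge t C.toList.length with hl | hl
    · rw [List.getD_eq_getElem _ _ hl]
      exact Finset.mem_toList.1 (List.getElem_mem hl)
    · exact absurd (List.getD_eq_default _ _ hl) h0
  · intro hz
    obtain ⟨t, ht, rfl⟩ := List.getElem_of_mem (Finset.mem_toList.2 hz)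
    refine ⟨(Finset.mem_erase.1 (hC hz)).1, t, ?_, ?_⟩
    · rw [Finset.length_toList] at ht; omega
    · rw [hdig t (by rw [Finset.length_toList] at ht; omega), List.getD_eq_getElem _ _ ht]

section Impl

variable {N c c' z : Env → ℤ} {k : ℕ}

theorem Impl.codeDigit (hN : Impl N) (hc : Impl c) (t : ℕ) :
    Impl fun e => codeDigit (N e) (c e) t :=
  have hb : Impl fun e => 2 * N e + 1 := ((Impl.const 2).mul hN).add (.const 1)
  ((hc.div (hb.npow t)).mod hb).sub hN

theorem ImplP.mem_decode (hN : Impl N) (hc : Impl c) (hz : Impl z) :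
    ImplP fun e => z e ∈ decode k (N e) (c e) :=
  ((ImplP.eq hz (.const 0)).not.and (ImplP.exists_lt_const
    (fun t => ImplP.eq (hN.codeDigit hc t) hz) k)).congr fun _ => FineGrained.mem_decode

theorem ImplP.forall_mem_decode {p : Env → ℤ → Prop} (hN : Impl N) (hc : Impl c)
    (hp : ∀ z, Impl z → ImplP fun e => p e (z e)) :
    ImplP fun e => ∀ z ∈ decode k (N e) (c e), p e z :=
  (ImplP.forall_lt_const (fun t => (ImplP.ne (hN.codeDigit hc t) (.const 0)).imp
    (hp _ (hN.codeDigit hc t))) k).congr fun e => by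
      simp only [FineGrained.mem_decode]
      constructor
      · exact fun h t ht h0 => h _ ⟨h0, t, ht, rfl⟩
      · rintro h z ⟨h0, t, ht, rfl⟩
        exact h t ht h0

theorem ImplP.decode_subset (hN : Impl N) (hc : Impl c) (hc' : Impl c') :
    ImplP fun e => decode k (N e) (c e) ⊆ decode k (N e) (c' e) :=
  ImplP.forall_mem_decode hN hc fun _ hz => ImplP.mem_decode hN hc' hz

theorem ImplP.decode_eq (hN : Impl N) (hc : Impl c) (hc' : Impl c') :
    ImplP fun e => decode k (N e) (c e) = decode k (N e) (c' e) :=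
  ((ImplP.decode_subset hN hc hc').and (ImplP.decode_subset hN hc' hc)).congr
    fun _ => Finset.Subset.antisymm_iff

theorem ImplP.decode_eq_sdiff (hN : Impl N) (hc : Impl c) (hc' : Impl c') {h : Env → ℤ}
    (hh : Impl h) :
    ImplP fun e => decode k (N e) (c e) = decode k (N e) (c' e) \ decode k (N e) (h e) :=
  ((ImplP.forall_mem_decode (k := k)
    (p := fun e z => z ∈ decode k (N e) (c' e) ∧ ¬ z ∈ decode k (N e) (h e)) hN hc
    fun z hz => (ImplP.mem_decode hN hc' hz).and (ImplP.mem_decode hN hh hz).not).and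
   (ImplP.forall_mem_decode (k := k)
    (p := fun e z => z ∈ decode k (N e) (h e) ∨ z ∈ decode k (N e) (c e)) hN hc'
    fun z hz => (ImplP.mem_decode hN hh hz).or (ImplP.mem_decode hN hc hz))).congr fun e => by
      rw [Finset.ext_iff]
      simp only [Finset.mem_sdiff]
      constructor
      · exact fun H => ⟨fun z hz => (H z).1 hz, fun z hz => by have := H z; tauto⟩
      · exact fun H z => ⟨fun hz => H.1 z hz, fun hz => by have := H.2 z hz.1; tauto⟩

theorem Impl.card_decode (hN : Impl N) (hc : Impl c) :
    Impl fun e => ((decode k (N e) (c e)).card : ℤ) := by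
  classical
  induction k with
  | zero => exact (Impl.const 0).congr fun e => by simp [decode]
  | succ k ih =>
    refine (ih.add (Impl.ite (p := fun e => FineGrained.codeDigit (N e) (c e) k = 0 ∨
      FineGrained.codeDigit (N e) (c e) k ∈ decode k (N e) (c e))
      ((ImplP.eq (hN.codeDigit hc k) (.const 0)).or
      (ImplP.mem_decode (k := k) hN hc (hN.codeDigit hc k))) (.const 0) (.const 1))).congr fun e => ?_
    set d := FineGrained.codeDigit (N e) (c e) k with hd
    have hins : ((Finset.range (k + 1)).image (FineGrained.codeDigit (N e) (c e))) =
        insert d ((Finset.range k).image (FineGrained.codeDigit (N e) (c e))) := by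
      rw [Finset.range_add_one, Finset.image_insert]
    split_ifs with h
    · rw [add_zero, Nat.cast_inj]
      congr 1
      rw [decode, hins]
      rcases h with h | h
      · rw [h]; ext z; simp [decode]
      · rw [Finset.insert_eq_of_mem (Finset.mem_of_mem_erase h)]
        rfl
    · push Not at h
      rw [decode, hins, Finset.erase_insert_of_ne h.1]
      have := Finset.card_insert_of_notMem h.2
      exact_mod_cast this

end Impl

/-! ### One round of sparsification on codes -/

section Round

variable (k : ℕ) (θ : ℕ → ℕ) (N : ℤ) (Λ : ℕ) (m : ℤ → Prop)

/-- `c` is the code of a minimal member of the family with codes `m`. -/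
def MinimalCode (c : ℤ) : Prop :=
  m c ∧ ∀ c' < Λ, m (c' : ℕ) → decode k N (c' : ℕ) ⊆ decode k N c →
    decode k N c ⊆ decode k N (c' : ℕ)

/-- `c` is the least code of its clause. -/
def LeastCode (c : ℤ) : Prop :=
  ∀ c' < Λ, ((c' : ℕ) : ℤ) < c → ¬ decode k N (c' : ℕ) = decode k N c

open Classical in
/-- The number of minimal members of size `j` above the set with code `h`. -/
noncomputable def codeDegree (j : ℕ) (h : ℤ) : ℕ :=
  ((Finset.range Λ).filter fun c : ℕ => (MinimalCode k N Λ m c ∧ LeastCode k N Λ c) ∧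
    ((decode k N c).card : ℤ) = j ∧ decode k N h ⊆ decode k N c).card

/-- The set with code `h` is the heart of a flower. -/
def FlowerCode (j i : ℕ) (h : ℤ) : Prop :=
  ((decode k N h).card : ℤ) ≠ 0 ∧ ((decode k N h).card : ℤ) + i = j ∧ 1 ≤ i ∧
    (θ i : ℤ) ≤ codeDegree k N Λ m j h

/-- `h` is the least code of a heart of a smallest flower. -/
def SelectedCode (j i : ℕ) (h : ℤ) : Prop :=
  FlowerCode k θ N Λ m j i h ∧
  (∀ j' < k + 1, ∀ i' < k + 1, (j' < j ∨ j' = j ∧ i' < i) →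
    ∀ h' < Λ, ¬ FlowerCode k θ N Λ m j' i' (h' : ℕ)) ∧
  ∀ h' < Λ, ((h' : ℕ) : ℤ) < h → ¬ FlowerCode k θ N Λ m j i (h' : ℕ)

/-- The codes of the family after one round: the heart of the selected flower is added, or its
petals if `petal` holds. Without a flower, nothing is added. -/
def roundCodes (petal : Prop) (c : ℤ) : Prop :=
  m c ∨ ∃ j < k + 1, ∃ i < k + 1, ∃ h < Λ, SelectedCode k θ N Λ m j i (h : ℕ) ∧
    ((petal ∧ ∃ C < Λ, (MinimalCode k N Λ m (C : ℕ) ∧ ((decode k N (C : ℕ)).card : ℤ) = j ∧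
      decode k N (h : ℕ) ⊆ decode k N (C : ℕ)) ∧
        decode k N c = decode k N (C : ℕ) \ decode k N (h : ℕ)) ∨
      (¬ petal ∧ decode k N c = decode k N (h : ℕ)))

end Round

section Impl

variable {N b c h : Env → ℤ} {k : ℕ} {θ : ℕ → ℕ}

theorem ImplP.minimalCode (a : ℕ) (hN : Impl N) (hb : Impl b) (hc : Impl c) :
    ImplP fun e => MinimalCode k (N e) e.lam (fun z => e.arr a (b e + z) = 1) (c e) :=
  (ImplP.eq ((hb.add hc).get a) (.const 1)).and
    (ImplP.forall_lt (p := fun e i => e.arr a (b e + i) = 1 →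
      decode k (N e) i ⊆ decode k (N e) (c e) → decode k (N e) (c e) ⊆ decode k (N e) i)
      ((ImplP.eq ((hb.pop.add (.var 0)).get a) (.const 1)).imp
        ((ImplP.decode_subset hN.pop (.var 0) hc.pop).imp
          (ImplP.decode_subset hN.pop hc.pop (.var 0)))))

theorem ImplP.leastCode (hN : Impl N) (hc : Impl c) :
    ImplP fun e => LeastCode k (N e) e.lam (c e) :=
  ImplP.forall_lt (p := fun e i => i < c e → ¬ decode k (N e) i = decode k (N e) (c e))
    ((ImplP.lt (.var 0) hc.pop).imp (ImplP.decode_eq hN.pop (.var 0) hc.pop).not)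

theorem Impl.codeDegree (a : ℕ) (hN : Impl N) (hb : Impl b) (hh : Impl h) (j : ℕ) :
    Impl fun e => (codeDegree k (N e) e.lam (fun z => e.arr a (b e + z) = 1) j (h e) : ℤ) := by
  classical
  exact Impl.count (p := fun e c => (MinimalCode k (N e) e.lam (fun z => e.arr a (b e + z) = 1) c ∧
      LeastCode k (N e) e.lam c) ∧ ((decode k (N e) c).card : ℤ) = j ∧
      decode k (N e) (h e) ⊆ decode k (N e) c)
    (((ImplP.minimalCode a hN.pop hb.pop (.var 0)).and (ImplP.leastCode hN.pop (.var 0))).and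
      ((ImplP.eq (Impl.card_decode hN.pop (.var 0)) (.const j)).and
        (ImplP.decode_subset hN.pop hh.pop (.var 0))))

theorem ImplP.flowerCode (a : ℕ) (hN : Impl N) (hb : Impl b) (hh : Impl h) (j i : ℕ) :
    ImplP fun e => FlowerCode k θ (N e) e.lam (fun z => e.arr a (b e + z) = 1) j i (h e) :=
  (ImplP.ne (Impl.card_decode hN hh) (.const 0)).and
    ((ImplP.eq ((Impl.card_decode hN hh).add (.const i)) (.const j)).and
      ((ImplP.const (1 ≤ i)).and (ImplP.le (.const (θ i)) (Impl.codeDegree a hN hb hh j))))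

theorem ImplP.selectedCode (a : ℕ) (hN : Impl N) (hb : Impl b) (hh : Impl h) (j i : ℕ) :
    ImplP fun e => SelectedCode k θ (N e) e.lam (fun z => e.arr a (b e + z) = 1) j i (h e) :=
  (ImplP.flowerCode a hN hb hh j i).and
    ((ImplP.forall_lt_const (fun j' => ImplP.forall_lt_const (fun i' =>
      (ImplP.const (j' < j ∨ j' = j ∧ i' < i)).imp
        (ImplP.forall_lt (p := fun e h' => ¬ FlowerCode k θ (N e) e.lam
          (fun z => e.arr a (b e + z) = 1) j' i' h')
          (ImplP.flowerCode a hN.pop hb.pop (.var 0) j' i').not)) _) _).and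
    (ImplP.forall_lt (p := fun e h' => h' < h e → ¬ FlowerCode k θ (N e) e.lam
      (fun z => e.arr a (b e + z) = 1) j i h')
      ((ImplP.lt (.var 0) hh.pop).imp (ImplP.flowerCode a hN.pop hb.pop (.var 0) j i).not)))

theorem ImplP.roundCodes (a : ℕ) (hN : Impl N) (hb : Impl b) (hc : Impl c) {q : Env → Prop}
    (hq : ImplP q) :
    ImplP fun e => roundCodes k θ (N e) e.lam (fun z => e.arr a (b e + z) = 1) (q e) (c e) :=
  (ImplP.eq ((hb.add hc).get a) (.const 1)).or
    (ImplP.exists_lt_const (fun j => ImplP.exists_lt_const (fun i =>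
      ImplP.exists_lt (p := fun e h => SelectedCode k θ (N e) e.lam
          (fun z => e.arr a (b e + z) = 1) j i h ∧
        ((q e ∧ ∃ C < e.lam, (MinimalCode k (N e) e.lam (fun z => e.arr a (b e + z) = 1) (C : ℕ) ∧
          ((decode k (N e) (C : ℕ)).card : ℤ) = j ∧
          decode k (N e) h ⊆ decode k (N e) (C : ℕ)) ∧
          decode k (N e) (c e) = decode k (N e) (C : ℕ) \ decode k (N e) h) ∨
        (¬ q e ∧ decode k (N e) (c e) = decode k (N e) h)))
      ((ImplP.selectedCode a hN.pop hb.pop (.var 0) j i).and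
        ((hq.pop.and (ImplP.exists_lt (p := fun e C => (MinimalCode k (N e.pop) e.lam
            (fun z => e.arr a (b e.pop + z) = 1) C ∧ ((decode k (N e.pop) C).card : ℤ) = j ∧
            decode k (N e.pop) (e.var 0) ⊆ decode k (N e.pop) C) ∧
            decode k (N e.pop) (c e.pop) = decode k (N e.pop) C \ decode k (N e.pop) (e.var 0))
          (((ImplP.minimalCode a hN.pop.pop hb.pop.pop (.var 0)).and
            ((ImplP.eq (Impl.card_decode hN.pop.pop (.var 0)) (.const j)).and
              (ImplP.decode_subset hN.pop.pop (Impl.var 0).pop (.var 0)))).and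
            (ImplP.decode_eq_sdiff hN.pop.pop hc.pop.pop (.var 0) (Impl.var 0).pop)))).or
        (hq.pop.not.and (ImplP.decode_eq hN.pop hc.pop (.var 0)))))) _) _)

end Impl

section Round

variable {k : ℕ} {θ : ℕ → ℕ} {N Λ : ℕ} {m : ℤ → Prop}

open Classical in
/-- The family of the clauses with codes `m`. -/
noncomputable def familyOf (k N Λ : ℕ) (m : ℤ → Prop) : Finset (Finset ℤ) :=
  ((Finset.range Λ).filter fun c : ℕ => m c).image fun c : ℕ => decode k N c

/-- The set of codes contains all codes of a clause or none. -/
def ClosedCodes (k N : ℕ) (m : ℤ → Prop) : Prop :=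
  ∀ c c', decode k N c = decode k N c' → m c → m c'

theorem mem_familyOf {C : Finset ℤ} :
    C ∈ familyOf k N Λ m ↔ ∃ c : ℕ, c < Λ ∧ m c ∧ decode k N c = C := by
  simp [familyOf, and_assoc]

theorem decode_mem_familyOf (hm : ClosedCodes k N m) {c : ℕ} (hc : c < Λ) :
    decode k N c ∈ familyOf k N Λ m ↔ m c := by
  rw [mem_familyOf]
  exact ⟨fun ⟨c', _, h, he⟩ => hm _ _ he h, fun h => ⟨c, hc, h, rfl⟩⟩

theorem minimalCode_iff (hm : ClosedCodes k N m) {c : ℕ} (hc : c < Λ) :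
    MinimalCode k N Λ m c ↔ decode k N c ∈ minimalSets (familyOf k N Λ m) := by
  rw [MinimalCode, mem_minimalSets, decode_mem_familyOf hm hc]
  refine and_congr_right fun _ => ⟨fun h D hD => ?_, fun h c' hc' hmc' => ?_⟩
  · obtain ⟨c', hc', hmc', rfl⟩ := mem_familyOf.1 hD
    exact h c' hc' hmc'
  · exact h _ ((decode_mem_familyOf hm hc').2 hmc')

theorem exists_leastCode {c : ℕ} (hc : c < Λ) :
    ∃ c' < Λ, decode k N (c' : ℕ) = decode k N c ∧ LeastCode k N Λ (c' : ℕ) := by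
  classical
  have hex : ∃ c' : ℕ, c' < Λ ∧ decode k N c' = decode k N c := ⟨c, hc, rfl⟩
  refine ⟨Nat.find hex, (Nat.find_spec hex).1, (Nat.find_spec hex).2, fun c' hc' hlt he => ?_⟩
  exact Nat.find_min hex (by exact_mod_cast hlt) ⟨hc', he.trans (Nat.find_spec hex).2⟩

theorem codeDegree_eq (hm : ClosedCodes k N m) (j : ℕ) (h : ℤ) :
    codeDegree k N Λ m j h = (minimalAbove (familyOf k N Λ m) j (decode k N h)).card := by
  classical
  rw [codeDegree]
  have himg : ((Finset.range Λ).filter fun c : ℕ =>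
      (MinimalCode k N Λ m c ∧ LeastCode k N Λ c) ∧ ((decode k N c).card : ℤ) = j ∧
        decode k N h ⊆ decode k N c).image (fun c : ℕ => decode k N c) =
      minimalAbove (familyOf k N Λ m) j (decode k N h) := by
    ext D
    simp only [Finset.mem_image, Finset.mem_filter, Finset.mem_range, mem_minimalAbove]
    constructor
    · rintro ⟨c, ⟨hc, ⟨h1, -⟩, h2, h3⟩, rfl⟩
      exact ⟨(minimalCode_iff hm hc).1 h1, by exact_mod_cast h2, h3⟩
    · rintro ⟨h1, h2, h3⟩
      obtain ⟨c, hc, hmc, rfl⟩ := mem_familyOf.1 (mem_minimalSets.1 h1).1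
      obtain ⟨c', hc', he, hl⟩ := exists_leastCode (k := k) (N := N) hc
      exact ⟨c', ⟨hc', ⟨(minimalCode_iff hm hc').2 (he ▸ h1), hl⟩, by rw [he]; exact_mod_cast h2,
        he ▸ h3⟩, he⟩
  rw [← himg, Finset.card_image_of_injOn]
  intro c hc c' hc' he
  simp only [Finset.coe_filter, Finset.mem_range, Set.mem_ofPred_eq] at hc hc'
  rcases lt_trichotomy c c' with hlt | heq | hlt
  · exact absurd he (hc'.2.1.2 c hc.1 (by exact_mod_cast hlt))
  · exact heq
  · exact absurd he.symm (hc.2.1.2 c' hc'.1 (by exact_mod_cast hlt))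

theorem flowerCode_iff (hm : ClosedCodes k N m) {j i : ℕ} {h : ℤ} :
    FlowerCode k θ N Λ m j i h ↔ IsFlower θ (familyOf k N Λ m) j i (decode k N h) := by
  rw [FlowerCode, codeDegree_eq hm]
  constructor
  · rintro ⟨h1, h2, h3, h4⟩
    exact ⟨Finset.card_ne_zero.1 (by exact_mod_cast h1), by exact_mod_cast h2, h3,
      by exact_mod_cast h4⟩
  · rintro ⟨h1, h2, h3, h4⟩
    exact ⟨by exact_mod_cast Finset.card_ne_zero.2 h1, by exact_mod_cast h2, h3,
      by exact_mod_cast h4⟩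

theorem card_le_of_mem_familyOf {C : Finset ℤ} (h : C ∈ familyOf k N Λ m) : C.card ≤ k := by
  obtain ⟨c, -, -, rfl⟩ := mem_familyOf.1 h
  exact card_decode_le _ _ _

theorem subset_of_mem_familyOf {C : Finset ℤ} (h : C ∈ familyOf k N Λ m) : C ⊆ literalCodes N := by
  obtain ⟨c, -, -, rfl⟩ := mem_familyOf.1 h
  exact decode_subset _ _ _

/-- Sizes of flowers are at most `k`, and the heart has a code. -/
theorem IsFlower.exists_code (hΛ : (2 * N + 1) ^ k ≤ Λ) (hθ : Monotone θ) (hθ1 : 1 ≤ θ 0)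
    {j i : ℕ} {H : Finset ℤ} (h : IsFlower θ (familyOf k N Λ m) j i H) :
    j < k + 1 ∧ i < k + 1 ∧ ∃ c : ℕ, c < Λ ∧ decode k N c = H := by
  obtain ⟨C, hC⟩ : (minimalAbove (familyOf k N Λ m) j H).Nonempty := Finset.card_pos.1
    ((hθ1.trans (hθ (Nat.zero_le i))).trans h.le_card)
  rw [mem_minimalAbove, mem_minimalSets] at hC
  have h1 := card_le_of_mem_familyOf hC.1.1
  have h2 := h.card_add
  obtain ⟨c, hc, he⟩ := exists_decode_eq (k := k) (hC.2.2.trans (subset_of_mem_familyOf hC.1.1))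
    (by omega)
  exact ⟨by omega, by omega, c, hc.trans_le hΛ, he⟩

theorem SelectedCode.isSmallestFlower (hΛ : (2 * N + 1) ^ k ≤ Λ) (hθ : Monotone θ) (hθ1 : 1 ≤ θ 0)
    (hm : ClosedCodes k N m) {j i : ℕ} {h : ℤ} (hs : SelectedCode k θ N Λ m j i h) :
    IsSmallestFlower θ (familyOf k N Λ m) j i (decode k N h) := by
  refine ⟨(flowerCode_iff hm).1 hs.1, fun j' i' H' hlt hF => ?_⟩
  obtain ⟨hj, hi, c, hc, rfl⟩ := hF.exists_code hΛ hθ hθ1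
  exact hs.2.1 j' hj i' hi hlt c hc ((flowerCode_iff hm).2 hF)

theorem exists_selectedCode (hΛ : (2 * N + 1) ^ k ≤ Λ) (hθ : Monotone θ) (hθ1 : 1 ≤ θ 0)
    (hm : ClosedCodes k N m) (hF : ∃ j i H, IsFlower θ (familyOf k N Λ m) j i H) :
    ∃ j < k + 1, ∃ i < k + 1, ∃ h < Λ, SelectedCode k θ N Λ m j i (h : ℕ) := by
  classical
  obtain ⟨j, i, H, hF⟩ := hF
  have hj : ∃ j i H, IsFlower θ (familyOf k N Λ m) j i H := ⟨j, i, H, hF⟩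
  have hi := Nat.find_spec hj
  obtain ⟨H, hF⟩ := Nat.find_spec hi
  set j := Nat.find hj
  set i := Nat.find hi
  obtain ⟨hjk, hik, c, hc, rfl⟩ := hF.exists_code hΛ hθ hθ1
  have hh : ∃ h < Λ, FlowerCode k θ N Λ m j i (h : ℕ) := ⟨c, hc, (flowerCode_iff hm).2 hF⟩
  refine ⟨j, hjk, i, hik, Nat.find hh, (Nat.find_spec hh).1, (Nat.find_spec hh).2, ?_, ?_⟩
  · intro j' _ i' _ hlt h' _ hF'
    rw [flowerCode_iff hm] at hF'
    rcases hlt with hlt | ⟨rfl, hlt⟩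
    · exact Nat.find_min hj hlt ⟨i', _, hF'⟩
    · exact Nat.find_min hi hlt ⟨_, hF'⟩
  · intro h' hh' hlt hF'
    exact Nat.find_min hh (by exact_mod_cast hlt) ⟨hh', hF'⟩

theorem SelectedCode.unique {j i h j' i' h' : ℕ} (hs : SelectedCode k θ N Λ m j i (h : ℕ))
    (hs' : SelectedCode k θ N Λ m j' i' (h' : ℕ)) (hj : j < k + 1) (hi : i < k + 1) (hh : h < Λ)
    (hj' : j' < k + 1) (hi' : i' < k + 1) (hh' : h' < Λ) : j' = j ∧ i' = i ∧ h' = h := by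
  have h1 : ¬ (j' < j ∨ j' = j ∧ i' < i) := fun hlt => hs.2.1 j' hj' i' hi' hlt h' hh' hs'.1
  have h2 : ¬ (j < j' ∨ j = j' ∧ i < i') := fun hlt => hs'.2.1 j hj i hi hlt h hh hs.1
  obtain rfl : j' = j := by omega
  obtain rfl : i' = i := by omega
  refine ⟨rfl, rfl, ?_⟩
  rcases lt_trichotomy h' h with hlt | heq | hlt
  · exact absurd hs'.1 (hs.2.2 h' hh' (by exact_mod_cast hlt))
  · exact heq
  · exact absurd hs.1 (hs'.2.2 h hh (by exact_mod_cast hlt))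

theorem ClosedCodes.roundCodes (hm : ClosedCodes k N m) (petal : Prop) :
    ClosedCodes k N (roundCodes k θ N Λ m petal) := by
  intro c c' he h
  rw [FineGrained.roundCodes] at h ⊢
  rw [← he]
  exact h.imp_left (hm c c' he)

theorem roundCodes_of_no_flower (hm : ClosedCodes k N m)
    (hno : ∀ j i H, ¬ IsFlower θ (familyOf k N Λ m) j i H) (petal : Prop) :
    roundCodes k θ N Λ m petal = m := by
  funext c
  rw [roundCodes, eq_iff_iff, or_iff_left]
  rintro ⟨j, -, i, -, h, -, hs, -⟩
  exact hno j i _ ((flowerCode_iff hm).1 hs.1)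

theorem familyOf_roundCodes (hΛ : (2 * N + 1) ^ k ≤ Λ) (hm : ClosedCodes k N m) {j i h : ℕ}
    (hj : j < k + 1) (hi : i < k + 1) (hh : h < Λ) (hs : SelectedCode k θ N Λ m j i (h : ℕ))
    (petal : Prop) [Decidable petal] :
    familyOf k N Λ (roundCodes k θ N Λ m petal) = familyOf k N Λ m ∪
      if petal then petals (familyOf k N Λ m) j (decode k N h) else {decode k N h} := by
  have hround : ∀ c, roundCodes k θ N Λ m petal c ↔ m c ∨
      decode k N c ∈ if petal then petals (familyOf k N Λ m) j (decode k N h)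
        else {decode k N h} := by
    intro c
    rw [roundCodes]
    refine or_congr_right ?_
    constructor
    · rintro ⟨j', hj', i', hi', h', hh', hs', hc⟩
      obtain ⟨rfl, rfl, rfl⟩ := hs.unique hs' hj hi hh hj' hi' hh'
      rcases hc with ⟨hp, C, hC, ⟨h1, h2, h3⟩, he⟩ | ⟨hp, he⟩
      · rw [if_pos hp, he]
        exact Finset.mem_image.2 ⟨_, mem_minimalAbove.2 ⟨(minimalCode_iff hm hC).1 h1,
          by exact_mod_cast h2, h3⟩, rfl⟩
      · simp [if_neg hp, he]
    · intro hc
      refine ⟨j, hj, i, hi, h, hh, hs, ?_⟩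
      split_ifs at hc with hp
      · obtain ⟨D, hD, he⟩ := Finset.mem_image.1 hc
        rw [mem_minimalAbove] at hD
        obtain ⟨C, hC, -, rfl⟩ := mem_familyOf.1 (mem_minimalSets.1 hD.1).1
        exact Or.inl ⟨hp, C, hC, ⟨(minimalCode_iff hm hC).2 hD.1, by exact_mod_cast hD.2.1,
          hD.2.2⟩, he.symm⟩
      · exact Or.inr ⟨hp, by simpa using hc⟩
  ext D
  rw [Finset.mem_union, mem_familyOf]
  constructor
  · rintro ⟨c, hc, hr, rfl⟩
    exact ((hround c).1 hr).imp_left fun h => mem_familyOf.2 ⟨c, hc, h, rfl⟩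
  · rintro (hD | hD)
    · obtain ⟨c, hc, hmc, rfl⟩ := mem_familyOf.1 hD
      exact ⟨c, hc, (hround c).2 (Or.inl hmc), rfl⟩
    · have hcode : D ⊆ literalCodes N ∧ D.card ≤ k := by
        split_ifs at hD with hp
        · obtain ⟨C, hC, rfl⟩ := Finset.mem_image.1 hD
          have hCF := (mem_minimalSets.1 (mem_minimalAbove.1 hC).1).1
          exact ⟨Finset.sdiff_subset.trans (subset_of_mem_familyOf hCF),
            (Finset.card_le_card Finset.sdiff_subset).trans (card_le_of_mem_familyOf hCF)⟩
        · rw [Finset.mem_singleton] at hD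
          subst hD
          exact ⟨decode_subset _ _ _, card_decode_le _ _ _⟩
      obtain ⟨c, hc, rfl⟩ := exists_decode_eq hcode.1 hcode.2
      exact ⟨c, hc.trans_le hΛ, (hround c).2 (Or.inr hD), rfl⟩

/-- The codes after `s` rounds; `petal` tells in which rounds the petals are added. -/
def codeSeq (k : ℕ) (θ : ℕ → ℕ) (N Λ : ℕ) (m : ℤ → Prop) (petal : ℕ → Prop) : ℕ → ℤ → Prop
  | 0 => m
  | s + 1 => roundCodes k θ N Λ (codeSeq k θ N Λ m petal s) (petal s)

theorem ClosedCodes.codeSeq (hm : ClosedCodes k N m) (petal : ℕ → Prop) (s : ℕ) :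
    ClosedCodes k N (codeSeq k θ N Λ m petal s) := by
  induction s with
  | zero => exact hm
  | succ s ih => exact ih.roundCodes _

theorem codeSeq_congr {petal petal' : ℕ → Prop} {s : ℕ} (h : ∀ i < s, petal i ↔ petal' i) :
    codeSeq k θ N Λ m petal s = codeSeq k θ N Λ m petal' s := by
  induction s with
  | zero => rfl
  | succ s ih =>
    rw [codeSeq, codeSeq, ih fun i hi => h i (by omega), propext (h s (by omega))]

theorem codeSeq_of_no_flower (hm : ClosedCodes k N m) {petal : ℕ → Prop} {s : ℕ}
    (hno : ∀ j i H, ¬ IsFlower θ (familyOf k N Λ (codeSeq k θ N Λ m petal s)) j i H) (t : ℕ) :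
    codeSeq k θ N Λ m petal (s + t) = codeSeq k θ N Λ m petal s := by
  induction t with
  | zero => rfl
  | succ t ih =>
    rw [← add_assoc, codeSeq, ih]
    exact roundCodes_of_no_flower (hm.codeSeq petal s) hno _

theorem codeSeq_of_zero (petal : ℕ → Prop) (s : ℕ) {c : ℤ} (h : m c) :
    codeSeq k θ N Λ m petal s c := by
  induction s with
  | zero => exact h
  | succ s ih => exact Or.inl ih

end Round

/-! ### Encoding the choices between hearts and petals by few bits -/

/-- The advice is read in blocks of `w` bits. A block `d < 2 ^ w - 1` stands for `d` hearts followed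
by a petal, the block `2 ^ w - 1` for as many hearts. The state `x * 2 ^ w + g` consists of the
blocks `x` that are not yet finished and the number `g` of hearts already taken from the current
one. -/
def adviceNext (w Y : ℕ) : ℕ :=
  if Y % 2 ^ w < Y / 2 ^ w % 2 ^ w ∧ Y % 2 ^ w + 1 < 2 ^ w - 1 then Y + 1
  else Y / (2 ^ w * 2 ^ w) * 2 ^ w

/-- The choice that a state of the advice calls for. -/
def AdvicePetal (w Y : ℕ) : Prop := Y / 2 ^ w % 2 ^ w ≤ Y % 2 ^ w

/-- The state of the advice `l` after `s` choices. -/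
def adviceState (w l s : ℕ) : ℕ := (adviceNext w)^[s] (l * 2 ^ w)

theorem adviceState_succ (w l s : ℕ) :
    adviceState w l (s + 1) = adviceNext w (adviceState w l s) :=
  Function.iterate_succ_apply' _ _ _

theorem adviceState_le (w l s : ℕ) : adviceState w l s ≤ l * 2 ^ w + s := by
  induction s with
  | zero => exact le_rfl
  | succ s ih =>
    rw [adviceState_succ, adviceNext]
    split_ifs
    · omega
    · have h1 : adviceState w l s / (2 ^ w * 2 ^ w) * 2 ^ w ≤ adviceState w l s := by
        rw [← Nat.div_div_eq_div_mul]
        exact (Nat.div_mul_le_self _ _).trans (Nat.div_le_self _ _)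
      omega

/-- The choices encoded by the first block, and the state after it. -/
theorem adviceState_block {w l d : ℕ} (hd : d < 2 ^ w) :
    (∀ s, s ≤ d → s < 2 ^ w - 1 → adviceState w (l * 2 ^ w + d) s = (l * 2 ^ w + d) * 2 ^ w + s ∧
      (AdvicePetal w (adviceState w (l * 2 ^ w + d) s) ↔ d = s)) ∧
    ∀ s, s + 1 = (if d < 2 ^ w - 1 then d + 1 else 2 ^ w - 1) → ∀ t,
      adviceState w (l * 2 ^ w + d) (s + 1 + t) = adviceState w l t := by
  have hpos : 0 < 2 ^ w := by positivity
  have hmod : ∀ s < 2 ^ w, ((l * 2 ^ w + d) * 2 ^ w + s) % 2 ^ w = s := fun s hs => by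
    rw [mul_comm, Nat.mul_add_mod, Nat.mod_eq_of_lt hs]
  have hdiv : ∀ s < 2 ^ w, ((l * 2 ^ w + d) * 2 ^ w + s) / 2 ^ w = l * 2 ^ w + d := fun s hs => by
    rw [mul_comm, Nat.mul_add_div hpos, Nat.div_eq_of_lt hs, add_zero]
  have hdig : (l * 2 ^ w + d) % 2 ^ w = d := by rw [mul_comm, Nat.mul_add_mod, Nat.mod_eq_of_lt hd]
  have hrest : (l * 2 ^ w + d) / 2 ^ w = l := by
    rw [mul_comm, Nat.mul_add_div hpos, Nat.div_eq_of_lt hd, add_zero]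
  have hstate : ∀ s, s ≤ d → s < 2 ^ w - 1 →
      adviceState w (l * 2 ^ w + d) s = (l * 2 ^ w + d) * 2 ^ w + s := by
    intro s
    induction s with
    | zero => intros; rfl
    | succ s ih =>
      intro h1 h2
      rw [adviceState_succ, ih (by omega) (by omega), adviceNext, hmod s (by omega),
        hdiv s (by omega), hdig, if_pos (by omega), add_assoc]
  refine ⟨fun s h1 h2 => ⟨hstate s h1 h2, ?_⟩, fun s hs t => ?_⟩
  · rw [hstate s h1 h2, AdvicePetal, hmod s (by omega), hdiv s (by omega), hdig]
    omega
  · have hlast : adviceState w (l * 2 ^ w + d) (s + 1) = l * 2 ^ w := by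
      have h12 : s ≤ d ∧ s < 2 ^ w - 1 := by split_ifs at hs <;> omega
      rw [adviceState_succ, hstate s h12.1 h12.2, adviceNext, hmod s (by omega), hdiv s (by omega),
        hdig, if_neg (by split_ifs at hs <;> omega), ← Nat.div_div_eq_div_mul, hdiv s (by omega),
        hrest]
    rw [adviceState, add_comm, Function.iterate_add_apply]
    exact congrArg _ hlast

open Classical in
/-- Few petals among few choices are encoded by few blocks. -/
theorem exists_advice {w : ℕ} (hw : 1 ≤ w) (L : ℕ) (δ : ℕ → Prop) :
    ∃ l < (2 ^ w) ^ (L / (2 ^ w - 1) + ((Finset.range L).filter δ).card + 1),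
      ∀ s < L, AdvicePetal w (adviceState w l s) ↔ δ s := by
  induction L using Nat.strong_induction_on generalizing δ with
  | _ L ih =>
    have hpos : 2 ≤ 2 ^ w := by
      calc 2 = 2 ^ 1 := rfl
        _ ≤ 2 ^ w := Nat.pow_le_pow_right (by norm_num) hw
    set W := 2 ^ w - 1 with hW
    have hWpos : 0 < W := by omega
    have hcount : ∀ a, a ≤ L → ((Finset.range (L - a)).filter fun s => δ (a + s)).card +
        ((Finset.range a).filter δ).card = ((Finset.range L).filter δ).card := by
      intro a ha
      conv_rhs => rw [show L = a + (L - a) by omega]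
      simp only [Finset.card_filter]
      rw [Finset.sum_range_add, add_comm]
    -- the first block stands for the choices up to the first petal, or for `W` hearts
    by_cases h : ∃ d, d < L ∧ d < W ∧ δ d
    · obtain ⟨hdL, hdW, hδ⟩ := Nat.find_spec h
      have hmin : ∀ s < Nat.find h, ¬ δ s := fun s hs hδs =>
        Nat.find_min h hs ⟨by omega, by omega, hδs⟩
      set d := Nat.find h with hd
      obtain ⟨l, hl, hlδ⟩ := ih (L - (d + 1)) (by omega) fun s => δ (d + 1 + s)
      obtain ⟨hb1, hb2⟩ := adviceState_block (w := w) (l := l) (d := d) (by omega)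
      refine ⟨l * 2 ^ w + d, ?_, fun s hs => ?_⟩
      · have hc := hcount (d + 1) (by omega)
        have h1 : 1 ≤ ((Finset.range (d + 1)).filter δ).card :=
          Finset.card_pos.2 ⟨d, by simp [hδ]⟩
        have h2 : (L - (d + 1)) / W ≤ L / W := Nat.div_le_div_right (by omega)
        calc l * 2 ^ w + d < (l + 1) * 2 ^ w := by rw [add_mul]; omega
          _ ≤ (2 ^ w) ^ ((L - (d + 1)) / W +
              ((Finset.range (L - (d + 1))).filter fun s => δ (d + 1 + s)).card + 1) * 2 ^ w :=
            Nat.mul_le_mul_right _ hl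
          _ = (2 ^ w) ^ ((L - (d + 1)) / W +
              ((Finset.range (L - (d + 1))).filter fun s => δ (d + 1 + s)).card + 1 + 1) :=
            (pow_succ _ _).symm
          _ ≤ _ := Nat.pow_le_pow_right (by omega) (by omega)
      · rcases Nat.lt_or_ge d s with hds | hds
        · obtain ⟨t, rfl⟩ : ∃ t, s = d + 1 + t := ⟨s - (d + 1), by omega⟩
          rw [hb2 d (by rw [if_pos hdW])]
          exact hlδ t (by omega)
        · rw [(hb1 s hds (by omega)).2]
          constructor
          · rintro rfl; exact hδ
          · intro hs'
            by_contra hne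
            exact hmin s (by omega) hs'
    · push Not at h
      rcases Nat.lt_or_ge L W with hLW | hLW
      · obtain ⟨hb1, -⟩ := adviceState_block (w := w) (l := 0) (d := W) (by omega)
        rw [zero_mul, zero_add] at hb1
        refine ⟨W, ?_, fun s hs => ?_⟩
        · calc W < (2 ^ w) ^ 1 := by rw [pow_one]; omega
            _ ≤ _ := Nat.pow_le_pow_right (by omega) (Nat.le_add_left 1 _)
        · rw [(hb1 s (by omega) (by omega)).2]
          exact ⟨fun _ => by omega, fun h' => absurd h' (h s hs (by omega))⟩
      · obtain ⟨l, hl, hlδ⟩ := ih (L - W) (by omega) fun s => δ (W + s)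
        obtain ⟨hb1, hb2⟩ := adviceState_block (w := w) (l := l) (d := W) (by omega)
        refine ⟨l * 2 ^ w + W, ?_, fun s hs => ?_⟩
        · have hc := hcount W hLW
          have h2 : (L - W) / W + 1 = L / W := by
            rw [← Nat.add_div_right _ hWpos, Nat.sub_add_cancel hLW]
          calc l * 2 ^ w + W < (l + 1) * 2 ^ w := by rw [add_mul]; omega
            _ ≤ (2 ^ w) ^ ((L - W) / W +
                ((Finset.range (L - W)).filter fun s => δ (W + s)).card + 1) * 2 ^ w :=
              Nat.mul_le_mul_right _ hl
            _ = (2 ^ w) ^ ((L - W) / W +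
                ((Finset.range (L - W)).filter fun s => δ (W + s)).card + 1 + 1) :=
              (pow_succ _ _).symm
            _ ≤ _ := Nat.pow_le_pow_right (by omega) (by omega)
        · rcases Nat.lt_or_ge s W with hsW | hsW
          · rw [(hb1 s (by omega) (by omega)).2]
            exact ⟨fun _ => by omega, fun h' => absurd h' (h s hs hsW)⟩
          · obtain ⟨t, rfl⟩ : ∃ t, s = W + t := ⟨s - W, by omega⟩
            have := hb2 (W - 1) (by rw [if_neg (lt_irrefl _)]; omega) t
            rw [show W - 1 + 1 = W by omega] at this
            rw [this]
            exact hlδ t (by omega)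

/-! ### Some advice leads to a sparse family that keeps a given assignment -/

/-- Every member of the family contains an element with property `τ`. -/
def Hits (τ : ℤ → Prop) (F : Finset (Finset ℤ)) : Prop := ∀ C ∈ F, ∃ z ∈ C, τ z

/-- The choice in one round that keeps `τ`: petals, if the selected heart contains no `τ`. -/
def KeepingPetal (k : ℕ) (θ : ℕ → ℕ) (N Λ : ℕ) (τ : ℤ → Prop) (m : ℤ → Prop) : Prop :=
  ∃ j < k + 1, ∃ i < k + 1, ∃ h < Λ, SelectedCode k θ N Λ m j i (h : ℕ) ∧
    ∀ z ∈ decode k N (h : ℕ), ¬ τ z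

/-- The codes after `s` rounds in which all choices keep `τ`. -/
def keepingSeq (k : ℕ) (θ : ℕ → ℕ) (N Λ : ℕ) (τ : ℤ → Prop) (m : ℤ → Prop) : ℕ → ℤ → Prop
  | 0 => m
  | s + 1 => roundCodes k θ N Λ (keepingSeq k θ N Λ τ m s)
      (KeepingPetal k θ N Λ τ (keepingSeq k θ N Λ τ m s))

open Classical in
/-- The sparsification lemma: if `τ` satisfies all clauses, then some advice of the given length
leads to a sparse family all of whose clauses are still satisfied by `τ`. -/
theorem exists_advice_hits {k N Λ R w : ℕ} {m τ : ℤ → Prop} (hR : 1 ≤ R) (hw : 1 ≤ w)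
    (hm : ClosedCodes k N m) (hΛ : (2 * N + 1) ^ k ≤ Λ) (hΛ' : sparsifyBound R k * N ≤ Λ)
    (hwR : R * sparsifyBound R k ≤ 2 ^ w - 1) (hτ : Hits τ (familyOf k N Λ m)) :
    ∃ l < (2 ^ w) ^ ((k + 1) * (N / R) + 1),
      Hits τ (familyOf k N Λ (codeSeq k (flowerThreshold R) N Λ m
        (fun s => AdvicePetal w (adviceState w l s)) Λ)) ∧
      (minimalSets (familyOf k N Λ (codeSeq k (flowerThreshold R) N Λ m
        (fun s => AdvicePetal w (adviceState w l s)) Λ))).card ≤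
        1 + 2 * N * (k * flowerThreshold R k) := by
  set θ := flowerThreshold R with hθdef
  have hθ : Monotone θ := flowerThreshold_mono R
  have hθ1 : 1 ≤ θ 0 := one_le_flowerThreshold hR 0
  have hL : (literalCodes N).card ≤ 2 * N := (card_literalCodes N).le
  set K := keepingSeq k θ N Λ τ m with hK
  set δ : ℕ → Prop := fun s => KeepingPetal k θ N Λ τ (K s) with hδ
  have hKδ : ∀ s, codeSeq k θ N Λ m δ s = K s := by
    intro s
    induction s with
    | zero => rfl
    | succ s ih => rw [codeSeq, ih]; rfl
  have hKclosed : ∀ s, ClosedCodes k N (K s) := fun s => hKδ s ▸ hm.codeSeq δ s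
  -- one round that keeps `τ`, in terms of families
  have hround : ∀ s, (∃ j i H, IsFlower θ (familyOf k N Λ (K s)) j i H) →
      ∃ j i H, IsSmallestFlower θ (familyOf k N Λ (K s)) j i H ∧ (δ s ↔ ∀ z ∈ H, ¬ τ z) ∧
        familyOf k N Λ (K (s + 1)) = familyOf k N Λ (K s) ∪
          if δ s then petals (familyOf k N Λ (K s)) j H else {H} := by
    intro s hF
    obtain ⟨j, hj, i, hi, h, hh, hs⟩ := exists_selectedCode hΛ hθ hθ1 (hKclosed s) hF
    refine ⟨j, i, _, hs.isSmallestFlower hΛ hθ hθ1 (hKclosed s), ?_,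
      familyOf_roundCodes hΛ (hKclosed s) hj hi hh hs _⟩
    constructor
    · rintro ⟨j', hj', i', hi', h', hh', hs', hz⟩
      obtain ⟨rfl, rfl, rfl⟩ := hs.unique hs' hj hi hh hj' hi' hh'
      exact hz
    · exact fun hz => ⟨j, hj, i, hi, h, hh, hs, hz⟩
  -- a petal is hit because its heart is not: the true literal of the whole set lies in the petal
  have hhits : ∀ s, Hits τ (familyOf k N Λ (K s)) := by
    intro s
    induction s with
    | zero => exact hτ
    | succ s ih =>
      by_cases hF : ∃ j i H, IsFlower θ (familyOf k N Λ (K s)) j i H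
      · obtain ⟨j, i, H, -, hd, he⟩ := hround s hF
        rw [he]
        intro C hC
        rcases Finset.mem_union.1 hC with hC | hC
        · exact ih C hC
        · split_ifs at hC with hδs
          · obtain ⟨D, hD, rfl⟩ := Finset.mem_image.1 hC
            obtain ⟨z, hz, hτz⟩ := ih D (mem_minimalSets.1 (mem_minimalAbove.1 hD).1).1
            exact ⟨z, Finset.mem_sdiff.2 ⟨hz, fun hzH => hd.1 hδs z hzH hτz⟩, hτz⟩
          · rw [Finset.mem_singleton] at hC
            subst hC
            by_contra hcon
            exact hδs (hd.2 fun z hz hτz => hcon ⟨z, hz, hτz⟩)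
      · push Not at hF
        have : K (s + 1) = K s := roundCodes_of_no_flower (hKclosed s) hF _
        rw [this]
        exact ih
  have hinv : ∀ s, (∀ s' < s, ∃ j i H, IsFlower θ (familyOf k N Λ (K s')) j i H) →
      ∃ p, SparsifyInv θ (literalCodes N) k (familyOf k N Λ m) (familyOf k N Λ (K s)) s p ∧
        ((Finset.range s).filter δ).card = ∑ i ∈ Finset.range k, p i := by
    intro s
    induction s with
    | zero =>
      exact fun _ => ⟨0, .init θ (fun C hC => subset_of_mem_familyOf hC)
        (fun C hC => card_le_of_mem_familyOf hC), by simp⟩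
    | succ s ih =>
      intro hF
      obtain ⟨p, hI, hp⟩ := ih fun s' hs' => hF s' (by omega)
      obtain ⟨j, i, H, hS, -, he⟩ := hround s (hF s (by omega))
      rw [he, Finset.range_add_one, Finset.filter_insert]
      split_ifs with hδs
      · obtain ⟨hik, hI'⟩ := hI.petal hθ hθ1 hS
        refine ⟨_, hI', ?_⟩
        rw [Finset.card_insert_of_notMem (by simp), hp, Finset.sum_add_distrib, Finset.sum_ite_eq',
          if_pos (Finset.mem_range.2 hik)]
      · exact ⟨p, hI.heart hθ hθ1 hS, hp⟩
  -- the number of rounds with a flower is bounded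
  have hfinal : ∃ s, ∀ j i H, ¬ IsFlower θ (familyOf k N Λ (K s)) j i H := by
    by_contra hcon
    push Not at hcon
    obtain ⟨p, hI, -⟩ := hinv (sparsifyBound R k * N + 1) fun s _ => hcon s
    have := hI.steps_le_mul hR hL
    omega
  set S := Nat.find hfinal with hSdef
  have hno := Nat.find_spec hfinal
  obtain ⟨p, hI, hp⟩ := hinv S fun s hs => by
    have := Nat.find_min hfinal hs
    push Not at this
    exact this
  have hS := hI.steps_le_mul hR hL
  obtain ⟨l, hl, hlδ⟩ := exists_advice hw S δ
  -- after the last flower, the remaining rounds change nothing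
  have hseq : codeSeq k θ N Λ m (fun s => AdvicePetal w (adviceState w l s)) Λ = K S := by
    have h1 : codeSeq k θ N Λ m (fun s => AdvicePetal w (adviceState w l s)) S = K S := by
      rw [← hKδ]
      exact codeSeq_congr hlδ
    have h2 := codeSeq_of_no_flower hm (by rw [h1]; exact hno) (Λ - S)
    rw [← h1, ← h2]
    congr 1
    omega
  refine ⟨l, hl.trans_le (Nat.pow_le_pow_right (by positivity) ?_), ?_, ?_⟩
  · -- at most `N / R` blocks without petals, and as many blocks with petals of each of `k` sizes
    have h1 : S / (2 ^ w - 1) ≤ N / R := by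
      have hb := one_le_sparsifyBound R k
      have : sparsifyBound R k * N / (R * sparsifyBound R k) = N / R := by
        rw [mul_comm R, Nat.mul_div_mul_left _ _ hb]
      rw [← this]
      exact Nat.div_le_div hS hwR (Nat.mul_ne_zero (by omega) (by omega))
    have h2 : ((Finset.range S).filter δ).card ≤ k * (N / R) := by
      rw [hp]
      refine (Finset.sum_le_card_nsmul _ _ (N / R) fun i _ => ?_).trans (by simp)
      exact (Nat.le_div_iff_mul_le hR).2 (hI.petals_mul_le hR hL i)
    rw [add_mul, one_mul]
    omega
  · rw [hseq]
    exact hhits S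
  · rw [hseq]
    exact card_minimalSets_le hθ hθ1 hL (fun C hC => subset_of_mem_familyOf hC)
      (fun C hC => card_le_of_mem_familyOf hC) hno

/-! ### From formulas to families of clauses -/

/-- The bit of `a` at position `x` (for `0 ≤ x ≤ Λ`). -/
def bitAt (Λ : ℕ) (a x : ℤ) : ℤ := a / 2 ^ min x.toNat Λ % 2

/-- The literal with code `z` has one of the variables `lo, …, lo + h - 1` and is made true by the
assignment whose values are the bits of `a`. -/
def TrueOn (Λ : ℕ) (lo h a z : ℤ) : Prop :=
  (lo < |z| ∧ |z| ≤ lo + h) ∧ (bitAt Λ a (|z| - 1 - lo) = 1 ↔ 0 < z)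

/-- The literal with code `z` is made true by the bits of `a` and `b`, the values of the first and
of the last variables. -/
def TrueUnder (Λ : ℕ) (h a b z : ℤ) : Prop := TrueOn Λ 0 h a z ∨ TrueOn Λ h h b z

/-- The codes of the clauses of a formula that is stored in the array `A`. -/
def initCodes (k : ℕ) (N : ℤ) (Λ : ℕ) (A : ℤ → ℤ) (M c : ℤ) : Prop :=
  ∃ j < Λ, ((j : ℕ) : ℤ) < M ∧ (∀ z ∈ decode k N c, ∃ r < k, A ((j : ℕ) * k + (r : ℕ)) = z) ∧
    ∀ r < k, A ((j : ℕ) * k + (r : ℕ)) ≠ 0 → A ((j : ℕ) * k + (r : ℕ)) ∈ decode k N c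

theorem bitAt_natCast {Λ a x : ℕ} (hx : x ≤ Λ) : bitAt Λ a x = ((a / 2 ^ x % 2 : ℕ) : ℤ) := by
  rw [bitAt, Int.toNat_natCast, min_eq_left hx]
  push_cast
  rfl

theorem KCNF.input_arr {k N : ℕ} (φ : KCNF k N) {j r : ℕ} (hj : j < φ.clauses.length) (hr : r < k) :
    φ.input.arr 0 ((j : ℤ) * k + r) = φ.code j r := by
  have h1 : ((j : ℤ) * k + r) = ((j * k + r : ℕ) : ℤ) := by push_cast; rfl
  have h2 : j * k + r < φ.clauses.length * k := by
    calc j * k + r < (j + 1) * k := by rw [add_mul]; omega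
      _ ≤ _ := Nat.mul_le_mul_right _ hj
  simp only [KCNF.input, h1, Int.toNat_natCast]
  rw [if_pos ⟨trivial, Int.natCast_nonneg _, by exact_mod_cast h2⟩]
  have hk : 0 < k := by omega
  congr 1
  · rw [mul_comm, Nat.mul_add_div hk, Nat.div_eq_of_lt hr, add_zero]
  · rw [mul_comm, Nat.mul_add_mod, Nat.mod_eq_of_lt hr]

theorem Literal.code_ne_zero {N : ℕ} (l : Literal N) : Literal.code l ≠ 0 := by
  unfold Literal.code
  split_ifs <;> omega

theorem Literal.abs_code {N : ℕ} (l : Literal N) : |Literal.code l| = (l.1 : ℕ) + 1 := by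
  unfold Literal.code
  split_ifs
  · exact abs_of_nonneg (by omega)
  · rw [abs_neg]; exact abs_of_nonneg (by omega)

theorem Literal.code_pos {N : ℕ} (l : Literal N) : 0 < Literal.code l ↔ l.2 = true := by
  unfold Literal.code
  split_ifs with h <;> simp [h]

theorem KCNF.code_eq {k N : ℕ} (φ : KCNF k N) {j r : ℕ} (hj : j < φ.clauses.length) :
    φ.code j r = 0 ∧ (φ.clauses[j]).length ≤ r ∨
      ∃ h : r < (φ.clauses[j]).length, φ.code j r = Literal.code (φ.clauses[j][r]) := by
  unfold KCNF.code
  rw [List.getD_eq_getElem _ _ hj]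
  rcases Nat.lt_or_ge r (φ.clauses[j]).length with h | h
  · exact Or.inr ⟨h, by simp [List.getElem?_eq_getElem h]⟩
  · exact Or.inl ⟨by simp [List.getElem?_eq_none h], h⟩

theorem KCNF.abs_code_le {k N : ℕ} (φ : KCNF k N) {j r : ℕ} (hj : j < φ.clauses.length) :
    |φ.code j r| ≤ N := by
  rcases φ.code_eq (r := r) hj with ⟨h, -⟩ | ⟨h, he⟩
  · simp [h]
  · rw [he, Literal.abs_code]
    have := (φ.clauses[j][r]).1.isLt
    omega

/-- A formula has fewer clauses than there are codes of clauses. -/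
theorem KCNF.length_le {k N : ℕ} (φ : KCNF k N) : φ.clauses.length ≤ (2 * N + 1) ^ k := by
  classical
  let f : List (Literal N) → Fin k → Option (Literal N) := fun l r => l[(r : ℕ)]?
  have hinj : Set.InjOn f {c | c.length ≤ k} := by
    intro c hc c' hc' he
    refine List.ext_getElem? fun i => ?_
    rcases Nat.lt_or_ge i k with h | h
    · exact congrFun he ⟨i, h⟩
    · rw [List.getElem?_eq_none (le_trans hc h), List.getElem?_eq_none (le_trans hc' h)]
  have h1 : (φ.clauses.toFinset.image f).card = φ.clauses.length := by
    rw [Finset.card_image_of_injOn, List.toFinset_card_of_nodup φ.nodup]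
    exact hinj.mono fun c hc => φ.width_le c (by simpa using hc)
  rw [← h1]
  refine (Finset.card_le_univ _).trans (le_of_eq ?_)
  simp [mul_comm]

section

variable {k N Λ h : ℕ}

theorem initCodes_closed (A : ℤ → ℤ) (M : ℤ) : ClosedCodes k N (initCodes k N Λ A M) := by
  intro c c' he hc
  unfold initCodes at hc ⊢
  rwa [he] at hc

/-- The families of the clauses of `φ` are hit by the true literals of the satisfying assignments. -/
theorem hits_initCodes_iff (φ : KCNF k N) (hΛ : (2 * N + 1) ^ k ≤ Λ) (τ : ℤ → Prop) :
    Hits τ (familyOf k N Λ (initCodes k N Λ (φ.input.arr 0) φ.clauses.length)) ↔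
      ∀ c ∈ φ.clauses, ∃ l ∈ c, τ (Literal.code l) := by
  constructor
  · intro H c hc
    obtain ⟨j, hj, rfl⟩ := List.getElem_of_mem hc
    -- the set of literals of the clause
    set C : Finset ℤ := ((φ.clauses[j]).map Literal.code).toFinset with hC
    have hCL : C ⊆ literalCodes N := by
      intro z hz
      obtain ⟨l, -, rfl⟩ := List.mem_map.1 (List.mem_toFinset.1 hz)
      rw [literalCodes, Finset.mem_erase, Finset.mem_Icc]
      have h1 := Literal.abs_code l
      have h2 := abs_le.1 (show |Literal.code l| ≤ N by rw [h1]; have := l.1.isLt; omega)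
      exact ⟨Literal.code_ne_zero l, h2⟩
    have hlen : (φ.clauses[j]).length ≤ k := φ.width_le _ hc
    have hCk : C.card ≤ k := (List.toFinset_card_le _).trans (by simpa using hlen)
    obtain ⟨c, hcΛ, he⟩ := exists_decode_eq hCL hCk
    have hinit : initCodes k N Λ (φ.input.arr 0) φ.clauses.length c := by
      refine ⟨j, (hj.trans_le φ.length_le).trans_le hΛ, by exact_mod_cast hj, fun z hz => ?_,
        fun r hr h0 => ?_⟩
      · rw [he] at hz
        obtain ⟨l, hl, rfl⟩ := List.mem_map.1 (List.mem_toFinset.1 hz)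
        obtain ⟨r, hr, rfl⟩ := List.getElem_of_mem hl
        refine ⟨r, by omega, ?_⟩
        rw [KCNF.input_arr φ hj (by omega)]
        rcases φ.code_eq (r := r) hj with ⟨-, h⟩ | ⟨h, h'⟩
        · omega
        · exact h'
      · rw [KCNF.input_arr φ hj hr] at h0 ⊢
        rcases φ.code_eq (r := r) hj with ⟨h, -⟩ | ⟨h, h'⟩
        · exact absurd h h0
        · rw [he, h']
          exact List.mem_toFinset.2 (List.mem_map.2 ⟨_, List.getElem_mem h, rfl⟩)
    obtain ⟨z, hz, hτ⟩ := H _ (mem_familyOf.2 ⟨c, hcΛ.trans_le hΛ, hinit, rfl⟩)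
    rw [he] at hz
    obtain ⟨l, hl, rfl⟩ := List.mem_map.1 (List.mem_toFinset.1 hz)
    exact ⟨l, hl, hτ⟩
  · intro H C hC
    obtain ⟨c, -, ⟨j, -, hj, -, h2⟩, rfl⟩ := mem_familyOf.1 hC
    have hj : j < φ.clauses.length := by exact_mod_cast hj
    obtain ⟨l, hl, hτ⟩ := H _ (List.getElem_mem hj)
    obtain ⟨r, hr, rfl⟩ := List.getElem_of_mem hl
    have hrk : r < k := hr.trans_le (φ.width_le _ (List.getElem_mem hj))
    have hcode : φ.input.arr 0 ((j : ℤ) * k + r) = Literal.code (φ.clauses[j][r]) := by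
      rw [KCNF.input_arr φ hj hrk]
      rcases φ.code_eq (r := r) hj with ⟨-, h⟩ | ⟨h, h'⟩
      · omega
      · exact h'
    have := h2 r hrk
    rw [hcode] at this
    exact ⟨_, this (Literal.code_ne_zero _), hτ⟩

theorem satisfiable_iff_hits (φ : KCNF k N) (hΛ : (2 * N + 1) ^ k ≤ Λ) (hΛN : N ≤ Λ)
    (hh : N ≤ 2 * h) :
    φ.Satisfiable ↔ ∃ a < 2 ^ h, ∃ b < 2 ^ h, Hits (TrueUnder Λ (h : ℕ) (a : ℕ) (b : ℕ))
      (familyOf k N Λ (initCodes k N Λ (φ.input.arr 0) φ.clauses.length)) := by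
  simp only [hits_initCodes_iff φ hΛ, KCNF.Satisfiable]
  -- truth of a literal of the variable `v`
  have key : ∀ (a b : ℕ) (l : Literal N), TrueUnder Λ (h : ℕ) (a : ℕ) (b : ℕ) (Literal.code l) ↔
      ((if (l.1 : ℕ) < h then a / 2 ^ (l.1 : ℕ) % 2 else b / 2 ^ ((l.1 : ℕ) - h) % 2) = 1 ↔
        l.2 = true) := by
    intro a b l
    have hl := l.1.isLt
    simp only [TrueUnder, TrueOn, Literal.abs_code, Literal.code_pos]
    split_ifs with hv
    · rw [show (((l.1 : ℕ) : ℤ) + 1 - 1 - 0) = ((l.1 : ℕ) : ℤ) by ring, bitAt_natCast (by omega)]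
      have h1 : ¬ ((h : ℤ) < ((l.1 : ℕ) : ℤ) + 1) := by omega
      have h2 : (0 : ℤ) < ((l.1 : ℕ) : ℤ) + 1 ∧ ((l.1 : ℕ) : ℤ) + 1 ≤ 0 + h := by omega
      simp only [h1, h2, false_and, or_false, true_and, and_self]
      norm_cast
    · rw [show (((l.1 : ℕ) : ℤ) + 1 - 1 - (h : ℤ)) = ((((l.1 : ℕ) - h : ℕ)) : ℤ) by omega,
        bitAt_natCast (Λ := Λ) (a := b) (by omega)]
      have h1 : ¬ (((l.1 : ℕ) : ℤ) + 1 ≤ 0 + h) := by omega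
      have h2 : (h : ℤ) < ((l.1 : ℕ) : ℤ) + 1 ∧ ((l.1 : ℕ) : ℤ) + 1 ≤ h + h := by omega
      simp only [h1, h2, and_false, false_and, false_or, true_and, and_self]
      norm_cast
  constructor
  · rintro ⟨σ, hσ⟩
    have hex : ∀ lo : ℕ, ∃ a < 2 ^ h, ∀ t < h,
        a / 2 ^ t % 2 = if ∃ hlt : lo + t < N, σ ⟨lo + t, hlt⟩ = true then 1 else 0 := by
      classical
      intro lo
      obtain ⟨a, ha, h'⟩ := exists_digits 2 h
        (fun t => if ∃ hlt : lo + t < N, σ ⟨lo + t, hlt⟩ = true then 1 else 0)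
        (fun t _ => by split_ifs <;> omega)
      exact ⟨a, ha, fun t ht => by rw [h' t ht]⟩
    obtain ⟨a, ha, ha'⟩ := hex 0
    obtain ⟨b, hb, hb'⟩ := hex h
    refine ⟨a, ha, b, hb, fun c hc => ?_⟩
    obtain ⟨l, hl, he⟩ := hσ c hc
    refine ⟨l, hl, (key a b l).2 ?_⟩
    have hlN := l.1.isLt
    split_ifs with hv
    · rw [ha' _ hv]
      simp [hlN, he]
    · rw [hb' _ (by omega)]
      have : h + ((l.1 : ℕ) - h) = l.1 := by omega
      simp [this, he]
  · rintro ⟨a, -, b, -, H⟩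
    refine ⟨fun v => decide ((if (v : ℕ) < h then a / 2 ^ (v : ℕ) % 2
      else b / 2 ^ ((v : ℕ) - h) % 2) = 1), fun c hc => ?_⟩
    obtain ⟨l, hl, ht⟩ := H c hc
    refine ⟨l, hl, ?_⟩
    have := (key a b l).1 ht
    rw [Bool.eq_iff_iff]
    simpa using this

end

/-! ### The positions of the clauses of a sparse family -/

section Positions

variable (k : ℕ) (N : ℤ) (Λ : ℕ) (m : ℤ → Prop)

/-- `c` is the least code of a minimal member of the family. -/
def ListedCode (c : ℤ) : Prop := MinimalCode k N Λ m c ∧ LeastCode k N Λ c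

open Classical in
/-- The number of minimal members. -/
noncomputable def listLength : ℕ :=
  ((Finset.range Λ).filter fun c : ℕ => ListedCode k N Λ m c).card

open Classical in
/-- The number of minimal members that are listed before `c`. -/
noncomputable def listIndex (c : ℤ) : ℕ :=
  ((Finset.range Λ).filter fun c' : ℕ => ListedCode k N Λ m c' ∧ (c' : ℤ) < c).card

/-- The minimal member at position `pos`, if there is one, has a true literal among the variables
`lo, …, lo + h - 1` under the bits of `a`. -/
def ClauseOn (lo h a pos : ℤ) : Prop :=
  ∀ c < Λ, (ListedCode k N Λ m (c : ℕ) ∧ (listIndex k N Λ m (c : ℕ) : ℤ) = pos) →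
    ¬ ∀ z ∈ decode k N (c : ℕ), ¬ TrueOn Λ lo h a z

end Positions

section Positions

variable {k N Λ : ℕ} {m : ℤ → Prop}

theorem listLength_eq (hm : ClosedCodes k N m) :
    listLength k N Λ m = (minimalSets (familyOf k N Λ m)).card := by
  classical
  have himg : ((Finset.range Λ).filter fun c : ℕ => ListedCode k N Λ m c).image
      (fun c : ℕ => decode k N c) = minimalSets (familyOf k N Λ m) := by
    ext D
    simp only [Finset.mem_image, Finset.mem_filter, Finset.mem_range]
    constructor
    · rintro ⟨c, ⟨hc, h1, -⟩, rfl⟩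
      exact (minimalCode_iff hm hc).1 h1
    · intro h1
      obtain ⟨c, hc, hmc, rfl⟩ := mem_familyOf.1 (mem_minimalSets.1 h1).1
      obtain ⟨c', hc', he, hl⟩ := exists_leastCode (k := k) (N := N) hc
      exact ⟨c', ⟨hc', (minimalCode_iff hm hc').2 (he ▸ h1), hl⟩, he⟩
  rw [← himg, Finset.card_image_of_injOn]
  · rfl
  intro c hc c' hc' he
  simp only [Finset.coe_filter, Finset.mem_range, Set.mem_ofPred_eq] at hc hc'
  rcases lt_trichotomy c c' with hlt | heq | hlt
  · exact absurd he (hc'.2.2 c hc.1 (by exact_mod_cast hlt))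
  · exact heq
  · exact absurd he.symm (hc.2.2 c' hc'.1 (by exact_mod_cast hlt))

theorem listIndex_lt {c : ℕ} (hc : c < Λ) (hl : ListedCode k N Λ m c) :
    listIndex k N Λ m c < listLength k N Λ m := by
  classical
  refine Finset.card_lt_card (Finset.ssubset_iff_of_subset ?_ |>.2 ⟨c, ?_, ?_⟩)
  · intro x hx
    simp only [Finset.mem_filter] at hx ⊢
    exact ⟨hx.1, hx.2.1⟩
  · simp [hc, hl]
  · simp

theorem listIndex_lt_listIndex {c c' : ℕ} (hc : c < Λ) (hl : ListedCode k N Λ m c) (h : c < c') :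
    listIndex k N Λ m c < listIndex k N Λ m c' := by
  classical
  refine Finset.card_lt_card (Finset.ssubset_iff_of_subset ?_ |>.2 ⟨c, ?_, ?_⟩)
  · intro x hx
    simp only [Finset.mem_filter] at hx ⊢
    exact ⟨hx.1, hx.2.1, by omega⟩
  · simp [hc, hl, h]
  · simp

/-- All positions are satisfied by one of two partial assignments if and only if together they hit
the family. -/
theorem forall_clauseOn_iff (hm : ClosedCodes k N m) {mc : ℕ} (hmc : listLength k N Λ m ≤ mc)
    {h a b : ℤ} :
    (∀ pos < mc, ClauseOn k N Λ m 0 h a (pos : ℕ) ∨ ClauseOn k N Λ m h h b (pos : ℕ)) ↔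
      Hits (TrueUnder Λ h a b) (familyOf k N Λ m) := by
  constructor
  · intro H C hC
    obtain ⟨D, hD, hDC⟩ := exists_minimalSets_subset hC
    obtain ⟨c, hc, -, rfl⟩ := mem_familyOf.1 (mem_minimalSets.1 hD).1
    obtain ⟨c', hc', he, hl⟩ := exists_leastCode (k := k) (N := N) hc
    have hlist : ListedCode k N Λ m c' := ⟨(minimalCode_iff hm hc').2 (he ▸ hD), hl⟩
    rcases H _ ((listIndex_lt hc' hlist).trans_le hmc) with h1 | h1
    all_goals
      have := h1 c' hc' ⟨hlist, rfl⟩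
      push Not at this
      obtain ⟨z, hz, ht⟩ := this
      rw [he] at hz
    · exact ⟨z, hDC hz, Or.inl ht⟩
    · exact ⟨z, hDC hz, Or.inr ht⟩
  · intro H pos _
    by_contra hcon
    push Not at hcon
    simp only [ClauseOn, not_forall, not_not] at hcon
    obtain ⟨⟨c, hc, ⟨hl, hi⟩, h1⟩, ⟨c', hc', ⟨hl', hi'⟩, h2⟩⟩ := hcon
    have hcc : c = c' := by
      rcases lt_trichotomy c c' with hlt | heq | hlt
      · have := listIndex_lt_listIndex hc hl hlt; omega
      · exact heq
      · have := listIndex_lt_listIndex hc' hl' hlt; omega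
    subst hcc
    obtain ⟨z, hz, ht⟩ := H _ (mem_minimalSets.1 ((minimalCode_iff hm hc).1 hl.1)).1
    rcases ht with ht | ht
    · exact h1 ⟨z, hz, ht⟩
    · exact h2 ⟨z, hz, ht⟩

end Positions

section Impl

variable {N b c M lo h x z pos : Env → ℤ} {k : ℕ}

theorem Impl.abs (hz : Impl z) : Impl fun e => |z e| := by
  classical
  refine (Impl.ite (p := fun e => z e < 0) (ImplP.lt hz (.const 0)) ((Impl.const 0).sub hz)
    hz).congr fun e => ?_
  split_ifs with h
  · rw [abs_of_neg h, zero_sub]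
  · exact abs_of_nonneg (not_lt.1 h)

theorem Impl.bitAt (hx : Impl x) (hz : Impl z) : Impl fun e => bitAt e.lam (x e) (z e) :=
  (hx.div ((Impl.const 2).powMin hz)).mod (.const 2)

theorem ImplP.trueOn (hlo : Impl lo) (hh : Impl h) (hx : Impl x) (hz : Impl z) :
    ImplP fun e => TrueOn e.lam (lo e) (h e) (x e) (z e) :=
  ((ImplP.lt hlo hz.abs).and (ImplP.le hz.abs (hlo.add hh))).and
    ((ImplP.eq (hx.bitAt ((hz.abs.sub (.const 1)).sub hlo)) (.const 1)).iff
      (ImplP.lt (.const 0) hz))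

theorem ImplP.initCodes (a : ℕ) (hN : Impl N) (hM : Impl M) (hc : Impl c) :
    ImplP fun e => initCodes k (N e) e.lam (e.arr a) (M e) (c e) :=
  have hcell : ∀ r : ℕ, Impl fun e => e.arr a (e.var 0 * k + r) := fun r =>
    (((Impl.var 0).mul (.const k)).add (.const r)).get a
  ImplP.exists_lt (p := fun e j => j < M e ∧
      (∀ z ∈ decode k (N e) (c e), ∃ r < k, e.arr a (j * k + (r : ℕ)) = z) ∧
      ∀ r < k, e.arr a (j * k + (r : ℕ)) ≠ 0 → e.arr a (j * k + (r : ℕ)) ∈ decode k (N e) (c e))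
    ((ImplP.lt (.var 0) hM.pop).and
      ((ImplP.forall_mem_decode
        (p := fun e z => ∃ r < k, e.arr a (e.var 0 * k + (r : ℕ)) = z) hN.pop hc.pop
        fun _ hz => ImplP.exists_lt_const (fun r => ImplP.eq (hcell r) hz) k).and
      (ImplP.forall_lt_const (fun r => (ImplP.ne (hcell r) (.const 0)).imp
        (ImplP.mem_decode hN.pop hc.pop (hcell r))) k)))

theorem ImplP.listedCode (a : ℕ) (hN : Impl N) (hb : Impl b) (hc : Impl c) :
    ImplP fun e => ListedCode k (N e) e.lam (fun z => e.arr a (b e + z) = 1) (c e) :=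
  (ImplP.minimalCode a hN hb hc).and (ImplP.leastCode hN hc)

theorem Impl.listLength (a : ℕ) (hN : Impl N) (hb : Impl b) :
    Impl fun e => (listLength k (N e) e.lam (fun z => e.arr a (b e + z) = 1) : ℤ) := by
  classical
  exact Impl.count (p := fun e c => ListedCode k (N e) e.lam (fun z => e.arr a (b e + z) = 1) c)
    (ImplP.listedCode a hN.pop hb.pop (.var 0))

theorem Impl.listIndex (a : ℕ) (hN : Impl N) (hb : Impl b) (hc : Impl c) :
    Impl fun e => (listIndex k (N e) e.lam (fun z => e.arr a (b e + z) = 1) (c e) : ℤ) := by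
  classical
  exact Impl.count (p := fun e c' => ListedCode k (N e) e.lam (fun z => e.arr a (b e + z) = 1) c' ∧
      c' < c e)
    ((ImplP.listedCode a hN.pop hb.pop (.var 0)).and (ImplP.lt (.var 0) hc.pop))

theorem ImplP.clauseOn (a : ℕ) (hN : Impl N) (hb : Impl b) (hlo : Impl lo) (hh : Impl h)
    (hx : Impl x) (hpos : Impl pos) :
    ImplP fun e => ClauseOn k (N e) e.lam (fun z => e.arr a (b e + z) = 1) (lo e) (h e) (x e)
      (pos e) :=
  ImplP.forall_lt (p := fun e c => (ListedCode k (N e) e.lam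
      (fun z => e.arr a (b e + z) = 1) c ∧
      (FineGrained.listIndex k (N e) e.lam (fun z => e.arr a (b e + z) = 1) c : ℤ) = pos e) →
      ¬ ∀ z ∈ decode k (N e) c, ¬ TrueOn e.lam (lo e) (h e) (x e) z)
    (((ImplP.listedCode a hN.pop hb.pop (.var 0)).and
      (ImplP.eq (Impl.listIndex a hN.pop hb.pop (.var 0)) hpos.pop)).imp
      (ImplP.forall_mem_decode (p := fun e z => ¬ TrueOn e.lam (lo e.pop) (h e.pop) (x e.pop) z)
        hN.pop (.var 0) fun _ hz => (ImplP.trueOn hlo.pop hh.pop hx.pop hz).not).not)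

end Impl

/-! ### The rows of the query matrix -/

section Entries

/-- The shape of the reduction: `J` bits of advice, `h` variables in each half, `mc` positions for
clauses, and loops of range `Λ` over codes of clauses of size `k` over `N` variables. -/
structure Shape where
  k : ℕ
  N : ℤ
  Λ : ℕ
  J : ℤ
  h : ℤ
  mc : ℤ

variable (S : Shape) (leaf : ℤ → ℤ → Prop)

/-- `2 ^ x`, for `0 ≤ x ≤ Λ`. -/
def Shape.pow2 (x : ℤ) : ℤ := 2 ^ min x.toNat S.Λ

/-- The entries of the row of advice `l` and first half `a` that are not zero. A position for a
clause has the entries (`a` satisfies it, `a` does not satisfy it), a position for a bit of the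
advice the entries (bit, complement), and the last position tells whether the clauses of the leaf
fit into the positions. -/
def Shape.FirstEntry (l a pos par : ℤ) : Prop :=
  (pos < S.mc ∧ (par = 0 ↔ ClauseOn S.k S.N S.Λ (leaf l) 0 S.h a pos)) ∨
  ((S.mc ≤ pos ∧ pos < S.mc + S.J) ∧ bitAt S.Λ l (pos - S.mc) + par = 1) ∨
  (pos = S.mc + S.J ∧ par = 0 ∧ (listLength S.k S.N S.Λ (leaf l) : ℤ) ≤ S.mc)

/-- The entries of the row of advice `l` and second half `b` that are not zero; a position for a
clause has the entries (`1`, `b` satisfies it). -/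
def Shape.SecondEntry (l b pos par : ℤ) : Prop :=
  (pos < S.mc ∧ (par = 0 ∨ ClauseOn S.k S.N S.Λ (leaf l) S.h S.h b pos)) ∨
  ((S.mc ≤ pos ∧ pos < S.mc + S.J) ∧ bitAt S.Λ l (pos - S.mc) + par = 1) ∨
  (pos = S.mc + S.J ∧ par = 0)

/-- The entries of the calibrating row that are not zero: its product with each row of a second half
is the greatest possible one. -/
def Shape.CalibratingEntry (pos par : ℤ) : Prop :=
  (pos < S.mc ∧ par = 0) ∨ (S.mc ≤ pos ∧ pos < S.mc + S.J) ∨ (pos = S.mc + S.J ∧ par = 0)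

open Classical in
/-- The entry in row `i` and column `col`. -/
noncomputable def Shape.entry (i col : ℤ) : ℤ :=
  if i < S.pow2 (S.J + S.h) then
    if S.FirstEntry leaf (i / S.pow2 S.h) (i % S.pow2 S.h) (col / 2) (col % 2)
    then 2 * (S.J + S.h + 2) else 0
  else if i < 2 * S.pow2 (S.J + S.h) then
    if S.SecondEntry leaf ((i - S.pow2 (S.J + S.h)) / S.pow2 S.h)
      ((i - S.pow2 (S.J + S.h)) % S.pow2 S.h) (col / 2) (col % 2)
    then 1 else 0
  else if i = 2 * S.pow2 (S.J + S.h) then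
    if S.CalibratingEntry (col / 2) (col % 2) then 2 * (S.J + S.h + 2) else 0
  else 0

/-- The position is satisfied by the first half `a` with advice `l` and the second half `b` with
advice `l'`. -/
def Shape.Agree (l a l' b pos : ℤ) : Prop :=
  (pos < S.mc ∧ (ClauseOn S.k S.N S.Λ (leaf l) 0 S.h a pos ∨
    ClauseOn S.k S.N S.Λ (leaf l') S.h S.h b pos)) ∨
  ((S.mc ≤ pos ∧ pos < S.mc + S.J) ∧ bitAt S.Λ l (pos - S.mc) = bitAt S.Λ l' (pos - S.mc)) ∨
  (pos = S.mc + S.J ∧ (listLength S.k S.N S.Λ (leaf l) : ℤ) ≤ S.mc)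

variable {S leaf}

theorem bitAt_eq_zero_or_one (Λ : ℕ) (a x : ℤ) : bitAt Λ a x = 0 ∨ bitAt Λ a x = 1 :=
  Int.emod_two_eq_zero_or_one _

open Classical in
theorem Shape.entry_mul_entry (hJ : 0 ≤ S.J) (l a l' b pos : ℤ) :
    (if S.FirstEntry leaf l a pos 0 then 1 else 0) *
        (if S.SecondEntry leaf l' b pos 0 then 1 else 0) +
      (if S.FirstEntry leaf l a pos 1 then 1 else 0) *
        (if S.SecondEntry leaf l' b pos 1 then 1 else 0) =
      if S.Agree leaf l a l' b pos then (1 : ℕ) else 0 := by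
  unfold Shape.FirstEntry Shape.SecondEntry Shape.Agree
  rcases lt_trichotomy pos S.mc with hp | hp | hp
  · have h1 : ¬ S.mc ≤ pos := not_le.2 hp
    have h2 : ¬ pos = S.mc + S.J := by omega
    by_cases hA : ClauseOn S.k S.N S.Λ (leaf l) 0 S.h a pos <;>
      by_cases hB : ClauseOn S.k S.N S.Λ (leaf l') S.h S.h b pos <;> simp [hp, h1, h2, hA, hB]
  all_goals
    have h0 : ¬ pos < S.mc := by omega
    have h1 : S.mc ≤ pos := by omega
    by_cases h2 : pos < S.mc + S.J
    · have h3 : ¬ pos = S.mc + S.J := by omega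
      rcases bitAt_eq_zero_or_one S.Λ l (pos - S.mc) with hA | hA <;>
        rcases bitAt_eq_zero_or_one S.Λ l' (pos - S.mc) with hB | hB <;>
        simp [h0, h1, h2, h3, hA, hB]
    · simp only [h0, h1, h2, false_and, and_false, false_or, true_and]
      by_cases h3 : pos = S.mc + S.J <;> simp [h3]

open Classical in
theorem Shape.calibrating_mul_entry (hJ : 0 ≤ S.J) (l' b pos : ℤ) (hpos : pos < S.mc + S.J + 1) :
    (if S.CalibratingEntry pos 0 then 1 else 0) *
        (if S.SecondEntry leaf l' b pos 0 then 1 else 0) +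
      (if S.CalibratingEntry pos 1 then 1 else 0) *
        (if S.SecondEntry leaf l' b pos 1 then 1 else 0) = (1 : ℕ) := by
  unfold Shape.CalibratingEntry Shape.SecondEntry
  rcases lt_trichotomy pos S.mc with hp | hp | hp
  · have h1 : ¬ S.mc ≤ pos := not_le.2 hp
    have h2 : ¬ pos = S.mc + S.J := by omega
    by_cases hB : ClauseOn S.k S.N S.Λ (leaf l') S.h S.h b pos <;> simp [hp, h1, h2, hB]
  all_goals
    have h0 : ¬ pos < S.mc := by omega
    have h1 : S.mc ≤ pos := by omega
    by_cases h2 : pos < S.mc + S.J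
    · have h3 : ¬ pos = S.mc + S.J := by omega
      rcases bitAt_eq_zero_or_one S.Λ l' (pos - S.mc) with hB | hB <;>
        simp [h0, h1, h2, h3, hB]
    · have h3 : pos = S.mc + S.J := by omega
      simp [h3]

theorem Shape.entry_nonneg (hJ : 0 ≤ S.J) (hh : 0 ≤ S.h) (i col : ℤ) : 0 ≤ S.entry leaf i col := by
  unfold Shape.entry
  split_ifs <;> omega

theorem Shape.entry_le (hJ : 0 ≤ S.J) (hh : 0 ≤ S.h) (i col : ℤ) :
    S.entry leaf i col ≤ 2 * (S.J + S.h + 2) := by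
  unfold Shape.entry
  split_ifs <;> omega

end Entries

theorem sum_range_two_mul (f : ℕ → ℕ) (n : ℕ) :
    ∑ c ∈ Finset.range (2 * n), f c = ∑ p ∈ Finset.range n, (f (2 * p) + f (2 * p + 1)) := by
  induction n with
  | zero => simp
  | succ n ih =>
    rw [show 2 * (n + 1) = 2 * n + 1 + 1 by ring, Finset.sum_range_succ, Finset.sum_range_succ,
      Finset.sum_range_succ, ih, add_assoc]

section Products

variable {k N Λ J h mc : ℕ} {leaf : ℤ → ℤ → Prop}

/-- The shape with the given parameters. -/
abbrev mkShape (k N Λ J h mc : ℕ) : Shape := ⟨k, N, Λ, J, h, mc⟩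

theorem mkShape_pow2 {x : ℕ} (hx : x ≤ Λ) : (mkShape k N Λ J h mc).pow2 x = ((2 ^ x : ℕ) : ℤ) := by
  simp [Shape.pow2, hx]

theorem mkShape_pow2_add (hx : J + h ≤ Λ) :
    (mkShape k N Λ J h mc).pow2 ((J : ℤ) + h) = ((2 ^ (J + h) : ℕ) : ℤ) := by
  rw [← Nat.cast_add]
  exact mkShape_pow2 hx

open Classical in
/-- The number of positions that are satisfied by the row `i` of a first half and the row `b` of a
second half. -/
noncomputable def agreeCount (k N Λ J h mc : ℕ) (leaf : ℤ → ℤ → Prop) (i b : ℕ) : ℕ :=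
  ((Finset.range (mc + J + 1)).filter fun pos : ℕ => (mkShape k N Λ J h mc).Agree leaf
    ((i / 2 ^ h : ℕ) : ℤ) ((i % 2 ^ h : ℕ) : ℤ) ((b / 2 ^ h : ℕ) : ℤ) ((b % 2 ^ h : ℕ) : ℤ) pos).card

theorem entry_first (hΛ : J + h ≤ Λ) {i col : ℕ} (hi : i < 2 ^ (J + h)) [Decidable
    ((mkShape k N Λ J h mc).FirstEntry leaf ((i / 2 ^ h : ℕ) : ℤ) ((i % 2 ^ h : ℕ) : ℤ)
      ((col / 2 : ℕ) : ℤ) ((col % 2 : ℕ) : ℤ))] :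
    ((mkShape k N Λ J h mc).entry leaf i col).toNat = 2 * (J + h + 2) *
      if (mkShape k N Λ J h mc).FirstEntry leaf ((i / 2 ^ h : ℕ) : ℤ) ((i % 2 ^ h : ℕ) : ℤ)
        ((col / 2 : ℕ) : ℤ) ((col % 2 : ℕ) : ℤ) then 1 else 0 := by
  rw [Shape.entry, mkShape_pow2_add hΛ, mkShape_pow2 (by omega), if_pos (by exact_mod_cast hi)]
  push_cast
  split_ifs <;> simp
  omega

theorem entry_second (hΛ : J + h ≤ Λ) {b col : ℕ} (hb : b < 2 ^ (J + h)) [Decidable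
    ((mkShape k N Λ J h mc).SecondEntry leaf ((b / 2 ^ h : ℕ) : ℤ) ((b % 2 ^ h : ℕ) : ℤ)
      ((col / 2 : ℕ) : ℤ) ((col % 2 : ℕ) : ℤ))] :
    ((mkShape k N Λ J h mc).entry leaf ((2 ^ (J + h) + b : ℕ) : ℤ) col).toNat =
      if (mkShape k N Λ J h mc).SecondEntry leaf ((b / 2 ^ h : ℕ) : ℤ) ((b % 2 ^ h : ℕ) : ℤ)
        ((col / 2 : ℕ) : ℤ) ((col % 2 : ℕ) : ℤ) then 1 else 0 := by
  rw [Shape.entry, mkShape_pow2_add hΛ, mkShape_pow2 (by omega), if_neg (by push_cast; omega),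
    if_pos (by push_cast; have : (b : ℤ) < 2 ^ (J + h) := (by exact_mod_cast hb); linarith)]
  rw [show ((2 ^ (J + h) + b : ℕ) : ℤ) - ((2 ^ (J + h) : ℕ) : ℤ) = b by push_cast; ring]
  push_cast
  split_ifs <;> simp

theorem entry_calibrating (hΛ : J + h ≤ Λ) {col : ℕ} [Decidable
    ((mkShape k N Λ J h mc).CalibratingEntry ((col / 2 : ℕ) : ℤ) ((col % 2 : ℕ) : ℤ))] :
    ((mkShape k N Λ J h mc).entry leaf ((2 * 2 ^ (J + h) : ℕ) : ℤ) col).toNat =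
      2 * (J + h + 2) * if (mkShape k N Λ J h mc).CalibratingEntry ((col / 2 : ℕ) : ℤ)
        ((col % 2 : ℕ) : ℤ) then 1 else 0 := by
  have hpos : (0 : ℤ) < 2 ^ (J + h) := by positivity
  rw [Shape.entry, mkShape_pow2_add hΛ, if_neg (by push_cast; omega),
    if_neg (by push_cast; omega), if_pos (by push_cast; ring)]
  push_cast
  split_ifs <;> simp
  omega

/-- The product of the rows of a first and a second half counts the satisfied positions. -/
theorem sum_entry_first (hΛ : J + h ≤ Λ) {i b : ℕ} (hi : i < 2 ^ (J + h)) (hb : b < 2 ^ (J + h)) :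
    ∑ col ∈ Finset.range (2 * (mc + J + 1)),
      ((mkShape k N Λ J h mc).entry leaf i col).toNat *
        ((mkShape k N Λ J h mc).entry leaf ((2 ^ (J + h) + b : ℕ) : ℤ) col).toNat =
      2 * (J + h + 2) * agreeCount k N Λ J h mc leaf i b := by
  classical
  simp only [entry_first hΛ hi, entry_second hΛ hb]
  rw [sum_range_two_mul, agreeCount, Finset.card_filter, Finset.mul_sum]
  refine Finset.sum_congr rfl fun pos _ => ?_
  rw [show 2 * pos / 2 = pos by omega, show 2 * pos % 2 = 0 by omega,
    show (2 * pos + 1) / 2 = pos by omega, show (2 * pos + 1) % 2 = 1 by omega]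
  have := Shape.entry_mul_entry (S := mkShape k N Λ J h mc) (leaf := leaf) (Int.natCast_nonneg J)
    ((i / 2 ^ h : ℕ) : ℤ) ((i % 2 ^ h : ℕ) : ℤ) ((b / 2 ^ h : ℕ) : ℤ) ((b % 2 ^ h : ℕ) : ℤ) pos
  rw [← this]
  push_cast
  ring

theorem sum_entry_calibrating (hΛ : J + h ≤ Λ) {b : ℕ} (hb : b < 2 ^ (J + h)) :
    ∑ col ∈ Finset.range (2 * (mc + J + 1)),
      ((mkShape k N Λ J h mc).entry leaf ((2 * 2 ^ (J + h) : ℕ) : ℤ) col).toNat *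
        ((mkShape k N Λ J h mc).entry leaf ((2 ^ (J + h) + b : ℕ) : ℤ) col).toNat =
      2 * (J + h + 2) * (mc + J + 1) := by
  classical
  simp only [entry_calibrating hΛ, entry_second hΛ hb]
  rw [sum_range_two_mul]
  refine (Finset.sum_congr rfl fun pos hpos => ?_).trans
    ((Finset.sum_const (2 * (J + h + 2))).trans (by rw [Finset.card_range, smul_eq_mul, mul_comm]))
  rw [Finset.mem_range] at hpos
  rw [show 2 * pos / 2 = pos by omega, show 2 * pos % 2 = 0 by omega,
    show (2 * pos + 1) / 2 = pos by omega, show (2 * pos + 1) % 2 = 1 by omega]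
  have := Shape.calibrating_mul_entry (S := mkShape k N Λ J h mc) (leaf := leaf)
    (Int.natCast_nonneg J) ((b / 2 ^ h : ℕ) : ℤ) ((b % 2 ^ h : ℕ) : ℤ) pos (by simp; omega)
  conv_rhs => rw [← mul_one (2 * (J + h + 2)), ← this]
  push_cast
  ring

theorem agreeCount_le (i b : ℕ) : agreeCount k N Λ J h mc leaf i b ≤ mc + J + 1 := by
  classical
  exact (Finset.card_filter_le _ _).trans (by simp)

theorem agreeCount_eq_iff {i b : ℕ} : agreeCount k N Λ J h mc leaf i b = mc + J + 1 ↔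
    ∀ pos < mc + J + 1, (mkShape k N Λ J h mc).Agree leaf ((i / 2 ^ h : ℕ) : ℤ)
      ((i % 2 ^ h : ℕ) : ℤ) ((b / 2 ^ h : ℕ) : ℤ) ((b % 2 ^ h : ℕ) : ℤ) pos := by
  classical
  rw [agreeCount]
  conv_lhs => rhs; rw [← Finset.card_range (mc + J + 1)]
  rw [Finset.card_filter_eq_iff]
  simp

/-- The rows `i` and `b` agree in all positions if and only if they have the same advice and their
halves together hit the family of that advice, provided that it is sparse. -/
theorem agreeCount_eq_iff_hits (hΛ : J ≤ Λ) (hleaf : ∀ l : ℕ, ClosedCodes k N (leaf l)) {i b : ℕ}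
    (hi : i < 2 ^ (J + h)) (hb : b < 2 ^ (J + h)) :
    agreeCount k N Λ J h mc leaf i b = mc + J + 1 ↔ i / 2 ^ h = b / 2 ^ h ∧
      listLength k N Λ (leaf ((i / 2 ^ h : ℕ) : ℤ)) ≤ mc ∧
      Hits (TrueUnder Λ (h : ℕ) ((i % 2 ^ h : ℕ) : ℤ) ((b % 2 ^ h : ℕ) : ℤ))
        (familyOf k N Λ (leaf ((i / 2 ^ h : ℕ) : ℤ))) := by
  rw [agreeCount_eq_iff]
  have hdiv : ∀ x < 2 ^ (J + h), x / 2 ^ h < 2 ^ J := fun x hx => by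
    rw [Nat.div_lt_iff_lt_mul (by positivity), ← pow_add]
    exact hx
  set l := i / 2 ^ h with hl
  set l' := b / 2 ^ h with hl'
  set a := i % 2 ^ h
  set b' := b % 2 ^ h
  simp only [Shape.Agree]
  constructor
  · intro H
    have hll : l = l' := by
      refine Nat.eq_of_testBit_eq fun t => ?_
      rcases Nat.lt_or_ge t J with ht | ht
      · rcases H (mc + t) (by omega) with h1 | h1 | h1
        · push_cast at h1; omega
        · have h2 := h1.2
          rw [show ((mc + t : ℕ) : ℤ) - (mc : ℤ) = t by push_cast; ring,
            bitAt_natCast (by omega), bitAt_natCast (by omega)] at h2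
          have h3 : l / 2 ^ t % 2 = l' / 2 ^ t % 2 := by exact_mod_cast h2
          rw [Nat.testBit_eq_decide_div_mod_eq, Nat.testBit_eq_decide_div_mod_eq, h3]
        · push_cast at h1; omega
      · have hp : 2 ^ J ≤ 2 ^ t := Nat.pow_le_pow_right (by norm_num) ht
        rw [Nat.testBit_lt_two_pow ((hdiv i hi).trans_le hp),
          Nat.testBit_lt_two_pow ((hdiv b hb).trans_le hp)]
    have hlen : listLength k N Λ (leaf l) ≤ mc := by
      rcases H (mc + J) (by omega) with h1 | h1 | h1
      · push_cast at h1; omega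
      · push_cast at h1; omega
      · exact_mod_cast h1.2
    refine ⟨hll, hlen, (forall_clauseOn_iff (hleaf l) hlen).1 fun pos hpos => ?_⟩
    rcases H pos (by omega) with h1 | h1 | h1
    · rw [← hll] at h1
      exact h1.2
    · omega
    · omega
  · rintro ⟨hll, hlen, hhit⟩ pos hpos
    rw [← forall_clauseOn_iff (hleaf l) hlen] at hhit
    rw [← hll]
    rcases Nat.lt_or_ge pos mc with h1 | h1
    · exact Or.inl ⟨by exact_mod_cast h1, hhit pos h1⟩
    rcases Nat.lt_or_ge pos (mc + J) with h2 | h2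
    · exact Or.inr (Or.inl ⟨⟨by exact_mod_cast h1, by exact_mod_cast h2⟩, rfl⟩)
    · exact Or.inr (Or.inr ⟨by omega, by exact_mod_cast hlen⟩)

end Products

/-- The codes of the leaf with advice `l`. -/
def leafCodes (k R w N Λ : ℕ) (m : ℤ → Prop) (l : ℤ) : ℤ → Prop :=
  codeSeq k (flowerThreshold R) N Λ m (fun s => AdvicePetal w (adviceState w l.toNat s)) Λ

/-- The formula is satisfiable if and only if some rows of first and second halves agree in all
positions. -/
theorem exists_agreeCount_iff {k N Λ R w h J mc : ℕ} (φ : KCNF k N) (hR : 1 ≤ R) (hw : 1 ≤ w)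
    (hΛ : (2 * N + 1) ^ k ≤ Λ) (hΛb : sparsifyBound R k * N ≤ Λ) (hΛN : N ≤ Λ) (hΛJ : J ≤ Λ)
    (hwR : R * sparsifyBound R k ≤ 2 ^ w - 1) (hh : N ≤ 2 * h)
    (hJ : J = w * ((k + 1) * (N / R) + 1)) (hmc : 1 + 2 * N * (k * flowerThreshold R k) ≤ mc) :
    (∃ i < 2 ^ (J + h), ∃ b < 2 ^ (J + h), agreeCount k N Λ J h mc
      (leafCodes k R w N Λ (initCodes k N Λ (φ.input.arr 0) φ.clauses.length)) i b = mc + J + 1) ↔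
      φ.Satisfiable := by
  set m₀ := initCodes k N Λ (φ.input.arr 0) φ.clauses.length with hm₀
  have hcl : ClosedCodes k N m₀ := initCodes_closed _ _
  have hleaf : ∀ l : ℕ, ClosedCodes k N (leafCodes k R w N Λ m₀ l) := fun l => hcl.codeSeq _ _
  rw [satisfiable_iff_hits φ hΛ hΛN hh]
  constructor
  · rintro ⟨i, hi, b, hb, H⟩
    obtain ⟨-, -, H⟩ := (agreeCount_eq_iff_hits hΛJ hleaf hi hb).1 H
    refine ⟨i % 2 ^ h, Nat.mod_lt _ (by positivity), b % 2 ^ h, Nat.mod_lt _ (by positivity),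
      fun C hC => H C ?_⟩
    obtain ⟨c, hc, hmc, rfl⟩ := mem_familyOf.1 hC
    exact mem_familyOf.2 ⟨c, hc, codeSeq_of_zero _ _ hmc, rfl⟩
  · rintro ⟨a, ha, b, hb, H⟩
    obtain ⟨l, hl, h1, h2⟩ := exists_advice_hits hR hw hcl hΛ hΛb hwR H
    rw [← pow_mul, ← hJ] at hl
    have hlt : ∀ x < 2 ^ h, l * 2 ^ h + x < 2 ^ (J + h) := fun x hx => by
      calc l * 2 ^ h + x < (l + 1) * 2 ^ h := by rw [add_mul]; omega
        _ ≤ 2 ^ J * 2 ^ h := Nat.mul_le_mul_right _ hl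
        _ = 2 ^ (J + h) := (pow_add _ _ _).symm
    have hdiv : ∀ x < 2 ^ h, (l * 2 ^ h + x) / 2 ^ h = l := fun x hx => by
      rw [mul_comm, Nat.mul_add_div (by positivity), Nat.div_eq_of_lt hx, add_zero]
    have hmod : ∀ x < 2 ^ h, (l * 2 ^ h + x) % 2 ^ h = x := fun x hx => by
      rw [mul_comm, Nat.mul_add_mod, Nat.mod_eq_of_lt hx]
    refine ⟨_, hlt a ha, _, hlt b hb, (agreeCount_eq_iff_hits hΛJ hleaf (hlt a ha) (hlt b hb)).2 ?_⟩
    rw [hdiv a ha, hdiv b hb, hmod a ha, hmod b hb]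
    refine ⟨rfl, ?_, h1⟩
    rw [listLength_eq (hleaf l)]
    exact h2.trans hmc

section Congr

variable {k Λ : ℕ} {N : ℤ} {m m' : ℤ → Prop} {θ : ℕ → ℕ}

theorem minimalCode_congr (h : ∀ c < Λ, m (c : ℕ) ↔ m' (c : ℕ)) {c : ℕ} (hc : c < Λ) :
    MinimalCode k N Λ m c ↔ MinimalCode k N Λ m' c := by
  unfold MinimalCode
  exact and_congr (h c hc) (forall₂_congr fun c' hc' => by rw [h c' hc'])

theorem codeDegree_congr (h : ∀ c < Λ, m (c : ℕ) ↔ m' (c : ℕ)) (j : ℕ) (x : ℤ) :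
    codeDegree k N Λ m j x = codeDegree k N Λ m' j x := by
  unfold codeDegree
  classical
  congr 1
  refine Finset.filter_congr fun c hc => ?_
  rw [minimalCode_congr h (Finset.mem_range.1 hc)]

theorem selectedCode_congr (h : ∀ c < Λ, m (c : ℕ) ↔ m' (c : ℕ)) (j i : ℕ) (x : ℤ) :
    SelectedCode k θ N Λ m j i x ↔ SelectedCode k θ N Λ m' j i x := by
  simp only [SelectedCode, FlowerCode, codeDegree_congr h]

theorem roundCodes_congr (h : ∀ c < Λ, m (c : ℕ) ↔ m' (c : ℕ)) {q q' : Prop} (hq : q ↔ q')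
    {c : ℕ} (hc : c < Λ) : roundCodes k θ N Λ m q c ↔ roundCodes k θ N Λ m' q' c := by
  have hC : ∀ C : ℕ, ∀ p : Prop, (C < Λ ∧ (MinimalCode k N Λ m (C : ℕ) ∧ p)) ↔
      (C < Λ ∧ (MinimalCode k N Λ m' (C : ℕ) ∧ p)) := fun C p =>
    and_congr_right fun hC => by rw [minimalCode_congr h hC]
  simp only [roundCodes, selectedCode_congr h, h c hc, hq, and_assoc, hC]

theorem listedCode_congr (h : ∀ c < Λ, m (c : ℕ) ↔ m' (c : ℕ)) {c : ℕ} (hc : c < Λ) :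
    ListedCode k N Λ m c ↔ ListedCode k N Λ m' c := by
  unfold ListedCode
  rw [minimalCode_congr h hc]

theorem listLength_congr (h : ∀ c < Λ, m (c : ℕ) ↔ m' (c : ℕ)) :
    listLength k N Λ m = listLength k N Λ m' := by
  unfold listLength
  classical
  congr 1
  exact Finset.filter_congr fun c hc => listedCode_congr h (Finset.mem_range.1 hc)

theorem listIndex_congr (h : ∀ c < Λ, m (c : ℕ) ↔ m' (c : ℕ)) (x : ℤ) :
    listIndex k N Λ m x = listIndex k N Λ m' x := by
  unfold listIndex
  classical
  congr 1
  refine Finset.filter_congr fun c hc => ?_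
  rw [listedCode_congr h (Finset.mem_range.1 hc)]

theorem clauseOn_congr (h : ∀ c < Λ, m (c : ℕ) ↔ m' (c : ℕ)) (lo x a pos : ℤ) :
    ClauseOn k N Λ m lo x a pos ↔ ClauseOn k N Λ m' lo x a pos := by
  unfold ClauseOn
  exact forall₂_congr fun c hc => by rw [listedCode_congr h hc, listIndex_congr h]

theorem Shape.firstEntry_congr {S : Shape} {leaf leaf' : ℤ → ℤ → Prop} {l : ℤ}
    (h : ∀ c < S.Λ, leaf l (c : ℕ) ↔ leaf' l (c : ℕ)) (a pos par : ℤ) :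
    S.FirstEntry leaf l a pos par ↔ S.FirstEntry leaf' l a pos par := by
  unfold Shape.FirstEntry
  rw [clauseOn_congr h, listLength_congr h]

theorem Shape.secondEntry_congr {S : Shape} {leaf leaf' : ℤ → ℤ → Prop} {l : ℤ}
    (h : ∀ c < S.Λ, leaf l (c : ℕ) ↔ leaf' l (c : ℕ)) (b pos par : ℤ) :
    S.SecondEntry leaf l b pos par ↔ S.SecondEntry leaf' l b pos par := by
  unfold Shape.SecondEntry
  rw [clauseOn_congr h]

theorem Shape.entry_congr {S : Shape} {leaf leaf' : ℤ → ℤ → Prop} {i : ℤ} {P H : ℕ}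
    (hP : S.pow2 (S.J + S.h) = P) (hH : S.pow2 S.h = H) (hi : 0 ≤ i)
    (h : ∀ l : ℕ, l ≤ (P - 1) / H → ∀ c < S.Λ, leaf l (c : ℕ) ↔ leaf' l (c : ℕ)) (col : ℤ) :
    S.entry leaf i col = S.entry leaf' i col := by
  have key : ∀ x : ℤ, 0 ≤ x → x < P →
      ∀ c < S.Λ, leaf (x / H) (c : ℕ) ↔ leaf' (x / H) (c : ℕ) := by
    intro x hx hxP
    lift x to ℕ using hx
    have := h (x / H) (Nat.div_le_div_right (by omega))
    push_cast at this
    exact this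
  unfold Shape.entry
  rw [hP, hH]
  by_cases h1 : i < P
  · rw [if_pos h1, if_pos h1]
    rw [propext (Shape.firstEntry_congr (leaf := leaf) (leaf' := leaf') (key i hi h1) _ _ _)]
  · by_cases h2 : i < 2 * P
    · have h3 := key (i - P) (by omega) (by omega)
      rw [if_neg h1, if_neg h1, if_pos h2, if_pos h2]
      rw [propext (Shape.secondEntry_congr (leaf := leaf) (leaf' := leaf') h3 _ _ _)]
    · simp only [if_neg h1, if_neg h2]

end Congr

/-! ### Linear independence of the powers of Euler's number -/

open Polynomial in
/-- Hermite's theorem, for polynomials with nonzero constant coefficient: simultaneous rational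
approximations of the powers of `e` turn a root `e` into a nonzero integer of absolute value less
than one. -/
theorem aeval_exp_one_ne_zero_of_coeff_zero_ne_zero {p : ℤ[X]} (hp : p.coeff 0 ≠ 0) :
    aeval (Complex.exp 1) p ≠ 0 := by
  intro h0
  set m := p.natDegree with hm
  set f : ℤ[X] := ∏ i ∈ Finset.range m, (X - C ((i : ℤ) + 1)) with hf
  have hf0 : f.eval 0 ≠ 0 := by
    rw [hf, eval_prod]
    refine Finset.prod_ne_zero_iff.2 fun i _ => ?_
    simp only [eval_sub, eval_X, eval_C]
    omega
  have hfne : f ≠ 0 := by rintro h; rw [h] at hf0; simp at hf0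
  have hroot : ∀ i < m, ((i : ℂ) + 1) ∈ f.aroots ℂ := by
    intro i hi
    rw [mem_aroots]
    refine ⟨hfne, ?_⟩
    rw [hf, map_prod]
    exact Finset.prod_eq_zero (Finset.mem_range.2 hi) (by simp)
  obtain ⟨c, hc⟩ := LindemannWeierstrass.exp_polynomial_approx f hf0
  set A : ℝ := ∑ i ∈ Finset.range m, |(p.coeff (i + 1) : ℝ)| with hA
  -- a large prime for which the error terms are small
  have hlim : Filter.Tendsto (fun q : ℕ => A * (c ^ q / (q - 1).factorial)) Filter.atTop
      (nhds 0) := by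
    have h1 : Filter.Tendsto (fun q : ℕ => c * (c ^ q / (q.factorial : ℝ))) Filter.atTop
        (nhds (c * 0)) := (FloorSemiring.tendsto_pow_div_factorial_atTop c).const_mul c
    rw [mul_zero] at h1
    have h2 : Filter.Tendsto (fun q : ℕ => c ^ q / ((q - 1).factorial : ℝ)) Filter.atTop
        (nhds 0) := by
      refine (Filter.tendsto_add_atTop_iff_nat 1).1 (h1.congr fun q => ?_)
      rw [Nat.add_sub_cancel, pow_succ]
      ring
    simpa using h2.const_mul A
  obtain ⟨q₀, hq₀⟩ := Filter.eventually_atTop.1 (hlim.eventually (gt_mem_nhds one_pos))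
  obtain ⟨q, hq, hqp⟩ := Nat.exists_infinite_primes
    (q₀ + (f.eval 0).natAbs + (p.coeff 0).natAbs + 1)
  obtain ⟨n, hn, g, -, hg⟩ := hc q (by omega) hqp
  -- the integer `z` is not divisible by `q`, but of absolute value less than one
  set z : ℤ := n * p.coeff 0 + q * ∑ i ∈ Finset.range m, p.coeff (i + 1) * g.eval ((i : ℤ) + 1)
    with hz
  have hexp : (n : ℂ) * p.coeff 0 + ∑ i ∈ Finset.range m,
      (p.coeff (i + 1) : ℂ) * (n • Complex.exp ((i : ℂ) + 1)) = 0 := by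
    have h1 : aeval (Complex.exp 1) p = ∑ i ∈ Finset.range (m + 1),
        (p.coeff i : ℂ) * Complex.exp 1 ^ i := by
      rw [aeval_eq_sum_range, ← hm]
      simp
    rw [h1, Finset.sum_range_succ'] at h0
    have h2 : ∀ i : ℕ, Complex.exp 1 ^ (i + 1) = Complex.exp ((i : ℂ) + 1) := fun i => by
      rw [← Complex.exp_nat_mul]; push_cast; ring_nf
    have h3 : (n : ℂ) * (∑ i ∈ Finset.range m, (p.coeff (i + 1) : ℂ) * Complex.exp 1 ^ (i + 1) +
        (p.coeff 0 : ℂ) * Complex.exp 1 ^ 0) = 0 := by rw [h0, mul_zero]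
    rw [mul_add, Finset.mul_sum, pow_zero, mul_one, add_comm] at h3
    rw [← h3]
    congr 1
    refine Finset.sum_congr rfl fun i _ => ?_
    rw [h2, zsmul_eq_mul]
    ring
  have hzC : (z : ℂ) = -∑ i ∈ Finset.range m, (p.coeff (i + 1) : ℂ) *
      (n • Complex.exp ((i : ℂ) + 1) - q • aeval ((i : ℂ) + 1) g) := by
    have h1 : ∀ i : ℕ, aeval ((i : ℂ) + 1) g = ((g.eval ((i : ℤ) + 1) : ℤ) : ℂ) := fun i => by
      have : ((i : ℂ) + 1) = algebraMap ℤ ℂ ((i : ℤ) + 1) := by simp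
      rw [this, aeval_algebraMap_apply]
      simp
    simp only [mul_sub, Finset.sum_sub_distrib]
    rw [neg_sub, eq_sub_iff_add_eq, hz]
    push_cast
    rw [add_right_comm, hexp, zero_add, Finset.mul_sum]
    refine Finset.sum_congr rfl fun i _ => ?_
    rw [h1, nsmul_eq_mul]
    ring
  have hzlt : ‖(z : ℂ)‖ < 1 := by
    rw [hzC, norm_neg]
    refine lt_of_le_of_lt ?_ (hq₀ q (by omega))
    refine (norm_sum_le _ _).trans ?_
    rw [hA, Finset.sum_mul]
    refine Finset.sum_le_sum fun i hi => ?_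
    rw [norm_mul]
    refine mul_le_mul (by simp) (hg (hroot i (Finset.mem_range.1 hi))) (norm_nonneg _)
      (abs_nonneg _)
  have hz0 : z = 0 := by
    rw [Complex.norm_intCast] at hzlt
    have : |z| < 1 := by exact_mod_cast hzlt
    exact Int.abs_lt_one_iff.1 this
  have hdvd : (q : ℤ) ∣ n * p.coeff 0 := by
    refine ⟨-∑ i ∈ Finset.range m, p.coeff (i + 1) * g.eval ((i : ℤ) + 1), ?_⟩
    linear_combination hz0
  rcases (Nat.prime_iff_prime_int.1 hqp).dvd_or_dvd hdvd with h | h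
  · exact hn h
  · have := Int.natAbs_dvd_natAbs.2 h
    rw [Int.natAbs_natCast] at this
    have := Nat.le_of_dvd (Int.natAbs_pos.2 hp) this
    omega

open Polynomial in
theorem aeval_exp_one_ne_zero {p : ℤ[X]} (hp : p ≠ 0) : aeval (Complex.exp 1) p ≠ 0 := by
  obtain ⟨n, hn⟩ : ∃ n, p.natDegree = n := ⟨_, rfl⟩
  induction n using Nat.strong_induction_on generalizing p with
  | _ n ih =>
    by_cases h0 : p.coeff 0 = 0
    · have hX : p.divX * X = p := by
        have := p.divX_mul_X_add
        rwa [h0, C_0, add_zero] at this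
      have hne : p.divX ≠ 0 := fun h => hp (by rw [← hX, h, zero_mul])
      have hdeg : p.divX.natDegree < n := by
        have := natDegree_mul_X hne
        rw [hX] at this
        omega
      rw [← hX, map_mul, aeval_X]
      exact mul_ne_zero (ih _ hdeg hne rfl) (Complex.exp_ne_zero 1)
    · exact aeval_exp_one_ne_zero_of_coeff_zero_ne_zero h0

/-- A vanishing integer combination of powers of `e` has vanishing coefficients. -/
theorem sum_coeff_eq_zero_of_sum_exp_eq_zero {ι : Type*} {s : Finset ι} {b x : ι → ℤ}
    (h : ∑ i ∈ s, (b i : ℝ) * Real.exp (x i) = 0) (z : ℤ) :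
    ∑ i ∈ s with x i = z, b i = 0 := by
  classical
  by_cases hz : ∃ i ∈ s, x i = z
  swap
  · push Not at hz
    rw [Finset.filter_false_of_mem hz, Finset.sum_empty]
  -- shifted by `M`, all exponents are natural numbers
  obtain ⟨M, hM⟩ : ∃ M : ℤ, ∀ i ∈ s, 0 ≤ x i + M := by
    refine ⟨∑ i ∈ s, |x i|, fun i hi => ?_⟩
    have h1 : |x i| ≤ ∑ i ∈ s, |x i| :=
      Finset.single_le_sum (f := fun i => |x i|) (fun i _ => abs_nonneg _) hi
    have := neg_abs_le (x i)
    omega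
  set p : Polynomial ℤ := ∑ i ∈ s, Polynomial.monomial (x i + M).toNat (b i) with hp
  have hev : Polynomial.aeval (Complex.exp 1) p = 0 := by
    rw [hp, map_sum]
    have h1 : ∀ i ∈ s, Polynomial.aeval (Complex.exp 1) (Polynomial.monomial (x i + M).toNat (b i)) =
        Complex.exp M * (((b i : ℝ) * Real.exp (x i) : ℝ) : ℂ) := by
      intro i hi
      rw [Polynomial.aeval_monomial, ← Complex.exp_nat_mul]
      have h2 : (((x i + M).toNat : ℕ) : ℂ) = (x i : ℂ) + M := by
        have : (((x i + M).toNat : ℕ) : ℤ) = x i + M := Int.toNat_of_nonneg (hM i hi)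
        exact_mod_cast congrArg (Int.cast : ℤ → ℂ) this
      rw [h2, mul_one, Complex.exp_add]
      push_cast
      simp
      ring
    rw [Finset.sum_congr rfl h1, ← Finset.mul_sum, ← Complex.ofReal_sum, h]
    simp
  have hp0 : p = 0 := by
    by_contra hne
    exact aeval_exp_one_ne_zero hne hev
  have hc : p.coeff (z + M).toNat = 0 := by rw [hp0, Polynomial.coeff_zero]
  rw [hp, Polynomial.finsetSum_coeff] at hc
  rw [Finset.sum_filter]
  refine Eq.trans ?_ hc
  refine Finset.sum_congr rfl fun i hi => ?_
  rw [Polynomial.coeff_monomial]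
  obtain ⟨j, hj, rfl⟩ := hz
  have h1 := hM i hi
  have h2 := hM j hj
  exact if_congr ⟨fun h => by rw [h], fun h => by omega⟩ rfl rfl

/-! ### The self-attention instance of a formula -/

/-- The contents of the cells of a stored matrix that is given by a function on pairs of natural
numbers. -/
theorem storeMatrix_apply {n m : ℕ} (f : ℕ → ℕ → ℕ) (z : ℤ) :
    storeMatrix (fun (i : Fin n) (j : Fin m) => f i j) z =
      if 0 ≤ z ∧ z < n * m then (f (z.toNat % n) (z.toNat / n) : ℤ) else 0 := by
  unfold storeMatrix
  split_ifs with hz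
  · obtain ⟨h0, h1⟩ := hz
    lift z to ℕ using h0
    have h1' : z < n * m := by exact_mod_cast h1
    have hn : 0 < n := Nat.pos_of_ne_zero fun h => by simp [h] at h1'
    rw [Int.toNat_natCast, Finset.sum_eq_single (⟨z % n, Nat.mod_lt _ hn⟩ : Fin n),
      Finset.sum_eq_single (⟨z / n, Nat.div_lt_of_lt_mul h1'⟩ : Fin m)]
    · rw [if_pos]
      have := Nat.div_add_mod' z n
      push_cast at this ⊢
      exact_mod_cast this.symm
    · intro j _ hj
      rw [if_neg]
      intro h
      refine hj (Fin.ext ?_)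
      have h' : z = j * n + z % n := by exact_mod_cast h
      have h2 := Nat.div_add_mod' z n
      have h3 : (j : ℕ) * n = z / n * n := by omega
      exact Nat.eq_of_mul_eq_mul_right hn h3
    · simp
    · intro i _ hi
      refine Finset.sum_eq_zero fun j _ => if_neg fun h => hi (Fin.ext ?_)
      have h' : z = j * n + i := by exact_mod_cast h
      rw [h']
      simp [Nat.mod_eq_of_lt i.2]
    · simp
  · refine Finset.sum_eq_zero fun i _ => Finset.sum_eq_zero fun j _ => if_neg fun h => hz ?_
    have h1 : (j : ℕ) * n + i < n * m := by
      calc (j : ℕ) * n + i < (j + 1) * n := by rw [add_mul]; have := i.2; omega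
        _ ≤ m * n := Nat.mul_le_mul_right _ j.2
        _ = n * m := mul_comm _ _
    exact ⟨by rw [h]; positivity, by rw [h]; exact_mod_cast h1⟩

section Instance

variable (k N Λ J h mc : ℕ) (leaf : ℤ → ℤ → Prop) (d dv : ℕ)

/-- Entry of the query matrix, as a natural number; columns that are not needed are zero. -/
noncomputable def queryEntry (i col : ℕ) : ℕ :=
  if col < 2 * (mc + J + 1) then ((mkShape k N Λ J h mc).entry leaf i col).toNat else 0

/-- Entry of the value matrix: its first column selects the rows of the second halves. -/
def valueEntry (i col : ℕ) : ℕ :=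
  if col = 0 ∧ 2 ^ (J + h) ≤ i ∧ i < 2 * 2 ^ (J + h) then 1 else 0

/-- The instance of self-attention that is built from the codes of the leaves. -/
noncomputable def attentionInstance : AttentionInstance (2 ^ (J + h + 2)) d dv where
  Q := fun i col => queryEntry k N Λ J h mc leaf i col
  V := fun i col => valueEntry J h i col
  Q_le := fun i col => by
    rw [Nat.log_pow (by norm_num), queryEntry]
    have := Shape.entry_le (S := mkShape k N Λ J h mc) (leaf := leaf) (Int.natCast_nonneg J)
      (Int.natCast_nonneg h) (i : ℕ) (col : ℕ)
    simp only at this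
    split_ifs <;> omega
  V_le := fun i col => by
    unfold valueEntry
    split_ifs <;> omega

variable {k N Λ J h mc leaf d dv}

theorem attentionInstance_Y_eq_sum (hd : 2 * (mc + J + 1) ≤ d) (hdv : 0 < dv)
    (i : Fin (2 ^ (J + h + 2))) :
    (attentionInstance k N Λ J h mc leaf d dv).Y i ⟨0, hdv⟩ =
      ∑ b ∈ Finset.range (2 ^ (J + h)), Real.exp ((∑ col ∈ Finset.range (2 * (mc + J + 1)),
        ((mkShape k N Λ J h mc).entry leaf (i : ℕ) col).toNat *
          ((mkShape k N Λ J h mc).entry leaf ((2 ^ (J + h) + b : ℕ) : ℤ) col).toNat : ℕ) : ℝ) := by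
  set P := 2 ^ (J + h) with hP
  have hn : 2 ^ (J + h + 2) = P + P + 2 * P := by rw [hP, pow_add]; ring
  set E : ℕ → ℕ → ℕ := fun i b => ∑ col ∈ Finset.range (2 * (mc + J + 1)),
    ((mkShape k N Λ J h mc).entry leaf i col).toNat *
      ((mkShape k N Λ J h mc).entry leaf (b : ℕ) col).toNat with hE
  have hdot : ∀ i j : Fin (2 ^ (J + h + 2)),
      ((attentionInstance k N Λ J h mc leaf d dv).Q.map (Nat.cast : ℕ → ℝ)) i ⬝ᵥ
        ((attentionInstance k N Λ J h mc leaf d dv).Q.map (Nat.cast : ℕ → ℝ)) j = (E i j : ℕ) := by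
    intro i j
    rw [dotProduct, hE]
    refine Eq.trans (b := ∑ col : Fin d, ((queryEntry k N Λ J h mc leaf i col : ℕ) : ℝ) *
      ((queryEntry k N Λ J h mc leaf j col : ℕ) : ℝ)) rfl ?_
    rw [Fin.sum_univ_eq_sum_range (fun col => ((queryEntry k N Λ J h mc leaf i col : ℕ) : ℝ) *
      ((queryEntry k N Λ J h mc leaf j col : ℕ) : ℝ)) d]
    push_cast
    symm
    refine Finset.sum_subset_zero_on_sdiff (Finset.range_subset_range.2 hd) ?_ ?_
    · intro col hc
      simp only [Finset.mem_sdiff, Finset.mem_range] at hc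
      simp [queryEntry, hc.2]
    · intro col hc
      rw [Finset.mem_range] at hc
      simp [queryEntry, hc]
  have hY : (attentionInstance k N Λ J h mc leaf d dv).Y i ⟨0, hdv⟩ =
      ∑ j : Fin (2 ^ (J + h + 2)), Real.exp (E i j : ℕ) * (valueEntry J h j 0 : ℕ) := by
    unfold AttentionInstance.Y expDotAttention attention
    rw [Matrix.mul_apply]
    refine Finset.sum_congr rfl fun j _ => ?_
    simp only [scoreMatrix, id, Matrix.of_apply, hdot]
    rfl
  rw [hY, Fin.sum_univ_eq_sum_range (fun j => Real.exp (E i j : ℕ) * (valueEntry J h j 0 : ℕ))]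
  generalize (i : ℕ) = i'
  rw [hn, Finset.sum_range_add, Finset.sum_range_add, Finset.sum_eq_zero, zero_add,
    Finset.sum_eq_zero (s := Finset.range (2 * P)), add_zero]
  · refine Finset.sum_congr rfl fun b hb => ?_
    rw [Finset.mem_range] at hb
    rw [valueEntry, if_pos ⟨rfl, by omega, by omega⟩, Nat.cast_one, mul_one]
  · intro b _
    rw [valueEntry, if_neg (by rintro ⟨-, -, h⟩; omega), Nat.cast_zero, mul_zero]
  · intro b hb
    rw [Finset.mem_range] at hb
    rw [valueEntry, if_neg (by rintro ⟨-, h, -⟩; omega), Nat.cast_zero, mul_zero]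

theorem attentionInstance_Y_first (hΛ : J + h ≤ Λ) (hd : 2 * (mc + J + 1) ≤ d) (hdv : 0 < dv)
    (i : Fin (2 ^ (J + h + 2))) (hi : (i : ℕ) < 2 ^ (J + h)) :
    (attentionInstance k N Λ J h mc leaf d dv).Y i ⟨0, hdv⟩ =
      ∑ b ∈ Finset.range (2 ^ (J + h)),
        Real.exp ((2 * (J + h + 2) * agreeCount k N Λ J h mc leaf i b : ℕ) : ℝ) := by
  rw [attentionInstance_Y_eq_sum hd hdv]
  refine Finset.sum_congr rfl fun b hb => ?_
  rw [sum_entry_first hΛ hi (Finset.mem_range.1 hb)]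

theorem attentionInstance_Y_calibrating (hΛ : J + h ≤ Λ) (hd : 2 * (mc + J + 1) ≤ d) (hdv : 0 < dv)
    (i : Fin (2 ^ (J + h + 2))) (hi : (i : ℕ) = 2 * 2 ^ (J + h)) :
    (attentionInstance k N Λ J h mc leaf d dv).Y i ⟨0, hdv⟩ =
      2 ^ (J + h) * Real.exp ((2 * (J + h + 2) * (mc + J + 1) : ℕ) : ℝ) := by
  rw [attentionInstance_Y_eq_sum hd hdv, hi]
  rw [Finset.sum_congr rfl fun b hb => by
    rw [sum_entry_calibrating hΛ (Finset.mem_range.1 hb)], Finset.sum_const, Finset.card_range,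
    nsmul_eq_mul]
  push_cast
  rfl

theorem attentionInstance_input_query (hd : 2 * (mc + J + 1) ≤ d) (z : ℤ) :
    (attentionInstance k N Λ J h mc leaf d dv).input.arr 0 z =
      if 0 ≤ z ∧ z < 2 ^ (J + h + 2) * (2 * (mc + J + 1) : ℕ) then
        (mkShape k N Λ J h mc).entry leaf (z % 2 ^ (J + h + 2)) (z / 2 ^ (J + h + 2)) else 0 := by
  have h1 := storeMatrix_apply (n := 2 ^ (J + h + 2)) (m := d) (queryEntry k N Λ J h mc leaf) z
  refine Eq.trans (b := storeMatrix (fun (i : Fin (2 ^ (J + h + 2))) (j : Fin d) =>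
    queryEntry k N Λ J h mc leaf i j) z) ?_ (h1.trans ?_)
  · simp only [AttentionInstance.input]
    rfl
  have hn : 0 < 2 ^ (J + h + 2) := by positivity
  rcases lt_or_ge z 0 with hz | hz
  · rw [if_neg (by omega), if_neg (by omega)]
  lift z to ℕ using hz
  by_cases hz : z < 2 ^ (J + h + 2) * (2 * (mc + J + 1))
  · have h2 : z < 2 ^ (J + h + 2) * d := hz.trans_le (Nat.mul_le_mul_left _ hd)
    rw [if_pos ⟨by positivity, by exact_mod_cast h2⟩, if_pos ⟨by positivity, by exact_mod_cast hz⟩,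
      queryEntry, if_pos (Nat.div_lt_of_lt_mul (by rw [Int.toNat_natCast]; exact hz)),
      Int.toNat_of_nonneg (Shape.entry_nonneg (Int.natCast_nonneg J) (Int.natCast_nonneg h) _ _),
      Int.toNat_natCast]
    push_cast
    rfl
  · have h2 : ¬ (z / 2 ^ (J + h + 2) < 2 * (mc + J + 1)) := by
      rw [Nat.div_lt_iff_lt_mul hn, mul_comm]
      exact hz
    rw [Int.toNat_natCast, queryEntry, if_neg h2,
      if_neg (c := 0 ≤ (z : ℤ) ∧ (z : ℤ) < 2 ^ (J + h + 2) * (2 * (mc + J + 1) : ℕ))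
        fun h => hz (by exact_mod_cast h.2)]
    simp

theorem attentionInstance_input_value (hdv : 0 < dv) (z : ℤ) :
    (attentionInstance k N Λ J h mc leaf d dv).input.arr 1 z =
      if 2 ^ (J + h) ≤ z ∧ z < 2 * 2 ^ (J + h) then 1 else 0 := by
  have h1 := storeMatrix_apply (n := 2 ^ (J + h + 2)) (m := dv) (valueEntry J h) z
  refine Eq.trans (b := storeMatrix (fun (i : Fin (2 ^ (J + h + 2))) (j : Fin dv) =>
    valueEntry J h i j) z) ?_ (h1.trans ?_)
  · simp only [AttentionInstance.input]
    rfl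
  have hn : 2 ^ (J + h + 2) = 4 * 2 ^ (J + h) := by rw [pow_add]; ring
  have hP : 0 < 2 ^ (J + h) := by positivity
  rw [hn]
  set P := 2 ^ (J + h) with hPdef
  have hPz : (2 : ℤ) ^ (J + h) = P := by rw [hPdef]; push_cast; rfl
  rw [hPz]
  rcases lt_or_ge z 0 with hz | hz
  · rw [if_neg (by omega), if_neg (by omega)]
  lift z to ℕ using hz
  by_cases hz : P ≤ z ∧ z < 2 * P
  · have h2 : z < 4 * P * dv := lt_of_lt_of_le (by omega) (Nat.le_mul_of_pos_right _ hdv)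
    rw [if_pos ⟨by positivity, by exact_mod_cast h2⟩, if_pos (by omega), Int.toNat_natCast,
      Nat.mod_eq_of_lt (by omega), Nat.div_eq_of_lt (by omega), valueEntry, ← hPdef,
      if_pos ⟨rfl, hz⟩, Nat.cast_one]
  · have hv : valueEntry J h (z % (4 * P)) (z / (4 * P)) = 0 := by
      rw [valueEntry, if_neg]
      rintro ⟨h3, h4⟩
      rw [Nat.div_eq_zero_iff] at h3
      rw [Nat.mod_eq_of_lt (by omega)] at h4
      exact hz h4
    rw [if_neg (c := (P : ℤ) ≤ z ∧ (z : ℤ) < 2 * P) (by omega), Int.toNat_natCast, hv]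
    simp

end Instance

/-! ### Recovering the greatest score from the output -/

theorem two_pow_le_exp (m : ℕ) : (2 : ℝ) ^ m ≤ Real.exp m := by
  have h : (2 : ℝ) ≤ Real.exp 1 := by
    have := Real.add_one_le_exp (1 : ℝ)
    linarith
  calc (2 : ℝ) ^ m ≤ Real.exp 1 ^ m := pow_le_pow_left₀ (by norm_num) h m
    _ = Real.exp m := by rw [← Real.exp_nat_mul, mul_one]

theorem exp_le_four_pow (m : ℕ) : Real.exp m ≤ (4 : ℝ) ^ m := by
  have h : Real.exp 1 ≤ (4 : ℝ) := by
    have := Real.exp_one_lt_d9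
    linarith
  calc Real.exp m = Real.exp 1 ^ m := by rw [← Real.exp_nat_mul, mul_one]
    _ ≤ (4 : ℝ) ^ m := pow_le_pow_left₀ (Real.exp_nonneg 1) h m

section Threshold

variable {E T c : ℕ} {μ : ℝ} {g : ℕ → ℕ} {p q p' q' : ℤ}

/-- The sum of exponentials of scores in a row. -/
noncomputable def rowSum (E : ℕ) (g : ℕ → ℕ) : ℝ :=
  ∑ b ∈ Finset.range (2 ^ E), Real.exp ((2 * (E + 2) * g b : ℕ) : ℝ)

theorem two_pow_le_rowSum : (2 : ℝ) ^ E ≤ rowSum E g := by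
  have h : ∑ b ∈ Finset.range (2 ^ E), (1 : ℝ) ≤ rowSum E g :=
    Finset.sum_le_sum fun b _ => Real.one_le_exp (Nat.cast_nonneg _)
  simpa using h

/-- The greatest possible score `T` occurs in a row if and only if the sum of the row is not much
smaller than the sum of the calibrating row; approximations of these sums tell this. -/
theorem threshold_iff (hμ : 0 ≤ μ) (hμ1 : μ < 1) (hc : 1 + μ ≤ 4 * c * (1 - μ))
    (hc' : 4 * c * (1 + μ) ≤ 2 ^ (E + 2) * (1 - μ)) (hT : 1 ≤ T) (hg : ∀ b < 2 ^ E, g b ≤ T)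
    (hq : 0 < q) (hq' : 0 < q') (hy : |(p : ℝ) / q - rowSum E g| ≤ μ * rowSum E g)
    (hy' : |(p' : ℝ) / q' - 2 ^ E * Real.exp ((2 * (E + 2) * T : ℕ) : ℝ)| ≤
      μ * (2 ^ E * Real.exp ((2 * (E + 2) * T : ℕ) : ℝ))) :
    p' / q' * q ≤ c * 2 ^ (E + 2) * p ↔ ∃ b < 2 ^ E, g b = T := by
  set w := p' / q' with hw
  set A := Real.exp ((2 * (E + 2) * T : ℕ) : ℝ) with hA
  set P : ℝ := 2 ^ E with hP
  have hP1 : 1 ≤ P := one_le_pow₀ (by norm_num)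
  have hn : (2 : ℝ) ^ (E + 2) = 4 * P := by rw [pow_add]; ring
  rw [hn] at hc'
  have hqR : (0 : ℝ) < q := by exact_mod_cast hq
  have hqR' : (0 : ℝ) < q' := by exact_mod_cast hq'
  have hw1 : (w : ℝ) ≤ (p' : ℝ) / q' := by
    rw [le_div_iff₀ hqR']
    exact_mod_cast Int.ediv_mul_le p' hq'.ne'
  have hw2 : (p' : ℝ) / q' < w + 1 := by
    rw [div_lt_iff₀ hqR']
    exact_mod_cast Int.lt_ediv_add_one_mul_self p' hq'
  set y : ℝ := (p : ℝ) / q with hydef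
  set y' : ℝ := (p' : ℝ) / q' with hydef'
  have hiff : w * q ≤ c * 2 ^ (E + 2) * p ↔ (w : ℝ) ≤ c * (4 * P) * y := by
    rw [hydef, ← mul_div_assoc, le_div_iff₀ hqR, ← hn]
    norm_cast
  rw [hiff]
  have hy1 := (abs_le.1 hy).1
  have hy2 := (abs_le.1 hy).2
  have hy3 := (abs_le.1 hy').1
  have hy4 := (abs_le.1 hy').2
  have hA0 : 0 < A := Real.exp_pos _
  have hμ' : 0 < 1 - μ := by linarith
  have hc0 : (0 : ℝ) ≤ c := Nat.cast_nonneg c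
  constructor
  · intro hle
    by_contra hno
    push Not at hno
    have hc1 : (1 : ℝ) ≤ c := by
      have : c ≠ 0 := by
        rintro rfl
        simp at hc
        linarith
      exact_mod_cast Nat.one_le_iff_ne_zero.2 this
    -- the greatest score is missed, which makes the row smaller by the factor `n ^ 2`
    have hsmall : rowSum E g * (16 * P * P) ≤ P * A := by
      have h1 : ∀ b ∈ Finset.range (2 ^ E),
          Real.exp ((2 * (E + 2) * g b : ℕ) : ℝ) * (16 * P * P) ≤ A := by
        intro b hb
        rw [Finset.mem_range] at hb
        have h2 : g b + 1 ≤ T := lt_of_le_of_ne (hg b hb) (hno b hb)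
        have h3 : (16 : ℝ) * P * P ≤ Real.exp ((2 * (E + 2) : ℕ) : ℝ) := by
          refine le_trans (le_of_eq ?_) (two_pow_le_exp _)
          rw [hP, show 2 * (E + 2) = E + E + 4 by ring, pow_add, pow_add]
          ring
        calc _ ≤ Real.exp ((2 * (E + 2) * g b : ℕ) : ℝ) * Real.exp ((2 * (E + 2) : ℕ) : ℝ) :=
              mul_le_mul_of_nonneg_left h3 (Real.exp_nonneg _)
          _ = Real.exp ((2 * (E + 2) * (g b + 1) : ℕ) : ℝ) := by
              rw [← Real.exp_add]; push_cast; ring_nf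
          _ ≤ A := Real.exp_le_exp.2 (by exact_mod_cast Nat.mul_le_mul_left _ h2)
      rw [rowSum, Finset.sum_mul]
      refine (Finset.sum_le_sum h1).trans (le_of_eq ?_)
      simp [hP]
    have hr0 : 0 ≤ rowSum E g := le_trans (by positivity) two_pow_le_rowSum
    -- hence the threshold is below a quarter of the calibrating value
    have h4 : c * (4 * P) * y ≤ (1 - μ) * (P * A) / 4 := by
      have h5 : y ≤ (1 + μ) * rowSum E g := by linarith
      have h6 : c * (4 * P) * y ≤ c * (4 * P) * ((1 + μ) * rowSum E g) :=
        mul_le_mul_of_nonneg_left h5 (by positivity)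
      have h7 : c * (4 * P) * ((1 + μ) * rowSum E g) ≤ (4 * P * (1 - μ)) * (P * rowSum E g) := by
        have := mul_le_mul_of_nonneg_right hc' (show 0 ≤ P * rowSum E g by positivity)
        linarith
      have h8 : (4 * P * (1 - μ)) * (P * rowSum E g) =
          (1 - μ) * (rowSum E g * (16 * P * P)) / 4 := by ring
      have h9 := mul_le_mul_of_nonneg_left hsmall hμ'.le
      linarith
    have h10 : (1 - μ) * (P * A) ≤ y' := by linarith
    have h11 : 4 * P ≤ A := by
      have h12 : (2 : ℝ) ^ (E + 2) ≤ A := by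
        refine le_trans ?_ (two_pow_le_exp _)
        refine pow_le_pow_right₀ (by norm_num) ?_
        nlinarith
      linarith
    have h13 : 4 ≤ (1 - μ) * (P * A) := by
      have h14 : 4 ≤ 4 * P * (1 - μ) := by nlinarith
      have h15 : P * (1 - μ) * (4 * P) ≤ P * (1 - μ) * A :=
        mul_le_mul_of_nonneg_left h11 (by positivity)
      nlinarith
    linarith
  · rintro ⟨b, hb, rfl⟩
    have h1 : A ≤ rowSum E g := Finset.single_le_sum
      (f := fun b => Real.exp ((2 * (E + 2) * g b : ℕ) : ℝ))
      (fun b _ => Real.exp_nonneg _) (Finset.mem_range.2 hb)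
    have h2 : (1 - μ) * A ≤ y := by nlinarith
    have h3 : y' ≤ (1 + μ) * (P * A) := by linarith
    have h4 : (1 + μ) * (P * A) ≤ 4 * c * (1 - μ) * (P * A) :=
      mul_le_mul_of_nonneg_right hc (by positivity)
    have h5 : c * (4 * P) * ((1 - μ) * A) ≤ c * (4 * P) * y :=
      mul_le_mul_of_nonneg_left h2 (by positivity)
    linarith

/-- The integer part of the calibrating value is short. -/
theorem abs_threshold_le (hμ1 : μ < 1) (hq' : 0 < q')
    (hy' : |(p' : ℝ) / q' - 2 ^ E * Real.exp ((2 * (E + 2) * T : ℕ) : ℝ)| ≤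
      μ * (2 ^ E * Real.exp ((2 * (E + 2) * T : ℕ) : ℝ))) :
    |p' / q'| ≤ 2 ^ (1 + E + 2 * (2 * (E + 2) * T)) := by
  have hqR' : (0 : ℝ) < q' := by exact_mod_cast hq'
  set A := 2 ^ E * Real.exp ((2 * (E + 2) * T : ℕ) : ℝ) with hA
  have hA0 : 0 < A := by positivity
  have hy3 := (abs_le.1 hy').1
  have hy4 := (abs_le.1 hy').2
  have h0 : 0 ≤ (p' : ℝ) / q' := by nlinarith
  have h1 : 0 ≤ p' := by
    rw [div_nonneg_iff] at h0
    rcases h0 with h | h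
    · exact_mod_cast h.1
    · linarith [h.2]
  rw [abs_of_nonneg (Int.ediv_nonneg h1 hq'.le)]
  have hw1 : ((p' / q' : ℤ) : ℝ) ≤ (p' : ℝ) / q' := by
    rw [le_div_iff₀ hqR']
    exact_mod_cast Int.ediv_mul_le p' hq'.ne'
  have h2 : ((p' / q' : ℤ) : ℝ) ≤ 2 ^ (1 + E + 2 * (2 * (E + 2) * T)) := by
    calc ((p' / q' : ℤ) : ℝ) ≤ 2 * A := by nlinarith
      _ ≤ 2 * (2 ^ E * 4 ^ (2 * (E + 2) * T)) := by
          rw [hA]; gcongr; exact exp_le_four_pow _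
      _ = 2 ^ (1 + E + 2 * (2 * (E + 2) * T)) := by
          rw [pow_add, pow_add, pow_mul 2 2]; norm_num; ring
  exact_mod_cast h2

/-- An additive approximation of a large number is a multiplicative one. -/
theorem abs_sub_le_half_mul {y Y : ℝ} (h : |y - Y| ≤ μ) (hY : (2 : ℝ) ^ E ≤ Y)
    (hμ : 2 * μ ≤ 2 ^ E) : |y - Y| ≤ 1 / 2 * Y := by
  linarith

end Threshold

/-- The coefficient of the greatest power of `e` in a symbolic sum of exponentials is the number of
greatest scores. -/
theorem sum_coeff_eq_card {E T L : ℕ} {g : ℕ → ℕ} {b x : ℕ → ℤ} {p : ℕ → Prop} [DecidablePred p]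
    (h : rowSum E g = ∑ r ∈ Finset.range L, if p r then (b r : ℝ) * Real.exp (x r) else 0) :
    ∑ r ∈ Finset.range L, (if p r ∧ x r = ((2 * (E + 2) * T : ℕ) : ℤ) then b r else 0) =
      (((Finset.range (2 ^ E)).filter fun b => g b = T).card : ℤ) := by
  have h0 : ∑ r ∈ (Finset.range (2 ^ E)).disjSum ((Finset.range L).filter p),
      ((Sum.elim (fun _ => 1) (fun r => - b r) r : ℤ) : ℝ) *
        Real.exp ((Sum.elim (fun b => ((2 * (E + 2) * g b : ℕ) : ℤ)) x r : ℤ) : ℝ) = 0 := by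
    rw [Finset.sum_disjSum]
    simp only [Sum.elim_inl, Sum.elim_inr]
    rw [← Finset.sum_filter] at h
    have h1 : ∑ r ∈ (Finset.range L).filter p, ((-b r : ℤ) : ℝ) * Real.exp (x r) = - rowSum E g := by
      rw [h, ← Finset.sum_neg_distrib]
      exact Finset.sum_congr rfl fun r _ => by push_cast; ring
    rw [h1, rowSum]
    push_cast
    simp
  have h2 := sum_coeff_eq_zero_of_sum_exp_eq_zero h0 ((2 * (E + 2) * T : ℕ) : ℤ)
  rw [Finset.sum_filter, Finset.sum_disjSum] at h2
  replace h2 : ∑ b ∈ Finset.range (2 ^ E), (if ((2 * (E + 2) * g b : ℕ) : ℤ) =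
      ((2 * (E + 2) * T : ℕ) : ℤ) then (1 : ℤ) else 0) + ∑ r ∈ (Finset.range L).filter p,
      (if x r = ((2 * (E + 2) * T : ℕ) : ℤ) then -b r else 0) = 0 := h2
  rw [Finset.card_filter, Nat.cast_sum]
  simp only [Nat.cast_ite, Nat.cast_one, Nat.cast_zero]
  have h3 : ∑ r ∈ (Finset.range L).filter p,
      (if x r = ((2 * (E + 2) * T : ℕ) : ℤ) then -b r else 0) =
      -∑ r ∈ Finset.range L, (if p r ∧ x r = ((2 * (E + 2) * T : ℕ) : ℤ) then b r else 0) := by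
    rw [Finset.sum_filter, ← Finset.sum_neg_distrib]
    refine Finset.sum_congr rfl fun r _ => ?_
    by_cases hp : p r <;> simp [hp, neg_ite]
  rw [h3] at h2
  have h4 : ∑ b ∈ Finset.range (2 ^ E), (if ((2 * (E + 2) * g b : ℕ) : ℤ) =
      ((2 * (E + 2) * T : ℕ) : ℤ) then (1 : ℤ) else 0) =
      ∑ b ∈ Finset.range (2 ^ E), if g b = T then 1 else 0 := by
    refine Finset.sum_congr rfl fun b _ => if_congr ?_ rfl rfl
    rw [Nat.cast_inj]
    exact ⟨fun h => Nat.eq_of_mul_eq_mul_left (by omega) h, fun h => by rw [h]⟩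
  rw [h4] at h2
  linarith

/-! ### Programs that fill arrays -/

/-- The loop `for i < n`, with `i` in register `ri` and `n` in register `rn`. -/
def forLoop (ri rn : ℕ) (p : Program) : Program :=
  .seq (.assign ri (.const 0)) (.loop (.op .lt (.reg ri) (.reg rn))
    (.seq p (.assign ri (.op .add (.reg ri) (.const 1)))))

theorem bitCost_natCast_le {i b : ℕ} (h : i ≤ 2 ^ b) : bitCost (i : ℤ) ≤ b + 2 :=
  bitCost_le_of_abs_le (by rw [Nat.abs_cast]; exact_mod_cast h)

theorem bitCost_ite_le (p : Prop) [Decidable p] : bitCost (if p then 1 else 0) ≤ 2 := by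
  split_ifs <;> decide

theorem exec_forLoop {ri rn : ℕ} {p : Program} {s : State} (n b : ℕ) (hn : n ≤ 2 ^ b)
    (I : ℕ → State → Prop) (cost : ℕ → ℕ) (hne : ri ≠ rn) (hs : s.reg rn = n)
    (h0 : I 0 (s.setReg ri 0))
    (step : ∀ i < n, ∀ s, I i s → s.reg ri = i → s.reg rn = n → ∃ s' t, Exec p s s' t ∧
      s'.reg ri = i ∧ s'.reg rn = n ∧ I (i + 1) (s'.setReg ri (i + 1)) ∧ t ≤ cost i) :
    ∃ s' t, Exec (forLoop ri rn p) s s' t ∧ I n s' ∧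
      t ≤ ∑ i ∈ Finset.range n, cost i + (n + 1) * (4 * b + 20) := by
  have hcost : ∀ i ≤ n, bitCost (i : ℤ) ≤ b + 2 := fun i hi => bitCost_natCast_le (hi.trans hn)
  have b1 : bitCost 1 = 2 := by decide
  have b0 : bitCost 0 = 1 := by decide
  obtain ⟨s', t, hx, hI, ht⟩ := Exec.loop_of_invariant (e := .op .lt (.reg ri) (.reg rn))
    (p := .seq p (.assign ri (.op .add (.reg ri) (.const 1))))
    (fun i s => I i s ∧ s.reg ri = i ∧ s.reg rn = n) n (fun i => cost i + (4 * b + 19)) (2 * b + 8)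
    (s := s.setReg ri 0)
    (by
      rintro i hi s ⟨hI, h1, h2⟩
      obtain ⟨s', t, hx, h1', h2', hI', ht⟩ := step i hi s hI h1 h2
      refine ⟨by simp [Expr.eval, BinOp.eval, h1, h2, hi], _, _, .seq hx (.assign _ _ _),
        ⟨?_, ?_, ?_⟩, ?_⟩
      · simpa [Expr.eval, BinOp.eval, h1'] using hI'
      · simp [State.setReg, Expr.eval, BinOp.eval, h1']
      · simp [State.setReg, hne.symm, h2']
      · have c1 := hcost i hi.le
        have c2 := hcost n le_rfl
        have c3 := hcost (i + 1) hi
        have c4 := bitCost_ite_le ((i : ℤ) < n)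
        push_cast at c3
        simp only [Expr.cost, Expr.eval, BinOp.eval, h1, h2, h1', b1]
        omega)
    (by
      rintro s ⟨-, h1, h2⟩
      have c2 := hcost n le_rfl
      refine ⟨by simp [Expr.eval, BinOp.eval, h1, h2], ?_⟩
      simp only [Expr.cost, Expr.eval, BinOp.eval, h1, h2, lt_irrefl, if_false, b0]
      omega)
    ⟨h0, by simp [State.setReg], by simp [State.setReg, hne.symm, hs]⟩
  refine ⟨s', _, .seq (.assign _ _ _) hx, hI.1, ?_⟩
  rw [Finset.sum_add_distrib, Finset.sum_const, Finset.card_range, smul_eq_mul] at ht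
  simp only [Expr.cost, b0]
  nlinarith

/-- The environment of the expressions that are evaluated by the reduction: the counter of the
loop, the number of variables and the number of clauses of the formula. -/
def stdEnv (Λ : ℕ) (g : ℕ → ℤ → ℤ) (v N M : ℤ) : Env :=
  ⟨Λ, g, fun n => if n = 0 then v else if n = 2 then M else N⟩

/-- The registers that hold the variables of `stdEnv`; the counter is in register `r`. -/
def stdVars (ρ r : ℕ) : ℕ → ℕ := fun n => if n = 0 then r else if n = 2 then ρ + 1 else ρ

/-- A state of the reduction: the registers below `ρ` belong to another program, those from `ρ` on
hold the parameters `N`, `M`, `Λ`. -/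
structure Ready (ρ Λ : ℕ) (N M : ℤ) (f : ℕ → ℤ) (g : ℕ → ℤ → ℤ) (s : State) : Prop where
  reg : ∀ r < ρ, s.reg r = f r
  regN : s.reg ρ = N
  regM : s.reg (ρ + 1) = M
  regΛ : s.reg (ρ + 2) = Λ
  arr : s.arr = g

/-- The parameters and the contents of the arrays have at most `Λ` bits. -/
structure Small (Λ : ℕ) (N M : ℤ) (g : ℕ → ℤ → ℤ) : Prop where
  N : |N| ≤ 2 ^ Λ
  M : |M| ≤ 2 ^ Λ
  arr : ∀ a z, |g a z| ≤ 2 ^ Λ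

theorem Small.bounded {Λ : ℕ} {N M v : ℤ} {g : ℕ → ℤ → ℤ} (h : Small Λ N M g) (hv : |v| ≤ 2 ^ Λ) :
    (stdEnv Λ g v N M).Bounded Λ := by
  refine ⟨Nat.lt_two_pow_self.le, h.arr, fun n => ?_⟩
  simp only [stdEnv]
  split_ifs
  exacts [hv, h.M, h.N]

/-- The arrays `g` after writing `val` into the first `n` cells of array `a`. -/
def filled (g : ℕ → ℤ → ℤ) (a : ℕ) (val : ℕ → ℤ) (n : ℕ) : ℕ → ℤ → ℤ :=
  Function.update g a fun z => if 0 ≤ z ∧ z < n then val z.toNat else g a z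

theorem filled_same {g : ℕ → ℤ → ℤ} {a : ℕ} {val : ℕ → ℤ} {n i : ℕ} (hi : i < n) :
    filled g a val n a i = val i := by
  simp [filled, hi]

theorem filled_ne {g : ℕ → ℤ → ℤ} {a a' : ℕ} {val : ℕ → ℤ} {n : ℕ} (h : a' ≠ a) :
    filled g a val n a' = g a' := by
  simp [filled, h]

theorem Small.filled {Λ : ℕ} {N M : ℤ} {g : ℕ → ℤ → ℤ} (h : Small Λ N M g) {a n : ℕ}
    {val : ℕ → ℤ} (hv : ∀ v < n, |val v| ≤ 2 ^ Λ) : Small Λ N M (filled g a val n) := by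
  refine ⟨h.N, h.M, fun a' z => ?_⟩
  by_cases ha : a' = a
  · subst ha
    simp only [FineGrained.filled, Function.update_self]
    split_ifs with hz
    · exact hv _ (by omega)
    · exact h.arr _ _
  · rw [filled_ne ha]
    exact h.arr _ _

theorem filled_succ (g : ℕ → ℤ → ℤ) (a : ℕ) (val : ℕ → ℤ) (n : ℕ) :
    Function.update (filled g a val n) a (Function.update (filled g a val n a) n (val n)) =
      filled g a val (n + 1) := by
  unfold filled
  rw [Function.update_idem]
  congr 1
  funext z
  rw [Function.update_self, Function.update_apply]
  rcases eq_or_ne z n with rfl | hz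
  · simp
  · rw [if_neg hz]
    exact if_congr (by push_cast; omega) rfl rfl

theorem stdVars_lt {ρ r t : ℕ} (h : ρ + 1 < t) (hr : r < t) (n : ℕ) : stdVars ρ r n < t := by
  unfold stdVars
  split_ifs <;> omega

/-- A program that fills the first cells of an array with the values of a bounded expression. -/
theorem exists_fill (ρ a : ℕ) {B e : Env → ℤ} (hB : Impl B) (he : Impl e) :
    ∃ (p : Program) (c : ℕ), ∀ (Λ : ℕ) (N M : ℤ) (f : ℕ → ℤ) (g : ℕ → ℤ → ℤ) (s : State) (n : ℕ)
      (val : ℕ → ℤ), Ready ρ Λ N M f g s → Small Λ N M g → B (stdEnv Λ g N N M) = n → n ≤ 2 ^ Λ →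
      (∀ v < n, |val v| ≤ 2 ^ Λ) →
      (∀ v < n, e (stdEnv Λ (filled g a val v) v N M) = val v) →
      ∃ s' τ, Exec p s s' τ ∧ Ready ρ Λ N M f (filled g a val n) s' ∧
        τ ≤ (n + 1) * (2 * Λ + 2) ^ c := by
  obtain ⟨xB, hB⟩ := hB
  obtain ⟨xe, he⟩ := he
  obtain ⟨cB, hcB⟩ := xB.exec_compile
  obtain ⟨ce, hce⟩ := xe.exec_compile
  refine ⟨.seq (xB.compile (ρ + 2) (stdVars ρ ρ) (ρ + 4)) (forLoop (ρ + 3) (ρ + 4)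
    (.seq (xe.compile (ρ + 2) (stdVars ρ (ρ + 3)) (ρ + 5))
      (.store a (.reg (ρ + 3)) (.reg (ρ + 5))))), cB + ce + 1 + 8, ?_⟩
  intro Λ N M f g s n val hs hsm hn hnΛ hv hval
  have henv : s.env Λ (stdVars ρ ρ) = stdEnv Λ g N N M := by
    simp only [State.env, stdEnv, hs.arr, Env.mk.injEq, true_and]
    funext m
    simp only [stdVars]
    split_ifs <;> simp [hs.regN, hs.regM]
  obtain ⟨s₁, τ₁, hx₁, hev₁, hτ₁⟩ := hcB (ρ + 2) Λ Λ (stdVars ρ ρ) (ρ + 4) s hs.regΛ (by omega)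
    (stdVars_lt (by omega) (by omega)) (by rw [henv]; exact hsm.bounded hsm.N)
  rw [henv, hB, hn] at hev₁
  have hr₁ : Ready ρ Λ N M f g s₁ := by
    refine ⟨fun r hr => (hev₁.reg r (by omega)).trans (hs.reg r hr),
      (hev₁.reg _ (by omega)).trans hs.regN, (hev₁.reg _ (by omega)).trans hs.regM,
      (hev₁.reg _ (by omega)).trans hs.regΛ, hev₁.arr.trans hs.arr⟩
  have hset : ∀ {s : State} {g : ℕ → ℤ → ℤ} {z : ℤ}, Ready ρ Λ N M f g s →
      Ready ρ Λ N M f g (s.setReg (ρ + 3) z) := by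
    intro s g z h
    refine ⟨fun r hr => ?_, ?_, ?_, ?_, h.arr⟩
    · have : r ≠ ρ + 3 := by omega
      simp [State.setReg, this, h.reg r hr]
    · simp [State.setReg, h.regN]
    · simp [State.setReg, h.regM]
    · simp [State.setReg, h.regΛ]
  obtain ⟨s₂, τ₂, hx₂, hr₂, hτ₂⟩ := exec_forLoop (ri := ρ + 3) (rn := ρ + 4) n Λ hnΛ
    (p := .seq (xe.compile (ρ + 2) (stdVars ρ (ρ + 3)) (ρ + 5))
      (.store a (.reg (ρ + 3)) (.reg (ρ + 5))))
    (fun i s => Ready ρ Λ N M f (filled g a val i) s) (fun _ => (Λ + Λ + 2) ^ ce + 2 * Λ + 5)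
    (s := s₁) (by omega) hev₁.result
    (by
      have : filled g a val 0 = g := by
        funext a' z
        by_cases ha : a' = a
        · subst ha
          have : ¬ (0 ≤ z ∧ z < 0) := by omega
          simp [filled, this]
        · rw [filled_ne ha]
      rw [this]
      exact hset hr₁)
    (by
      intro i hi s₃ hr₃ h1 h2
      have hiΛ : |(i : ℤ)| ≤ 2 ^ Λ := by
        rw [Nat.abs_cast]; exact_mod_cast hi.le.trans hnΛ
      have henv₃ : s₃.env Λ (stdVars ρ (ρ + 3)) = stdEnv Λ (filled g a val i) i N M := by
        simp only [State.env, stdEnv, hr₃.arr, Env.mk.injEq, true_and]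
        funext m
        simp only [stdVars]
        split_ifs <;> simp [hr₃.regN, hr₃.regM, h1]
      obtain ⟨s₄, τ₄, hx₄, hev₄, hτ₄⟩ := hce (ρ + 2) Λ Λ (stdVars ρ (ρ + 3)) (ρ + 5) s₃ hr₃.regΛ
        (by omega) (stdVars_lt (by omega) (by omega)) (by
          rw [henv₃]
          exact (hsm.filled fun v hv' => hv v (by omega)).bounded hiΛ)
      rw [henv₃, he, hval i hi] at hev₄
      have h3 : s₄.reg (ρ + 3) = i := (hev₄.reg _ (by omega)).trans h1
      refine ⟨_, _, .seq hx₄ (.store _ _ _ _), h3, (hev₄.reg _ (by omega)).trans h2,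
        hset ⟨fun r hr => (hev₄.reg r (by omega)).trans (hr₃.reg r hr),
          (hev₄.reg _ (by omega)).trans hr₃.regN, (hev₄.reg _ (by omega)).trans hr₃.regM,
          (hev₄.reg _ (by omega)).trans hr₃.regΛ, ?_⟩, ?_⟩
      · simp only [State.setArr, Expr.eval, h3, hev₄.result, hev₄.arr, hr₃.arr]
        exact filled_succ g a val i
      · have c1 := bitCost_le_of_abs_le hiΛ
        have c2 := bitCost_le_of_abs_le (hv i hi)
        simp only [Expr.cost, h3, hev₄.result]
        omega)
  refine ⟨s₂, _, .seq hx₁ hx₂, hr₂, ?_⟩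
  rw [Finset.sum_const, Finset.card_range, smul_eq_mul] at hτ₂
  set X := 2 * Λ + 2 with hX
  rw [show Λ + Λ + 2 = X by omega] at hτ₁ hτ₂
  have h1 : 1 ≤ X ^ cB := Nat.one_le_pow _ _ (by omega)
  have h2 : 1 ≤ X ^ ce := Nat.one_le_pow _ _ (by omega)
  have h3 : X ^ cB ≤ X ^ cB * X ^ ce := Nat.le_mul_of_pos_right _ h2
  have h4 : X ^ ce ≤ X ^ cB * X ^ ce := Nat.le_mul_of_pos_left _ h1
  have h5 : 1 ≤ X ^ cB * X ^ ce := Nat.mul_le_mul h1 h2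
  have h6 : X ≤ X ^ cB * X ^ ce * X := Nat.le_mul_of_pos_left _ h5
  have h7 : X ^ cB * X ^ ce ≤ X ^ cB * X ^ ce * X := Nat.le_mul_of_pos_right _ (by omega)
  have h8 : 2 ^ 8 ≤ X ^ 8 := Nat.pow_le_pow_left (by omega) 8
  have h9 : τ₁ + τ₂ ≤ (n + 1) * (X ^ cB + X ^ ce + 6 * Λ + 25) := by nlinarith
  refine h9.trans (Nat.mul_le_mul_left _ ?_)
  calc X ^ cB + X ^ ce + 6 * Λ + 25 ≤ X ^ cB * X ^ ce * X * 2 ^ 8 := by omega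
    _ ≤ X ^ cB * X ^ ce * X * X ^ 8 := Nat.mul_le_mul_left _ h8
    _ = X ^ (cB + ce + 1 + 8) := by ring

/-- A program that writes the value of a bounded expression into a register. -/
theorem exists_assign (ρ r : ℕ) (hr : r < ρ) {B : Env → ℤ} (hB : Impl B) :
    ∃ (p : Program) (c : ℕ), ∀ (Λ : ℕ) (N M : ℤ) (f : ℕ → ℤ) (g : ℕ → ℤ → ℤ) (s : State),
      Ready ρ Λ N M f g s → Small Λ N M g → |B (stdEnv Λ g N N M)| ≤ 2 ^ Λ →
      ∃ s' τ, Exec p s s' τ ∧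
        Ready ρ Λ N M (Function.update f r (B (stdEnv Λ g N N M))) g s' ∧
        τ ≤ (2 * Λ + 2) ^ c := by
  obtain ⟨xB, hB⟩ := hB
  obtain ⟨cB, hcB⟩ := xB.exec_compile
  refine ⟨.seq (xB.compile (ρ + 2) (stdVars ρ ρ) (ρ + 4)) (.assign r (.reg (ρ + 4))), cB + 0 + 2, ?_⟩
  intro Λ N M f g s hs hsm hn
  have henv : s.env Λ (stdVars ρ ρ) = stdEnv Λ g N N M := by
    simp only [State.env, stdEnv, hs.arr, Env.mk.injEq, true_and]
    funext m
    simp only [stdVars]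
    split_ifs <;> simp [hs.regN, hs.regM]
  obtain ⟨s₁, τ₁, hx₁, hev₁, hτ₁⟩ := hcB (ρ + 2) Λ Λ (stdVars ρ ρ) (ρ + 4) s hs.regΛ (by omega)
    (stdVars_lt (by omega) (by omega)) (by rw [henv]; exact hsm.bounded hsm.N)
  rw [henv, hB] at hev₁
  refine ⟨_, _, .seq hx₁ (.assign _ _ _), ⟨fun r' hr' => ?_, ?_, ?_, ?_, hev₁.arr.trans hs.arr⟩, ?_⟩
  · by_cases h : r' = r
    · subst h
      simp [State.setReg, Expr.eval, hev₁.result]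
    · simp [State.setReg, h, hev₁.reg r' (by omega), hs.reg r' hr']
  · have : ρ ≠ r := by omega
    simp [State.setReg, this, hev₁.reg ρ (by omega), hs.regN]
  · have : ρ + 1 ≠ r := by omega
    simp [State.setReg, this, hev₁.reg (ρ + 1) (by omega), hs.regM]
  · have : ρ + 2 ≠ r := by omega
    simp [State.setReg, this, hev₁.reg (ρ + 2) (by omega), hs.regΛ]
  · have c1 := bitCost_le_of_abs_le hn
    simp only [Expr.cost, hev₁.result]
    rw [show Λ + Λ + 2 = 2 * Λ + 2 by omega] at hτ₁
    set X := 2 * Λ + 2 with hX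
    have h2 : 1 ≤ X ^ cB := Nat.one_le_pow _ _ (by omega)
    have h3 : X * X ≤ X ^ cB * (X * X) := Nat.le_mul_of_pos_left _ h2
    rw [show X ^ (cB + 0 + 2) = X ^ cB * (X * X) by ring]
    have h4 : 2 * X ≤ X * X := Nat.mul_le_mul_right _ (by omega)
    rcases Nat.eq_zero_or_pos Λ with h0 | h0
    · subst h0
      have h5 : X ^ cB * 4 = X ^ cB * (X * X) := by rw [hX]
      omega
    · have h5 : X ^ cB * (X * 4) ≤ X ^ cB * (X * X) :=
        Nat.mul_le_mul_left _ (Nat.mul_le_mul_left _ (by omega))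
      have h6 : X ≤ X ^ cB * X := Nat.le_mul_of_pos_left _ h2
      have h7 : X ^ cB ≤ X ^ cB * X := Nat.le_mul_of_pos_right _ (by omega)
      have h8 : X ^ cB * (X * 4) = 4 * (X ^ cB * X) := by ring
      omega

/-! ### Writing down the self-attention instance -/

/-- The number of bits of advice. -/
def adviceBits (k R w N : ℕ) : ℕ := w * ((k + 1) * (N / R) + 1)

/-- The number of variables in each half. -/
def halfSize (N : ℕ) : ℕ := N / 2 + 1

/-- The number of positions for clauses. -/
def clausePositions (k R N : ℕ) : ℕ := 1 + 2 * N * (k * flowerThreshold R k)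

/-- The binary logarithm of the number of rows of first halves. -/
def logRows (k R w N : ℕ) : ℕ := adviceBits k R w N + halfSize N

/-- The greatest score, up to the common factor `2 * (logRows + 2)`. -/
def topScore (k R w N : ℕ) : ℕ := clausePositions k R N + adviceBits k R w N + 1

/-- The range `Λ` of all loops is large enough for the formulas over `N` variables. -/
structure Room (k R w N Λ : ℕ) : Prop where
  codes : (2 * N + 1) ^ k ≤ Λ
  rounds : sparsifyBound R k * N ≤ Λ
  vars : N ≤ Λ
  width : k ≤ Λ
  four : 4 ≤ Λ
  rows : 2 * logRows k R w N + 4 ≤ Λ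
  top : topScore k R w N ≤ Λ
  leaves : 2 ^ adviceBits k R w N * ((Λ + 1) * (Λ + 1)) ≤ 2 ^ Λ
  advice : 2 ^ adviceBits k R w N * 2 ^ w + Λ ≤ 2 ^ Λ
  queries : 2 ^ (logRows k R w N + 2) * (2 * topScore k R w N) ≤ 2 ^ Λ

theorem pred_div_mod {u q : ℕ} (h : 0 < u % q) : (u - 1) / q = u / q ∧
    (u - 1) % q + 1 = u % q ∧ u / q * q + (u - 1) % q = u - 1 := by
  rcases Nat.eq_zero_or_pos q with rfl | hq
  · simp at h ⊢
    omega
  have h1 := Nat.div_add_mod u q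
  have h2 := Nat.mod_lt u hq
  have h3 : u - 1 = q * (u / q) + (u % q - 1) := by omega
  have h4 : u % q - 1 < q := by omega
  have h5 : (u - 1) / q = u / q := by
    rw [h3, Nat.mul_add_div hq, Nat.div_eq_of_lt h4, add_zero]
  have h6 : (u - 1) % q = u % q - 1 := by
    rw [h3, Nat.mul_add_mod, Nat.mod_eq_of_lt h4]
  refine ⟨h5, by omega, ?_⟩
  rw [h6, mul_comm]
  exact h3.symm

theorem mul_add_div_mod {x r q : ℕ} (h : r < q) : (x * q + r) / q = x ∧ (x * q + r) % q = r := by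
  rw [mul_comm, Nat.mul_add_div (by omega), Nat.mul_add_mod, Nat.div_eq_of_lt h,
    Nat.mod_eq_of_lt h]
  simp

section Impl

variable {k R w : ℕ} {N : Env → ℤ}

theorem Impl.adviceBits (hN : Impl N) : Impl fun e => (w : ℤ) * ((k + 1) * (N e / R) + 1) :=
  (Impl.const w).mul (((Impl.const (k + 1)).mul (hN.div (.const R))).add (.const 1))

theorem adviceBits_cast (N : ℕ) :
    ((adviceBits k R w N : ℕ) : ℤ) = (w : ℤ) * ((k + 1) * ((N : ℤ) / R) + 1) := by
  simp [adviceBits]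

theorem Impl.halfSize (hN : Impl N) : Impl fun e => N e / 2 + 1 := (hN.div (.const 2)).add (.const 1)

theorem halfSize_cast (N : ℕ) : ((halfSize N : ℕ) : ℤ) = (N : ℤ) / 2 + 1 := by
  simp [halfSize]

theorem Impl.clausePositions (hN : Impl N) :
    Impl fun e => 1 + 2 * N e * (k * flowerThreshold R k : ℕ) :=
  (Impl.const 1).add (((Impl.const 2).mul hN).mul (.const _))

theorem clausePositions_cast (N : ℕ) : ((clausePositions k R N : ℕ) : ℤ) =
    1 + 2 * (N : ℤ) * (k * flowerThreshold R k : ℕ) := by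
  simp [clausePositions]

/-- The shape of the reduction for `N` variables. -/
abbrev reductionShape (k R w Λ : ℕ) (N : ℤ) : Shape :=
  ⟨k, N, Λ, (w : ℤ) * ((k + 1) * (N / R) + 1), N / 2 + 1, 1 + 2 * N * (k * flowerThreshold R k : ℕ)⟩

theorem reductionShape_natCast (Λ N : ℕ) : reductionShape k R w Λ N =
    mkShape k N Λ (adviceBits k R w N) (halfSize N) (clausePositions k R N) := by
  simp only [mkShape, adviceBits_cast, halfSize_cast, clausePositions_cast]

/-- The codes of leaves, if they are stored in the array `A`. -/
def storedLeaf (Λ : ℕ) (A : ℤ → ℤ) (l c : ℤ) : Prop :=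
  A ((l * (Λ + 1) + Λ) * Λ + c) = 1

variable {i col pos par x z : Env → ℤ}

theorem Impl.pow2 (hz : Impl z) :
    Impl fun e => (reductionShape k R w e.lam (N e)).pow2 (z e) := (Impl.const 2).powMin hz

theorem ImplP.firstEntry (a : ℕ) (hN : Impl N) (hz : Impl z) (hx : Impl x) (hpos : Impl pos)
    (hpar : Impl par) : ImplP fun e => (reductionShape k R w e.lam (N e)).FirstEntry
      (storedLeaf e.lam (e.arr a)) (z e) (x e) (pos e) (par e) := by
  have hJ : Impl fun e => (w : ℤ) * ((k + 1) * (N e / R) + 1) := hN.adviceBits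
  have hmc := hN.clausePositions (k := k) (R := R)
  have hb : Impl fun e => (z e * (e.lam + 1) + e.lam) * e.lam :=
    ((hz.mul (Impl.lam.add (.const 1))).add .lam).mul .lam
  have hend := hmc.add hJ
  exact ((ImplP.lt hpos hmc).and ((ImplP.eq hpar (.const 0)).iff
      (ImplP.clauseOn a hN hb (.const 0) hN.halfSize hx hpos))).or
    ((((ImplP.le hmc hpos).and (ImplP.lt hpos hend)).and
      (ImplP.eq ((hz.bitAt (hpos.sub hmc)).add hpar) (.const 1))).or
    ((ImplP.eq hpos hend).and ((ImplP.eq hpar (.const 0)).and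
      (ImplP.le (Impl.listLength a hN hb) hmc))))

theorem ImplP.secondEntry (a : ℕ) (hN : Impl N) (hz : Impl z) (hx : Impl x) (hpos : Impl pos)
    (hpar : Impl par) : ImplP fun e => (reductionShape k R w e.lam (N e)).SecondEntry
      (storedLeaf e.lam (e.arr a)) (z e) (x e) (pos e) (par e) := by
  have hJ : Impl fun e => (w : ℤ) * ((k + 1) * (N e / R) + 1) := hN.adviceBits
  have hmc := hN.clausePositions (k := k) (R := R)
  have hb : Impl fun e => (z e * (e.lam + 1) + e.lam) * e.lam :=
    ((hz.mul (Impl.lam.add (.const 1))).add .lam).mul .lam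
  have hend := hmc.add hJ
  exact ((ImplP.lt hpos hmc).and ((ImplP.eq hpar (.const 0)).or
      (ImplP.clauseOn a hN hb hN.halfSize hN.halfSize hx hpos))).or
    ((((ImplP.le hmc hpos).and (ImplP.lt hpos hend)).and
      (ImplP.eq ((hz.bitAt (hpos.sub hmc)).add hpar) (.const 1))).or
    ((ImplP.eq hpos hend).and (ImplP.eq hpar (.const 0))))

theorem ImplP.calibratingEntry (hN : Impl N) (hpos : Impl pos) (hpar : Impl par) :
    ImplP fun e => (reductionShape k R w e.lam (N e)).CalibratingEntry (pos e) (par e) := by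
  have hJ : Impl fun e => (w : ℤ) * ((k + 1) * (N e / R) + 1) := hN.adviceBits
  have hmc := hN.clausePositions (k := k) (R := R)
  have hend := hmc.add hJ
  exact ((ImplP.lt hpos hmc).and (ImplP.eq hpar (.const 0))).or
    (((ImplP.le hmc hpos).and (ImplP.lt hpos hend)).or
    ((ImplP.eq hpos hend).and (ImplP.eq hpar (.const 0))))

theorem Impl.entry (a : ℕ) (hN : Impl N) (hi : Impl i) (hcol : Impl col) :
    Impl fun e => (reductionShape k R w e.lam (N e)).entry (storedLeaf e.lam (e.arr a)) (i e)
      (col e) := by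
  classical
  have hJ : Impl fun e => (w : ℤ) * ((k + 1) * (N e / R) + 1) := hN.adviceBits
  have hP := Impl.pow2 (k := k) (R := R) (w := w) (N := N) (hJ.add hN.halfSize)
  have hH := Impl.pow2 (k := k) (R := R) (w := w) (N := N) hN.halfSize
  have hv := (Impl.const 2).mul ((hJ.add hN.halfSize).add (.const 2))
  have h2 := hcol.div (.const 2)
  have h3 := hcol.mod (.const 2)
  exact Impl.ite (ImplP.lt hi hP)
    (Impl.ite (ImplP.firstEntry a hN (hi.div hH) (hi.mod hH) h2 h3) hv (.const 0))
    (Impl.ite (ImplP.lt hi ((Impl.const 2).mul hP))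
      (Impl.ite (ImplP.secondEntry a hN ((hi.sub hP).div hH) ((hi.sub hP).mod hH) h2 h3)
        (.const 1) (.const 0))
      (Impl.ite (ImplP.eq hi ((Impl.const 2).mul hP))
        (Impl.ite (ImplP.calibratingEntry hN h2 h3) hv (.const 0)) (.const 0)))

end Impl

theorem stdEnv_var_zero (Λ : ℕ) (g : ℕ → ℤ → ℤ) (v N M : ℤ) : (stdEnv Λ g v N M).var 0 = v := rfl

theorem stdEnv_var_one (Λ : ℕ) (g : ℕ → ℤ → ℤ) (v N M : ℤ) : (stdEnv Λ g v N M).var 1 = N := rfl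

theorem stdEnv_var_two (Λ : ℕ) (g : ℕ → ℤ → ℤ) (v N M : ℤ) : (stdEnv Λ g v N M).var 2 = M := rfl

theorem two_pow_min_toNat {x Λ : ℕ} (hx : x ≤ Λ) {z : ℤ} (hz : z = x) :
    (2 : ℤ) ^ min z.toNat Λ = ((2 ^ x : ℕ) : ℤ) := by
  subst hz
  simp [hx]

theorem add_le_mul_pow {P X a b c d : ℕ} (hX : 2 ≤ X) (ha : a ≤ P * X ^ c) (hb : b ≤ P * X ^ d) :
    a + b ≤ P * X ^ (c + d + 1) := by
  have h1 : X ^ c + X ^ d ≤ X ^ (c + d + 1) := by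
    have h2 : X ^ c ≤ X ^ (c + d) := Nat.pow_le_pow_right (by omega) (by omega)
    have h3 : X ^ d ≤ X ^ (c + d) := Nat.pow_le_pow_right (by omega) (by omega)
    have h4 : X ^ (c + d) * 2 ≤ X ^ (c + d) * X := Nat.mul_le_mul_left _ hX
    rw [pow_succ]
    omega
  calc a + b ≤ P * (X ^ c + X ^ d) := by rw [mul_add]; omega
    _ ≤ P * X ^ (c + d + 1) := Nat.mul_le_mul_left _ h1

section Fill

variable (ρ k R w : ℕ)

/-- The first array of the reduction lists the states of the advice. -/
theorem exists_fill_advice : ∃ (p : Program) (c : ℕ), ∀ (Λ N : ℕ) (M : ℤ) (f : ℕ → ℤ)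
    (g : ℕ → ℤ → ℤ) (s : State), Ready ρ Λ N M f g s → Small Λ N M g → Room k R w N Λ →
    ∃ s' τ g', Exec p s s' τ ∧ Ready ρ Λ N M f g' s' ∧ Small Λ N M g' ∧
      (∀ a ≠ ρ, g' a = g a) ∧ (∀ l < 2 ^ adviceBits k R w N, ∀ s ≤ Λ,
        g' ρ ((l * (Λ + 1) + s : ℕ) : ℤ) = adviceState w l s) ∧
      τ ≤ 2 ^ logRows k R w N * (2 * Λ + 2) ^ c := by
  classical
  have hcell : Impl fun e => e.arr ρ (e.var 0 - 1) := ((Impl.var 0).sub (.const 1)).get ρ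
  have hlam1 : Impl fun e => (e.lam : ℤ) + 1 := Impl.lam.add (.const 1)
  have hY1 := hcell.mod (.const (2 ^ w))
  have hY2 := hcell.div (.const (2 ^ w))
  have he : Impl fun e => if e.var 0 % (e.lam + 1) = 0 then e.var 0 / (e.lam + 1) * 2 ^ w else
      if e.arr ρ (e.var 0 - 1) % 2 ^ w < e.arr ρ (e.var 0 - 1) / 2 ^ w % 2 ^ w ∧
        e.arr ρ (e.var 0 - 1) % 2 ^ w + 1 < 2 ^ w - 1 then e.arr ρ (e.var 0 - 1) + 1
      else e.arr ρ (e.var 0 - 1) / (2 ^ w * 2 ^ w) * 2 ^ w :=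
    Impl.ite (ImplP.eq ((Impl.var 0).mod hlam1) (.const 0))
      (((Impl.var 0).div hlam1).mul (.const (2 ^ w)))
      (Impl.ite ((ImplP.lt hY1 (hY2.mod (.const (2 ^ w)))).and
        (ImplP.lt (hY1.add (.const 1)) (.const (2 ^ w - 1)))) (hcell.add (.const 1))
        ((hcell.div (.const (2 ^ w * 2 ^ w))).mul (.const (2 ^ w))))
  have hB : Impl fun e => 2 ^ min ((w : ℤ) * ((k + 1) * (e.var 1 / R) + 1)).toNat e.lam *
      ((e.lam : ℤ) + 1) := ((Impl.const 2).powMin (Impl.var 1).adviceBits).mul hlam1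
  obtain ⟨p, c, H⟩ := exists_fill ρ ρ hB he
  refine ⟨p, c + 2, fun Λ N M f g s hs hsm hr => ?_⟩
  set J := adviceBits k R w N with hJ
  have hJΛ : J ≤ Λ := by have := hr.rows; unfold logRows at this; omega
  set val : ℕ → ℤ := fun v => (adviceState w (v / (Λ + 1)) (v % (Λ + 1)) : ℕ) with hval
  set n := 2 ^ J * (Λ + 1) with hn
  have hnΛ : n ≤ 2 ^ Λ := by
    refine le_trans ?_ hr.leaves
    rw [← mul_assoc]
    exact Nat.le_mul_of_pos_right _ (by omega)
  have hvalΛ : ∀ v < n, |val v| ≤ 2 ^ Λ := by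
    intro v hv
    rw [hval]
    simp only
    rw [Nat.abs_cast]
    have h1 : v / (Λ + 1) ≤ 2 ^ J := (Nat.div_le_of_le_mul (by rw [mul_comm]; exact hv.le))
    have h2 : v % (Λ + 1) ≤ Λ := Nat.lt_succ_iff.1 (Nat.mod_lt _ (by omega))
    have h3 := adviceState_le w (v / (Λ + 1)) (v % (Λ + 1))
    have h4 : v / (Λ + 1) * 2 ^ w ≤ 2 ^ J * 2 ^ w := Nat.mul_le_mul_right _ h1
    have h5 := hr.advice
    rw [← hJ] at h5
    exact_mod_cast (by omega : adviceState w (v / (Λ + 1)) (v % (Λ + 1)) ≤ 2 ^ Λ)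
  obtain ⟨s', τ, hx, hs', hτ⟩ := H Λ N M f g s n val hs hsm
    (by
      rw [stdEnv_var_one, ← adviceBits_cast]
      change 2 ^ min (adviceBits k R w N : ℤ).toNat Λ * ((Λ : ℤ) + 1) = (n : ℤ)
      rw [two_pow_min_toNat hJΛ rfl, hn]
      push_cast
      rfl)
    hnΛ hvalΛ
    (by
      intro v hv
      change (if (v : ℤ) % ((Λ : ℤ) + 1) = 0 then _ else _) = val v
      rw [stdEnv_var_zero]
      change (if (v : ℤ) % ((Λ : ℤ) + 1) = 0 then (v : ℤ) / ((Λ : ℤ) + 1) * 2 ^ w else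
        if filled g ρ val v ρ (v - 1) % 2 ^ w < filled g ρ val v ρ (v - 1) / 2 ^ w % 2 ^ w ∧
          filled g ρ val v ρ (v - 1) % 2 ^ w + 1 < 2 ^ w - 1 then filled g ρ val v ρ (v - 1) + 1
        else filled g ρ val v ρ (v - 1) / (2 ^ w * 2 ^ w) * 2 ^ w) = val v
      rcases Nat.eq_zero_or_pos (v % (Λ + 1)) with h0 | h0
      · rw [if_pos (by exact_mod_cast h0), hval]
        simp only [h0, adviceState, Function.iterate_zero, id]
        push_cast
        rfl
      · have h1 : v = v - 1 + 1 := by have := Nat.mod_le v (Λ + 1); omega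
        have h2 := pred_div_mod h0
        have h3 : ((v : ℤ) - 1) = ((v - 1 : ℕ) : ℤ) := by omega
        rw [if_neg (by exact_mod_cast h0.ne'), h3, filled_same (by omega), hval]
        simp only
        rw [← h2.2.1, adviceState_succ, h2.1]
        set Y := adviceState w (v / (Λ + 1)) ((v - 1) % (Λ + 1))
        have h4 : ((Y : ℤ) % 2 ^ w < (Y : ℤ) / 2 ^ w % 2 ^ w ∧ (Y : ℤ) % 2 ^ w + 1 < 2 ^ w - 1) ↔
            (Y % 2 ^ w < Y / 2 ^ w % 2 ^ w ∧ Y % 2 ^ w + 1 < 2 ^ w - 1) := by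
          have h5 : ((2 : ℤ) ^ w - 1) = ((2 ^ w - 1 : ℕ) : ℤ) := by
            rw [Nat.cast_sub Nat.one_le_two_pow]; push_cast; rfl
          rw [h5]
          norm_cast
        rw [adviceNext]
        split_ifs with h6 h7 h7
        · push_cast; rfl
        · exact absurd (h4.1 h6) h7
        · exact absurd (h4.2 h7) h6
        · push_cast; rfl)
  refine ⟨s', τ, _, hx, hs', hsm.filled hvalΛ, fun a ha => filled_ne ha, fun l hl s hs => ?_, ?_⟩
  · have h1 : l * (Λ + 1) + s < n := by
      calc l * (Λ + 1) + s < (l + 1) * (Λ + 1) := by rw [add_mul]; omega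
        _ ≤ n := Nat.mul_le_mul_right _ hl
    rw [filled_same h1, hval]
    simp only
    rw [(mul_add_div_mod (Nat.lt_succ_of_le hs)).1, (mul_add_div_mod (Nat.lt_succ_of_le hs)).2]
  · have h1 : 2 ^ J ≤ 2 ^ logRows k R w N := Nat.pow_le_pow_right (by norm_num) (by simp [logRows, hJ])
    have h2 : n + 1 ≤ 2 ^ J * (Λ + 2) := by
      have : 1 ≤ 2 ^ J := Nat.one_le_two_pow
      rw [hn]
      nlinarith
    calc τ ≤ (n + 1) * (2 * Λ + 2) ^ c := hτ
      _ ≤ (2 ^ logRows k R w N * (2 * Λ + 2) ^ 2) * (2 * Λ + 2) ^ c := by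
          refine Nat.mul_le_mul_right _ (h2.trans (Nat.mul_le_mul h1 ?_))
          nlinarith
      _ = 2 ^ logRows k R w N * (2 * Λ + 2) ^ (c + 2) := by ring

/-- The second array of the reduction lists the codes of all stages of all branches. -/
theorem exists_fill_codes (hρ : 0 < ρ) : ∃ (p : Program) (c : ℕ), ∀ (Λ N : ℕ) (M : ℤ) (f : ℕ → ℤ)
    (g : ℕ → ℤ → ℤ) (s : State), Ready ρ Λ N M f g s → Small Λ N M g → Room k R w N Λ →
    (∀ l < 2 ^ adviceBits k R w N, ∀ s ≤ Λ,
      g ρ ((l * (Λ + 1) + s : ℕ) : ℤ) = adviceState w l s) →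
    ∃ s' τ g', Exec p s s' τ ∧ Ready ρ Λ N M f g' s' ∧ Small Λ N M g' ∧
      (∀ a ≠ ρ + 1, g' a = g a) ∧ (∀ l < 2 ^ adviceBits k R w N, ∀ c < Λ,
        (storedLeaf Λ (g' (ρ + 1)) (l : ℕ) (c : ℕ) ↔
          leafCodes k R w N Λ (initCodes k N Λ (g 0) M) l c)) ∧
      τ ≤ 2 ^ logRows k R w N * (2 * Λ + 2) ^ c := by
  classical
  have hlam1 : Impl fun e => (e.lam : ℤ) + 1 := Impl.lam.add (.const 1)
  have hu : Impl fun e => e.var 0 / e.lam := (Impl.var 0).div .lam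
  have hc : Impl fun e => e.var 0 % e.lam := (Impl.var 0).mod .lam
  have hcell : Impl fun e => e.arr ρ (e.var 0 / e.lam - 1) := (hu.sub (.const 1)).get ρ
  have hq : ImplP fun e => e.arr ρ (e.var 0 / e.lam - 1) / 2 ^ w % 2 ^ w ≤
      e.arr ρ (e.var 0 / e.lam - 1) % 2 ^ w :=
    ImplP.le ((hcell.div (.const (2 ^ w))).mod (.const (2 ^ w))) (hcell.mod (.const (2 ^ w)))
  have hb : Impl fun e => (e.var 0 / e.lam - 1) * e.lam := (hu.sub (.const 1)).mul .lam
  have he : Impl fun e => if (e.var 0 / e.lam % (e.lam + 1) = 0 ∧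
      initCodes k (e.var 1) e.lam (e.arr 0) (e.var 2) (e.var 0 % e.lam)) ∨
      (¬ e.var 0 / e.lam % (e.lam + 1) = 0 ∧ roundCodes k (flowerThreshold R) (e.var 1) e.lam
        (fun z => e.arr (ρ + 1) ((e.var 0 / e.lam - 1) * e.lam + z) = 1)
        (e.arr ρ (e.var 0 / e.lam - 1) / 2 ^ w % 2 ^ w ≤ e.arr ρ (e.var 0 / e.lam - 1) % 2 ^ w)
        (e.var 0 % e.lam)) then 1 else 0 :=
    Impl.ite ((ImplP.eq (hu.mod hlam1) (.const 0)).ite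
      (ImplP.initCodes 0 (.var 1) (.var 2) hc) (ImplP.roundCodes (ρ + 1) (.var 1) hb hc hq))
      (.const 1) (.const 0)
  have hB : Impl fun e => 2 ^ min ((w : ℤ) * ((k + 1) * (e.var 1 / R) + 1)).toNat e.lam *
      ((e.lam : ℤ) + 1) * e.lam :=
    (((Impl.const 2).powMin (Impl.var 1).adviceBits).mul hlam1).mul .lam
  obtain ⟨p, c, H⟩ := exists_fill ρ (ρ + 1) hB he
  refine ⟨p, c + 2, fun Λ N M f g s hs hsm hr hadv => ?_⟩
  set J := adviceBits k R w N with hJ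
  have hJΛ : J ≤ Λ := by have := hr.rows; unfold logRows at this; omega
  have hΛ0 : 0 < Λ := by have := hr.four; omega
  set seq : ℕ → ℕ → ℤ → Prop := fun l s => codeSeq k (flowerThreshold R) N Λ
    (initCodes k N Λ (g 0) M) (fun s => AdvicePetal w (adviceState w l s)) s with hseq
  set val : ℕ → ℤ := fun v => if seq (v / Λ / (Λ + 1)) (v / Λ % (Λ + 1)) ((v % Λ : ℕ) : ℤ)
    then 1 else 0 with hval
  set n := 2 ^ J * (Λ + 1) * Λ with hn
  have hnΛ : n ≤ 2 ^ Λ := by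
    refine le_trans ?_ hr.leaves
    rw [← mul_assoc]
    exact Nat.mul_le_mul_left _ (by omega)
  have hvalΛ : ∀ v < n, |val v| ≤ 2 ^ Λ := by
    intro v hv
    have : (1 : ℤ) ≤ 2 ^ Λ := one_le_pow₀ (by norm_num)
    rw [hval]
    simp only
    split_ifs <;> simp [this]
  obtain ⟨s', τ, hx, hs', hτ⟩ := H Λ N M f g s n val hs hsm
    (by
      rw [stdEnv_var_one, ← adviceBits_cast]
      change 2 ^ min (adviceBits k R w N : ℤ).toNat Λ * ((Λ : ℤ) + 1) * Λ = (n : ℤ)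
      rw [two_pow_min_toNat hJΛ rfl, hn]
      push_cast
      rfl)
    hnΛ hvalΛ
    (by
      intro v hv
      rw [stdEnv_var_zero, stdEnv_var_one, stdEnv_var_two]
      set G := filled g (ρ + 1) val v with hG
      have hG0 : G 0 = g 0 := filled_ne (by omega)
      have hGρ : G ρ = g ρ := filled_ne (by omega)
      change (if ((v : ℤ) / Λ % ((Λ : ℤ) + 1) = 0 ∧ initCodes k N Λ (G 0) M ((v : ℤ) % Λ)) ∨
        (¬ (v : ℤ) / Λ % ((Λ : ℤ) + 1) = 0 ∧ roundCodes k (flowerThreshold R) N Λ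
        (fun z => G (ρ + 1) (((v : ℤ) / Λ - 1) * Λ + z) = 1)
        (G ρ ((v : ℤ) / Λ - 1) / 2 ^ w % 2 ^ w ≤ G ρ ((v : ℤ) / Λ - 1) % 2 ^ w)
        ((v : ℤ) % Λ)) then (1 : ℤ) else 0) = val v
      rw [hval]
      refine if_congr ?_ rfl rfl
      rw [hG0, hGρ]
      have hcu : ((v : ℤ) % Λ) = ((v % Λ : ℕ) : ℤ) := by push_cast; rfl
      have huu : ((v : ℤ) / Λ) = ((v / Λ : ℕ) : ℤ) := by push_cast; rfl
      rw [hcu, huu]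
      set u := v / Λ with hu
      have hcΛ : v % Λ < Λ := Nat.mod_lt _ hΛ0
      rcases Nat.eq_zero_or_pos (u % (Λ + 1)) with h0 | h0
      · have h0' : ((u : ℤ) % ((Λ : ℤ) + 1) = 0) := by exact_mod_cast h0
        rw [h0]
        simp only [h0', true_and, not_true, false_and, or_false, hseq, codeSeq]
      · have h0' : ¬ ((u : ℤ) % ((Λ : ℤ) + 1) = 0) := by exact_mod_cast h0.ne'
        simp only [h0', false_and, not_false_eq_true, true_and, false_or]
        have h1 : u = u - 1 + 1 := by have := Nat.mod_le u (Λ + 1); omega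
        have h2 := pred_div_mod h0
        have h3 : ((u : ℤ) - 1) = ((u - 1 : ℕ) : ℤ) := by omega
        rw [h3]
        have hseq1 : seq (u / (Λ + 1)) (u % (Λ + 1)) ((v % Λ : ℕ) : ℤ) ↔
            roundCodes k (flowerThreshold R) N Λ (seq (u / (Λ + 1)) ((u - 1) % (Λ + 1)))
              (AdvicePetal w (adviceState w (u / (Λ + 1)) ((u - 1) % (Λ + 1))))
              ((v % Λ : ℕ) : ℤ) := by
          rw [← h2.2.1]
          exact Iff.rfl
        rw [hseq1]
        refine roundCodes_congr (fun c' hc' => ?_) ?_ hcΛ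
        · have h4 : (((u - 1 : ℕ) : ℤ) * Λ + (c' : ℕ)) = (((u - 1) * Λ + c' : ℕ) : ℤ) := by
            push_cast; rfl
          have h5 : (u - 1) * Λ + c' < v := by
            have h6 := Nat.div_mul_le_self v Λ
            rw [← hu, h1, add_mul] at h6
            omega
          rw [h4, hG, filled_same h5, hval]
          simp only
          rw [(mul_add_div_mod hc').1, (mul_add_div_mod hc').2, h2.1]
          split_ifs with h7 <;> simp [h7]
        · have h4 : u / (Λ + 1) < 2 ^ J := by
            rw [Nat.div_lt_iff_lt_mul (by omega), hu, Nat.div_lt_iff_lt_mul hΛ0]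
            exact hv
          have h5 := hadv _ h4 ((u - 1) % (Λ + 1)) (Nat.lt_succ_iff.1 (Nat.mod_lt _ (by omega)))
          rw [h2.2.2] at h5
          rw [h5, AdvicePetal]
          norm_cast)
  refine ⟨s', τ, _, hx, hs', hsm.filled hvalΛ, fun a ha => filled_ne ha, fun l hl c' hc' => ?_, ?_⟩
  · have h1 : (l * (Λ + 1) + Λ) * Λ + c' < n := by
      calc (l * (Λ + 1) + Λ) * Λ + c' < (l * (Λ + 1) + Λ + 1) * Λ := by rw [add_mul _ 1]; omega
        _ = (l + 1) * (Λ + 1) * Λ := by ring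
        _ ≤ n := Nat.mul_le_mul_right _ (Nat.mul_le_mul_right _ hl)
    have h2 : (((l : ℕ) : ℤ) * (Λ + 1) + Λ) * Λ + ((c' : ℕ) : ℤ) =
      (((l * (Λ + 1) + Λ) * Λ + c' : ℕ) : ℤ) := by push_cast; rfl
    rw [storedLeaf, h2, filled_same h1, hval]
    simp only
    rw [(mul_add_div_mod hc').1, (mul_add_div_mod hc').2,
      (mul_add_div_mod (Nat.lt_succ_self Λ)).1, (mul_add_div_mod (Nat.lt_succ_self Λ)).2, leafCodes,
      Int.toNat_natCast]
    split_ifs with h7 <;> simpa using h7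
  · have h1 : 2 ^ J ≤ 2 ^ logRows k R w N := Nat.pow_le_pow_right (by norm_num) (by simp [logRows, hJ])
    have h2 : n + 1 ≤ 2 ^ J * ((2 * Λ + 2) ^ 2) := by
      have : 1 ≤ 2 ^ J := Nat.one_le_two_pow
      have h3 : (Λ + 1) * Λ + 1 ≤ (2 * Λ + 2) ^ 2 := by nlinarith
      have h4 : 2 ^ J * ((Λ + 1) * Λ + 1) = n + 2 ^ J := by rw [hn]; ring
      exact le_trans (by omega) (Nat.mul_le_mul_left (2 ^ J) h3)
    calc τ ≤ (n + 1) * (2 * Λ + 2) ^ c := hτ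
      _ ≤ (2 ^ logRows k R w N * (2 * Λ + 2) ^ 2) * (2 * Λ + 2) ^ c :=
          Nat.mul_le_mul_right _ (h2.trans (Nat.mul_le_mul_right _ h1))
      _ = 2 ^ logRows k R w N * (2 * Λ + 2) ^ (c + 2) := by ring

end Fill

theorem mul_self_le_two_pow {n : ℕ} (h : 4 ≤ n) : n * n ≤ 2 ^ n := by
  induction n, h using Nat.le_induction with
  | base => norm_num
  | succ n hn ih =>
    rw [pow_succ]
    nlinarith

/-- The array `A` holds the parameters that are needed to evaluate the output of an algorithm for
self-attention. -/
structure ParamArray (A : ℤ → ℤ) (E T : ℕ) : Prop where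
  rows : A 0 = ((2 ^ E : ℕ) : ℤ)
  top : A 1 = ((2 * (E + 2) * T : ℕ) : ℤ)
  modulus : A 2 = ((2 ^ (2 * E + 1) : ℕ) : ℤ)
  size : A 3 = ((2 ^ (E + 2) : ℕ) : ℤ)

section Fill

variable (ρ k R w : ℕ)

theorem logRows_cast (N : ℕ) : ((logRows k R w N : ℕ) : ℤ) =
    (w : ℤ) * ((k + 1) * ((N : ℤ) / R) + 1) + ((N : ℤ) / 2 + 1) := by
  rw [logRows, Nat.cast_add, adviceBits_cast, halfSize_cast]

theorem topScore_cast (N : ℕ) : ((topScore k R w N : ℕ) : ℤ) =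
    1 + 2 * (N : ℤ) * (k * flowerThreshold R k : ℕ) + (w : ℤ) * ((k + 1) * ((N : ℤ) / R) + 1) + 1 := by
  rw [topScore, Nat.cast_add, Nat.cast_add, clausePositions_cast, adviceBits_cast, Nat.cast_one]

theorem Impl.logRows {N : Env → ℤ} (hN : Impl N) :
    Impl fun e => (w : ℤ) * ((k + 1) * (N e / R) + 1) + (N e / 2 + 1) :=
  hN.adviceBits.add hN.halfSize

theorem Impl.topScore {N : Env → ℤ} (hN : Impl N) :
    Impl fun e => 1 + 2 * N e * (k * flowerThreshold R k : ℕ) +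
      (w : ℤ) * ((k + 1) * (N e / R) + 1) + 1 :=
  (hN.clausePositions.add hN.adviceBits).add (.const 1)

/-- The third array of the reduction holds the parameters. -/
theorem exists_fill_params : ∃ (p : Program) (c : ℕ), ∀ (Λ N : ℕ) (M : ℤ) (f : ℕ → ℤ)
    (g : ℕ → ℤ → ℤ) (s : State), Ready ρ Λ N M f g s → Small Λ N M g → Room k R w N Λ →
    ∃ s' τ g', Exec p s s' τ ∧ Ready ρ Λ N M f g' s' ∧ Small Λ N M g' ∧
      (∀ a ≠ ρ + 2, g' a = g a) ∧ ParamArray (g' (ρ + 2)) (logRows k R w N) (topScore k R w N) ∧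
      τ ≤ 2 ^ logRows k R w N * (2 * Λ + 2) ^ c := by
  have hE := (Impl.var 1).logRows k R w
  have hT := (Impl.var 1).topScore k R w
  have he : Impl fun e => if e.var 0 = 0 then
      2 ^ min ((w : ℤ) * ((k + 1) * (e.var 1 / R) + 1) + (e.var 1 / 2 + 1)).toNat e.lam else
      if e.var 0 = 1 then 2 * ((w : ℤ) * ((k + 1) * (e.var 1 / R) + 1) + (e.var 1 / 2 + 1) + 2) *
        (1 + 2 * e.var 1 * (k * flowerThreshold R k : ℕ) +
          (w : ℤ) * ((k + 1) * (e.var 1 / R) + 1) + 1) else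
      if e.var 0 = 2 then
        2 ^ min (2 * ((w : ℤ) * ((k + 1) * (e.var 1 / R) + 1) + (e.var 1 / 2 + 1)) + 1).toNat e.lam
      else 2 ^ min ((w : ℤ) * ((k + 1) * (e.var 1 / R) + 1) + (e.var 1 / 2 + 1) + 2).toNat e.lam :=
    Impl.ite (ImplP.eq (.var 0) (.const 0)) ((Impl.const 2).powMin hE)
      (Impl.ite (ImplP.eq (.var 0) (.const 1))
        (((Impl.const 2).mul (hE.add (.const 2))).mul hT)
        (Impl.ite (ImplP.eq (.var 0) (.const 2))
          ((Impl.const 2).powMin (((Impl.const 2).mul hE).add (.const 1)))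
          ((Impl.const 2).powMin (hE.add (.const 2)))))
  obtain ⟨p, c, H⟩ := exists_fill ρ (ρ + 2) (Impl.const 4) he
  refine ⟨p, 3 + c, fun Λ N M f g s hs hsm hr => ?_⟩
  set E := logRows k R w N with hEdef
  set T := topScore k R w N with hTdef
  have hrows := hr.rows
  have htop := hr.top
  have hfour := hr.four
  rw [← hEdef] at hrows
  rw [← hTdef] at htop
  set val : ℕ → ℤ := fun v => ((if v = 0 then 2 ^ E else if v = 1 then 2 * (E + 2) * T else
    if v = 2 then 2 ^ (2 * E + 1) else 2 ^ (E + 2) : ℕ) : ℤ) with hval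
  have hvalΛ : ∀ v < 4, |val v| ≤ 2 ^ Λ := by
    intro v _
    rw [hval]
    simp only
    rw [Nat.abs_cast]
    have h : (if v = 0 then 2 ^ E else if v = 1 then 2 * (E + 2) * T else
      if v = 2 then 2 ^ (2 * E + 1) else 2 ^ (E + 2) : ℕ) ≤ 2 ^ Λ := by
      split_ifs
      · exact Nat.pow_le_pow_right (by norm_num) (by omega)
      · refine (Nat.mul_le_mul (by omega : 2 * (E + 2) ≤ Λ) htop).trans (mul_self_le_two_pow hfour)
      · exact Nat.pow_le_pow_right (by norm_num) (by omega)
      · exact Nat.pow_le_pow_right (by norm_num) (by omega)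
    exact_mod_cast h
  obtain ⟨s', τ, hx, hs', hτ⟩ := H Λ N M f g s 4 val hs hsm rfl
    (le_trans (by norm_num) (Nat.pow_le_pow_right (by norm_num) (by omega : 2 ≤ Λ))) hvalΛ
    (by
      intro v hv
      rw [stdEnv_var_zero, stdEnv_var_one, ← logRows_cast, ← topScore_cast, ← hEdef, ← hTdef]
      change (if (v : ℤ) = 0 then 2 ^ min (E : ℤ).toNat Λ else
        if (v : ℤ) = 1 then 2 * ((E : ℤ) + 2) * T else
        if (v : ℤ) = 2 then 2 ^ min (2 * (E : ℤ) + 1).toNat Λ else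
        2 ^ min ((E : ℤ) + 2).toNat Λ) = val v
      rw [two_pow_min_toNat (x := E) (by omega) rfl,
        two_pow_min_toNat (x := 2 * E + 1) (by omega) (by push_cast; rfl),
        two_pow_min_toNat (x := E + 2) (by omega) (by push_cast; rfl), hval]
      simp only
      interval_cases v <;> simp)
  refine ⟨s', τ, _, hx, hs', hsm.filled hvalΛ, fun a ha => filled_ne ha, ⟨?_, ?_, ?_, ?_⟩, ?_⟩
  · exact filled_same (i := 0) (by norm_num)
  · exact filled_same (i := 1) (by norm_num)
  · exact filled_same (i := 2) (by norm_num)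
  · exact filled_same (i := 3) (by norm_num)
  · refine hτ.trans ?_
    have h1 : 2 ^ 3 ≤ (2 * Λ + 2) ^ 3 := Nat.pow_le_pow_left (by omega) 3
    rw [pow_add, ← mul_assoc]
    refine Nat.mul_le_mul_right _ ?_
    calc 4 + 1 ≤ 1 * (2 * Λ + 2) ^ 3 := by omega
      _ ≤ 2 ^ E * (2 * Λ + 2) ^ 3 := Nat.mul_le_mul_right _ Nat.one_le_two_pow

/-- The formula is erased from array `0`. -/
theorem exists_clear : ∃ (p : Program) (c : ℕ), ∀ (Λ N M : ℕ) (f : ℕ → ℤ)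
    (g : ℕ → ℤ → ℤ) (s : State), Ready ρ Λ N M f g s → Small Λ N M g → Room k R w N Λ →
    M ≤ (2 * N + 1) ^ k → (∀ z : ℤ, ¬ (0 ≤ z ∧ z < M * k) → g 0 z = 0) →
    ∃ s' τ g', Exec p s s' τ ∧ Ready ρ Λ N M f g' s' ∧ Small Λ N M g' ∧
      (∀ a ≠ 0, g' a = g a) ∧ (∀ z, g' 0 z = 0) ∧
      τ ≤ 2 ^ logRows k R w N * (2 * Λ + 2) ^ c := by
  obtain ⟨p, c, H⟩ := exists_fill ρ 0 ((Impl.var 2).mul (.const k)) (Impl.const 0)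
  refine ⟨p, 2 + c, fun Λ N M f g s hs hsm hr hM hg => ?_⟩
  have h1 : M * k ≤ Λ * Λ := Nat.mul_le_mul (hM.trans hr.codes) hr.width
  have hv : ∀ v < M * k, |(fun _ => 0 : ℕ → ℤ) v| ≤ 2 ^ Λ := by intro v _; simp
  obtain ⟨s', τ, hx, hs', hτ⟩ := H Λ N M f g s (M * k) (fun _ => 0) hs hsm
    (by rw [stdEnv_var_two]; push_cast; rfl) (h1.trans (mul_self_le_two_pow hr.four)) hv
    (fun _ _ => rfl)
  refine ⟨s', τ, _, hx, hs', hsm.filled hv, fun a ha => filled_ne ha, fun z => ?_, ?_⟩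
  · simp only [filled, Function.update_self]
    split_ifs with hz
    · rfl
    · exact hg z (by push_cast at hz; exact hz)
  · refine hτ.trans ?_
    rw [pow_add, ← mul_assoc]
    refine Nat.mul_le_mul_right _ ?_
    calc M * k + 1 ≤ 1 * (2 * Λ + 2) ^ 2 := by nlinarith
      _ ≤ _ := Nat.mul_le_mul_right _ Nat.one_le_two_pow

/-- Array `0` receives the query matrix. -/
theorem exists_fill_queries (hρ : 0 < ρ) : ∃ (p : Program) (c : ℕ), ∀ (Λ N M : ℕ) (f : ℕ → ℤ)
    (g : ℕ → ℤ → ℤ) (s : State) (leaf : ℤ → ℤ → Prop), Ready ρ Λ N M f g s → Small Λ N M g →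
    Room k R w N Λ → (∀ z, g 0 z = 0) → (∀ l < 2 ^ adviceBits k R w N, ∀ c < Λ,
      (storedLeaf Λ (g (ρ + 1)) (l : ℕ) (c : ℕ) ↔ leaf l c)) →
    ∃ s' τ g', Exec p s s' τ ∧ Ready ρ Λ N M f g' s' ∧ Small Λ N M g' ∧
      (∀ a ≠ 0, g' a = g a) ∧ (∀ z, g' 0 z =
        if 0 ≤ z ∧ z < 2 ^ (logRows k R w N + 2) * (2 * topScore k R w N : ℕ) then
          (reductionShape k R w Λ N).entry leaf (z % 2 ^ (logRows k R w N + 2))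
            (z / 2 ^ (logRows k R w N + 2)) else 0) ∧
      τ ≤ 2 ^ logRows k R w N * (2 * Λ + 2) ^ c := by
  have hE := (Impl.var 1).logRows k R w
  have hT := (Impl.var 1).topScore k R w
  have hn := (Impl.const 2).powMin (hE.add (.const 2))
  obtain ⟨p, c, H⟩ := exists_fill ρ 0 (hn.mul ((Impl.const 2).mul hT))
    (Impl.entry (k := k) (R := R) (w := w) (ρ + 1) (.var 1) ((Impl.var 0).mod hn)
      ((Impl.var 0).div hn))
  refine ⟨p, 4 + c, fun Λ N M f g s leaf hs hsm hr hg hleaf => ?_⟩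
  set E := logRows k R w N with hEdef
  set T := topScore k R w N with hTdef
  have hrows := hr.rows
  have htop := hr.top
  have hqueries := hr.queries
  rw [← hEdef] at hrows hqueries
  rw [← hTdef] at htop hqueries
  have hE0 : (0 : ℤ) ≤ (w : ℤ) * ((k + 1) * ((N : ℤ) / R) + 1) := by positivity
  have hh0 : (0 : ℤ) ≤ (N : ℤ) / 2 + 1 := by positivity
  set val : ℕ → ℤ := fun v => (reductionShape k R w Λ N).entry leaf ((v : ℤ) % 2 ^ (E + 2))
    ((v : ℤ) / 2 ^ (E + 2)) with hval
  have hvalΛ : ∀ v < 2 ^ (E + 2) * (2 * T), |val v| ≤ 2 ^ Λ := by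
    intro v _
    have h1 : 0 ≤ val v := Shape.entry_nonneg hE0 hh0 _ _
    have h2 : val v ≤ _ := Shape.entry_le hE0 hh0 _ _
    rw [abs_of_nonneg h1]
    refine h2.trans ?_
    simp only
    rw [← logRows_cast, ← hEdef]
    have h3 : 2 * (E + 2) ≤ 2 ^ Λ := by
      have := (Nat.lt_two_pow_self (n := Λ)).le
      omega
    exact_mod_cast h3
  obtain ⟨s', τ, hx, hs', hτ⟩ := H Λ N M f g s (2 ^ (E + 2) * (2 * T)) val hs hsm
    (by
      rw [stdEnv_var_one, ← logRows_cast, ← topScore_cast, ← hEdef, ← hTdef]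
      change 2 ^ min ((E : ℤ) + 2).toNat Λ * (2 * (T : ℤ)) = _
      rw [two_pow_min_toNat (x := E + 2) (by omega) (by push_cast; rfl)]
      push_cast
      rfl) hqueries hvalΛ
    (by
      intro v hv
      rw [stdEnv_var_zero, stdEnv_var_one, ← logRows_cast, ← hEdef]
      change (reductionShape k R w Λ N).entry (storedLeaf Λ (filled g 0 val v (ρ + 1)))
        ((v : ℤ) % 2 ^ min ((E : ℤ) + 2).toNat Λ) ((v : ℤ) / 2 ^ min ((E : ℤ) + 2).toNat Λ) = val v
      rw [two_pow_min_toNat (x := E + 2) (by omega) (by push_cast; rfl), filled_ne (by omega), hval]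
      simp only
      push_cast
      have hJE : adviceBits k R w N + halfSize N = E := rfl
      refine Shape.entry_congr (P := 2 ^ E) (H := 2 ^ halfSize N) ?_ ?_
        (Int.emod_nonneg _ (by positivity)) (fun l hl c' hc' => hleaf l ?_ c' hc') _
      · rw [reductionShape_natCast, mkShape_pow2_add (by omega), hJE]
      · rw [reductionShape_natCast, mkShape_pow2 (by omega)]
      · rw [Nat.le_div_iff_mul_le (by positivity)] at hl
        have h1 : l * 2 ^ halfSize N < 2 ^ adviceBits k R w N * 2 ^ halfSize N := by
          rw [← pow_add, hJE]
          have := Nat.one_le_two_pow (n := E)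
          omega
        exact lt_of_mul_lt_mul_right h1 (Nat.zero_le _))
  refine ⟨s', τ, _, hx, hs', hsm.filled hvalΛ, fun a ha => filled_ne ha, fun z => ?_, ?_⟩
  · simp only [filled, Function.update_self, hg]
    refine if_ctx_congr ?_ (fun hz => ?_) (fun _ => rfl)
    · push_cast; rfl
    · rw [hval]
      simp only [Int.toNat_of_nonneg hz.1]
  · refine hτ.trans ?_
    rw [pow_add (2 * Λ + 2), ← mul_assoc (2 ^ E)]
    refine Nat.mul_le_mul_right _ ?_
    have h1 : 2 ^ (E + 2) * (2 * T) + 1 ≤ 2 ^ E * (8 * T + 1) := by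
      have := Nat.one_le_two_pow (n := E)
      rw [pow_add]
      nlinarith
    refine h1.trans (Nat.mul_le_mul_left _ ?_)
    have h2 : (2 * Λ + 2) * 2 ^ 3 ≤ (2 * Λ + 2) * (2 * Λ + 2) ^ 3 :=
      Nat.mul_le_mul_left _ (Nat.pow_le_pow_left (by omega) 3)
    calc 8 * T + 1 ≤ (2 * Λ + 2) * 2 ^ 3 := by omega
      _ ≤ (2 * Λ + 2) * (2 * Λ + 2) ^ 3 := h2
      _ = (2 * Λ + 2) ^ 4 := by ring

/-- Array `1` receives the value matrix. -/
theorem exists_fill_values : ∃ (p : Program) (c : ℕ), ∀ (Λ N M : ℕ) (f : ℕ → ℤ)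
    (g : ℕ → ℤ → ℤ) (s : State), Ready ρ Λ N M f g s → Small Λ N M g →
    Room k R w N Λ → (∀ z, g 1 z = 0) →
    ∃ s' τ g', Exec p s s' τ ∧ Ready ρ Λ N M f g' s' ∧ Small Λ N M g' ∧
      (∀ a ≠ 1, g' a = g a) ∧ (∀ z, g' 1 z =
        if 2 ^ logRows k R w N ≤ z ∧ z < 2 * 2 ^ logRows k R w N then 1 else 0) ∧
      τ ≤ 2 ^ logRows k R w N * (2 * Λ + 2) ^ c := by
  have hE := (Impl.var 1).logRows k R w
  have hP := (Impl.const 2).powMin hE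
  have he : Impl fun e => if 2 ^ min ((w : ℤ) * ((k + 1) * (e.var 1 / R) + 1) +
      (e.var 1 / 2 + 1)).toNat e.lam ≤ e.var 0 then 1 else 0 :=
    Impl.ite (ImplP.le hP (.var 0)) (.const 1) (.const 0)
  obtain ⟨p, c, H⟩ := exists_fill ρ 1 ((Impl.const 2).mul hP) he
  refine ⟨p, 2 + c, fun Λ N M f g s hs hsm hr hg => ?_⟩
  set E := logRows k R w N with hEdef
  have hrows := hr.rows
  rw [← hEdef] at hrows
  set val : ℕ → ℤ := fun v => if (2 : ℤ) ^ E ≤ v then 1 else 0 with hval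
  have hvalΛ : ∀ v < 2 * 2 ^ E, |val v| ≤ 2 ^ Λ := by
    intro v _
    have : (1 : ℤ) ≤ 2 ^ Λ := one_le_pow₀ (by norm_num)
    rw [hval]
    simp only
    split_ifs <;> simp [this]
  obtain ⟨s', τ, hx, hs', hτ⟩ := H Λ N M f g s (2 * 2 ^ E) val hs hsm
    (by
      rw [stdEnv_var_one, ← logRows_cast, ← hEdef]
      change 2 * 2 ^ min (E : ℤ).toNat Λ = _
      rw [two_pow_min_toNat (x := E) (by omega) rfl]
      push_cast
      rfl)
    (by rw [← pow_succ']; exact Nat.pow_le_pow_right (by norm_num) (by omega)) hvalΛ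
    (by
      intro v hv
      rw [stdEnv_var_zero, stdEnv_var_one, ← logRows_cast, ← hEdef]
      change (if 2 ^ min (E : ℤ).toNat Λ ≤ (v : ℤ) then (1 : ℤ) else 0) = val v
      rw [two_pow_min_toNat (x := E) (by omega) rfl, hval]
      push_cast
      rfl)
  refine ⟨s', τ, _, hx, hs', hsm.filled hvalΛ, fun a ha => filled_ne ha, fun z => ?_, ?_⟩
  · simp only [filled, Function.update_self, hg, hval]
    have hP : (0 : ℤ) < 2 ^ E := by positivity
    push_cast
    by_cases h1 : 0 ≤ z ∧ z < 2 * 2 ^ E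
    · rw [if_pos h1, Int.toNat_of_nonneg h1.1]
      exact if_congr ⟨fun h => ⟨h, h1.2⟩, fun h => h.1⟩ rfl rfl
    · rw [if_neg h1, if_neg]
      rintro ⟨h2, h3⟩
      exact h1 ⟨by linarith, h3⟩
  · refine hτ.trans ?_
    rw [pow_add, ← mul_assoc]
    refine Nat.mul_le_mul_right _ ?_
    have h2 : 2 ^ 2 ≤ (2 * Λ + 2) ^ 2 := Nat.pow_le_pow_left (by omega) 2
    have h3 : 2 ^ E * 2 ^ 2 ≤ 2 ^ E * (2 * Λ + 2) ^ 2 := Nat.mul_le_mul_left _ h2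
    have := Nat.one_le_two_pow (n := E)
    omega

end Fill

section Prologue

variable (ρ k R w : ℕ)

/-- A program that replaces a formula by an instance of self-attention. -/
theorem exists_prologue (hρ : 2 ≤ ρ) : ∃ (p : Program) (c : ℕ), ∀ (Λ N M : ℕ) (f : ℕ → ℤ)
    (g : ℕ → ℤ → ℤ) (s : State), Ready ρ Λ N M f g s → Small Λ N M g → Room k R w N Λ →
    M ≤ (2 * N + 1) ^ k → (∀ z : ℤ, ¬ (0 ≤ z ∧ z < M * k) → g 0 z = 0) → (∀ z, g 1 z = 0) →
    ∃ s' τ, Exec p s s' τ ∧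
      (∀ r < ρ, s'.reg r = Function.update f 0 ((2 ^ (logRows k R w N + 2) : ℕ) : ℤ) r) ∧
      (∀ z, s'.arr 0 z =
        if 0 ≤ z ∧ z < 2 ^ (logRows k R w N + 2) * (2 * topScore k R w N : ℕ) then
          (reductionShape k R w Λ N).entry (leafCodes k R w N Λ (initCodes k N Λ (g 0) M))
            (z % 2 ^ (logRows k R w N + 2)) (z / 2 ^ (logRows k R w N + 2)) else 0) ∧
      (∀ z, s'.arr 1 z =
        if 2 ^ logRows k R w N ≤ z ∧ z < 2 * 2 ^ logRows k R w N then 1 else 0) ∧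
      (∀ a, 2 ≤ a → a < ρ → s'.arr a = g a) ∧
      ParamArray (s'.arr (ρ + 2)) (logRows k R w N) (topScore k R w N) ∧
      τ ≤ 2 ^ logRows k R w N * (2 * Λ + 2) ^ c := by
  obtain ⟨p₁, c₁, H₁⟩ := exists_fill_advice ρ k R w
  obtain ⟨p₂, c₂, H₂⟩ := exists_fill_codes ρ k R w (by omega)
  obtain ⟨p₃, c₃, H₃⟩ := exists_fill_params ρ k R w
  obtain ⟨p₄, c₄, H₄⟩ := exists_clear ρ k R w
  obtain ⟨p₅, c₅, H₅⟩ := exists_fill_queries ρ k R w (by omega)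
  obtain ⟨p₆, c₆, H₆⟩ := exists_fill_values ρ k R w
  obtain ⟨p₇, c₇, H₇⟩ := exists_assign ρ 0 (by omega) ((Impl.const 3).get (ρ + 2))
  refine ⟨.seq p₁ (.seq p₂ (.seq p₃ (.seq p₄ (.seq p₅ (.seq p₆ p₇))))),
    c₁ + (c₂ + (c₃ + (c₄ + (c₅ + (c₆ + c₇ + 1) + 1) + 1) + 1) + 1) + 1, ?_⟩
  intro Λ N M f g s hs hsm hr hM hg0 hg1
  obtain ⟨s₁, τ₁, g₁, x₁, r₁, m₁, a₁, v₁, t₁⟩ := H₁ Λ N M f g s hs hsm hr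
  obtain ⟨s₂, τ₂, g₂, x₂, r₂, m₂, a₂, v₂, t₂⟩ := H₂ Λ N M f g₁ s₁ r₁ m₁ hr v₁
  obtain ⟨s₃, τ₃, g₃, x₃, r₃, m₃, a₃, v₃, t₃⟩ := H₃ Λ N M f g₂ s₂ r₂ m₂ hr
  have hlow : ∀ a < ρ, g₃ a = g a := fun a ha => by
    rw [a₃ a (by omega), a₂ a (by omega), a₁ a (by omega)]
  obtain ⟨s₄, τ₄, g₄, x₄, r₄, m₄, a₄, v₄, t₄⟩ := H₄ Λ N M f g₃ s₃ r₃ m₃ hr hM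
    (by rw [hlow 0 (by omega)]; exact hg0)
  obtain ⟨s₅, τ₅, g₅, x₅, r₅, m₅, a₅, v₅, t₅⟩ := H₅ Λ N M f g₄ s₄
    (leafCodes k R w N Λ (initCodes k N Λ (g 0) M)) r₄ m₄ hr v₄
    (by
      intro l hl c hc
      rw [a₄ _ (by omega), a₃ _ (by omega), v₂ l hl c hc, a₁ 0 (by omega)])
  obtain ⟨s₆, τ₆, g₆, x₆, r₆, m₆, a₆, v₆, t₆⟩ := H₆ Λ N M f g₅ s₅ r₅ m₅ hr
    (by rw [a₅ 1 (by omega), a₄ 1 (by omega), hlow 1 (by omega)]; exact hg1)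
  have hpar : g₆ (ρ + 2) = g₃ (ρ + 2) := by
    rw [a₆ _ (by omega), a₅ _ (by omega), a₄ _ (by omega)]
  have hval : g₆ (ρ + 2) 3 = ((2 ^ (logRows k R w N + 2) : ℕ) : ℤ) := by rw [hpar]; exact v₃.size
  have hrows := hr.rows
  obtain ⟨s₇, τ₇, x₇, r₇, t₇⟩ := H₇ Λ N M f g₆ s₆ r₆ m₆ (by
    change |g₆ (ρ + 2) 3| ≤ _
    rw [hval, Nat.abs_cast]
    exact_mod_cast Nat.pow_le_pow_right (by norm_num) (by omega))
  have hB : (stdEnv Λ g₆ N N M).arr (ρ + 2) 3 = ((2 ^ (logRows k R w N + 2) : ℕ) : ℤ) := hval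
  rw [hB] at r₇
  refine ⟨s₇, _, .seq x₁ (.seq x₂ (.seq x₃ (.seq x₄ (.seq x₅ (.seq x₆ x₇))))), r₇.reg, ?_, ?_, ?_,
    ?_, ?_⟩
  · rw [r₇.arr, a₆ 0 (by omega)]
    exact v₅
  · rw [r₇.arr]
    exact v₆
  · intro a ha haρ
    rw [r₇.arr, a₆ a (by omega), a₅ a (by omega), a₄ a (by omega), hlow a haρ]
  · rw [r₇.arr, hpar]
    exact v₃
  · have hX : 2 ≤ 2 * Λ + 2 := by omega
    have t₇' : τ₇ ≤ 2 ^ logRows k R w N * (2 * Λ + 2) ^ c₇ :=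
      t₇.trans (Nat.le_mul_of_pos_left _ (by positivity))
    exact add_le_mul_pow hX t₁ (add_le_mul_pow hX t₂ (add_le_mul_pow hX t₃ (add_le_mul_pow hX t₄
      (add_le_mul_pow hX t₅ (add_le_mul_pow hX t₆ t₇')))))

/-! ### Setting up the registers, and trying all assignments -/

/-- The range of the loops, for formulas over `N` variables: a multiple of a polynomial that exceeds
the number of codes of clauses. -/
def loopRange (κ k N : ℕ) : ℕ := κ * (2 * N + 1) ^ (k + 1)

variable {k}

theorem le_loopRange {κ N : ℕ} (hκ : 1 ≤ κ) : N ≤ loopRange κ k N ∧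
    (2 * N + 1) ^ k ≤ loopRange κ k N := by
  have h1 : 1 ≤ (2 * N + 1) ^ k := Nat.one_le_pow _ _ (by omega)
  have h2 : (2 * N + 1) ^ (k + 1) ≤ loopRange κ k N := Nat.le_mul_of_pos_left _ hκ
  rw [pow_succ] at h2
  constructor
  · have : 2 * N + 1 ≤ (2 * N + 1) ^ k * (2 * N + 1) := Nat.le_mul_of_pos_left _ h1
    omega
  · exact (Nat.le_mul_of_pos_right _ (by omega)).trans h2

theorem KCNF.input_small {N Λ : ℕ} (φ : KCNF k N) (hN : N ≤ Λ) (hM : (2 * N + 1) ^ k ≤ Λ) :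
    Small Λ N φ.clauses.length φ.input.arr := by
  have hΛ : (Λ : ℤ) ≤ 2 ^ Λ := by exact_mod_cast (Nat.lt_two_pow_self (n := Λ)).le
  have hNΛ : (N : ℤ) ≤ Λ := by exact_mod_cast hN
  have hMΛ : (φ.clauses.length : ℤ) ≤ Λ := by exact_mod_cast φ.length_le.trans hM
  refine ⟨by rw [Nat.abs_cast]; linarith, by rw [Nat.abs_cast]; linarith, fun a z => ?_⟩
  simp only [KCNF.input]
  split_ifs with h
  · obtain ⟨-, h0, h1⟩ := h
    lift z to ℕ using h0
    have h1' : z < φ.clauses.length * k := by exact_mod_cast h1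
    have hk : 0 < k := Nat.pos_of_ne_zero fun h => by simp [h] at h1'
    have h2 : z / k < φ.clauses.length := (Nat.div_lt_iff_lt_mul hk).2 h1'
    have h3 := φ.abs_code_le (r := z % k) h2
    rw [Int.toNat_natCast]
    linarith
  · simp

/-- A program that sets up the registers of the reduction. -/
theorem exists_init (hρ : 2 ≤ ρ) {κ : ℕ} (hκ : 1 ≤ κ) : ∃ (p : Program) (c : ℕ), ∀ (N : ℕ)
    (φ : KCNF k N), ∃ s' τ, Exec p φ.input s' τ ∧
      Ready ρ (loopRange κ k N) N φ.clauses.length (fun _ => 0) φ.input.arr s' ∧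
      τ ≤ (2 * loopRange κ k N + 2) ^ c := by
  obtain ⟨e, he⟩ : Impl fun e => (κ : ℤ) * (2 * e.var 0 + 1) ^ (k + 1) :=
    (Impl.const κ).mul ((((Impl.const 2).mul (.var 0)).add (.const 1)).npow _)
  obtain ⟨c, hc⟩ := e.exec_compile
  refine ⟨.seq (.assign ρ (.reg 0)) (.seq (.assign (ρ + 1) (.reg 1)) (.seq (.assign 0 (.const 0))
    (.seq (.assign 1 (.const 0)) (.seq (e.compile ρ (fun _ => ρ) (ρ + 4))
      (.assign (ρ + 2) (.reg (ρ + 4))))))), 1 + 1 + c + 5, fun N φ => ?_⟩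
  set Λ := loopRange κ k N with hΛ
  obtain ⟨hNΛ, hMΛ⟩ := le_loopRange (k := k) (N := N) hκ
  rw [← hΛ] at hNΛ hMΛ
  have hsm := φ.input_small hNΛ hMΛ
  set s₁ := (((φ.input.setReg ρ N).setReg (ρ + 1) φ.clauses.length).setReg 0 0).setReg 1 0 with hs₁
  have h10 : (1 : ℕ) ≠ ρ := by omega
  have h00 : (0 : ℕ) ≠ ρ := by omega
  have e1 : (φ.input.setReg ρ N).reg 1 = φ.clauses.length := by
    simp [State.setReg, h10, KCNF.input]
  have hρ₁ : s₁.reg ρ = N := by simp [hs₁, State.setReg, h10.symm, h00.symm]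
  obtain ⟨s₂, τ, hx, hev, hτ⟩ := hc ρ N Λ (fun _ => ρ) (ρ + 4) s₁ hρ₁ (by omega)
    (fun _ => by omega) ⟨by
      change N ≤ 2 ^ Λ
      exact hNΛ.trans Nat.lt_two_pow_self.le, hsm.arr, fun _ => by
      change |s₁.reg ρ| ≤ 2 ^ Λ
      rw [hρ₁]; exact hsm.N⟩
  have hden : e.den (s₁.env N fun _ => ρ) = Λ := by
    rw [he]
    change (κ : ℤ) * (2 * s₁.reg ρ + 1) ^ (k + 1) = Λ
    rw [hρ₁, hΛ, loopRange]
    push_cast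
    rfl
  rw [hden] at hev
  have x₁ : Exec (.assign ρ (.reg 0)) φ.input (φ.input.setReg ρ N) (bitCost N + 1) :=
    Exec.assign φ.input ρ (.reg 0)
  have x₂ : Exec (.assign (ρ + 1) (.reg 1)) (φ.input.setReg ρ N)
      ((φ.input.setReg ρ N).setReg (ρ + 1) φ.clauses.length) (bitCost φ.clauses.length + 1) := by
    have h := Exec.assign (φ.input.setReg ρ N) (ρ + 1) (.reg 1)
    simp only [Expr.eval, Expr.cost, e1] at h
    exact h
  have x₃ : Exec (.assign 0 (.const 0)) _ _ 2 :=
    Exec.assign ((φ.input.setReg ρ N).setReg (ρ + 1) φ.clauses.length) 0 (.const 0)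
  have x₄ : Exec (.assign 1 (.const 0)) _ s₁ 2 := Exec.assign _ 1 (.const 0)
  have hx' := x₁.seq (x₂.seq (x₃.seq (x₄.seq (hx.seq (.assign _ (ρ + 2) (.reg (ρ + 4)))))))
  refine ⟨_, _, hx', ⟨fun r hr => ?_, ?_, ?_, ?_, ?_⟩, ?_⟩
  · have h1 : r ≠ ρ + 2 := by omega
    have h2 : r ≠ ρ + 1 := by omega
    have h3 : r ≠ ρ := by omega
    simp only [State.setReg, Function.update_of_ne h1]
    rw [hev.reg r (by omega)]
    by_cases h4 : r = 1
    · simp [hs₁, State.setReg, h4]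
    · by_cases h5 : r = 0
      · simp [hs₁, State.setReg, h5]
      · simp [hs₁, State.setReg, h2, h3, h4, h5, KCNF.input]
  · simp [State.setReg, hev.reg ρ (by omega), hρ₁]
  · have : s₁.reg (ρ + 1) = φ.clauses.length := by
      have h2 : (ρ + 1) ≠ 0 := by omega
      simp [hs₁, State.setReg, h00.symm]
    simp [State.setReg, hev.reg (ρ + 1) (by omega), this]
  · simp [State.setReg, Expr.eval, hev.result]
  · exact hev.arr
  · have c1 := bitCost_le_of_abs_le hsm.N
    have c2 := bitCost_le_of_abs_le hsm.M
    have c3 : bitCost (Λ : ℤ) ≤ Λ + 2 := bitCost_natCast_le Nat.lt_two_pow_self.le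
    simp only [Expr.cost, hev.result]
    have h1 : τ ≤ (2 * Λ + 2) ^ c := hτ.trans (Nat.pow_le_pow_left (by omega) c)
    have h2 := sum_three_pow_le (X := 2 * Λ + 2) (a := 1) (b := 1) (c := c) (m := 8) (by omega)
      le_rfl
    rw [pow_one] at h2
    have h3 : 1 ≤ Λ := (Nat.one_le_pow _ _ (by omega)).trans hMΛ
    omega

/-- For few variables, all assignments are tried. -/
theorem exists_bruteForce (hρ : 1 ≤ ρ) : ∃ (p : Program) (c : ℕ), ∀ (Λ N : ℕ) (φ : KCNF k N)
    (f : ℕ → ℤ) (s : State), Ready ρ Λ N φ.clauses.length f φ.input.arr s → N ≤ Λ →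
    (2 * N + 1) ^ k ≤ Λ → 2 ^ N ≤ Λ →
    ∃ s' τ, Exec p s s' τ ∧ (s'.reg 0 ≠ 0 ↔ φ.Satisfiable) ∧ τ ≤ (2 * Λ + 2) ^ c := by
  classical
  have hP : Impl fun e => 2 ^ min (e.var 1).toNat e.lam := (Impl.const 2).powMin (.var 1)
  have hB : Impl fun e => if ∃ a < e.lam, ((a : ℕ) : ℤ) < 2 ^ min (e.var 1).toNat e.lam ∧
      ∃ b < e.lam, ((b : ℕ) : ℤ) < 2 ^ min (e.var 1).toNat e.lam ∧
      ∀ c < e.lam, initCodes k (e.var 1) e.lam (e.arr 0) (e.var 2) (c : ℕ) →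
        ¬ ∀ z ∈ decode k (e.var 1) (c : ℕ), ¬ TrueUnder e.lam (e.var 1) (a : ℕ) (b : ℕ) z
      then 1 else 0 :=
    Impl.ite (ImplP.exists_lt (p := fun e a => a < 2 ^ min (e.var 1).toNat e.lam ∧
      ∃ b < e.lam, ((b : ℕ) : ℤ) < 2 ^ min (e.var 1).toNat e.lam ∧
      ∀ c < e.lam, initCodes k (e.var 1) e.lam (e.arr 0) (e.var 2) (c : ℕ) →
        ¬ ∀ z ∈ decode k (e.var 1) (c : ℕ), ¬ TrueUnder e.lam (e.var 1) a (b : ℕ) z)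
      ((ImplP.lt (.var 0) hP.pop).and (ImplP.exists_lt (p := fun e b =>
        b < 2 ^ min (e.var 2).toNat e.lam ∧
        ∀ c < e.lam, initCodes k (e.var 2) e.lam (e.arr 0) (e.var 3) (c : ℕ) →
          ¬ ∀ z ∈ decode k (e.var 2) (c : ℕ), ¬ TrueUnder e.lam (e.var 2) (e.var 0) b z)
        ((ImplP.lt (.var 0) hP.pop.pop).and (ImplP.forall_lt (p := fun e c =>
          initCodes k (e.var 3) e.lam (e.arr 0) (e.var 4) c →
          ¬ ∀ z ∈ decode k (e.var 3) c, ¬ TrueUnder e.lam (e.var 3) (e.var 1) (e.var 0) z)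
          ((ImplP.initCodes 0 (.var 4) (.var 5) (.var 0)).imp
            (ImplP.forall_mem_decode (p := fun e z =>
              ¬ TrueUnder e.lam (e.var 4) (e.var 2) (e.var 1) z) (.var 4) (.var 0) fun _ hz =>
              ((ImplP.trueOn (.const 0) (.var 4) (.var 2) hz).or
                (ImplP.trueOn (.var 4) (.var 4) (.var 1) hz)).not).not)))))) (.const 1) (.const 0)
  obtain ⟨p, c, H⟩ := exists_assign ρ 0 hρ hB
  refine ⟨p, c, fun Λ N φ f s hs hN hM hΛ => ?_⟩
  set b := (if ∃ a < Λ, ((a : ℕ) : ℤ) < 2 ^ min (N : ℤ).toNat Λ ∧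
      ∃ b < Λ, ((b : ℕ) : ℤ) < 2 ^ min (N : ℤ).toNat Λ ∧
      ∀ c < Λ, initCodes k N Λ (φ.input.arr 0) φ.clauses.length (c : ℕ) →
        ¬ ∀ z ∈ decode k (N : ℤ) (c : ℕ), ¬ TrueUnder Λ (N : ℤ) (a : ℕ) (b : ℕ) z
      then 1 else 0 : ℤ) with hb
  obtain ⟨s', τ, hx, hs', hτ⟩ := H Λ N φ.clauses.length f φ.input.arr s hs (φ.input_small hN hM) (by
    change |b| ≤ 2 ^ Λ
    have : (1 : ℤ) ≤ 2 ^ Λ := one_le_pow₀ (by norm_num)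
    rw [hb]
    split_ifs <;> simp [this])
  refine ⟨s', τ, hx, ?_, hτ⟩
  have hreg : s'.reg 0 = b := by
    rw [hs'.reg 0 (by omega), Function.update_self]
    rfl
  rw [hreg, hb, satisfiable_iff_hits φ hM hN (h := N) (by omega), two_pow_min_toNat hN rfl]
  have hHits : ∀ a b : ℕ, Hits (TrueUnder Λ (N : ℕ) (a : ℕ) (b : ℕ))
      (familyOf k N Λ (initCodes k N Λ (φ.input.arr 0) φ.clauses.length)) ↔
      ∀ c < Λ, initCodes k N Λ (φ.input.arr 0) φ.clauses.length (c : ℕ) →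
        ¬ ∀ z ∈ decode k (N : ℤ) (c : ℕ), ¬ TrueUnder Λ (N : ℤ) (a : ℕ) (b : ℕ) z := by
    intro a b
    constructor
    · intro h c hc hcc hno
      obtain ⟨z, hz, ht⟩ := h _ (mem_familyOf.2 ⟨c, hc, hcc, rfl⟩)
      exact hno z hz ht
    · intro h C hC
      obtain ⟨c, hc, hcc, rfl⟩ := mem_familyOf.1 hC
      have := h c hc hcc
      push Not at this
      exact this
  simp only [← hHits]
  rw [ne_eq, ite_eq_right_iff, Classical.not_imp]
  constructor
  · rintro ⟨⟨a, -, ha, b, -, hb, h⟩, -⟩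
    exact ⟨a, by exact_mod_cast ha, b, by exact_mod_cast hb, h⟩
  · rintro ⟨a, ha, b, hb, h⟩
    exact ⟨⟨a, by omega, by exact_mod_cast ha, b, by omega, by exact_mod_cast hb, h⟩, one_ne_zero⟩

end Prologue

/-! ### Reading the output of an algorithm for self-attention -/

theorem bitCost_binOp_le (o : BinOp) (x y : ℤ) :
    bitCost (o.eval x y) ≤ bitCost x + bitCost y + 3 := by
  have := bitCost_le_of_abs_le (abs_binOp_eval_le (o := o) (abs_le_two_pow_bitCost x)
    (abs_le_two_pow_bitCost y))
  omega

/-- All constants, registers and cells that the expression reads have cost at most `B`. -/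
def Expr.LeavesBounded (s : State) (B : ℕ) : Expr → Prop
  | .const z => bitCost z ≤ B
  | .reg r => bitCost (s.reg r) ≤ B
  | .get a idx => idx.LeavesBounded s B ∧ bitCost (s.arr a (idx.eval s)) ≤ B
  | .op _ e₁ e₂ => e₁.LeavesBounded s B ∧ e₂.LeavesBounded s B

/-- The number of nodes of an expression. -/
def Expr.nodes : Expr → ℕ
  | .const _ => 1
  | .reg _ => 1
  | .get _ idx => idx.nodes + 1
  | .op _ e₁ e₂ => e₁.nodes + e₂.nodes + 1

theorem Expr.bitCost_eval_le {s : State} {B : ℕ} : ∀ {e : Expr}, e.LeavesBounded s B →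
    bitCost (e.eval s) ≤ e.nodes * (B + 3)
  | .const _, h => by simp only [Expr.LeavesBounded, Expr.eval, Expr.nodes] at *; omega
  | .reg _, h => by simp only [Expr.LeavesBounded, Expr.eval, Expr.nodes] at *; omega
  | .get _ _, h => by
    have := h.2
    simp only [Expr.eval, Expr.nodes] at *
    nlinarith
  | .op o e₁ e₂, h => by
    have h1 := Expr.bitCost_eval_le h.1
    have h2 := Expr.bitCost_eval_le h.2
    have h3 := bitCost_binOp_le o (e₁.eval s) (e₂.eval s)
    simp only [Expr.eval, Expr.nodes]
    nlinarith

theorem Expr.cost_le {s : State} {B : ℕ} : ∀ {e : Expr}, e.LeavesBounded s B →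
    e.cost s ≤ e.nodes ^ 2 * (B + 3)
  | .const _, h => by simp only [Expr.LeavesBounded, Expr.cost, Expr.nodes] at *; omega
  | .reg _, h => by simp only [Expr.LeavesBounded, Expr.cost, Expr.nodes] at *; omega
  | .get _ idx, h => by
    have h1 := Expr.cost_le h.1
    have h2 := h.2
    simp only [Expr.cost, Expr.nodes]
    have h3 : (idx.nodes + 1) ^ 2 * (B + 3) =
      idx.nodes ^ 2 * (B + 3) + (2 * idx.nodes) * (B + 3) + (B + 3) := by ring
    omega
  | .op o e₁ e₂, h => by
    have h1 := Expr.cost_le h.1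
    have h2 := Expr.cost_le h.2
    have h3 := Expr.bitCost_eval_le (e := .op o e₁ e₂) h
    simp only [Expr.cost, Expr.nodes] at *
    simp only [Expr.eval] at h3
    have h4 : (e₁.nodes + e₂.nodes + 1) ^ 2 * (B + 3) = e₁.nodes ^ 2 * (B + 3) +
      e₂.nodes ^ 2 * (B + 3) + (e₁.nodes + e₂.nodes + 1) * (B + 3) +
      (2 * e₁.nodes * e₂.nodes + e₁.nodes + e₂.nodes) * (B + 3) := by ring
    omega

/-- A sum of costs along the first cells of an array that was empty at the beginning. -/
theorem Exec.sum_range_bitCost_le {p : Program} {s s' : State} {t : ℕ} (h : Exec p s s' t) {a : ℕ}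
    (ha : ∀ z, s.arr a z = 0) (n : ℕ) :
    ∑ i ∈ Finset.range n, bitCost (s'.arr a i) ≤ n + t := by
  have h1 := h.sum_bitCost_arr_le a ((Finset.range n).map ⟨Nat.cast, Nat.cast_injective⟩)
  rw [Finset.sum_map, Finset.sum_map] at h1
  have h2 : ∀ z : ℤ, bitCost (s.arr a z) = 1 := fun z => by rw [ha]; decide
  simp only [h2, Finset.sum_const, Finset.card_range, smul_eq_mul, mul_one] at h1
  exact h1

theorem bitCost_le_add {p : Program} {s s' : State} {t : ℕ} (h : Exec p s s' t) {a : ℕ}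
    (ha : ∀ z, s.arr a z = 0) (z : ℤ) : bitCost (s'.arr a z) ≤ t + 1 := by
  have h1 := h.sum_bitCost_arr_le a {z}
  have h2 : bitCost (s.arr a z) = 1 := by rw [ha]; decide
  simp only [Finset.sum_singleton, h2] at h1
  omega

/-- From the answers of an algorithm to suitable instances, another program finds out whether the
greatest possible score occurs, in a time that is not much longer than that of the algorithm. -/
def RecoversTopScore (d dv : ℕ → ℕ)
    (Holds : {n m : ℕ} → State → Matrix (Fin n) (Fin m) ℝ → Prop)
    (Rel : {n m : ℕ} → Matrix (Fin n) (Fin m) ℝ → Matrix (Fin n) (Fin m) ℝ → Prop) : Prop :=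
  ∀ ρ, 6 ≤ ρ → ∃ (q : Program) (c E₀ : ℕ), ∀ (E T : ℕ), E₀ ≤ E → 1 ≤ T →
    ∀ (x : AttentionInstance (2 ^ (E + 2)) (d (2 ^ (E + 2))) (dv (2 ^ (E + 2))))
      (hdv : 0 < dv (2 ^ (E + 2))) (g : ℕ → ℕ → ℕ), (∀ i b, g i b ≤ T) →
      (∀ i : Fin (2 ^ (E + 2)), (i : ℕ) < 2 ^ E → x.Y i ⟨0, hdv⟩ = rowSum E (g i)) →
      (∀ i : Fin (2 ^ (E + 2)), (i : ℕ) = 2 * 2 ^ E →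
        x.Y i ⟨0, hdv⟩ = 2 ^ E * Real.exp ((2 * (E + 2) * T : ℕ) : ℝ)) →
      ∀ (p : Program) (s u : State) (t : ℕ), Exec p x.input s t →
        (∃ Yhat : Matrix (Fin (2 ^ (E + 2))) (Fin (dv (2 ^ (E + 2)))) ℝ,
          Holds s Yhat ∧ Rel Yhat x.Y) →
        s.AgreeBelow ρ u → ParamArray (u.arr (ρ + 2)) E T →
        ∃ u' τ, Exec q u u' τ ∧ (u'.reg 0 ≠ 0 ↔ ∃ i < 2 ^ E, ∃ b < 2 ^ E, g i b = T) ∧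
          τ ≤ (t + 2 ^ E) * (E + T + t.size + 2) ^ c

theorem mul_le_mul_two_pow {P X K m : ℕ} (hX : 2 ≤ X) :
    K * (P * X ^ m) ≤ P * X ^ (K + m) := by
  have h1 : K ≤ X ^ K := (Nat.lt_pow_self (by omega)).le
  calc K * (P * X ^ m) = P * (K * X ^ m) := by ring
    _ ≤ P * (X ^ K * X ^ m) := Nat.mul_le_mul_left _ (Nat.mul_le_mul_right _ h1)
    _ = P * X ^ (K + m) := by rw [pow_add]

section Rational

theorem threshold_bounds {E T X : ℕ} (h1 : E + 2 ≤ X) (h2 : T ≤ X) :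
    E + 4 ≤ 2 * X ^ 2 ∧ 1 + E + 2 * (2 * (E + 2) * T) + 2 ≤ 20 * X ^ 2 ∧ 2 * X ≤ X ^ 2 := by
  have h3 := Nat.mul_le_mul h1 h2
  have h4 : 2 * (2 * (E + 2) * T) = 4 * ((E + 2) * T) := by ring
  have h5 : 2 * X ≤ X * X := Nat.mul_le_mul_right _ (by omega)
  rw [h4, sq]
  generalize (E + 2) * T = y at *
  generalize X * X = z at *
  omega

/-- The number of rows found so far, updated by the comparison of the row whose index is in
register `ρ` with the calibrating row, whose value is in register `ρ + 2`. -/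
def compareStep (ρ c : ℕ) : Expr :=
  .op .add (.reg 0) (.op .sub (.const 1) (.op .lt
    (.op .mul (.op .mul (.const c) (.get (ρ + 2) (.const 3))) (.get 2 (.reg ρ)))
    (.op .mul (.reg (ρ + 2)) (.get 3 (.reg ρ)))))

theorem compareStep_eval {ρ c E T i m : ℕ} {W : ℤ} {v : State}
    (hpar : ParamArray (v.arr (ρ + 2)) E T) (h0 : v.reg 0 = m) (h1 : v.reg (ρ + 2) = W)
    (h3 : v.reg ρ = i) :
    (compareStep ρ c).eval v = m + if W * v.arr 3 (i : ℕ) ≤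
      c * (2 ^ (E + 2) : ℕ) * v.arr 2 (i : ℕ) then 1 else 0 := by
  simp only [compareStep, Expr.eval, BinOp.eval, h0, h1, h3, hpar.size]
  by_cases hle : W * v.arr 3 (i : ℕ) ≤ c * (2 ^ (E + 2) : ℕ) * v.arr 2 (i : ℕ)
  · rw [if_pos hle, if_neg (not_lt.2 hle)]
    ring
  · rw [if_neg hle, if_pos (not_le.1 hle)]
    ring

theorem compareStep_cost_le {ρ c E T i m X : ℕ} {W : ℤ} {v : State}
    (hpar : ParamArray (v.arr (ρ + 2)) E T) (h0 : v.reg 0 = m) (h1 : v.reg (ρ + 2) = W)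
    (h3 : v.reg ρ = i) (hi : i ≤ 2 ^ E) (hm : m ≤ 2 ^ E)
    (hW : |W| ≤ 2 ^ (1 + E + 2 * (2 * (E + 2) * T))) (hX1 : E + 2 ≤ X) (hX2 : T ≤ X) :
    (compareStep ρ c).cost v ≤ 256 * (bitCost (v.arr 2 i) + bitCost (v.arr 3 i) + bitCost c +
      20 * X ^ 2 + 3) := by
  have hbi : bitCost (i : ℤ) ≤ E + 2 := bitCost_natCast_le hi
  have hbm : bitCost (m : ℤ) ≤ E + 2 := bitCost_natCast_le hm
  have hbn : bitCost ((2 ^ (E + 2) : ℕ) : ℤ) ≤ E + 4 := bitCost_natCast_le le_rfl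
  have hbW := bitCost_le_of_abs_le hW
  have b1 : bitCost 1 = 2 := by decide
  have b3 : bitCost 3 = 3 := by decide
  obtain ⟨hX3, hX4, -⟩ := threshold_bounds hX1 hX2
  have hX5 : 4 ≤ 20 * X ^ 2 := by omega
  have hnodes : (compareStep ρ c).nodes ^ 2 = 256 := by simp [compareStep, Expr.nodes]
  rw [← hnodes]
  refine Expr.cost_le ?_
  simp only [compareStep, Expr.LeavesBounded, Expr.eval, h0, h1, h3, hpar.size, b1, b3]
  refine ⟨?_, ?_, ⟨⟨?_, ?_, ?_⟩, ?_, ?_⟩, ?_, ?_, ?_⟩ <;> omega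

/-- The program that evaluates a rational output: it compares the rows of the first halves with the
calibrating row, which is row `2 * 2 ^ E`. A row with the approximation `p / q` is counted if
`W * q ≤ c * n * p`, where `W` is the integer part of the approximation in the calibrating row. -/
def compareRows (ρ c : ℕ) : Program :=
  .seq (.assign (ρ + 1) (.get (ρ + 2) (.const 0)))
  (.seq (.assign (ρ + 2) (.op .div (.get 2 (.op .mul (.const 2) (.reg (ρ + 1))))
    (.get 3 (.op .mul (.const 2) (.reg (ρ + 1))))))
  (.seq (.assign 0 (.const 0))
  (forLoop ρ (ρ + 1) (.assign 0 (compareStep ρ c)))))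

theorem compareRows_time_le {P t bc E X c₂ τ S : ℕ} (hP : 1 ≤ P) (hX : E + 2 ≤ X)
    (hX2 : 2 * X ≤ X ^ 2) (hc₂ : c₂ ≤ 81 * (t + E + 6)) (hτ : τ ≤ S + (P + 1) * (4 * E + 20))
    (hS : S ≤ 256 * (2 * (P + t) + P * (bc + 20 * X ^ 2 + 3)) + P) :
    1 + (E + 2) + 1 + (c₂ + 1 + (2 + τ)) ≤ (20000 * (bc + 2)) * ((t + P) * X ^ 2) := by
  have hX3 : 4 ≤ X ^ 2 := by omega
  generalize X ^ 2 = Z at *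
  have h1 : P * 4 ≤ P * Z := Nat.mul_le_mul_left _ hX3
  have h2 : t * 4 ≤ t * Z := Nat.mul_le_mul_left _ hX3
  have h3 : (P + 1) * (4 * E + 20) ≤ (2 * P) * (12 * Z) := Nat.mul_le_mul (by omega) (by omega)
  have h4 : P * (bc + 20 * Z + 3) ≤ P * ((bc + 21) * Z) := by
    refine Nat.mul_le_mul_left _ ?_
    have : bc * 4 ≤ bc * Z := Nat.mul_le_mul_left _ hX3
    have h : (bc + 21) * Z = bc * Z + 21 * Z := by ring
    rw [h]
    omega
  have h5 : 1 * Z ≤ P * Z := Nat.mul_le_mul_right _ hP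
  have h6 : (20000 * (bc + 2)) * ((t + P) * Z) = 20000 * (bc * (t * Z)) + 20000 * (bc * (P * Z)) +
    40000 * (t * Z) + 40000 * (P * Z) := by ring
  have h7 : P * ((bc + 21) * Z) = bc * (P * Z) + 21 * (P * Z) := by ring
  have h8 : 2 * P * (12 * Z) = 24 * (P * Z) := by ring
  rw [h6]
  rw [h7] at h4
  rw [h8] at h3
  generalize P * (bc + 20 * Z + 3) = y1 at *
  generalize (P + 1) * (4 * E + 20) = y2 at *
  generalize bc * (t * Z) = y3 at *
  generalize bc * (P * Z) = y4 at *
  omega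

theorem exec_compareRows (ρ c : ℕ) (hρ : 6 ≤ ρ) {E T t : ℕ} {x u : State} {p : Program} {s : State}
    (hx : Exec p x s t) (hx2 : ∀ z, x.arr 2 z = 0) (hx3 : ∀ z, x.arr 3 z = 0)
    (hu : s.AgreeBelow ρ u) (hpar : ParamArray (u.arr (ρ + 2)) E T)
    (hw : |s.arr 2 (2 * 2 ^ E) / s.arr 3 (2 * 2 ^ E)| ≤ 2 ^ (1 + E + 2 * (2 * (E + 2) * T))) :
    ∃ u' τ, Exec (compareRows ρ c) u u' τ ∧
      (u'.reg 0 ≠ 0 ↔ ∃ i < 2 ^ E, s.arr 2 (2 * 2 ^ E) / s.arr 3 (2 * 2 ^ E) *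
        s.arr 3 (i : ℕ) ≤ c * 2 ^ (E + 2) * s.arr 2 (i : ℕ)) ∧
      τ ≤ (20000 * (bitCost c + 2)) * ((t + 2 ^ E) * (E + T + t.size + 2) ^ 2) := by
  set P := 2 ^ E with hP
  set X := E + T + t.size + 2 with hX
  have hPz : (2 : ℤ) ^ E = (P : ℤ) := by rw [hP]; push_cast; rfl
  rw [hPz] at hw ⊢
  set W := s.arr 2 (2 * P) / s.arr 3 (2 * P) with hW
  have hnz : (2 : ℤ) ^ (E + 2) = ((2 ^ (E + 2) : ℕ) : ℤ) := by push_cast; rfl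
  rw [hnz]
  have hu2 : u.arr 2 = s.arr 2 := (hu.2 2 (by omega)).symm
  have hu3 : u.arr 3 = s.arr 3 := (hu.2 3 (by omega)).symm
  have b0 : bitCost 0 = 1 := by decide
  have b2 : bitCost 2 = 3 := by decide
  have hbP : bitCost (P : ℤ) ≤ E + 2 := bitCost_natCast_le le_rfl
  have hX1 : E + 2 ≤ X := by omega
  have hX2 : T ≤ X := by omega
  -- the initial assignments
  set u₁ := u.setReg (ρ + 1) P with hu₁
  have x₁ : Exec (.assign (ρ + 1) (.get (ρ + 2) (.const 0))) u u₁ (1 + bitCost (P : ℤ) + 1) := by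
    have h := Exec.assign u (ρ + 1) (.get (ρ + 2) (.const 0))
    simp only [Expr.eval, Expr.cost, hpar.rows, b0] at h
    exact h
  have hu₁P : u₁.reg (ρ + 1) = P := by simp [hu₁, State.setReg]
  set u₂ := u₁.setReg (ρ + 2) W with hu₂
  have hev : (Expr.op .div (.get 2 (.op .mul (.const 2) (.reg (ρ + 1))))
      (.get 3 (.op .mul (.const 2) (.reg (ρ + 1))))).eval u₁ = W := by
    simp only [Expr.eval, BinOp.eval, hu₁P]
    rw [hW, ← hu2, ← hu3]
    rfl
  have x₂ := Exec.assign u₁ (ρ + 2) (.op .div (.get 2 (.op .mul (.const 2) (.reg (ρ + 1))))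
      (.get 3 (.op .mul (.const 2) (.reg (ρ + 1)))))
  rw [hev] at x₂
  have c₂ := Expr.cost_le (s := u₁) (B := t + E + 3)
    (e := .op .div (.get 2 (.op .mul (.const 2) (.reg (ρ + 1))))
      (.get 3 (.op .mul (.const 2) (.reg (ρ + 1))))) (by
      have h2 : u₁.arr 2 = s.arr 2 := hu2
      have h3 : u₁.arr 3 = s.arr 3 := hu3
      have h4 := bitCost_le_add hx hx2 (2 * P)
      have h5 := bitCost_le_add hx hx3 (2 * P)
      simp only [Expr.LeavesBounded, Expr.eval, BinOp.eval, hu₁P, h2, h3, b2]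
      clear_value P
      refine ⟨⟨⟨?_, ?_⟩, ?_⟩, ⟨?_, ?_⟩, ?_⟩ <;> omega)
  set u₃ := u₂.setReg 0 0 with hu₃
  have x₃ : Exec (.assign 0 (.const 0)) u₂ u₃ 2 := Exec.assign u₂ 0 (.const 0)
  -- the loop counts the rows that pass the comparison
  have hρ0 : (0 : ℕ) ≠ ρ := by omega
  have hu₃P : u₃.reg (ρ + 1) = P := by simp [hu₃, hu₂, State.setReg, hu₁P]
  have hu₃W : u₃.reg (ρ + 2) = W := by simp [hu₃, hu₂, State.setReg]
  have hu₃arr : u₃.arr = u.arr := rfl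
  set cnt : ℕ → ℕ := fun i => ((Finset.range i).filter fun j : ℕ =>
    W * s.arr 3 (j : ℕ) ≤ c * (2 ^ (E + 2) : ℕ) * s.arr 2 (j : ℕ)).card with hcnt
  have hcntle : ∀ i, cnt i ≤ i := fun i => (Finset.card_filter_le _ _).trans (by simp)
  have hcnts : ∀ i, cnt (i + 1) = cnt i + if W * s.arr 3 (i : ℕ) ≤
      c * (2 ^ (E + 2) : ℕ) * s.arr 2 (i : ℕ) then 1 else 0 := by
    intro i
    simp only [hcnt, Finset.range_add_one, Finset.filter_insert]
    split_ifs
    · rw [Finset.card_insert_of_notMem (by simp)]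
    · rfl
  set B : ℕ → ℕ := fun i => bitCost (s.arr 2 i) + bitCost (s.arr 3 i) + bitCost c + 20 * X ^ 2
    with hB
  obtain ⟨u', τ, hxl, hI, hτ⟩ := exec_forLoop (ri := ρ) (rn := ρ + 1) (s := u₃) P E le_rfl
    (p := .assign 0 (compareStep ρ c))
    (fun i v => v.reg 0 = cnt i ∧ v.reg (ρ + 2) = W ∧ v.arr = u.arr)
    (fun i => 256 * (B i + 3) + 1) (by omega) hu₃P
    ⟨by simp [hu₃, State.setReg, hρ0, hcnt], by simp [State.setReg, hu₃W], hu₃arr⟩ (by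
      rintro i hi v ⟨h0, h1, h2⟩ h3 h4
      rw [← h2] at hpar hu2 hu3
      refine ⟨_, _, .assign _ _ _, ?_, ?_, ⟨?_, ?_, ?_⟩, ?_⟩
      · simp [State.setReg, hρ0.symm, h3]
      · simp [State.setReg, h4]
      · simp only [State.setReg, Function.update_of_ne hρ0, Function.update_self]
        rw [compareStep_eval hpar h0 h1 h3, hcnts, hu2, hu3]
        push_cast
        rfl
      · simp [State.setReg, h1]
      · exact h2
      · have h5 := compareStep_cost_le (c := c) hpar h0 h1 h3 hi.le ((hcntle i).trans hi.le) hw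
          hX1 hX2
        rw [hu2, hu3] at h5
        exact Nat.add_le_add_right h5 1)
  refine ⟨u', _, x₁.seq (x₂.seq (x₃.seq hxl)), ?_, ?_⟩
  · rw [hI.1, hcnt]
    simp only [ne_eq, Nat.cast_eq_zero, Finset.card_eq_zero, Finset.filter_eq_empty_iff]
    push Not
    simp
  · have hsum : ∑ i ∈ Finset.range P, (256 * (B i + 3) + 1) ≤
        256 * (2 * (P + t) + P * (bitCost c + 20 * X ^ 2 + 3)) + P := by
      have h2 := hx.sum_range_bitCost_le hx2 P
      have h3 := hx.sum_range_bitCost_le hx3 P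
      rw [Finset.sum_add_distrib, ← Finset.mul_sum]
      simp only [hB, Finset.sum_add_distrib, Finset.sum_const, Finset.card_range, smul_eq_mul,
        mul_one]
      have h4 : P * bitCost c + P * (20 * X ^ 2) + P * 3 = P * (bitCost c + 20 * X ^ 2 + 3) := by
        ring
      omega
    simp only [Expr.nodes] at c₂
    have hX3 := (threshold_bounds hX1 hX2).2.2
    have h := compareRows_time_le Nat.one_le_two_pow hX1 hX3 c₂ hτ hsum
    exact le_trans (by omega) h

end Rational

theorem AttentionInstance.input_arr_eq_zero {n d dv : ℕ} (x : AttentionInstance n d dv) {a : ℕ}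
    (ha : 2 ≤ a) (z : ℤ) : x.input.arr a z = 0 := by
  simp only [AttentionInstance.input]
  rw [if_neg (by omega), if_neg (by omega)]

/-- Rational approximations with a relative error less than one tell the rows that contain the
greatest possible score. -/
theorem recoversTopScore_rational {d dv : ℕ → ℕ}
    {Rel : {n m : ℕ} → Matrix (Fin n) (Fin m) ℝ → Matrix (Fin n) (Fin m) ℝ → Prop} {μ : ℝ} {E₁ : ℕ}
    (hμ : 0 ≤ μ) (hμ1 : μ < 1)
    (hRel : ∀ {E n m : ℕ} {Yhat Y : Matrix (Fin n) (Fin m) ℝ}, E₁ ≤ E → Rel Yhat Y →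
      ∀ i j, (2 : ℝ) ^ E ≤ Y i j → |Yhat i j - Y i j| ≤ μ * Y i j) :
    RecoversTopScore d dv HoldsRational Rel := by
  intro ρ hρ
  have hμ' : 0 < 1 - μ := by linarith
  -- `c` is so large that the rows with the score `T` pass the test, and the size is so large that
  -- all other rows fail
  obtain ⟨c, hc⟩ := exists_nat_ge ((1 + μ) / (4 * (1 - μ)))
  obtain ⟨E₂, hE₂⟩ := pow_unbounded_of_one_lt (4 * c * (1 + μ) / (1 - μ)) one_lt_two
  refine ⟨compareRows ρ c, 20000 * (bitCost c + 2) + 2, max E₁ E₂, ?_⟩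
  intro E T hE hT x hdv g hg hY hY' p s u t hx hout hu hpar
  obtain ⟨Yhat, hh, hrel⟩ := hout
  have hc1 : 1 + μ ≤ 4 * c * (1 - μ) := by
    rw [div_le_iff₀ (by positivity)] at hc
    linarith
  have hc2 : 4 * c * (1 + μ) ≤ 2 ^ (E + 2) * (1 - μ) := by
    rw [div_lt_iff₀ hμ'] at hE₂
    have : (2 : ℝ) ^ E₂ ≤ 2 ^ (E + 2) := pow_le_pow_right₀ one_le_two (by omega)
    nlinarith
  have hn : (2 : ℕ) ^ (E + 2) = 4 * 2 ^ E := by ring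
  have hP : 0 < 2 ^ E := by positivity
  -- the approximation of the calibrating row
  have hcal := hh ⟨2 * 2 ^ E, by omega⟩ ⟨0, hdv⟩
  have hcal' := hY' ⟨2 * 2 ^ E, by omega⟩ rfl
  have hacc := hRel (le_trans (le_max_left _ _) hE) hrel ⟨2 * 2 ^ E, by omega⟩ ⟨0, hdv⟩ (by
    rw [hcal']
    exact le_mul_of_one_le_right (by positivity) (Real.one_le_exp (Nat.cast_nonneg _)))
  rw [hcal', hcal.2] at hacc
  have hz : (((⟨0, hdv⟩ : Fin (dv (2 ^ (E + 2)))) : ℕ) : ℤ) * ((2 ^ (E + 2) : ℕ) : ℤ) +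
      ((⟨2 * 2 ^ E, by omega⟩ : Fin (2 ^ (E + 2))) : ℕ) = 2 * 2 ^ E := by
    push_cast
    ring
  rw [hz] at hcal hacc
  obtain ⟨u', τ, hx', hiff, hτ⟩ := exec_compareRows ρ c hρ hx
    (fun z => x.input_arr_eq_zero le_rfl z) (fun z => x.input_arr_eq_zero (by omega) z) hu hpar
    (abs_threshold_le hμ1 hcal.1 hacc)
  refine ⟨u', τ, hx', ?_, hτ.trans (mul_le_mul_two_pow (by omega))⟩
  rw [hiff]
  refine exists_congr fun i => and_congr_right fun hi => ?_
  have hrow := hh ⟨i, by omega⟩ ⟨0, hdv⟩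
  have hrow' := hY ⟨i, by omega⟩ hi
  have hacc' := hRel (le_trans (le_max_left _ _) hE) hrel ⟨i, by omega⟩ ⟨0, hdv⟩ (by
    rw [hrow']
    exact two_pow_le_rowSum)
  rw [hrow', hrow.2] at hacc'
  have hz' : (((⟨0, hdv⟩ : Fin (dv (2 ^ (E + 2)))) : ℕ) : ℤ) * ((2 ^ (E + 2) : ℕ) : ℤ) +
      ((⟨i, by omega⟩ : Fin (2 ^ (E + 2))) : ℕ) = i := by
    push_cast
    ring
  rw [hz'] at hrow hacc'
  exact threshold_iff hμ hμ1 hc1 hc2 hT (fun b _ => hg i b) hrow.1 hcal.1 hacc' hacc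

theorem recoversTopScore_mulApprox {d dv : ℕ → ℕ} {μ : ℝ} (hμ : 0 ≤ μ) (hμ1 : μ < 1) :
    RecoversTopScore d dv HoldsRational fun Yhat Y => ∀ i j, |Yhat i j - Y i j| ≤ μ * |Y i j| :=
  recoversTopScore_rational (E₁ := 0) hμ hμ1 fun {E _ _ _ _} _ h i j hY => by
    have h1 := h i j
    have h2 : (0 : ℝ) < 2 ^ E := by positivity
    rwa [abs_of_pos (h2.trans_le hY)] at h1

/-- An additive error is a small relative error, since all relevant entries are at least a
quarter of the size. -/
theorem recoversTopScore_addApprox {d dv : ℕ → ℕ} (μ : ℝ) :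
    RecoversTopScore d dv HoldsRational fun Yhat Y => ∀ i j, |Yhat i j - Y i j| ≤ μ := by
  obtain ⟨E₁, hE₁⟩ := pow_unbounded_of_one_lt (2 * μ) one_lt_two
  refine recoversTopScore_rational (μ := 1 / 2) (E₁ := E₁) (by norm_num) (by norm_num)
    fun {E _ _ _ _} hE h i j hY => ?_
  exact abs_sub_le_half_mul (h i j) hY
    (hE₁.le.trans (pow_le_pow_right₀ one_le_two hE))

section Symbolic

/-- Adds the coefficient of the term whose index is in register `ρ` to register `0` if the term
belongs to the first column of one of the first `2 ^ E` rows and its exponent is that of the greatest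
score. Register `0` is reduced modulo `2 ^ (2 * E + 1)`, which keeps it short and does not change the
final sum, a number of pairs of rows. -/
def collectStep (ρ : ℕ) : Expr :=
  .op .mod (.op .add (.reg 0) (.op .mul (.op .mul
    (.op .mul (.op .sub (.const 1) (.op .lt (.get 2 (.reg ρ)) (.const 0)))
      (.op .lt (.get 2 (.reg ρ)) (.get (ρ + 2) (.const 0))))
    (.op .mul (.op .eq (.get 3 (.reg ρ)) (.const 0))
      (.op .eq (.get 5 (.reg ρ)) (.get (ρ + 2) (.const 1)))))
    (.get 4 (.reg ρ)))) (.get (ρ + 2) (.const 2))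

theorem collectStep_eval {ρ E T i : ℕ} {m : ℤ} {v : State}
    (hpar : ParamArray (v.arr (ρ + 2)) E T) (h0 : v.reg 0 = m) (h3 : v.reg ρ = i) :
    (collectStep ρ).eval v = (m + if (0 ≤ v.arr 2 i ∧ v.arr 2 i < (2 ^ E : ℕ) ∧ v.arr 3 i = 0) ∧
      v.arr 5 i = (2 * (E + 2) * T : ℕ) then v.arr 4 i else 0) % (2 ^ (2 * E + 1) : ℕ) := by
  simp only [collectStep, Expr.eval, BinOp.eval, h0, h3, hpar.rows, hpar.top, hpar.modulus]
  congr 2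
  generalize v.arr 2 i = a
  generalize v.arr 3 i = a'
  generalize v.arr 5 i = a''
  generalize ((2 ^ E : ℕ) : ℤ) = y
  generalize ((2 * (E + 2) * T : ℕ) : ℤ) = y'
  by_cases h1 : 0 ≤ a <;> by_cases h2 : a < y <;> by_cases h3 : a' = 0 <;> by_cases h4 : a'' = y' <;>
    simp [h1, h2, h3, h4, not_lt.2, not_le.1]

theorem collectStep_cost_le {ρ E T i m t X : ℕ} {v : State}
    (hpar : ParamArray (v.arr (ρ + 2)) E T) (h0 : v.reg 0 = m) (h3 : v.reg ρ = i) (hi : i ≤ t)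
    (hm : m ≤ 2 ^ (2 * E + 1)) (hX : X = E + T + t.size + 2) :
    (collectStep ρ).cost v ≤ 961 * (bitCost (v.arr 2 i) + bitCost (v.arr 3 i) +
      bitCost (v.arr 4 i) + bitCost (v.arr 5 i) + 3 * X ^ 2 + 3) := by
  have hbi : bitCost (i : ℤ) ≤ t.size + 2 := bitCost_natCast_le (hi.trans t.lt_size_self.le)
  have hbm : bitCost (m : ℤ) ≤ 2 * E + 1 + 2 := bitCost_natCast_le hm
  have hbP : bitCost ((2 ^ E : ℕ) : ℤ) ≤ E + 2 := bitCost_natCast_le le_rfl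
  have hbM : bitCost ((2 ^ (2 * E + 1) : ℕ) : ℤ) ≤ 2 * E + 1 + 2 := bitCost_natCast_le le_rfl
  have hbT : bitCost ((2 * (E + 2) * T : ℕ) : ℤ) ≤ 2 * (E + 2) * T + 2 :=
    bitCost_natCast_le Nat.lt_two_pow_self.le
  have b0 : bitCost 0 = 1 := by decide
  have b1 : bitCost 1 = 2 := by decide
  have b2 : bitCost 2 = 3 := by decide
  have h5 : 2 * (E + 2) * T ≤ 2 * X ^ 2 := by
    rw [sq, mul_assoc]
    exact Nat.mul_le_mul_left _ (Nat.mul_le_mul (by omega) (by omega))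
  have h6 : 2 * X ≤ X ^ 2 := by
    rw [sq]
    exact Nat.mul_le_mul_right _ (by omega)
  have hnodes : (collectStep ρ).nodes ^ 2 = 961 := by simp [collectStep, Expr.nodes]
  rw [← hnodes]
  refine Expr.cost_le ?_
  simp only [collectStep, Expr.LeavesBounded, Expr.eval, h0, h3, hpar.rows, hpar.top, hpar.modulus,
    b0, b1, b2]
  generalize X ^ 2 = z at *
  generalize 2 * (E + 2) * T = y at *
  refine ⟨⟨?_, ⟨⟨⟨?_, ⟨?_, ?_⟩, ?_⟩, ⟨?_, ?_⟩, ?_, ?_⟩, ⟨⟨?_, ?_⟩, ?_⟩, ⟨?_, ?_⟩, ?_, ?_⟩, ?_, ?_⟩,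
    ?_, ?_⟩ <;> omega

/-- The program that evaluates a symbolic output. -/
def collectTop (ρ : ℕ) : Program :=
  .seq (.assign (ρ + 1) (.op .mul (.reg 0) (.op .lt (.const 0) (.reg 0))))
  (.seq (.assign 0 (.const 0)) (forLoop ρ (ρ + 1) (.assign 0 (collectStep ρ))))

theorem collectTop_time_le {P L t sz E X c₁ τ S : ℕ} (hLt : L ≤ t) (hP : 1 ≤ P)
    (hX : X = E + sz + 2) (hX2 : 2 * X ≤ X ^ 2) (hc₁ : c₁ ≤ 25 * (E + 4 + t + 3))
    (hτ : τ ≤ S + (L + 1) * (4 * sz + 20))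
    (hS : S ≤ 961 * (4 * (L + t) + L * (3 * X ^ 2 + 3)) + L) :
    c₁ + 1 + (2 + τ) ≤ 20000 * ((t + P) * X ^ 2) := by
  have hX3 : 4 ≤ X ^ 2 := by omega
  generalize X ^ 2 = Z at *
  have h1 : (L + 1) * (4 * sz + 20) ≤ (t + P) * (12 * Z) := Nat.mul_le_mul (by omega) (by omega)
  have h2 : L * (3 * Z + 3) ≤ (t + P) * (4 * Z) := Nat.mul_le_mul (by omega) (by omega)
  have h3 : (t + P) * (12 * Z) = 12 * ((t + P) * Z) := by ring
  have h4 : (t + P) * (4 * Z) = 4 * ((t + P) * Z) := by ring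
  have h5 : (t + P) * 4 ≤ (t + P) * Z := Nat.mul_le_mul_left _ hX3
  have h6 : 1 * Z ≤ (t + P) * Z := Nat.mul_le_mul_right _ (by omega)
  rw [h3] at h1
  rw [h4] at h2
  generalize (t + P) * Z = y at *
  generalize L * (3 * Z + 3) = y' at *
  generalize (L + 1) * (4 * sz + 20) = y'' at *
  omega

theorem exec_collectTop (ρ : ℕ) (hρ : 6 ≤ ρ) {E T t : ℕ} {x u : State} {p : Program} {s : State}
    (hx : Exec p x s t) (hx0 : x.reg 0 = (2 ^ (E + 2) : ℕ))
    (hxa : ∀ a, 2 ≤ a → ∀ z, x.arr a z = 0)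
    (hs : ∀ r < (s.reg 0).toNat, s.arr 4 r ≠ 0)
    (hu : s.AgreeBelow ρ u) (hpar : ParamArray (u.arr (ρ + 2)) E T) :
    ∃ u' τ, Exec (collectTop ρ) u u' τ ∧
      u'.reg 0 = (∑ r ∈ Finset.range (s.reg 0).toNat,
        if (0 ≤ s.arr 2 r ∧ s.arr 2 r < (2 ^ E : ℕ) ∧ s.arr 3 r = 0) ∧
          s.arr 5 r = (2 * (E + 2) * T : ℕ) then s.arr 4 r else 0) % (2 ^ (2 * E + 1) : ℕ) ∧
      τ ≤ 20000 * ((t + 2 ^ E) * (E + T + t.size + 2) ^ 2) := by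
  set X := E + T + t.size + 2 with hX
  set L := (s.reg 0).toNat with hL
  have hua : ∀ a, a < 6 → u.arr a = s.arr a := fun a ha => (hu.2 a (by omega)).symm
  -- every term occupies a cell that has been written
  have hLt : L ≤ t := by
    have h1 := hx.sum_range_bitCost_le (hxa 4 (by omega)) L
    have h2 : ∑ i ∈ Finset.range L, 2 ≤ ∑ i ∈ Finset.range L, bitCost (s.arr 4 i) := by
      refine Finset.sum_le_sum fun i hi => ?_
      have h3 : 0 < (s.arr 4 i).natAbs.size :=
        Nat.size_pos.2 (Int.natAbs_pos.2 (hs i (Finset.mem_range.1 hi)))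
      rw [bitCost]
      omega
    rw [Finset.sum_const, Finset.card_range, smul_eq_mul] at h2
    omega
  have hu0 : u.reg 0 = s.reg 0 := (hu.1 0 (by omega)).symm
  have b0 : bitCost 0 = 1 := by decide
  have hbn : bitCost ((2 ^ (E + 2) : ℕ) : ℤ) ≤ E + 4 := bitCost_natCast_le le_rfl
  have hb0 : bitCost (s.reg 0) ≤ E + 4 + t := by
    have := hx.bitCost_reg_le 0
    rw [hx0] at this
    omega
  -- the number of terms
  have hev : (Expr.op .mul (.reg 0) (.op .lt (.const 0) (.reg 0))).eval u = L := by
    simp only [Expr.eval, BinOp.eval, hu0, hL]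
    split_ifs <;> omega
  have x₁ := Exec.assign u (ρ + 1) (.op .mul (.reg 0) (.op .lt (.const 0) (.reg 0)))
  rw [hev] at x₁
  have c₁ := Expr.cost_le (s := u) (B := E + 4 + t)
    (e := .op .mul (.reg 0) (.op .lt (.const 0) (.reg 0))) (by
      simp only [Expr.LeavesBounded, hu0, b0]
      omega)
  set u₁ := u.setReg (ρ + 1) L with hu₁
  set u₂ := u₁.setReg 0 0 with hu₂
  have x₂ : Exec (.assign 0 (.const 0)) u₁ u₂ 2 := Exec.assign u₁ 0 (.const 0)
  have hρ0 : (0 : ℕ) ≠ ρ := by omega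
  have hu₂L : u₂.reg (ρ + 1) = L := by simp [hu₂, hu₁, State.setReg]
  set M := 2 ^ (2 * E + 1) with hM
  have hM0 : (0 : ℤ) < M := by positivity
  set f : ℕ → ℤ := fun r => if (0 ≤ s.arr 2 r ∧ s.arr 2 r < (2 ^ E : ℕ) ∧ s.arr 3 r = 0) ∧
    s.arr 5 r = (2 * (E + 2) * T : ℕ) then s.arr 4 r else 0 with hf
  set B : ℕ → ℕ := fun i => bitCost (s.arr 2 i) + bitCost (s.arr 3 i) + bitCost (s.arr 4 i) +
    bitCost (s.arr 5 i) + 3 * X ^ 2 with hB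
  obtain ⟨u', τ, hxl, hI, hτ⟩ := exec_forLoop (ri := ρ) (rn := ρ + 1) (s := u₂) L t.size
    (hLt.trans t.lt_size_self.le) (p := .assign 0 (collectStep ρ))
    (fun i v => v.reg 0 = (∑ r ∈ Finset.range i, f r) % M ∧ v.arr = u.arr)
    (fun i => 961 * (B i + 3) + 1) (by omega) hu₂L
    ⟨by simp [hu₂, State.setReg, hρ0], rfl⟩ (by
      rintro i hi v ⟨h0, h2⟩ h3 h4
      rw [← h2] at hpar hua
      have e2 := hua 2 (by omega)
      have e3 := hua 3 (by omega)
      have e4 := hua 4 (by omega)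
      have e5 := hua 5 (by omega)
      refine ⟨_, _, .assign _ _ _, ?_, ?_, ⟨?_, ?_⟩, ?_⟩
      · simp [State.setReg, hρ0.symm, h3]
      · simp [State.setReg, h4]
      · simp only [State.setReg, Function.update_of_ne hρ0, Function.update_self]
        rw [collectStep_eval hpar h0 h3, e2, e3, e4, e5, Finset.sum_range_succ, ← hM,
          Int.emod_add_emod]
      · exact h2
      · obtain ⟨m, hm⟩ := Int.eq_ofNat_of_zero_le (Int.emod_nonneg
          (∑ r ∈ Finset.range i, f r) hM0.ne')
        have hmM := Int.emod_lt_of_pos (∑ r ∈ Finset.range i, f r) hM0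
        rw [hm] at h0 hmM
        have h5 := collectStep_cost_le hpar h0 h3 (hi.le.trans hLt) (by exact_mod_cast hmM.le) hX
        rw [e2, e3, e4, e5] at h5
        exact Nat.add_le_add_right h5 1)
  refine ⟨u', _, x₁.seq (x₂.seq hxl), hI.1, ?_⟩
  have hsum : ∑ i ∈ Finset.range L, (961 * (B i + 3) + 1) ≤
      961 * (4 * (L + t) + L * (3 * X ^ 2 + 3)) + L := by
    have h2 := hx.sum_range_bitCost_le (hxa 2 (by omega)) L
    have h3 := hx.sum_range_bitCost_le (hxa 3 (by omega)) L
    have h4 := hx.sum_range_bitCost_le (hxa 4 (by omega)) L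
    have h5 := hx.sum_range_bitCost_le (hxa 5 (by omega)) L
    rw [Finset.sum_add_distrib, ← Finset.mul_sum]
    simp only [hB, Finset.sum_add_distrib, Finset.sum_const, Finset.card_range, smul_eq_mul,
      mul_one]
    have h6 : L * (3 * X ^ 2 + 3) = L * (3 * X ^ 2) + L * 3 := by ring
    omega
  simp only [Expr.nodes] at c₁
  have hX3 : 2 * X ≤ X ^ 2 := by
    rw [sq]
    exact Nat.mul_le_mul_right _ (by omega)
  exact collectTop_time_le (E := E) (sz := t.size + T) hLt Nat.one_le_two_pow (by omega) hX3 c₁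
    (hτ.trans (Nat.add_le_add_left (Nat.mul_le_mul_left _ (by omega)) _)) hsum

/-- The terms of a symbolic output with the greatest possible exponent count the occurrences of the
greatest score, by the linear independence of the powers of `e`. -/
theorem recoversTopScore_exact {d dv : ℕ → ℕ} :
    RecoversTopScore d dv HoldsSymbolic fun Yhat Y => Yhat = Y := by
  classical
  intro ρ hρ
  refine ⟨collectTop ρ, 20000 + 2, 0, ?_⟩
  intro E T _ hT x hdv g hg hY hY' p s u t hx hout hu hpar
  obtain ⟨Yhat, hh, rfl⟩ := hout
  obtain ⟨u', τ, hx', hres, hτ⟩ := exec_collectTop ρ hρ hx rfl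
    (fun a ha => x.input_arr_eq_zero ha) hh.1 hu hpar
  refine ⟨u', τ, hx', ?_, hτ.trans (mul_le_mul_two_pow (by omega))⟩
  have hn : (2 : ℕ) ^ (E + 2) = 4 * 2 ^ E := by ring
  have hP : 0 < 2 ^ E := by positivity
  set cnt : ℕ → ℕ := fun i => ((Finset.range (2 ^ E)).filter fun b => g i b = T).card with hcnt
  have hrow : ∀ i ∈ Finset.range (2 ^ E), ∑ r ∈ Finset.range (s.reg 0).toNat,
      (if (s.arr 2 r = (i : ℤ) ∧ s.arr 3 r = 0) ∧ s.arr 5 r = ((2 * (E + 2) * T : ℕ) : ℤ)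
        then s.arr 4 r else 0) = (cnt i : ℤ) := by
    intro i hi
    rw [Finset.mem_range] at hi
    refine sum_coeff_eq_card (p := fun r => s.arr 2 r = (i : ℤ) ∧ s.arr 3 r = 0)
      (b := fun r => s.arr 4 r) (x := fun r => s.arr 5 r) ?_
    rw [← hY ⟨i, by omega⟩ hi, hh.2]
    simp
  -- the terms are grouped by their rows
  have hsum : (∑ r ∈ Finset.range (s.reg 0).toNat,
        if (0 ≤ s.arr 2 r ∧ s.arr 2 r < (2 ^ E : ℕ) ∧ s.arr 3 r = 0) ∧
          s.arr 5 r = (2 * (E + 2) * T : ℕ) then s.arr 4 r else 0) =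
      ((∑ i ∈ Finset.range (2 ^ E), cnt i : ℕ) : ℤ) := by
    rw [Nat.cast_sum, ← Finset.sum_congr rfl hrow, Finset.sum_comm]
    refine Finset.sum_congr rfl fun r _ => ?_
    by_cases h : (0 ≤ s.arr 2 r ∧ s.arr 2 r < (2 ^ E : ℕ) ∧ s.arr 3 r = 0) ∧
        s.arr 5 r = (2 * (E + 2) * T : ℕ)
    · obtain ⟨i, hi⟩ := Int.eq_ofNat_of_zero_le h.1.1
      have hi' : i < 2 ^ E := by
        have := h.1.2.1
        rw [hi] at this
        exact_mod_cast this
      rw [if_pos h, Finset.sum_eq_single_of_mem i (Finset.mem_range.2 hi')]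
      · rw [if_pos ⟨⟨hi, h.1.2.2⟩, h.2⟩]
      · intro j _ hj
        exact if_neg fun h' => hj (by have := h'.1.1; omega)
    · rw [if_neg h, Finset.sum_eq_zero]
      intro i hi
      refine if_neg fun h' => h ⟨⟨?_, ?_, h'.1.2⟩, h'.2⟩
      · rw [h'.1.1]
        positivity
      · rw [h'.1.1]
        exact_mod_cast Finset.mem_range.1 hi
  have hle : ∑ i ∈ Finset.range (2 ^ E), cnt i ≤ 2 ^ E * 2 ^ E := by
    refine (Finset.sum_le_card_nsmul _ _ (2 ^ E) fun i _ => ?_).trans (by simp)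
    exact (Finset.card_filter_le _ _).trans (by simp)
  have hlt : ∑ i ∈ Finset.range (2 ^ E), cnt i < 2 ^ (2 * E + 1) := by
    have h1 : 2 ^ (2 * E + 1) = 2 * (2 ^ E * 2 ^ E) := by ring
    have h2 : 0 < 2 ^ E * 2 ^ E := by positivity
    omega
  rw [hres, hsum, ← Int.natCast_mod, Nat.mod_eq_of_lt hlt]
  simp only [ne_eq, Nat.cast_eq_zero, Finset.sum_eq_zero_iff, Finset.mem_range, hcnt,
    Finset.card_eq_zero, Finset.filter_eq_empty_iff]
  push Not
  rfl

end Symbolic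

/-! ### The choice of the parameters -/

/-- The sparsification may use a threshold ratio `R` and digits of `w` bits such that the advice has
only `γ` bits per variable. -/
theorem exists_parameters (k : ℕ) {γ : ℝ} (hγ : 0 < γ) : ∃ R w : ℕ, 1 ≤ R ∧ 1 ≤ w ∧
    R * sparsifyBound R k ≤ 2 ^ w - 1 ∧ ((w * (k + 1) : ℕ) : ℝ) ≤ γ * R := by
  have h1 := tendsto_pow_const_div_const_pow_of_one_lt 1 (one_lt_two (α := ℝ))
  have h2 : 0 < γ / (4 * 2 ^ k * (k + 1)) := by positivity
  obtain ⟨r, hr1, hr2⟩ := ((h1.eventually (gt_mem_nhds h2)).and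
    (Filter.eventually_ge_atTop 1)).exists
  -- the bound `R * b k` is doubly exponential in `k` but polynomial in `R`, so that `w` is of the
  -- order of `log R`
  have hR : 1 ≤ 2 ^ r := Nat.one_le_two_pow
  refine ⟨2 ^ r, (r + 3) * 2 ^ k, hR, Nat.mul_pos (by omega) (by positivity), ?_, ?_⟩
  · have h3 := mul_sparsifyBound_le hR k
    have h4 : (8 * 2 ^ r) ^ 2 ^ k = 2 ^ ((r + 3) * 2 ^ k) := by
      rw [pow_mul, pow_add, mul_comm]
      norm_num
    rw [h4] at h3
    have h5 : 1 ≤ 2 ^ r * sparsifyBound (2 ^ r) k := Nat.mul_pos hR (one_le_sparsifyBound _ _)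
    rw [mul_assoc] at h3
    omega
  · rw [div_lt_div_iff₀ (by positivity) (by positivity), pow_one] at hr1
    have h3 : (1 : ℝ) ≤ r := by exact_mod_cast hr2
    have h4 : (0 : ℝ) ≤ 2 ^ k * (k + 1) := by positivity
    push_cast
    nlinarith

theorem adviceBits_le {k R w N : ℕ} {γ : ℝ} (hR : 1 ≤ R) (h : ((w * (k + 1) : ℕ) : ℝ) ≤ γ * R) :
    (adviceBits k R w N : ℝ) ≤ γ * N + w := by
  have hR' : (0 : ℝ) < R := by exact_mod_cast hR
  have h1 : ((N / R : ℕ) : ℝ) ≤ N / R := Nat.cast_div_le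
  have h2 : ((w * (k + 1) : ℕ) : ℝ) * ((N / R : ℕ) : ℝ) ≤ (γ * R) * (N / R) :=
    mul_le_mul h h1 (by positivity) ((Nat.cast_nonneg _).trans h)
  have h3 : γ * R * (N / R) = γ * N := by field_simp
  rw [h3] at h2
  rw [adviceBits]
  push_cast at *
  linarith

theorem logRows_add_two_le {k R w N : ℕ} {γ : ℝ} (hR : 1 ≤ R)
    (h : ((w * (k + 1) : ℕ) : ℝ) ≤ γ * R) :
    ((logRows k R w N + 2 : ℕ) : ℝ) ≤ (1 / 2 + γ) * N + (w + 3) := by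
  have h1 := adviceBits_le (N := N) hR h
  have h2 : ((N / 2 : ℕ) : ℝ) ≤ N / 2 := Nat.cast_div_le
  rw [logRows, halfSize]
  push_cast
  linarith

theorem le_two_mul_logRows (k R w N : ℕ) : N ≤ 2 * logRows k R w N := by
  rw [logRows, halfSize]
  omega

theorem adviceBits_le_mul (k R w N : ℕ) : adviceBits k R w N ≤ w * (k + 2) * (2 * N + 1) := by
  have h1 : N / R ≤ N := Nat.div_le_self _ _
  have h2 : (k + 1) * (N / R) ≤ (k + 1) * N := Nat.mul_le_mul_left _ h1
  have h3 : (k + 2) * (2 * N + 1) = (k + 1) * N + 1 + ((k + 1) * N + (2 * N + 1) + k) := by ring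
  rw [adviceBits, mul_assoc]
  exact Nat.mul_le_mul_left _ (by omega)

theorem topScore_le_mul (k R w N : ℕ) :
    topScore k R w N ≤ (k * flowerThreshold R k + w * (k + 2) + 2) * (2 * N + 1) := by
  have h1 := adviceBits_le_mul k R w N
  have h2 : (k * flowerThreshold R k + w * (k + 2) + 2) * (2 * N + 1) =
      2 * N * (k * flowerThreshold R k) + w * (k + 2) * (2 * N + 1) +
        (k * flowerThreshold R k + 4 * N + 2) := by ring
  rw [topScore, clausePositions, h2]
  omega

theorem Room.of_le {k R w N Λ : ℕ} (codes : (2 * N + 1) ^ k ≤ Λ)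
    (rounds : sparsifyBound R k * N ≤ Λ) (vars : N ≤ Λ) (width : k ≤ Λ) (large : 64 ≤ Λ)
    (rows : 2 * logRows k R w N + 4 ≤ Λ) (advice : 4 * (adviceBits k R w N + w) ≤ Λ)
    (top : topScore k R w N ≤ Λ) : Room k R w N Λ := by
  -- a quarter of the exponent is enough for every polynomial factor
  have h1 : (Λ + 1) * (Λ + 1) ≤ 2 ^ (Λ / 4 + Λ / 4) := by
    have h3 := mul_self_le_two_pow (n := Λ / 4) (by omega)
    have h4 : 16 * (Λ / 4) ≤ Λ / 4 * (Λ / 4) := Nat.mul_le_mul_right _ (by omega)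
    rw [pow_add]
    exact Nat.mul_le_mul (by omega) (by omega)
  have h2 : 2 * Λ ≤ 2 ^ (Λ / 2) := by
    have h3 := mul_self_le_two_pow (n := Λ / 2) (by omega)
    have h4 : 16 * (Λ / 2) ≤ Λ / 2 * (Λ / 2) := Nat.mul_le_mul_right _ (by omega)
    omega
  refine ⟨codes, rounds, vars, width, by omega, rows, top, ?_, ?_, ?_⟩
  · calc 2 ^ adviceBits k R w N * ((Λ + 1) * (Λ + 1))
        ≤ 2 ^ adviceBits k R w N * 2 ^ (Λ / 4 + Λ / 4) := Nat.mul_le_mul_left _ h1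
      _ = 2 ^ (adviceBits k R w N + (Λ / 4 + Λ / 4)) := (pow_add _ _ _).symm
      _ ≤ 2 ^ Λ := Nat.pow_le_pow_right (by norm_num) (by omega)
  · have h3 : 2 ^ adviceBits k R w N * 2 ^ w ≤ 2 ^ (Λ / 2) := by
      rw [← pow_add]
      exact Nat.pow_le_pow_right (by norm_num) (by omega)
    calc 2 ^ adviceBits k R w N * 2 ^ w + Λ ≤ 2 ^ (Λ / 2) + 2 ^ (Λ / 2) := by omega
      _ = 2 ^ (Λ / 2 + 1) := by rw [pow_succ, mul_two]
      _ ≤ 2 ^ Λ := Nat.pow_le_pow_right (by norm_num) (by omega)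
  · calc 2 ^ (logRows k R w N + 2) * (2 * topScore k R w N)
        ≤ 2 ^ (logRows k R w N + 2) * 2 ^ (Λ / 2) := Nat.mul_le_mul_left _ (by omega)
      _ = 2 ^ (logRows k R w N + 2 + Λ / 2) := (pow_add _ _ _).symm
      _ ≤ 2 ^ Λ := Nat.pow_le_pow_right (by norm_num) (by omega)

theorem exists_room (k R w : ℕ) : ∃ κ₀, ∀ κ ≥ κ₀, ∀ N, Room k R w N (loopRange κ k N) := by
  refine ⟨64 + k + sparsifyBound R k + 4 * (w * (k + 2) + w) + 8 +
    (k * flowerThreshold R k + w * (k + 2) + 2), fun κ hκ N => ?_⟩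
  have h1 : κ * (2 * N + 1) ≤ loopRange κ k N := by
    rw [loopRange]
    exact Nat.mul_le_mul_left _ (Nat.le_self_pow (by omega) _)
  have h2 : ∀ {c}, c ≤ κ → c * (2 * N + 1) ≤ loopRange κ k N := fun hc =>
    (Nat.mul_le_mul_right _ hc).trans h1
  obtain ⟨h3, h4⟩ := le_loopRange (κ := κ) (k := k) (N := N) (by omega)
  have h5 := adviceBits_le_mul k R w N
  have h6 := topScore_le_mul k R w N
  have hκ' : κ ≤ loopRange κ k N := by
    have := Nat.le_mul_of_pos_right κ (show 0 < 2 * N + 1 by omega)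
    omega
  have h7 : 4 * (w * (k + 2) + w) * (2 * N + 1) + 8 * (2 * N + 1) ≤ loopRange κ k N := by
    rw [← add_mul]
    exact h2 (by omega)
  have h8 : 4 * (w * (k + 2) + w) * (2 * N + 1) =
    4 * (w * (k + 2) * (2 * N + 1)) + (8 * (w * N) + 4 * w) := by ring
  refine .of_le h4 ?_ h3 (by omega) (by omega) ?_ ?_ (h6.trans (h2 (by omega)))
  · have h9 : sparsifyBound R k * N ≤ sparsifyBound R k * (2 * N + 1) :=
      Nat.mul_le_mul_left _ (by omega)
    exact h9.trans (h2 (by omega))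
  · rw [logRows, halfSize]
    omega
  · omega

/-- If the inner dimension grows faster than the logarithm of the size, then the instances for
formulas with many variables fit. -/
theorem exists_topScore_le {d : ℕ → ℕ}
    (hd : (fun n : ℕ => Real.log (n : ℝ)) =o[Filter.atTop] fun n : ℕ => (d n : ℝ)) (k R w : ℕ) :
    ∃ N₀, ∀ N ≥ N₀, 2 * topScore k R w N ≤ d (2 ^ (logRows k R w N + 2)) := by
  set C := k * flowerThreshold R k + w * (k + 2) + 2 with hC
  have hC0 : (0 : ℝ) < C := by
    rw [hC]
    positivity
  -- `topScore` is at most `C * (2 * N + 1)`, and `log n` is at least `(N + 4) / 4`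
  have h1 := (Asymptotics.isLittleO_iff.1 hd) (show 0 < 1 / (16 * (C : ℝ)) by positivity)
  obtain ⟨n₀, hn₀⟩ := Filter.eventually_atTop.1 h1
  refine ⟨n₀, fun N hN => ?_⟩
  have h2 := le_two_mul_logRows k R w N
  set E := logRows k R w N with hE
  have h3 : n₀ ≤ 2 ^ (E + 2) := by
    have h4 : N ≤ 2 ^ (E + 2) := by
      have h5 : E + 2 < 2 ^ (E + 2) := Nat.lt_two_pow_self
      have h6 : 2 * E + 2 ≤ 2 ^ (E + 2) := by
        have h7 : E < 2 ^ E := Nat.lt_two_pow_self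
        rw [pow_add]
        omega
      omega
    omega
  have h4 := hn₀ _ h3
  have h5 : Real.log ((2 ^ (E + 2) : ℕ) : ℝ) = (E + 2) * Real.log 2 := by
    push_cast
    rw [Real.log_pow]
    push_cast
    ring
  rw [h5, Real.norm_of_nonneg (by positivity), Real.norm_of_nonneg (by positivity), div_mul_eq_mul_div,
    one_mul, le_div_iff₀ (by positivity)] at h4
  have h6 : (1 / 2 : ℝ) ≤ Real.log 2 := by linarith [Real.log_two_gt_d9]
  have h7 : ((E : ℝ) + 2) * (1 / 2) ≤ (E + 2) * Real.log 2 :=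
    mul_le_mul_of_nonneg_left h6 (by positivity)
  have h8 : ((E : ℝ) + 2) * (1 / 2) * (16 * C) ≤ (E + 2) * Real.log 2 * (16 * C) :=
    mul_le_mul_of_nonneg_right h7 (by positivity)
  have h9 : (2 * (C * (2 * N + 1)) : ℕ) ≤ d (2 ^ (E + 2)) := by
    have h10 : (N : ℝ) ≤ 2 * E := by exact_mod_cast h2
    have h11 : (C : ℝ) * N ≤ C * (2 * E) := mul_le_mul_of_nonneg_left h10 hC0.le
    have h12 : ((2 * (C * (2 * N + 1)) : ℕ) : ℝ) ≤ d (2 ^ (E + 2)) := by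
      push_cast
      nlinarith
    exact_mod_cast h12
  exact (Nat.mul_le_mul_left 2 (topScore_le_mul k R w N)).trans h9

/-- Powers of a polynomial are dominated by every exponential function. -/
theorem exists_pow_le_two_rpow (a l m : ℕ) {δ : ℝ} (hδ : 0 < δ) :
    ∃ C : ℝ, 0 ≤ C ∧ ∀ N : ℕ, (((a * (2 * N + 1) ^ l) ^ m : ℕ) : ℝ) ≤ C * (2 : ℝ) ^ (δ * N) := by
  set b := δ * Real.log 2 / 2 with hb
  have hb0 : 0 < b := by
    have := Real.log_pos one_lt_two
    positivity
  set j := l * m with hj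
  refine ⟨a ^ m * (j.factorial / b ^ j * Real.exp b), by positivity, fun N => ?_⟩
  have h1 := Real.pow_div_factorial_le_exp (b * (2 * N + 1)) (by positivity) j
  rw [div_le_iff₀ (by positivity), mul_pow] at h1
  have h2 : Real.exp (b * (2 * N + 1)) = Real.exp b * (2 : ℝ) ^ (δ * N) := by
    rw [Real.rpow_def_of_pos two_pos, ← Real.exp_add, hb]
    congr 1
    ring
  rw [h2] at h1
  have h3 : ((2 * N + 1 : ℝ)) ^ j ≤ j.factorial / b ^ j * Real.exp b * (2 : ℝ) ^ (δ * N) := by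
    rw [div_mul_eq_mul_div, div_mul_eq_mul_div, le_div_iff₀ (by positivity)]
    linarith
  push_cast
  rw [mul_pow, ← pow_mul, ← hj, mul_assoc]
  exact mul_le_mul_of_nonneg_left h3 (by positivity)

/-! ### The reduction -/

variable {d dv : ℕ → ℕ} {Holds : {n m : ℕ} → State → Matrix (Fin n) (Fin m) ℝ → Prop}
  {Rel : {n m : ℕ} → Matrix (Fin n) (Fin m) ℝ → Matrix (Fin n) (Fin m) ℝ → Prop}

/-- The instance that the reduction writes down for a formula. -/
noncomputable def KCNF.attentionInstance {k N : ℕ} (φ : KCNF k N) (R w Λ d dv : ℕ) :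
    AttentionInstance (2 ^ (logRows k R w N + 2)) d dv :=
  FineGrained.attentionInstance k N Λ (adviceBits k R w N) (halfSize N) (clausePositions k R N)
    (leafCodes k R w N Λ (initCodes k N Λ (φ.input.arr 0) φ.clauses.length)) d dv

/-- The prologue leaves the machine in a state that the attention algorithm cannot tell from the
input of the instance. -/
theorem KCNF.attentionInstance_agreeBelow {k N : ℕ} (φ : KCNF k N) {R w Λ d dv ρ : ℕ} {u : State}
    (hd : 2 * topScore k R w N ≤ d) (hdv : 0 < dv)
    (hreg : ∀ r < ρ, u.reg r =
      Function.update (fun _ => (0 : ℤ)) 0 ((2 ^ (logRows k R w N + 2) : ℕ) : ℤ) r)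
    (h0 : ∀ z, u.arr 0 z =
        if 0 ≤ z ∧ z < 2 ^ (logRows k R w N + 2) * (2 * topScore k R w N : ℕ) then
          (reductionShape k R w Λ N).entry
            (leafCodes k R w N Λ (initCodes k N Λ (φ.input.arr 0) φ.clauses.length))
            (z % 2 ^ (logRows k R w N + 2)) (z / 2 ^ (logRows k R w N + 2)) else 0)
    (h1 : ∀ z, u.arr 1 z =
        if 2 ^ logRows k R w N ≤ z ∧ z < 2 * 2 ^ logRows k R w N then 1 else 0)
    (h2 : ∀ a, 2 ≤ a → a < ρ → u.arr a = φ.input.arr a) :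
    (φ.attentionInstance R w Λ d dv).input.AgreeBelow ρ u := by
  refine ⟨fun r hr => ?_, fun a ha => ?_⟩
  · rw [hreg r hr, Function.update_apply]
    rfl
  · rcases Nat.lt_or_ge a 2 with h | h
    · interval_cases a
      · funext z
        rw [h0, reductionShape_natCast]
        exact attentionInstance_input_query hd z
      · funext z
        rw [h1]
        exact attentionInstance_input_value hdv z
    · rw [h2 a h ha]
      funext z
      rw [AttentionInstance.input_arr_eq_zero _ h]
      simp only [KCNF.input]
      rw [if_neg fun h' => by omega]

/-- A program that decides the formulas with many variables by a single run of an algorithm for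
self-attention. -/
theorem exists_decide_of_attention (hrec : RecoversTopScore d dv Holds Rel) (hdv : ∀ n, 1 ≤ dv n)
    (pA : Program) (time : ℕ → ℝ)
    (hA : ∀ n : ℕ, 1 ≤ n → ∀ x : AttentionInstance n (d n) (dv n), ∃ s' t,
      Exec pA x.input s' t ∧ (∃ Yhat : Matrix (Fin n) (Fin (dv n)) ℝ, Holds s' Yhat ∧ Rel Yhat x.Y) ∧
      (t : ℝ) ≤ time n)
    {k R w : ℕ} (hR : 1 ≤ R) (hw : 1 ≤ w) (hRw : R * sparsifyBound R k ≤ 2 ^ w - 1) :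
    ∃ (ρ : ℕ) (p : Program) (c E₀ : ℕ), 6 ≤ ρ ∧ ∀ (Λ N : ℕ) (φ : KCNF k N) (s : State),
      Ready ρ Λ N φ.clauses.length (fun _ => 0) φ.input.arr s → Room k R w N Λ →
      E₀ ≤ logRows k R w N → 2 * topScore k R w N ≤ d (2 ^ (logRows k R w N + 2)) →
      ∃ (s' : State) (τ t : ℕ), Exec p s s' τ ∧ (s'.reg 0 ≠ 0 ↔ φ.Satisfiable) ∧
        (t : ℝ) ≤ time (2 ^ (logRows k R w N + 2)) ∧
        τ ≤ (t + 2 ^ logRows k R w N) * (2 * Λ + 2 + t.size) ^ c := by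
  obtain ⟨ρA, hρA⟩ := pA.exists_below
  -- the registers and arrays below `ρ` are those of the algorithm and those of its input and output
  set ρ := max 6 ρA with hρ
  have hρ6 : 6 ≤ ρ := le_max_left _ _
  have hbelow : pA.Below ρ := hρA.mono (le_max_right _ _)
  obtain ⟨pP, cP, HP⟩ := exists_prologue ρ k R w (by omega)
  obtain ⟨q, c, E₀, Hq⟩ := hrec ρ hρ6
  refine ⟨ρ, .seq pP (.seq pA q), cP + (0 + c + 1) + 1, E₀, hρ6, fun Λ N φ s hs hroom hE hd => ?_⟩
  have hM : φ.clauses.length ≤ (2 * N + 1) ^ k := φ.length_le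
  obtain ⟨s₁, τ₁, x₁, hreg, h0, h1, h2, hpar, hτ₁⟩ := HP Λ N φ.clauses.length (fun _ => 0)
    φ.input.arr s hs (φ.input_small hroom.vars hroom.codes) hroom hM
    (fun z hz => by
      simp only [KCNF.input]
      rw [if_neg fun h => hz h.2])
    (fun z => by
      simp only [KCNF.input]
      rw [if_neg fun h => absurd h.1 one_ne_zero])
  set n := 2 ^ (logRows k R w N + 2) with hn
  set x := φ.attentionInstance R w Λ (d n) (dv n) with hx
  have hag : x.input.AgreeBelow ρ s₁ :=
    φ.attentionInstance_agreeBelow hd (hdv n) hreg h0 h1 h2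
  obtain ⟨sA, t, xA, hout, ht⟩ := hA n Nat.one_le_two_pow x
  obtain ⟨s₂, x₂, hag₂, hab⟩ := xA.frame hbelow hag
  have hrows : adviceBits k R w N + halfSize N ≤ Λ := by
    have := hroom.rows
    rw [logRows] at this
    omega
  obtain ⟨s₃, τ₃, x₃, hiff, hτ₃⟩ := Hq (logRows k R w N) (topScore k R w N) hE
    (Nat.le_add_left 1 _) x (hdv n)
    (fun i b => agreeCount k N Λ (adviceBits k R w N) (halfSize N) (clausePositions k R N)
      (leafCodes k R w N Λ (initCodes k N Λ (φ.input.arr 0) φ.clauses.length)) i b)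
    (fun i b => agreeCount_le i b)
    (fun i hi => attentionInstance_Y_first hrows hd (hdv n) i hi)
    (fun i hi => attentionInstance_Y_calibrating hrows hd (hdv n) i hi)
    pA sA s₂ t xA hout hag₂ (by
      rw [← hab.2 (ρ + 2) (by omega)]
      exact hpar)
  refine ⟨s₃, _, t, x₁.seq (x₂.seq x₃), ?_, ht, ?_⟩
  · rw [hiff]
    have hhalf : N ≤ 2 * halfSize N := by
      rw [halfSize]
      omega
    exact exists_agreeCount_iff φ hR hw hroom.codes hroom.rounds hroom.vars (by omega) hRw hhalf rfl
      le_rfl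
  · have hZ : 2 ≤ 2 * Λ + 2 + t.size := by omega
    have hrows' := hroom.rows
    have htop := hroom.top
    refine add_le_mul_pow hZ (hτ₁.trans (Nat.mul_le_mul (by omega)
      (Nat.pow_le_pow_left (by omega) _))) (add_le_mul_pow hZ (by simp) (hτ₃.trans
      (Nat.mul_le_mul_left _ (Nat.pow_le_pow_left (by omega) _))))

/-- A program that decides all formulas: it tries all assignments if there are few variables. -/
theorem exists_decide (hrec : RecoversTopScore d dv Holds Rel) (hdv : ∀ n, 1 ≤ dv n)
    (hd : (fun n : ℕ => Real.log (n : ℝ)) =o[Filter.atTop] fun n : ℕ => (d n : ℝ))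
    (pA : Program) (time : ℕ → ℝ) (htime : ∀ n, 0 ≤ time n)
    (hA : ∀ n : ℕ, 1 ≤ n → ∀ x : AttentionInstance n (d n) (dv n), ∃ s' t,
      Exec pA x.input s' t ∧ (∃ Yhat : Matrix (Fin n) (Fin (dv n)) ℝ, Holds s' Yhat ∧ Rel Yhat x.Y) ∧
      (t : ℝ) ≤ time n)
    {k R w : ℕ} (hR : 1 ≤ R) (hw : 1 ≤ w) (hRw : R * sparsifyBound R k ≤ 2 ^ w - 1) :
    ∃ (p : Program) (κ a c : ℕ), ∀ (N : ℕ) (φ : KCNF k N), ∃ (s' : State) (τ t : ℕ), Exec p φ.input s' τ ∧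
      (s'.reg 0 ≠ 0 ↔ φ.Satisfiable) ∧ (t : ℝ) ≤ time (2 ^ (logRows k R w N + 2)) ∧
      logRows k R w N ≤ loopRange κ k N ∧
      τ ≤ (t + 2 ^ logRows k R w N) * (2 * loopRange κ k N + 2 + a + t.size) ^ c := by
  obtain ⟨ρ, pL, cL, E₀, hρ, HL⟩ := exists_decide_of_attention hrec hdv pA time hA hR hw hRw
  obtain ⟨N₁, hN₁⟩ := exists_topScore_le hd k R w
  obtain ⟨κ₀, hκ₀⟩ := exists_room k R w
  set N₀ := N₁ + 2 * E₀ with hN₀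
  -- the range of the loops exceeds the number of assignments to fewer than `N₀` variables
  set κ := κ₀ + 2 ^ N₀ with hκ
  have hκ1 : 1 ≤ κ := by
    have : 0 < 2 ^ N₀ := by positivity
    omega
  obtain ⟨pI, cI, HI⟩ := exists_init (k := k) ρ (by omega) hκ1
  obtain ⟨pB, cB, HB⟩ := exists_bruteForce (k := k) ρ (by omega)
  set a := bitCost N₀ + 10 with ha
  refine ⟨.seq pI (.ite (.op .lt (.reg ρ) (.const N₀)) pB pL), κ, a, cI + (1 + (cB + cL) + 1) + 1,
    fun N φ => ?_⟩
  obtain ⟨s₁, τ₁, x₁, hs₁, hτ₁⟩ := HI N φ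
  set Λ := loopRange κ k N with hΛ
  have hroom : Room k R w N Λ := hκ₀ κ (Nat.le_add_right _ _) N
  have hrows := hroom.rows
  have hev : (Expr.op .lt (.reg ρ) (.const N₀)).eval s₁ = if N < N₀ then 1 else 0 := by
    simp only [Expr.eval, BinOp.eval, hs₁.regN, Nat.cast_lt]
  have hcost : (Expr.op .lt (.reg ρ) (.const N₀)).cost s₁ + 1 ≤ 2 * Λ + 2 + a := by
    have h1 : bitCost (N : ℤ) ≤ N + 2 := bitCost_natCast_le Nat.lt_two_pow_self.le
    have h2 := bitCost_ite_le (N < N₀)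
    have h3 := hroom.vars
    have h4 : (Expr.op .lt (.reg ρ) (.const N₀)).cost s₁ = bitCost (N : ℤ) + bitCost N₀ +
        bitCost (if N < N₀ then 1 else 0) := by
      rw [← hev, Expr.cost, Expr.cost, Expr.cost, hs₁.regN]
      rfl
    omega
  have hZ : ∀ t : ℕ, 2 ≤ 2 * Λ + 2 + a + t.size := fun t => by omega
  have hpow : ∀ {y e : ℕ} (t : ℕ), y ≤ (2 * Λ + 2) ^ e →
      y ≤ (t + 2 ^ logRows k R w N) * (2 * Λ + 2 + a + t.size) ^ e := fun {y e} t hy => by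
    have h1 : (2 * Λ + 2) ^ e ≤ (2 * Λ + 2 + a + t.size) ^ e := Nat.pow_le_pow_left (by omega) _
    have h2 : 1 ≤ t + 2 ^ logRows k R w N := Nat.one_le_two_pow.trans (Nat.le_add_left _ _)
    exact (hy.trans h1).trans (Nat.le_mul_of_pos_left _ h2)
  have htest : ∀ t : ℕ, (Expr.op .lt (.reg ρ) (.const N₀)).cost s₁ + 1 ≤
      (t + 2 ^ logRows k R w N) * (2 * Λ + 2 + a + t.size) ^ 1 := fun t => by
    have h2 : 1 ≤ t + 2 ^ logRows k R w N := Nat.one_le_two_pow.trans (Nat.le_add_left _ _)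
    rw [pow_one]
    exact (hcost.trans (Nat.le_add_right _ _)).trans (Nat.le_mul_of_pos_left _ h2)
  rcases Nat.lt_or_ge N N₀ with hN | hN
  · have h2N : 2 ^ N ≤ Λ := by
      have h1 : 2 ^ N ≤ 2 ^ N₀ := Nat.pow_le_pow_right (by norm_num) hN.le
      have h2 : κ * 1 ≤ κ * (2 * N + 1) ^ (k + 1) :=
        Nat.mul_le_mul_left _ (Nat.one_le_pow _ _ (by omega))
      rw [hΛ, loopRange]
      omega
    obtain ⟨s₂, τ₂, x₂, hiff, hτ₂⟩ := HB Λ N φ _ s₁ hs₁ hroom.vars hroom.codes h2N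
    refine ⟨s₂, _, 0, x₁.seq (.iteTrue (by rw [hev, if_pos hN]; norm_num) x₂), hiff, ?_, by omega, ?_⟩
    · rw [Nat.cast_zero]
      exact htime _
    · rw [add_right_comm _ τ₂]
      exact add_le_mul_pow (hZ 0) (hpow 0 hτ₁) (add_le_mul_pow (hZ 0) (htest 0) (hpow 0
        (hτ₂.trans (Nat.pow_le_pow_right (by omega) (Nat.le_add_right _ _)))))
  · have hE : E₀ ≤ logRows k R w N := by
      have := le_two_mul_logRows k R w N
      omega
    obtain ⟨s₂, τ₂, t, x₂, hiff, ht, hτ₂⟩ := HL Λ N φ s₁ hs₁ hroom hE (hN₁ N (by omega))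
    refine ⟨s₂, _, t, x₁.seq (.iteFalse (by rw [hev, if_neg (by omega)]) x₂), hiff, ht, by omega, ?_⟩
    rw [add_right_comm _ τ₂]
    refine add_le_mul_pow (hZ t) (hpow t hτ₁) (add_le_mul_pow (hZ t) (htest t)
      (hτ₂.trans (Nat.mul_le_mul_left _ ?_)))
    exact (Nat.pow_le_pow_left (by omega) _).trans
      (Nat.pow_le_pow_right (by omega) (Nat.le_add_left _ _))

variable {d dv : ℕ → ℕ} {Holds : {n m : ℕ} → State → Matrix (Fin n) (Fin m) ℝ → Prop}
  {Rel : {n m : ℕ} → Matrix (Fin n) (Fin m) ℝ → Matrix (Fin n) (Fin m) ℝ → Prop}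

/-- The number `2 ^ E` is about the square root of the number of assignments, so that a time that
is subquadratic in the size of the instance is less than the number of assignments. -/
theorem two_rpow_logRows_le {k R w N : ℕ} {ε : ℝ} (hε : 0 < ε) (hε1 : ε ≤ 1) (hR : 1 ≤ R)
    (h : ((w * (k + 1) : ℕ) : ℝ) ≤ ε / 16 * R) :
    (2 : ℝ) ^ ((2 - ε) * ((logRows k R w N + 2 : ℕ) : ℝ)) ≤
      2 ^ (2 * (w + 3 : ℝ)) * 2 ^ ((1 - 3 * ε / 8) * N) := by
  rw [← Real.rpow_add two_pos]
  refine Real.rpow_le_rpow_of_exponent_le one_le_two ?_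
  have h1 := mul_le_mul_of_nonneg_left (logRows_add_two_le (N := N) hR h)
    (show 0 ≤ 2 - ε by linarith)
  have h2 : (2 - ε) * ((1 / 2 + ε / 16) * N + (w + 3)) = 2 * (w + 3) + (1 - 3 * ε / 8) * N -
      (ε * (w + 3) + ε ^ 2 / 16 * N) := by ring
  have h3 : 0 ≤ ε * (w + 3) + ε ^ 2 / 16 * N := by positivity
  linarith

/-- An algorithm for self-attention that takes subquadratic time, and whose answers tell whether the
greatest possible score occurs, contradicts the Strong Exponential Time Hypothesis. -/
theorem not_solvableInTime_of_recoversTopScore (hrec : RecoversTopScore d dv Holds Rel)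
    (hSETH : SETH) (hd : (fun n : ℕ => Real.log (n : ℝ)) =o[Filter.atTop] fun n : ℕ => (d n : ℝ))
    (hdv : ∀ n, 1 ≤ dv n) {ε : ℝ} (hε : 0 < ε) :
    ¬ (attentionProblem d dv Holds Rel).SolvableInTime (fun n => (n : ℝ) ^ (2 - ε)) := by
  rintro ⟨pA, K, hA⟩
  -- a smaller `ε` and a greater constant are allowed
  set η := min ε 1 with hη
  have hη0 : 0 < η := lt_min hε one_pos
  have hη1 : η ≤ 1 := min_le_right _ _
  set L := max K 1 with hL
  have hL1 : 1 ≤ L := le_max_right _ _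
  set time : ℕ → ℝ := fun n => L * (n : ℝ) ^ (2 - η) with htime
  have hA' : ∀ n : ℕ, 1 ≤ n → ∀ x : AttentionInstance n (d n) (dv n), ∃ s' t,
      Exec pA x.input s' t ∧ (∃ Yhat : Matrix (Fin n) (Fin (dv n)) ℝ, Holds s' Yhat ∧ Rel Yhat x.Y) ∧
      (t : ℝ) ≤ time n := by
    intro n hn x
    obtain ⟨s', t, h1, h2, h3⟩ := hA n hn x
    refine ⟨s', t, h1, h2, h3.trans (mul_le_mul (le_max_left _ _) ?_ (by positivity)
      (by positivity))⟩
    exact Real.rpow_le_rpow_of_exponent_le (by exact_mod_cast hn) (by linarith [min_le_left ε 1])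
  obtain ⟨k, hk⟩ := hSETH (η / 8) (by positivity)
  obtain ⟨R, w, hR, hw, hRw, hγ⟩ := exists_parameters k (γ := η / 16) (by positivity)
  obtain ⟨p, κ, a, c, hp⟩ := exists_decide hrec hdv hd pA time (fun n => by positivity) hA' hR hw hRw
  obtain ⟨l, hl⟩ := pow_unbounded_of_one_lt L one_lt_two
  obtain ⟨C, hC0, hC⟩ := exists_pow_le_two_rpow (4 * κ + a + l + 7) (k + 1) c
    (δ := η / 4) (by positivity)
  refine hk ⟨p, (L + 1) * 2 ^ (2 * (w + 3 : ℝ)) * C, fun N _ φ => ?_⟩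
  obtain ⟨s', τ, t, hx, hiff, ht, hE, hτ⟩ := hp N φ
  refine ⟨s', τ, hx, hiff, ?_⟩
  have hU := two_rpow_logRows_le (N := N) hη0 hη1 hR hγ
  set E := logRows k R w N with hEdef
  set U := (2 : ℝ) ^ ((2 - η) * ((E + 2 : ℕ) : ℝ)) with hUdef
  have ht' : (t : ℝ) ≤ L * U := by
    refine ht.trans (le_of_eq ?_)
    rw [htime]
    simp only
    rw [hUdef, mul_comm (2 - η), Real.rpow_mul two_pos.le, Real.rpow_natCast]
    push_cast
    rfl
  have hEU : (2 : ℝ) ^ E ≤ U := by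
    rw [hUdef, ← Real.rpow_natCast]
    refine Real.rpow_le_rpow_of_exponent_le one_le_two ?_
    have h1 : ((E : ℕ) : ℝ) ≤ ((E + 2 : ℕ) : ℝ) := by exact_mod_cast Nat.le_add_right _ _
    have h2 : (0 : ℝ) ≤ ((E + 2 : ℕ) : ℝ) := Nat.cast_nonneg _
    nlinarith
  have hU2 : U ≤ (2 : ℝ) ^ (2 * (E + 2)) := by
    rw [hUdef, ← Real.rpow_natCast]
    refine Real.rpow_le_rpow_of_exponent_le one_le_two ?_
    have h2 : (0 : ℝ) ≤ ((E + 2 : ℕ) : ℝ) := Nat.cast_nonneg _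
    rw [Nat.cast_mul]
    push_cast at *
    nlinarith
  -- the bit length of the running time is linear in `E`
  have hsize : t.size ≤ l + 2 * (E + 2) + 1 := by
    rw [Nat.size_le]
    have h1 : (t : ℝ) ≤ 2 ^ l * 2 ^ (2 * (E + 2)) :=
      ht'.trans (mul_le_mul hl.le hU2 (by positivity) (by positivity))
    have h2 : t ≤ 2 ^ (l + 2 * (E + 2)) := by
      rw [pow_add]
      exact_mod_cast h1
    exact h2.trans_lt (Nat.pow_lt_pow_right (by norm_num) (by omega))
  -- all polynomial factors are absorbed by a factor `2 ^ (η / 4 * N)`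
  have hbase : 2 * loopRange κ k N + 2 + a + t.size ≤
      (4 * κ + a + l + 7) * (2 * N + 1) ^ (k + 1) := by
    have h1 : (4 * κ + a + l + 7) * (2 * N + 1) ^ (k + 1) =
        4 * loopRange κ k N + (a + l + 7) * (2 * N + 1) ^ (k + 1) := by
      rw [loopRange]
      ring
    have h2 : a + l + 7 ≤ (a + l + 7) * (2 * N + 1) ^ (k + 1) :=
      Nat.le_mul_of_pos_right _ (by positivity)
    omega
  have hτ' : (τ : ℝ) ≤ (t + 2 ^ E) * (C * (2 : ℝ) ^ (η / 4 * N)) := by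
    have h1 : (τ : ℝ) ≤ ((t + 2 ^ E : ℕ) : ℝ) *
        ((((4 * κ + a + l + 7) * (2 * N + 1) ^ (k + 1)) ^ c : ℕ) : ℝ) := by
      exact_mod_cast hτ.trans (Nat.mul_le_mul_left _ (Nat.pow_le_pow_left hbase _))
    refine h1.trans ?_
    rw [Nat.cast_add, Nat.cast_pow 2 E, Nat.cast_two]
    exact mul_le_mul_of_nonneg_left (hC N) (by positivity)
  calc (τ : ℝ) ≤ (t + 2 ^ E) * (C * (2 : ℝ) ^ (η / 4 * N)) := hτ'
    _ ≤ ((L + 1) * (2 ^ (2 * (w + 3 : ℝ)) * 2 ^ ((1 - 3 * η / 8) * N))) *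
        (C * (2 : ℝ) ^ (η / 4 * N)) := by
      refine mul_le_mul_of_nonneg_right ?_ (by positivity)
      calc (t : ℝ) + 2 ^ E ≤ (L + 1) * U := by linarith
        _ ≤ _ := mul_le_mul_of_nonneg_left hU (by positivity)
    _ = (L + 1) * 2 ^ (2 * (w + 3 : ℝ)) * C * (2 ^ ((1 - 3 * η / 8) * N) * 2 ^ (η / 4 * N)) := by
      ring
    _ = (L + 1) * 2 ^ (2 * (w + 3 : ℝ)) * C * 2 ^ ((1 - η / 8) * N) := by
      rw [← Real.rpow_add two_pos]
      congr 2
      ring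

end FineGrained


theorem mainTheorem1 (hSETH : FineGrained.SETH) (d dv : ℕ → ℕ)
    (hd : (fun n : ℕ => Real.log (n : ℝ)) =o[Filter.atTop] fun n : ℕ => (d n : ℝ))
    (hdv : ∀ n, 1 ≤ dv n) (ε : ℝ) (hε : 0 < ε) :
    ¬ (FineGrained.exactAttention d dv).SolvableInTime (fun n => (n : ℝ) ^ (2 - ε)) ∧
    (∀ μ : ℝ, 0 ≤ μ → μ < 1 →
      ¬ (FineGrained.mulApproxAttention μ d dv).SolvableInTime (fun n => (n : ℝ) ^ (2 - ε))) ∧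
    (∀ μ : ℝ, 0 ≤ μ →
      ¬ (FineGrained.addApproxAttention μ d dv).SolvableInTime (fun n => (n : ℝ) ^ (2 - ε))) := by
  refine ⟨?_, fun μ hμ hμ1 => ?_, fun μ _ => ?_⟩
  · exact FineGrained.not_solvableInTime_of_recoversTopScore
      FineGrained.recoversTopScore_exact hSETH hd hdv hε
  · exact FineGrained.not_solvableInTime_of_recoversTopScore
      (FineGrained.recoversTopScore_mulApprox hμ hμ1) hSETH hd hdv hε
  · exact FineGrained.not_solvableInTime_of_recoversTopScore
      (FineGrained.recoversTopScore_addApprox μ) hSETH hd hdv hε
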